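/- **Setting.** All manifolds, maps and forms are smooth and finite-dimensional. Let $Q$ be a manifold with a mechanical lagrangian $L=\frac12\kappa-U$ ($\kappa$ a Riemannian metric, $U$ a potential) and a constant rank constraint distribution $D\subset TQ$. Let $\mathcal M=\kappa^\sharp(D)\subset T^*Q$ with projection $\tau:\mathcal M\to Q$, $H_{\mathcal M}$ the restriction of the hamiltonian, $\Omega_{\mathcal M}$ the pull back to $\mathcal M$ of the canonical 2-form $-d\Theta_Q$, and $\mathcal C=\{v\in T\mathcal M: T\tau(v)\in D\}$; the nonholonomic vector field $X_{nh}$ is the section of $\mathcal C$ with $\mathbf i_{X_{nh}}\Omega_{\mathcal M}|_{\mathcal C}=dH_{\mathcal M}|_{\mathcal C}$. Let a Lie group $G$ with Lie algebra $\mathfrak g$ act freely and properly on $Q$, its tangent lift preserving $L$ and $D$. Let $V$ be the tangent distribution to the $G$-orbits, assume $TQ=D+V$, and put $S=D\cap V$, $k=\operatorname{rank}S$. For $\xi\in\mathfrak g$ let $\xi_Q$ be its infinitesimal generator, and let $\langle J(m),\xi\rangle=m(\xi_Q)$ for $m\in\mathcal M$. Assume: * (vertical symmetry condition) there are a distribution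 $W\subset V$ with $TQ=D\oplus W$ and a closed normal subgroup $G_W\subset G$ with $W_q=T_q(\mathrm{Orb}_{G_W}(q))$ for all $q$; * there are smooth $\zeta_1,\dots,\zeta_k:Q\to\mathfrak g$ with $(\zeta_i)_Q\in S$ such that the functions $J_i(m)=m((\zeta_i)_Q)$ on $\mathcal M$ are $G$-invariant, satisfy $X_{nh}(J_i)=0$, and have linearly independent differentials at every point of $\mathcal M$. Choose a $G$-invariant distribution $Hor\subset D$ with $TQ=Hor\oplus V$. Let $P_D,P_W$ be the projections of $TQ=D\oplus W$ and $P_{Hor},P_V$ those of $TQ=Hor\oplus V$; let $A_W,A:TQ\to\mathfrak g$ be the 1-forms with $(A_W(v))_Q=P_W(v)$ and $(A(v))_Q=P_V(v)$, and let $Y^i$ be the 1-forms on $Q$ vanishing on $Hor\oplus W$ with $Y^i((\zeta_j)_Q)=\delta_{ij}$. Put $K_W=dA_W(P_D\cdot,P_D\cdot)$, $d^DY^i=dY^i(P_D\cdot,P_D\cdot)$ and $K_V=s\,dA(P_{Hor}\cdot,P_{Hor}\cdot)$, where $s\in\{1,-1\}$ is the sign convention for the curvature of a connection. For $m\in\mathcal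 M$ over $q$ and $u,v\in T_m\mathcal M$ with projections $u',v'\in T_qQ$ let $$B_1(u,v)=\langle J(m),K_W(u',v')\rangle+\sum_iJ_i(m)\,d^DY^i(u',v'),$$ $$\mathcal B(u,v)=\langle J(m),K_V(u',v')\rangle-\tfrac12\Big[\kappa\big(P_{Hor}u',\,\sigma(p,P_{Hor}v')_Q\big)-\kappa\big(P_{Hor}v',\,\sigma(p,P_{Hor}u')_Q\big)\Big],$$ where $\sigma=K_W+\sum_i d^DY^i\otimes\zeta_i$ and $p=P_V(T\tau X_{nh}(m))$; put $\mathbf B=B_1+\mathcal B$. The bracket $\{f,g\}_{\mathbf B}=X_g(f)$ on $\mathcal M$, where $X_g\in\mathcal C$ is determined by $\mathbf i_{X_g}(\Omega_{\mathcal M}+\mathbf B)|_{\mathcal C}=dg|_{\mathcal C}$, induces a bracket $\{\cdot,\cdot\}^{\mathbf B}_{red}$ on $\mathcal M/G$ by $\{f,g\}^{\mathbf B}_{red}\circ\rho=\{f\circ\rho,g\circ\rho\}_{\mathbf B}$, $\rho:\mathcal M\to\mathcal M/G$ the orbit projection; and $J_i=\bar J_i\circ\rho$. Orbit spaces and $F=G/G_W$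 carry the unique smooth structures for which the projections are submersions. Let $\widetilde Q=Q/G_W$ with projection $\pi:Q\to\widetilde Q$, and let $\mathfrak f$ be the Lie algebra of $F$, which acts on $\widetilde Q$ and, by cotangent lift, on $T^*\widetilde Q$, with canonical momentum map $\widetilde J:T^*\widetilde Q\to\mathfrak f^*$. Let $\rho_{G_W}:\mathcal M\to T^*\widetilde Q$ be given by $\rho_{G_W}(m)(T\pi(v))=m(v)$, $v\in D$. Let $\eta_i:\widetilde Q\to\mathfrak f$ be induced by $\zeta_i$ (i.e. $\eta_i(\pi(q))$ is the class of $\zeta_i(q)$), $\{\mu^i\}$ the dual basis of $\mathfrak f^*$-valued functions on $\widetilde Q$, and for $c\in\mathbb R^k$ let $\mu=\sum_ic_i\mu^i$, $\widetilde J^{-1}(\mu)=\{\alpha_x\in T^*\widetilde Q:\widetilde J(\alpha_x)=\mu(x)\}$. **Theorem.** All these objects are well defined; $\rho_{G_W}$ is the orbit projection of the $G_W$-action (a surjective submersion whose fibres are the $G_W$-orbits), and there are a smooth submersion $\rho_F:T^*\widetilde Q\to\mathcal M/G$ whose fibres are the $F$-orbits, with $\rho_F\circ\rho_{G_W}=\rho$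 (so $T^*\widetilde Q/F=\mathcal M/G$), and smooth 2-forms $B_{\langle J\mathcal K\rangle},\widetilde{\mathbf B}$ on $T^*\widetilde Q$ whose pull backs by $\rho_{G_W}$ are $\langle J,\tau^*K_W\rangle$ and $\mathbf B$. Put $\widetilde\Omega_{\mathbf B}=\Omega_{\widetilde Q}-B_{\langle J\mathcal K\rangle}+\widetilde{\mathbf B}$, with $\Omega_{\widetilde Q}$ the canonical 2-form of $T^*\widetilde Q$. 1. $\{\cdot,\cdot\}^{\mathbf B}_{red}$ is a twisted Poisson bracket: it is bilinear, skew-symmetric, satisfies the Leibniz identity, and its Jacobiator at $f,g,h$ is $\Phi(X_f,X_g,X_h)$ for some closed 3-form $\Phi$ on $\mathcal M/G$, with $X_f=\{\cdot,f\}^{\mathbf B}_{red}$. 2. For every $\mu=\sum_ic_i\mu^i$, $\widetilde J^{-1}(\mu)$ is an $F$-invariant embedded submanifold of $T^*\widetilde Q$; $\widetilde J^{-1}(\mu)/F=\rho_F(\widetilde J^{-1}(\mu))$ is an embedded submanifold of $\mathcal M/G$ which coincides with the common level set $\bigcap_i\bar J_i^{-1}(c_i)$; it carries a nondegenerate 2-form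 $\omega_\mu^{\mathbf B}$ with $\iota_\mu^*\widetilde\Omega_{\mathbf B}=\rho_\mu^*\omega_\mu^{\mathbf B}$, where $\iota_\mu$ is the inclusion of $\widetilde J^{-1}(\mu)$ and $\rho_\mu:\widetilde J^{-1}(\mu)\to\widetilde J^{-1}(\mu)/F$ the (submersive) projection; and $\omega_\mu^{\mathbf B}$ is the 2-form defined by the bracket: for every $f\in C^\infty(\mathcal M/G)$ the vector field $X_f$ is tangent to $\widetilde J^{-1}(\mu)/F$ and $\mathbf i_{X_f}\omega_\mu^{\mathbf B}=d\big(f|_{\widetilde J^{-1}(\mu)/F}\big)$. 3. The leaves of $\{\cdot,\cdot\}^{\mathbf B}_{red}$, i.e. the maximal connected integral manifolds of the distribution on $\mathcal M/G$ spanned by the $X_f$, are exactly the connected components of the almost symplectic manifolds $(\widetilde J^{-1}(\mu)/F,\omega_\mu^{\mathbf B})$, $c\in\mathbb R^k$. -/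

import Mathlib

open scoped Manifold ContDiff
open Bundle

noncomputable section

/-! ### Differential geometry on manifolds without boundary -/

section Generic

variable {E : Type*} [NormedAddCommGroup E] [NormedSpace ℝ E] {H : Type*} [TopologicalSpace H]
  (I : ModelWithCorners ℝ E H) {N : Type*} [TopologicalSpace N] [ChartedSpace H N]
  {E' : Type*} [NormedAddCommGroup E'] [NormedSpace ℝ E'] {H' : Type*} [TopologicalSpace H']
  (I' : ModelWithCorners ℝ E' H') {N' : Type*} [TopologicalSpace N'] [ChartedSpace H' N']

/-- Smooth submersion (between finite-dimensional manifolds). -/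
def IsSmoothSubmersion (f : N → N') : Prop :=
  ContMDiff I I' ∞ f ∧ ∀ x, Function.Surjective (mfderiv I I' f x)

/-- Smooth immersion (between finite-dimensional manifolds). -/
def IsSmoothImmersion (f : N → N') : Prop :=
  ContMDiff I I' ∞ f ∧ ∀ x, Function.Injective (mfderiv I I' f x)

/-- The tangent space at `x` of an embedded submanifold `A ⊆ N`: velocities at time `0` of the
smooth curves of `N` that stay in `A` and start at `x`. -/
def tangentSet (A : Set N) (x : N) : Set (TangentSpace I x) :=
  {v | ∃ c : ℝ → N, ContMDiff 𝓘(ℝ, ℝ) I ∞ c ∧ (∀ t, c t ∈ A) ∧ c 0 = x ∧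
    (mfderiv 𝓘(ℝ, ℝ) I c 0 (1 : ℝ) : E) = v}

/-- A smooth distribution of constant rank: locally framed by smooth vector fields. -/
def IsSmoothDistribution [IsManifold I 1 N] (Δ : ∀ x : N, Submodule ℝ (TangentSpace I x)) : Prop :=
  ∃ r : ℕ, ∀ x₀ : N, ∃ (A : Set N) (X : Fin r → ∀ x : N, TangentSpace I x),
    IsOpen A ∧ x₀ ∈ A ∧
    (∀ j, ContMDiffOn I I.tangent ∞ (fun x => (⟨x, X j x⟩ : TangentBundle I N)) A) ∧
    ∀ x ∈ A, LinearIndependent ℝ (fun j => X j x) ∧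
      Submodule.span ℝ (Set.range fun j => X j x) = Δ x

/-- Exterior derivative of a `V`-valued 1-form, with the convention
`dθ(X, Y) = X θ(Y) - Y θ(X) - θ([X, Y])`, computed at `x` in the preferred chart at `x`
(whose differential at `x` is the identity of `TangentSpace I x = E`). -/
def extDerivOne {V : Type*} [NormedAddCommGroup V] [NormedSpace ℝ V]
    (θ : ∀ x : N, TangentSpace I x →L[ℝ] V) (x : N) (u v : TangentSpace I x) : V :=
  let θc : E → E →L[ℝ] V := fun y =>
    (θ ((extChartAt I x).symm y)).comp (mfderiv 𝓘(ℝ, E) I (extChartAt I x).symm y)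
  let y₀ : E := extChartAt I x x
  fderiv ℝ θc y₀ u v - fderiv ℝ θc y₀ v u

/-- The differential of a real function, as a covector. -/
def dReal (f : N → ℝ) (x : N) : TangentSpace I x →L[ℝ] ℝ := mfderiv I 𝓘(ℝ, ℝ) f x

variable (N) in
/-- (Not necessarily smooth) real differential forms of degree `n`. -/
abbrev DForm (n : ℕ) := ∀ x : N, TangentSpace I x [⋀^Fin n]→L[ℝ] ℝ

/-- The expression of a form in the chart at `x₀`. -/
def DForm.inChart {n : ℕ} (Φ : DForm I N n) (x₀ : N) (y : E) : E [⋀^Fin n]→L[ℝ] ℝ :=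
  (Φ ((extChartAt I x₀).symm y)).compContinuousLinearMap
    (mfderiv 𝓘(ℝ, E) I (extChartAt I x₀).symm y)

def DForm.IsSmooth {n : ℕ} (Φ : DForm I N n) : Prop :=
  ∀ x₀ : N, ContDiffOn ℝ ∞ (DForm.inChart I Φ x₀) (extChartAt I x₀).target

def DForm.IsClosedForm {n : ℕ} (Φ : DForm I N n) : Prop :=
  ∀ x₀ : N, ∀ y ∈ (extChartAt I x₀).target, extDeriv (DForm.inChart I Φ x₀) y = 0

/-- The 2-form `Φ'` on `N'` satisfies `p^* Φ' = Φ`. -/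
def PullsBackTo (p : N → N') (Φ' : DForm I' N' 2)
    (Φ : ∀ x : N, TangentSpace I x → TangentSpace I x → ℝ) : Prop :=
  ∀ (x : N) (u v : TangentSpace I x), Φ' (p x) ![mfderiv I I' p x u, mfderiv I I' p x v] = Φ x u v

/-- A nondegenerate smooth 2-form. -/
def IsAlmostSymplectic (σ : DForm I N 2) : Prop :=
  DForm.IsSmooth I σ ∧ ∀ (x : N) (u : TangentSpace I x), (∀ v, σ x ![u, v] = 0) → u = 0

/-! ### Brackets, twisted Poisson brackets, and leaves -/

/-- The hamiltonian vector field `X_f = {·, f}` of a bracket: `dg (X_f) = {g, f}` for all smooth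
`g`. -/
def bracketHam (br : (N → ℝ) → (N → ℝ) → N → ℝ) (f : N → ℝ) (x : N) : TangentSpace I x :=
  Classical.epsilon fun X : TangentSpace I x =>
    ∀ g : N → ℝ, ContMDiff I 𝓘(ℝ, ℝ) ∞ g → dReal I g x X = br g f x

/-- A bracket on `C^∞(N)` which is bilinear, skew-symmetric, satisfies the Leibniz identity
(an almost Poisson bracket), and whose Jacobiator is given by a closed 3-form. -/
structure IsTwistedPoisson (br : (N → ℝ) → (N → ℝ) → N → ℝ) : Prop where
  smooth : ∀ f g : N → ℝ, ContMDiff I 𝓘(ℝ, ℝ) ∞ f → ContMDiff I 𝓘(ℝ, ℝ) ∞ g →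
    ContMDiff I 𝓘(ℝ, ℝ) ∞ (br f g)
  skew : ∀ f g : N → ℝ, ContMDiff I 𝓘(ℝ, ℝ) ∞ f → ContMDiff I 𝓘(ℝ, ℝ) ∞ g →
    br f g = - br g f
  add_left : ∀ f g h : N → ℝ, ContMDiff I 𝓘(ℝ, ℝ) ∞ f → ContMDiff I 𝓘(ℝ, ℝ) ∞ g →
    ContMDiff I 𝓘(ℝ, ℝ) ∞ h → br (f + g) h = br f h + br g h
  smul_left : ∀ (a : ℝ) (f g : N → ℝ), ContMDiff I 𝓘(ℝ, ℝ) ∞ f → ContMDiff I 𝓘(ℝ, ℝ) ∞ g →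
    br (a • f) g = a • br f g
  leibniz : ∀ f g h : N → ℝ, ContMDiff I 𝓘(ℝ, ℝ) ∞ f → ContMDiff I 𝓘(ℝ, ℝ) ∞ g →
    ContMDiff I 𝓘(ℝ, ℝ) ∞ h → br (f * g) h = f * br g h + br f h * g
  jacobi : ∃ Φ : DForm I N 3, DForm.IsSmooth I Φ ∧ DForm.IsClosedForm I Φ ∧
    ∀ f g h : N → ℝ, ContMDiff I 𝓘(ℝ, ℝ) ∞ f → ContMDiff I 𝓘(ℝ, ℝ) ∞ g →
      ContMDiff I 𝓘(ℝ, ℝ) ∞ h → ∀ x : N,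
      br f (br g h) x + br g (br h f) x + br h (br f g) x =
        Φ x ![bracketHam I br f x, bracketHam I br g x, bracketHam I br h x]

/-- The characteristic distribution: generated by the hamiltonian vector fields. -/
def charDistribution (br : (N → ℝ) → (N → ℝ) → N → ℝ) (x : N) :
    Submodule ℝ (TangentSpace I x) :=
  Submodule.span ℝ {X | ∃ f : N → ℝ, ContMDiff I 𝓘(ℝ, ℝ) ∞ f ∧ X = bracketHam I br f x}

/-- `j : P → N` is an injectively immersed connected integral manifold of `Δ`. -/
structure IsIntegralImmersion {r : ℕ} {P : Type*} [TopologicalSpace P]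
    [ChartedSpace (EuclideanSpace ℝ (Fin r)) P]
    (Δ : ∀ x : N, Submodule ℝ (TangentSpace I x)) (j : P → N) : Prop where
  isManifold : IsManifold (𝓡 r) ∞ P
  connected : ConnectedSpace P
  injective : Function.Injective j
  immersion : IsSmoothImmersion (𝓡 r) I j
  tangent : ∀ p : P, LinearMap.range (mfderiv (𝓡 r) I j p).toLinearMap = Δ (j p)

/-- `L ⊆ N` is a connected integral manifold of `Δ`, that is, `L` carries a manifold structure
(whose topology may be finer than the subspace topology) making the inclusion an injective
immersion with tangent spaces `Δ`. -/
def IsIntegralManifold (Δ : ∀ x : N, Submodule ℝ (TangentSpace I x)) (L : Set N) : Prop :=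
  ∃ (r : ℕ) (t : TopologicalSpace L) (cs : @ChartedSpace (EuclideanSpace ℝ (Fin r)) _ L t),
    @IsIntegralImmersion _ _ _ _ _ I N _ _ r L t cs Δ Subtype.val

/-- A leaf of the bracket: a maximal connected integral manifold of its characteristic
distribution. -/
def IsLeaf (br : (N → ℝ) → (N → ℝ) → N → ℝ) (L : Set N) : Prop :=
  Maximal (IsIntegralManifold I (charDistribution I br)) L

end Generic

/-! ### Cotangent bundles -/

section CotangentBundle

variable (E : Type*) [NormedAddCommGroup E] [NormedSpace ℝ E]
  (Q : Type*) [TopologicalSpace Q] [ChartedSpace E Q] [IsManifold 𝓘(ℝ, E) ∞ Q]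

/-- The cotangent bundle `T^*Q`. -/
abbrev CotBundle := TotalSpace (E →L[ℝ] ℝ) (fun q : Q => TangentSpace 𝓘(ℝ, E) q →L[ℝ] ℝ)

/-- The model with corners of `T^*Q`. -/
abbrev cotModel := (𝓘(ℝ, E)).prod 𝓘(ℝ, E →L[ℝ] ℝ)

variable {Q}

/-- The Liouville 1-form `Θ` of `T^*Q`. -/
def liouville (α : CotBundle E Q) : TangentSpace (cotModel E) α →L[ℝ] ℝ :=
  ContinuousLinearMap.comp (α.2 : E →L[ℝ] ℝ)
    (mfderiv (cotModel E) 𝓘(ℝ, E) (fun β : CotBundle E Q => β.1) α)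

/-- The canonical 2-form `Ω = -dΘ` of `T^*Q`. -/
def canonicalTwoForm (α : CotBundle E Q) (u v : TangentSpace (cotModel E) α) : ℝ :=
  - extDerivOne (cotModel E) (fun β : CotBundle E Q => liouville E β) α u v

end CotangentBundle

/-! ### Nonholonomic systems with symmetry -/

section Nonholonomic

variable (E : Type*) [NormedAddCommGroup E] [NormedSpace ℝ E]
  (Q : Type*) [TopologicalSpace Q] [ChartedSpace E Q] [IsManifold 𝓘(ℝ, E) ∞ Q]
  (EG : Type*) [NormedAddCommGroup EG] [NormedSpace ℝ EG]
  (G : Type*) [TopologicalSpace G] [ChartedSpace EG G] [Group G] [LieGroup 𝓘(ℝ, EG) ∞ G]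

/-- The data of a nonholonomic system with symmetry: the kinetic energy metric `κ`, the potential
`U`, the constraint distribution `D`, a vertical complement `W` of the constraints, a horizontal
distribution `Hor`, and `k` sections `ζ i` of `Q × 𝔤`. The Lie algebra `𝔤 = T_1 G` is realised, as
always in Mathlib, on the model space `EG`. -/
structure NHData where
  κ : ContMDiffRiemannianMetric 𝓘(ℝ, E) ∞ E (fun q : Q => TangentSpace 𝓘(ℝ, E) q)
  U : Q → ℝ
  D : ∀ q : Q, Submodule ℝ (TangentSpace 𝓘(ℝ, E) q)
  W : ∀ q : Q, Submodule ℝ (TangentSpace 𝓘(ℝ, E) q)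
  Hor : ∀ q : Q, Submodule ℝ (TangentSpace 𝓘(ℝ, E) q)
  k : ℕ
  ζ : Fin k → Q → EG

variable {E Q EG G}
variable [MulAction G Q]

variable (EG G) in
/-- The infinitesimal generator map `ξ ↦ ξ_Q(q)` of the action. -/
def infGen (q : Q) : EG →L[ℝ] TangentSpace 𝓘(ℝ, E) q :=
  (mfderiv 𝓘(ℝ, EG) 𝓘(ℝ, E) (fun g : G => g • q) 1 : EG →L[ℝ] E)

variable (EG G) in
/-- The vertical space `V_q`, tangent to the `G`-orbit. -/
def vertical (q : Q) : Submodule ℝ (TangentSpace 𝓘(ℝ, E) q) :=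
  LinearMap.range (infGen EG G q : EG →L[ℝ] TangentSpace 𝓘(ℝ, E) q).toLinearMap

variable (E) in
/-- The cotangent lift of the action: `g · m = m ∘ T(g⁻¹)`. -/
def cotLift (g : G) (m : CotBundle E Q) : CotBundle E Q :=
  ⟨g • m.1, ContinuousLinearMap.comp (m.2 : E →L[ℝ] ℝ)
    (mfderiv 𝓘(ℝ, E) 𝓘(ℝ, E) (fun q : Q => g⁻¹ • q) (g • m.1) : E →L[ℝ] E)⟩

/-- For a splitting `TQ = K ⊕ R` with `R` vertical, the `𝔤`-valued 1-form `A` on `Q` with kernel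
`K` and such that `(A v)_Q` is the component of `v` in `R`. -/
def connForm (G : Type*) [TopologicalSpace G] [ChartedSpace EG G] [Group G] [MulAction G Q]
    (K R : ∀ q : Q, Submodule ℝ (TangentSpace 𝓘(ℝ, E) q)) (q : Q) :
    TangentSpace 𝓘(ℝ, E) q →L[ℝ] EG :=
  Classical.epsilon fun A : TangentSpace 𝓘(ℝ, E) q →L[ℝ] EG =>
    ∀ v, infGen EG G q (A v) ∈ R q ∧ v - infGen EG G q (A v) ∈ K q

namespace NHData

variable (S : NHData E Q EG)

/-- The lagrangian `L = κ/2 - U`. -/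
def lagrangian (q : Q) (v : TangentSpace 𝓘(ℝ, E) q) : ℝ := (1 / 2) * S.κ.inner q v v - S.U q

/-- The inverse of the Legendre transformation `v ↦ κ(v, ·)`. -/
def legendreInv (m : CotBundle E Q) : TangentSpace 𝓘(ℝ, E) m.1 :=
  Classical.epsilon fun v : TangentSpace 𝓘(ℝ, E) m.1 => ∀ w, S.κ.inner m.1 v w = m.2 w

/-- The hamiltonian `H = κ/2 + U` on `T^*Q`. -/
def hamiltonian (m : CotBundle E Q) : ℝ :=
  (1 / 2) * S.κ.inner m.1 (S.legendreInv m) (S.legendreInv m) + S.U m.1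

/-- The constraint manifold `𝓜 = κ^♯(D) ⊆ T^*Q`. -/
abbrev M : Type _ := {m : CotBundle E Q // ∃ v ∈ S.D m.1, m.2 = S.κ.inner m.1 v}

/-- The projection `τ_𝓜 : 𝓜 → Q`. -/
def tau (m : S.M) : Q := m.1.1

/-! #### Forms on `Q` attached to the splittings `TQ = D ⊕ W = Hor ⊕ V` -/

variable (G) in
/-- `A_W : TQ → 𝔴 ⊆ 𝔤`, defined by `P_W(v) = (A_W(v))_Q`. -/
def AW (q : Q) : TangentSpace 𝓘(ℝ, E) q →L[ℝ] EG := connForm G S.D S.W q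

variable (G) in
/-- The projection `P_D : TQ → D` along `W`. -/
def PD (q : Q) (v : TangentSpace 𝓘(ℝ, E) q) : TangentSpace 𝓘(ℝ, E) q :=
  v - infGen EG G q (S.AW G q v)

variable (G) in
/-- The principal connection `A : TQ → 𝔤` with horizontal space `Hor`. -/
def A (q : Q) : TangentSpace 𝓘(ℝ, E) q →L[ℝ] EG := connForm G S.Hor (vertical EG G) q

variable (G) in
/-- The projection `P_V : TQ → V` along `Hor`. -/
def PV (q : Q) (v : TangentSpace 𝓘(ℝ, E) q) : TangentSpace 𝓘(ℝ, E) q :=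
  infGen EG G q (S.A G q v)

variable (G) in
/-- The projection `P_Hor : TQ → Hor` along `V`. -/
def PHor (q : Q) (v : TangentSpace 𝓘(ℝ, E) q) : TangentSpace 𝓘(ℝ, E) q :=
  v - infGen EG G q (S.A G q v)

variable (G) in
/-- `K_W = d^D A_W`. -/
def KW (q : Q) (u v : TangentSpace 𝓘(ℝ, E) q) : EG :=
  extDerivOne 𝓘(ℝ, E) (fun x : Q => S.AW G x) q (S.PD G q u) (S.PD G q v)

variable (G) in
/-- The curvature `dA(P_Hor ·, P_Hor ·)` of `A`. -/
def KV (q : Q) (u v : TangentSpace 𝓘(ℝ, E) q) : EG :=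
  extDerivOne 𝓘(ℝ, E) (fun x : Q => S.A G x) q (S.PHor G q u) (S.PHor G q v)

variable (G) in
/-- The 1-forms `Y^i` on `Q`: `Y^i = 0` on `Hor` and on `W`, and `Y^i((ζ_j)_Q) = δ_ij`. -/
def Y (i : Fin S.k) (q : Q) : TangentSpace 𝓘(ℝ, E) q →L[ℝ] ℝ :=
  Classical.epsilon fun θ : TangentSpace 𝓘(ℝ, E) q →L[ℝ] ℝ =>
    (∀ v ∈ S.Hor q, θ v = 0) ∧ (∀ v ∈ S.W q, θ v = 0) ∧
    ∀ j, θ (infGen EG G q (S.ζ j q)) = if i = j then 1 else 0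

variable (G) in
/-- `d^D Y^i`. -/
def dDY (i : Fin S.k) (q : Q) (u v : TangentSpace 𝓘(ℝ, E) q) : ℝ :=
  extDerivOne 𝓘(ℝ, E) (fun x : Q => S.Y G i x) q (S.PD G q u) (S.PD G q v)

variable (G) in
/-- The `𝔤`-valued 2-form `K_W + d^D Y^i ⊗ ζ_i`. -/
def sigma (q : Q) (u v : TangentSpace 𝓘(ℝ, E) q) : EG :=
  S.KW G q u v + ∑ i, S.dDY G i q u v • S.ζ i q

/-! #### Momenta -/

variable (G) in
/-- The canonical momentum map restricted to `𝓜`: `⟨J(m), ξ⟩ = m(ξ_Q)`. -/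
def momentum (m : S.M) (ξ : EG) : ℝ := m.1.2 (infGen EG G m.1.1 ξ)

variable (G) in
/-- `J_i = ⟨J^nh, ζ_i⟩`. -/
def J (i : Fin S.k) (m : S.M) : ℝ := S.momentum G m (S.ζ i (S.tau m))

/-! #### The orbit space `𝓜/G` -/

/-- Two points of `𝓜` are in the same orbit of the (cotangent lifted) `G`-action. -/
def SameOrbit (G : Type*) [Group G] [MulAction G Q] (m m' : S.M) : Prop :=
  ∃ g : G, m'.1 = cotLift E g m.1

/-- `𝓜/G`, with the quotient topology. -/
abbrev MG (G : Type*) [Group G] [MulAction G Q] : Type _ := Quot (S.SameOrbit G)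

variable (G) in
/-- The orbit projection `ρ : 𝓜 → 𝓜/G`. -/
def rho (m : S.M) : S.MG G := Quot.mk _ m

variable (G) in
/-- The functions `J̄_i` on `𝓜/G` induced by the `G`-invariant functions `J_i`. -/
def Jbar (i : Fin S.k) (x : S.MG G) : ℝ := S.J G i x.out

/-! #### Geometry of `𝓜`: for a manifold structure on `𝓜` -/

variable {EM : Type*} [NormedAddCommGroup EM] [NormedSpace ℝ EM] [ChartedSpace EM S.M]

variable (EM)

/-- `Tτ_𝓜`. -/
def dtau (m : S.M) : TangentSpace 𝓘(ℝ, EM) m →L[ℝ] TangentSpace 𝓘(ℝ, E) (S.tau m) :=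
  mfderiv 𝓘(ℝ, EM) 𝓘(ℝ, E) S.tau m

/-- The distribution `𝓒` on `𝓜`. -/
def C (m : S.M) : Submodule ℝ (TangentSpace 𝓘(ℝ, EM) m) :=
  (S.D (S.tau m)).comap (S.dtau EM m).toLinearMap

/-- `Ω_𝓜`, the pull back of the canonical 2-form to `𝓜`. -/
def OmegaM (m : S.M) (u v : TangentSpace 𝓘(ℝ, EM) m) : ℝ :=
  canonicalTwoForm E m.1 (mfderiv 𝓘(ℝ, EM) (cotModel E) (Subtype.val : S.M → CotBundle E Q) m u)
    (mfderiv 𝓘(ℝ, EM) (cotModel E) (Subtype.val : S.M → CotBundle E Q) m v)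

/-- `X` is the value at `m` of the hamiltonian vector field of `f` for the 2-section `β|_𝓒`:
`X ∈ 𝓒` and `i_X β|_𝓒 = df|_𝓒`. -/
def IsHam (β : ∀ m : S.M, TangentSpace 𝓘(ℝ, EM) m → TangentSpace 𝓘(ℝ, EM) m → ℝ)
    (f : S.M → ℝ) (m : S.M) (X : TangentSpace 𝓘(ℝ, EM) m) : Prop :=
  X ∈ S.C EM m ∧ ∀ u ∈ S.C EM m, β m X u = dReal 𝓘(ℝ, EM) f m u

/-- The hamiltonian vector field of `f` for `β|_𝓒`. -/
def hamVec (β : ∀ m : S.M, TangentSpace 𝓘(ℝ, EM) m → TangentSpace 𝓘(ℝ, EM) m → ℝ)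
    (f : S.M → ℝ) (m : S.M) : TangentSpace 𝓘(ℝ, EM) m :=
  Classical.epsilon (S.IsHam EM β f m)

/-- The nonholonomic vector field. -/
def Xnh (m : S.M) : TangentSpace 𝓘(ℝ, EM) m :=
  S.hamVec EM (S.OmegaM EM) (fun m => S.hamiltonian m.1) m

variable (G)

/-- The 2-form `⟨J, 𝓚_W⟩`. -/
def JKW (m : S.M) (u v : TangentSpace 𝓘(ℝ, EM) m) : ℝ :=
  S.momentum G m (S.KW G (S.tau m) (S.dtau EM m u) (S.dtau EM m v))

/-- `B_1 = ⟨J, 𝓚_W⟩ + J_i d^𝓒 𝓨^i`. -/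
def B1 (m : S.M) (u v : TangentSpace 𝓘(ℝ, EM) m) : ℝ :=
  S.JKW G EM m u v + ∑ i, S.J G i m * S.dDY G i (S.tau m) (S.dtau EM m u) (S.dtau EM m v)

/-- `κ_𝔤 ∧ i_{P_𝓥(X_nh)} [𝓚_W + d^𝓒 𝓨^i ⊗ ζ_i]`, evaluated on the horizontal parts of `u`, `v`. -/
def kappaWedge (m : S.M) (u v : TangentSpace 𝓘(ℝ, EM) m) : ℝ :=
  let q := S.tau m
  let p := S.PV G q (S.dtau EM m (S.Xnh EM m))
  let hu := S.PHor G q (S.dtau EM m u)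
  let hv := S.PHor G q (S.dtau EM m v)
  S.κ.inner q hu (infGen EG G q (S.sigma G q p hv)) -
    S.κ.inner q hv (infGen EG G q (S.sigma G q p hu))

/-- `𝓑 = ⟨J, 𝓚_𝓥⟩ - (1/2) (κ_𝔤 ∧ i_{P_𝓥(X_nh)} [𝓚_W + d^𝓒 𝓨^i ⊗ ζ_i])|_𝓗or`, where the curvature
`𝓚_𝓥` of the connection `𝓐 = τ_𝓜^* A` is `s τ_𝓜^* (dA(P_Hor ·, P_Hor ·))`, with `s = ±1` the sign
convention for the curvature. -/
def calB (s : ℝ) (m : S.M) (u v : TangentSpace 𝓘(ℝ, EM) m) : ℝ :=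
  S.momentum G m (s • S.KV G (S.tau m) (S.dtau EM m u) (S.dtau EM m v))
    - (1 / 2) * S.kappaWedge G EM m u v

/-- `𝐁 = B_1 + 𝓑`. -/
def Bform (s : ℝ) (m : S.M) (u v : TangentSpace 𝓘(ℝ, EM) m) : ℝ :=
  S.B1 G EM m u v + S.calB G EM s m u v

/-- `Ω_𝓜 + 𝐁`. -/
def OmegaB (s : ℝ) (m : S.M) (u v : TangentSpace 𝓘(ℝ, EM) m) : ℝ :=
  S.OmegaM EM m u v + S.Bform G EM s m u v

/-- The gauge transformed bracket `{f, g}_𝐁 = df(X_g)`. -/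
def bracketB (s : ℝ) (f g : S.M → ℝ) (m : S.M) : ℝ :=
  dReal 𝓘(ℝ, EM) f m (S.hamVec EM (S.OmegaB G EM s) g m)

/-- The reduced bracket `{·,·}_red^𝐁` on `𝓜/G`: `{f, g}_red ∘ ρ = {f ∘ ρ, g ∘ ρ}_𝐁`. -/
def redBracket (s : ℝ) (f g : S.MG G → ℝ) (x : S.MG G) : ℝ :=
  S.bracketB G EM s (f ∘ S.rho G) (g ∘ S.rho G) x.out

end NHData

/-! #### The partial reduction by `G_W` -/

variable (GW : Subgroup G)

variable (Q) in
/-- `Q̃ = Q/G_W`, with the quotient topology. -/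
abbrev QT : Type _ := MulAction.orbitRel.Quotient GW Q

/-- The orbit projection `Q → Q̃`. -/
def piQ (q : Q) : QT Q GW := Quotient.mk'' q

/-- The action of `F = G/G_W` on `Q̃`: `[g] · [q] = [g · q]`. -/
def FAct [GW.Normal] (h : G ⧸ GW) (x : QT Q GW) : QT Q GW :=
  Quotient.map₂ (fun (g : G) (q : Q) => g • q) (by
    intro g g' hg q q' hq
    have hg : g⁻¹ * g' ∈ GW := QuotientGroup.leftRel_apply.mp hg
    obtain ⟨w, hw⟩ := MulAction.orbitRel_apply.mp hq
    have hw : (w : G) • q' = q := hw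
    refine MulAction.orbitRel_apply.mpr ⟨⟨g * w * (g⁻¹ * g')⁻¹ * g⁻¹, ?_⟩, ?_⟩
    · have h1 := Subgroup.Normal.conj_mem ‹GW.Normal› _
        (GW.mul_mem w.2 (GW.inv_mem hg)) g
      simpa [mul_assoc] using h1
    · change (g * w * (g⁻¹ * g')⁻¹ * g⁻¹) • (g' • q') = g • q
      rw [← hw, smul_smul, smul_smul]
      congr 1
      group) h x

variable {EQ : Type*} [NormedAddCommGroup EQ] [NormedSpace ℝ EQ] [ChartedSpace EQ (QT Q GW)]

namespace NHData

variable (S : NHData E Q EG)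

variable (EQ) in
/-- The map `ρ_{G_W} : 𝓜 → T^*Q̃`: `ρ_{G_W}(m)` is the covector at `[q]`, `q = τ(m)`, given by
`Tπ(v) ↦ m(v)` for `v ∈ D_q` (recall that `Tπ : D_q → T_{[q]}Q̃` is an isomorphism). -/
def rhoGW (m : S.M) : CotBundle EQ (QT Q GW) :=
  ⟨piQ GW m.1.1, Classical.epsilon fun α : TangentSpace 𝓘(ℝ, EQ) (piQ GW m.1.1) →L[ℝ] ℝ =>
    ∀ v ∈ S.D m.1.1, α (mfderiv 𝓘(ℝ, E) 𝓘(ℝ, EQ) (piQ (Q := Q) GW) m.1.1 v) = m.1.2 v⟩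

end NHData

variable [GW.Normal]
  {EF : Type*} [NormedAddCommGroup EF] [NormedSpace ℝ EF] [ChartedSpace EF (G ⧸ GW)]

variable (EQ) in
/-- The cotangent lift to `T^*Q̃` of the `F`-action. -/
def cotLiftF (h : G ⧸ GW) (α : CotBundle EQ (QT Q GW)) : CotBundle EQ (QT Q GW) :=
  ⟨FAct GW h α.1, ContinuousLinearMap.comp (α.2 : EQ →L[ℝ] ℝ)
    (mfderiv 𝓘(ℝ, EQ) 𝓘(ℝ, EQ) (fun x : QT Q GW => FAct GW h⁻¹ x) (FAct GW h α.1) :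
      EQ →L[ℝ] EQ)⟩

variable (EF EQ) in
/-- The infinitesimal generator map `ν ↦ ν_Q̃(x)` of the `F`-action on `Q̃`; `𝔣 = T_1 F` is
realised on the model space `EF`. -/
def infGenF (x : QT Q GW) : EF →L[ℝ] EQ :=
  mfderiv 𝓘(ℝ, EF) 𝓘(ℝ, EQ) (fun h : G ⧸ GW => FAct GW h x) 1

variable (EF) in
/-- The canonical momentum map `J̃ : T^*Q̃ → 𝔣^*`, `⟨J̃(α), ν⟩ = α(ν_Q̃)`. -/
def momentumF (α : CotBundle EQ (QT Q GW)) : EF →L[ℝ] ℝ :=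
  ContinuousLinearMap.comp (α.2 : EQ →L[ℝ] ℝ) (infGenF GW EQ EF α.1)

namespace NHData

variable (S : NHData E Q EG)

variable (EF) in
/-- The `𝔣`-valued functions `η_i` on `Q̃`: `η_i([q])` is the class of `ζ_i(q)` in `𝔣 = 𝔤/𝔴`. -/
def eta (i : Fin S.k) (x : QT Q GW) : EF :=
  (mfderiv 𝓘(ℝ, EG) 𝓘(ℝ, EF) (fun g : G => (g : G ⧸ GW)) 1 : EG →L[ℝ] EF) (S.ζ i x.out)

variable (EF) in
/-- The dual basis of `𝔣^*`-valued functions `μ^i` on `Q̃`. -/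
def muBasis (x : QT Q GW) : Fin S.k → EF →L[ℝ] ℝ :=
  Classical.epsilon fun μ : Fin S.k → EF →L[ℝ] ℝ =>
    ∀ i j, μ i (S.eta GW EF j x) = if i = j then 1 else 0

variable (EF) in
/-- `μ = c_i μ^i` for constants `c_i`. -/
def mu (c : Fin S.k → ℝ) (x : QT Q GW) : EF →L[ℝ] ℝ := ∑ i, c i • S.muBasis GW EF x i

variable (EF EQ) in
/-- The level set `J̃⁻¹(μ) = {α_x | J̃(α_x) = μ(x)}` for `μ = c_i μ^i`. -/
def levelSet (c : Fin S.k → ℝ) : Set (CotBundle EQ (QT Q GW)) :=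
  {α | momentumF GW EF α = S.mu GW EF c α.1}

/-- The standing assumptions on a nonholonomic system with a `G`-symmetry satisfying the dimension
assumption, a vertical complement `W` satisfying the vertical symmetry condition, and
`k = rank S` functionally independent `G`-invariant horizontal gauge momenta `J_i`
(for a manifold structure on `𝓜`). -/
structure IsAdmissible (GW : Subgroup G) (EM : Type*) [NormedAddCommGroup EM] [NormedSpace ℝ EM]
    [ChartedSpace EM S.M] : Prop where
  /-- the action is free -/
  free : ∀ (g : G) (q : Q), g • q = q → g = 1
  potential_smooth : ContMDiff 𝓘(ℝ, E) 𝓘(ℝ, ℝ) ∞ S.U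
  D_smooth : IsSmoothDistribution 𝓘(ℝ, E) S.D
  /-- the tangent lift of the action preserves the lagrangian -/
  lagrangian_inv : ∀ (g : G) (q : Q) (v : TangentSpace 𝓘(ℝ, E) q),
    S.lagrangian (g • q) (mfderiv 𝓘(ℝ, E) 𝓘(ℝ, E) (fun x : Q => g • x) q v) = S.lagrangian q v
  /-- the tangent lift of the action preserves the constraints -/
  D_inv : ∀ (g : G) (q : Q), S.D (g • q) =
    (S.D q).map (mfderiv 𝓘(ℝ, E) 𝓘(ℝ, E) (fun x : Q => g • x) q).toLinearMap
  /-- dimension assumption `TQ = D + V` -/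
  dimension : ∀ q : Q, S.D q ⊔ vertical EG G q = ⊤
  /-- `k = rank S`, `S = D ∩ V` -/
  rank_S : ∀ q : Q, Module.finrank ℝ (S.D q ⊓ vertical EG G q : Submodule ℝ _) = S.k
  /-- `W` is a vertical complement of the constraints -/
  W_vertical : ∀ q : Q, S.W q ≤ vertical EG G q
  W_compl : ∀ q : Q, IsCompl (S.D q) (S.W q)
  /-- vertical symmetry condition: `W_q` is the tangent space of the `G_W`-orbit of `q` -/
  GW_closed : IsClosed (GW : Set G)
  W_orbit : ∀ q : Q, (S.W q : Set (TangentSpace 𝓘(ℝ, E) q)) =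
    tangentSet 𝓘(ℝ, E) (MulAction.orbit GW q) q
  /-- `Hor ⊆ D` is a `G`-invariant horizontal distribution -/
  Hor_smooth : IsSmoothDistribution 𝓘(ℝ, E) S.Hor
  Hor_le : ∀ q : Q, S.Hor q ≤ S.D q
  Hor_compl : ∀ q : Q, IsCompl (S.Hor q) (vertical EG G q)
  Hor_inv : ∀ (g : G) (q : Q), S.Hor (g • q) =
    (S.Hor q).map (mfderiv 𝓘(ℝ, E) 𝓘(ℝ, E) (fun x : Q => g • x) q).toLinearMap
  /-- the `ζ_i` are smooth sections of `𝔤_S → Q` -/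
  ζ_smooth : ∀ i, ContMDiff 𝓘(ℝ, E) 𝓘(ℝ, EG) ∞ (S.ζ i)
  ζ_mem : ∀ (i) (q : Q), infGen EG G q (S.ζ i q) ∈ S.D q
  /-- the `J_i` are `G`-invariant, functionally independent, and conserved -/
  J_inv : ∀ (i) (m m' : S.M), S.SameOrbit G m m' → S.J G i m = S.J G i m'
  J_indep : ∀ m : S.M, LinearIndependent ℝ
    (fun i => dReal 𝓘(ℝ, EM) (S.J G i) m)
  J_conserved : ∀ (i) (m : S.M), dReal 𝓘(ℝ, EM) (S.J G i) m (S.Xnh EM m) = 0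

end NHData

end Nonholonomic

end

namespace NHReduction
open Set Filter Topology

/-! ### Smooth families of linear maps -/

section LinearFamilies

variable {EX : Type*} [NormedAddCommGroup EX] [NormedSpace ℝ EX] {HX : Type*} [TopologicalSpace HX]
  {IX : ModelWithCorners ℝ EX HX} {X : Type*} [TopologicalSpace X] [ChartedSpace HX X]
  {F₁ : Type*} [NormedAddCommGroup F₁] [NormedSpace ℝ F₁] [FiniteDimensional ℝ F₁]
  {F₂ : Type*} [NormedAddCommGroup F₂] [NormedSpace ℝ F₂]

theorem contMDiffAt_sum {ι : Type*} (s : Finset ι) {f : ι → X → F₂} {x₀ : X}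
    (h : ∀ i ∈ s, ContMDiffAt IX 𝓘(ℝ, F₂) ∞ (f i) x₀) :
    ContMDiffAt IX 𝓘(ℝ, F₂) ∞ (fun x => ∑ i ∈ s, f i x) x₀ := by
  classical
  induction s using Finset.induction_on with
  | empty => simpa using contMDiffAt_const
  | insert a s ha ih =>
    simp only [Finset.sum_insert ha]
    exact (h a (by simp)).add (ih fun i hi => h i (by simp [hi]))

/-- A family of linear maps on a finite-dimensional space is smooth if its values on fixed vectors
are. -/
theorem contMDiffAt_clm_of_apply {B : X → F₁ →L[ℝ] F₂} {x₀ : X}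
    (h : ∀ a, ContMDiffAt IX 𝓘(ℝ, F₂) ∞ (fun x => B x a) x₀) :
    ContMDiffAt IX 𝓘(ℝ, F₁ →L[ℝ] F₂) ∞ B x₀ := by
  let b := Module.finBasis ℝ F₁
  have key : B = fun x => ∑ i, (ContinuousLinearMap.smulRightL ℝ F₁ F₂
      (LinearMap.toContinuousLinearMap (b.coord i))) (B x (b i)) := by
    funext x
    ext a
    conv_lhs => rw [← b.sum_repr a]
    simp only [map_sum, map_smul, sum_apply]
    exact Finset.sum_congr rfl fun i _ => rfl
  rw [key]
  exact contMDiffAt_sum _ fun i _ =>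
    (ContinuousLinearMap.contMDiff (ContinuousLinearMap.smulRightL ℝ F₁ F₂
      (LinearMap.toContinuousLinearMap (b.coord i)))).contMDiffAt.comp x₀ (h (b i))

/-- The solution of a smooth family of injective linear equations is smooth. -/
theorem contMDiffAt_of_injective [FiniteDimensional ℝ F₂] {B : X → F₁ →L[ℝ] F₂} {z : X → F₁}
    {c : X → F₂} {x₀ : X}
    (hB : ContMDiffAt IX 𝓘(ℝ, F₁ →L[ℝ] F₂) ∞ B x₀) (hc : ContMDiffAt IX 𝓘(ℝ, F₂) ∞ c x₀)
    (hinj : Function.Injective (B x₀)) (h : ∀ᶠ x in 𝓝 x₀, B x (z x) = c x) :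
    ContMDiffAt IX 𝓘(ℝ, F₁) ∞ z x₀ := by
  have : CompleteSpace F₁ := FiniteDimensional.complete ℝ F₁
  obtain ⟨l, hl⟩ := (B x₀ : F₁ →ₗ[ℝ] F₂).exists_leftInverse_of_injective
    (LinearMap.ker_eq_bot.mpr hinj)
  let L : F₂ →L[ℝ] F₁ := LinearMap.toContinuousLinearMap l
  let G : X → F₁ →L[ℝ] F₁ := fun x => L.comp (B x)
  have hG : ContMDiffAt IX 𝓘(ℝ, F₁ →L[ℝ] F₁) ∞ G x₀ := contMDiffAt_const.clm_comp hB
  have hG0 : G x₀ = ((ContinuousLinearEquiv.refl ℝ F₁ : F₁ ≃L[ℝ] F₁) : F₁ →L[ℝ] F₁) := by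
    ext a
    exact congrArg (fun T : F₁ →ₗ[ℝ] F₁ => T a) hl
  have hinv : ContMDiffAt IX 𝓘(ℝ, F₁ →L[ℝ] F₁) ∞ (fun x => (G x).inverse) x₀ := by
    have := contDiffAt_map_inverse (𝕜 := ℝ) (n := ∞) (ContinuousLinearEquiv.refl ℝ F₁)
    rw [← hG0] at this
    exact this.contMDiffAt.comp x₀ hG
  have hev : ∀ᶠ x in 𝓝 x₀, (G x).IsInvertible := by
    have hn := ContinuousLinearEquiv.nhds (ContinuousLinearEquiv.refl ℝ F₁)
    rw [← hG0] at hn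
    filter_upwards [hG.continuousAt hn] with x hx
    obtain ⟨e, he⟩ := hx
    exact ⟨e, he⟩
  refine (hinv.clm_apply (contMDiffAt_const.clm_apply hc : ContMDiffAt IX 𝓘(ℝ, F₁) ∞
    (fun x => L (c x)) x₀)).congr_of_eventuallyEq ?_
  filter_upwards [hev, h] with x hx hz
  have : L (c x) = G x (z x) := by simp [G, hz]
  rw [this]
  exact (hx.inverse_apply_eq.mpr rfl).symm

end LinearFamilies

/-! ### Vector fields along maps -/

section VectorFields

variable {E : Type*} [NormedAddCommGroup E] [NormedSpace ℝ E] {H : Type*} [TopologicalSpace H]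
  {I : ModelWithCorners ℝ E H} {N : Type*} [TopologicalSpace N] [ChartedSpace H N]
  [IsManifold I ∞ N]
  {E' : Type*} [NormedAddCommGroup E'] [NormedSpace ℝ E'] {H' : Type*} [TopologicalSpace H']
  {I' : ModelWithCorners ℝ E' H'} {N' : Type*} [TopologicalSpace N'] [ChartedSpace H' N']
  [IsManifold I' ∞ N']
  {EX : Type*} [NormedAddCommGroup EX] [NormedSpace ℝ EX] {HX : Type*} [TopologicalSpace HX]
  {IX : ModelWithCorners ℝ EX HX} {X : Type*} [TopologicalSpace X] [ChartedSpace HX X]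

theorem contMDiffAt_vector_iff {Z : X → TangentBundle I N} {x₀ : X} {b : N}
    (hb : (Z x₀).1 ∈ (chartAt H b).source) :
    ContMDiffAt IX I.tangent ∞ Z x₀ ↔
      ContMDiffAt IX I ∞ (fun x => (Z x).1) x₀ ∧
      ContMDiffAt IX 𝓘(ℝ, E) ∞
        (fun x => (mfderiv I 𝓘(ℝ, E) (extChartAt I b) (Z x).1 (Z x).2 : E)) x₀ := by
  rw [(trivializationAt E (TangentSpace I : N → Type _) b).contMDiffAt_iff
    (by rw [Trivialization.mem_source]; exact hb)]
  refine and_congr_right fun h1 => ?_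
  have hev : ∀ᶠ x in 𝓝 x₀, (Z x).1 ∈ (chartAt H b).source :=
    h1.continuousAt ((chartAt H b).open_source.mem_nhds hb)
  refine Filter.EventuallyEq.contMDiffAt_iff ?_
  filter_upwards [hev] with x hx
  have h := DFunLike.congr_fun
    (TangentBundle.continuousLinearMapAt_trivializationAt (I := I) hx) (Z x).2
  refine Eq.trans ?_ h
  rw [Trivialization.continuousLinearMapAt_apply, Trivialization.linearMapAt_apply, if_pos]
  exact hx

theorem contMDiffAt_tangentMap_comp {g : N → N'} {Z : X → TangentBundle I N} {x₀ : X}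
    (hZ : ContMDiffAt IX I.tangent ∞ Z x₀) (hg : ContMDiffAt I I' ∞ g (Z x₀).1) :
    ContMDiffAt IX I'.tangent ∞ (fun x => tangentMap I I' g (Z x)) x₀ := by
  have hb : ContMDiffAt IX I ∞ (fun x => (Z x).1) x₀ :=
    ((contMDiffAt_vector_iff (b := (Z x₀).1) (mem_chart_source _ _)).1 hZ).1
  have A : ContMDiffAt I 𝓘(ℝ, E →L[ℝ] E') ∞
      (inTangentCoordinates I I' id g (mfderiv I I' g) (Z x₀).1) (Z x₀).1 :=
    hg.mfderiv_const (m := ∞) (n := ∞) (by simp)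
  have A' := A.comp x₀ hb
  exact ContMDiffAt.clm_apply_of_inCoordinates (b₁ := fun x => (Z x).1)
    (b₂ := fun x => g (Z x).1) (ϕ := fun x => mfderiv I I' g (Z x).1) (v := fun x => (Z x).2)
    A' hZ (hg.comp x₀ hb)

theorem contMDiff_tangentMap' {g : N → N'} (hg : ContMDiff I I' ∞ g) :
    ContMDiff I.tangent I'.tangent ∞ (tangentMap I I' g) :=
  hg.contMDiff_tangentMap (by simp)

theorem contMDiffAt_base {Z : X → TangentBundle I N} {x₀ : X}
    (hZ : ContMDiffAt IX I.tangent ∞ Z x₀) : ContMDiffAt IX I ∞ (fun x => (Z x).1) x₀ :=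
  ((contMDiffAt_vector_iff (b := (Z x₀).1) (mem_chart_source _ _)).1 hZ).1

theorem contMDiffAt_vector_sum {ι : Type*} (s : Finset ι) {f : X → N}
    {Z : ι → ∀ x, TangentSpace I (f x)} {x₀ : X} (hf : ContMDiffAt IX I ∞ f x₀)
    (h : ∀ i ∈ s, ContMDiffAt IX I.tangent ∞ (fun x => (⟨f x, Z i x⟩ : TangentBundle I N)) x₀) :
    ContMDiffAt IX I.tangent ∞ (fun x => (⟨f x, ∑ i ∈ s, Z i x⟩ : TangentBundle I N)) x₀ := by
  refine (contMDiffAt_vector_iff (b := f x₀) (mem_chart_source _ _)).2 ⟨hf, ?_⟩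
  simp only [map_sum]
  exact contMDiffAt_sum s fun i hi =>
    ((contMDiffAt_vector_iff (b := f x₀) (mem_chart_source _ _)).1 (h i hi)).2

theorem contMDiffAt_vector_smul {f : X → N} {c : X → ℝ} {Z : ∀ x, TangentSpace I (f x)} {x₀ : X}
    (hc : ContMDiffAt IX 𝓘(ℝ, ℝ) ∞ c x₀)
    (h : ContMDiffAt IX I.tangent ∞ (fun x => (⟨f x, Z x⟩ : TangentBundle I N)) x₀) :
    ContMDiffAt IX I.tangent ∞ (fun x => (⟨f x, c x • Z x⟩ : TangentBundle I N)) x₀ := by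
  refine (contMDiffAt_vector_iff (b := f x₀) (mem_chart_source _ _)).2
    ⟨(contMDiffAt_base h : ContMDiffAt IX I ∞ f x₀), ?_⟩
  simp only [map_smul]
  exact hc.smul ((contMDiffAt_vector_iff (b := f x₀) (mem_chart_source _ _)).1 h).2

theorem contMDiffAt_vector_add {f : X → N} {Z Z' : ∀ x, TangentSpace I (f x)} {x₀ : X}
    (h : ContMDiffAt IX I.tangent ∞ (fun x => (⟨f x, Z x⟩ : TangentBundle I N)) x₀)
    (h' : ContMDiffAt IX I.tangent ∞ (fun x => (⟨f x, Z' x⟩ : TangentBundle I N)) x₀) :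
    ContMDiffAt IX I.tangent ∞ (fun x => (⟨f x, Z x + Z' x⟩ : TangentBundle I N)) x₀ := by
  refine (contMDiffAt_vector_iff (b := f x₀) (mem_chart_source _ _)).2
    ⟨(contMDiffAt_base h : ContMDiffAt IX I ∞ f x₀), ?_⟩
  simp only [map_add]
  exact ((contMDiffAt_vector_iff (b := f x₀) (mem_chart_source _ _)).1 h).2.add
    ((contMDiffAt_vector_iff (b := f x₀) (mem_chart_source _ _)).1 h').2

theorem contMDiffAt_vector_sub {f : X → N} {Z Z' : ∀ x, TangentSpace I (f x)} {x₀ : X}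
    (h : ContMDiffAt IX I.tangent ∞ (fun x => (⟨f x, Z x⟩ : TangentBundle I N)) x₀)
    (h' : ContMDiffAt IX I.tangent ∞ (fun x => (⟨f x, Z' x⟩ : TangentBundle I N)) x₀) :
    ContMDiffAt IX I.tangent ∞ (fun x => (⟨f x, Z x - Z' x⟩ : TangentBundle I N)) x₀ := by
  have := contMDiffAt_vector_add h (contMDiffAt_vector_smul (c := fun _ => (-1 : ℝ))
    contMDiffAt_const h')
  simpa [sub_eq_add_neg] using this

/-- A vector field along a map with values in a vector space. -/
theorem contMDiffAt_vectorSpace_iff {f : X → E} {Z : X → E} {x₀ : X} :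
    ContMDiffAt IX (𝓘(ℝ, E)).tangent ∞
      (fun x => (⟨f x, Z x⟩ : TangentBundle 𝓘(ℝ, E) E)) x₀ ↔
      ContMDiffAt IX 𝓘(ℝ, E) ∞ f x₀ ∧ ContMDiffAt IX 𝓘(ℝ, E) ∞ Z x₀ := by
  rw [contMDiffAt_vector_iff (b := f x₀) (mem_chart_source _ _)]
  refine and_congr_right fun h1 => ?_
  refine Filter.EventuallyEq.contMDiffAt_iff (Eventually.of_forall fun x => ?_)
  have : (extChartAt 𝓘(ℝ, E) (f x₀) : E → E) = id := by
    simp [chartAt_self_eq]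
  change mfderiv 𝓘(ℝ, E) 𝓘(ℝ, E) (extChartAt 𝓘(ℝ, E) (f x₀)) (f x) (Z x) = Z x
  rw [this, mfderiv_id]
  rfl

end VectorFields

/-! ### The inverse function theorem on manifolds -/

section InverseFunction

variable {E : Type*} [NormedAddCommGroup E] [NormedSpace ℝ E] [FiniteDimensional ℝ E]
  {H : Type*} [TopologicalSpace H]
  {I : ModelWithCorners ℝ E H} [I.Boundaryless] {N : Type*} [TopologicalSpace N]
  [ChartedSpace H N] [IsManifold I ∞ N]
  {E' : Type*} [NormedAddCommGroup E'] [NormedSpace ℝ E'] [FiniteDimensional ℝ E']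
  {H' : Type*} [TopologicalSpace H']
  {I' : ModelWithCorners ℝ E' H'} [I'.Boundaryless] {N' : Type*} [TopologicalSpace N']
  [ChartedSpace H' N'] [IsManifold I' ∞ N']

omit [FiniteDimensional ℝ E] [FiniteDimensional ℝ E'] [IsManifold I ∞ N] [IsManifold I' ∞ N']
  [I'.Boundaryless] in
theorem contDiffAt_written {f : N → N'} {x : N} (hf : ContMDiffAt I I' ∞ f x) :
    ContDiffAt ℝ ∞ (writtenInExtChartAt I I' x f) (extChartAt I x x) := by
  have := (contMDiffAt_iff.1 hf).2
  rwa [I.range_eq_univ, contDiffWithinAt_univ] at this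

omit [FiniteDimensional ℝ E] [FiniteDimensional ℝ E'] [IsManifold I ∞ N] [IsManifold I' ∞ N']
  [I'.Boundaryless] in
theorem hasFDerivAt_written {f : N → N'} {x : N} (hf : ContMDiffAt I I' ∞ f x) :
    HasFDerivAt (writtenInExtChartAt I I' x f) (mfderiv I I' f x : E →L[ℝ] E')
      (extChartAt I x x) := by
  have := (hf.mdifferentiableAt (by simp)).hasMFDerivAt.2
  rw [I.range_eq_univ] at this
  exact HasFDerivWithinAt.hasFDerivAt this univ_mem

theorem hasMFDerivAt_of_written {f : N → N'} {x : N} (hf : ContinuousAt f x) {L : E →L[ℝ] E'}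
    (h : HasFDerivAt (writtenInExtChartAt I I' x f) L (extChartAt I x x)) :
    HasMFDerivAt I I' f x L :=
  ⟨hf, HasFDerivAt.hasFDerivWithinAt h⟩

theorem contMDiffAt_chart_symm (x : N) {y : E} (hy : y ∈ (extChartAt I x).target) :
    ContMDiffAt 𝓘(ℝ, E) I ∞ (extChartAt I x).symm y :=
  (contMDiffOn_extChartAt_symm x).contMDiffAt ((isOpen_extChartAt_target x).mem_nhds hy)

/-- An immersion has a smooth local left inverse. -/
theorem exists_local_leftInverse {f : N → N'} {x : N} (hf : ContMDiffAt I I' ∞ f x)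
    (hinj : Function.Injective (mfderiv I I' f x)) :
    ∃ r : N' → N, ContMDiffAt I' I ∞ r (f x) ∧ ∀ᶠ y in 𝓝 x, r (f y) = y := by
  have : CompleteSpace E := FiniteDimensional.complete ℝ E
  let D : E →L[ℝ] E' := mfderiv I I' f x
  obtain ⟨l, hl⟩ := (D : E →ₗ[ℝ] E').exists_leftInverse_of_injective
    (LinearMap.ker_eq_bot.mpr hinj)
  let L : E' →L[ℝ] E := LinearMap.toContinuousLinearMap l
  let h : E → E := fun y => L (writtenInExtChartAt I I' x f y)
  have hh : ContDiffAt ℝ ∞ h (extChartAt I x x) := L.contDiff.contDiffAt.comp _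
    (contDiffAt_written hf)
  have hd : HasFDerivAt h ((ContinuousLinearEquiv.refl ℝ E : E ≃L[ℝ] E) : E →L[ℝ] E)
      (extChartAt I x x) := by
    have h1 := L.hasFDerivAt.comp (extChartAt I x x) (hasFDerivAt_written hf)
    have h2 : ((ContinuousLinearEquiv.refl ℝ E : E ≃L[ℝ] E) : E →L[ℝ] E) = L.comp D := by
      ext a
      exact (congrArg (fun T : E →ₗ[ℝ] E => T a) hl).symm
    rw [h2]
    exact h1
  let k := hh.localInverse hd (by simp)
  have hk : ContDiffAt ℝ ∞ k (h (extChartAt I x x)) := hh.to_localInverse hd (by simp)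
  have hk0 : k (h (extChartAt I x x)) = extChartAt I x x := hh.localInverse_apply_image hd (by simp)
  have hkev : ∀ᶠ y in 𝓝 (extChartAt I x x), k (h y) = y :=
    (hh.hasStrictFDerivAt' hd (by simp)).eventually_left_inverse
  refine ⟨fun z => (extChartAt I x).symm (k (L (extChartAt I' (f x) z))), ?_, ?_⟩
  · have h0 : L (extChartAt I' (f x) (f x)) = h (extChartAt I x x) := by
      simp [h, writtenInExtChartAt]
    have h1 : ContMDiffAt I' 𝓘(ℝ, E) ∞ (fun z => k (L (extChartAt I' (f x) z))) (f x) := by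
      have h2 : ContMDiffAt I' 𝓘(ℝ, E) ∞ (fun z => L (extChartAt I' (f x) z)) (f x) :=
        L.contMDiff.contMDiffAt.comp (f x) contMDiffAt_extChartAt
      rw [← h0] at hk
      exact hk.contMDiffAt.comp (f x) h2
    have h3 : k (L (extChartAt I' (f x) (f x))) = extChartAt I x x := by rw [h0, hk0]
    refine ContMDiffAt.comp (f x) ?_ h1
    rw [h3]
    exact contMDiffAt_chart_symm x (mem_extChartAt_target x)
  · have hc := continuousAt_extChartAt (I := I) x
    filter_upwards [hc.eventually hkev, extChartAt_source_mem_nhds (I := I) x] with y hy hys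
    have : L (extChartAt I' (f x) (f y)) = h (extChartAt I x y) := by
      change _ = L (extChartAt I' (f x) (f ((extChartAt I x).symm (extChartAt I x y))))
      rw [(extChartAt I x).left_inv hys]
    rw [this, hy, (extChartAt I x).left_inv hys]

/-- Continuous maps into an immersed manifold are smooth if they are smooth in the ambient
manifold. -/
theorem contMDiffAt_of_comp_immersion {EX : Type*} [NormedAddCommGroup EX] [NormedSpace ℝ EX]
    {HX : Type*} [TopologicalSpace HX] {IX : ModelWithCorners ℝ EX HX} {X : Type*}
    [TopologicalSpace X] [ChartedSpace HX X] {f : N → N'} (hf : IsSmoothImmersion I I' f)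
    {g : X → N} {x₀ : X} (hg : ContinuousAt g x₀)
    (hfg : ContMDiffAt IX I' ∞ (fun x => f (g x)) x₀) : ContMDiffAt IX I ∞ g x₀ := by
  obtain ⟨r, hr, hrf⟩ := exists_local_leftInverse (hf.1 (g x₀)) (hf.2 (g x₀))
  have h1 : ContMDiffAt IX I ∞ (fun x => r (f (g x))) x₀ := ContMDiffAt.comp x₀ hr hfg
  refine h1.congr_of_eventuallyEq ?_
  filter_upwards [hg.eventually hrf] with x hx using hx.symm

/-- A submersion has smooth local sections with prescribed derivative. -/
theorem exists_local_section {f : N → N'} {x : N} (hf : ContMDiffAt I I' ∞ f x)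
    (R : TangentSpace I' (f x) →L[ℝ] TangentSpace I x)
    (hR : ∀ v, mfderiv I I' f x (R v) = v) :
    ∃ σ : N' → N, ContMDiffAt I' I ∞ σ (f x) ∧ σ (f x) = x ∧ (∀ᶠ z in 𝓝 (f x), f (σ z) = z) ∧
      ∀ v, (mfderiv I' I σ (f x) v : E) = R v := by
  have : CompleteSpace E' := FiniteDimensional.complete ℝ E'
  let R₀ : E' →L[ℝ] E := R
  let y₀ : E := extChartAt I x x
  let h : E' → E' := fun w => writtenInExtChartAt I I' x f (y₀ + R₀ w)
  have ha : ContDiff ℝ ∞ (fun w : E' => y₀ + R₀ w) := contDiff_const.add R₀.contDiff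
  have hy0 : y₀ + R₀ 0 = extChartAt I x x := by simp [y₀]
  have hh : ContDiffAt ℝ ∞ h 0 := by
    have h0 : ContDiffAt ℝ ∞ (writtenInExtChartAt I I' x f) (y₀ + R₀ 0) := by
      rw [hy0]
      exact contDiffAt_written hf
    exact ContDiffAt.comp (g := writtenInExtChartAt I I' x f) (f := fun w : E' => y₀ + R₀ w)
      (0 : E') h0 ha.contDiffAt
  have had : HasFDerivAt (fun w : E' => y₀ + R₀ w) R₀ 0 := R₀.hasFDerivAt.const_add y₀
  have hd : HasFDerivAt h ((ContinuousLinearEquiv.refl ℝ E' : E' ≃L[ℝ] E') : E' →L[ℝ] E') 0 := by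
    have h0 : HasFDerivAt (writtenInExtChartAt I I' x f) (mfderiv I I' f x : E →L[ℝ] E')
      (y₀ + R₀ 0) := by rw [hy0]; exact hasFDerivAt_written hf
    have h1 := h0.comp 0 had
    have h2 : ((ContinuousLinearEquiv.refl ℝ E' : E' ≃L[ℝ] E') : E' →L[ℝ] E') =
        (mfderiv I I' f x : E →L[ℝ] E').comp R₀ := by
      ext a
      exact (hR a).symm
    rw [h2]
    exact h1
  have hh0 : h 0 = extChartAt I' (f x) (f x) := by simp [h, writtenInExtChartAt, y₀]
  let k := hh.localInverse hd (by simp)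
  have hk : ContDiffAt ℝ ∞ k (h 0) := hh.to_localInverse hd (by simp)
  have hk0 : k (h 0) = 0 := hh.localInverse_apply_image hd (by simp)
  have hkd : HasFDerivAt k (ContinuousLinearMap.id ℝ E') (h 0) :=
    (hh.hasStrictFDerivAt' hd (by simp)).to_localInverse.hasFDerivAt
  have hkev : ∀ᶠ y in 𝓝 (h 0), h (k y) = y :=
    (hh.hasStrictFDerivAt' hd (by simp)).eventually_right_inverse
  rw [hh0] at hk hk0 hkd hkev
  let σ : N' → N := fun z => (extChartAt I x).symm (y₀ + R₀ (k (extChartAt I' (f x) z)))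
  have hpt : y₀ + R₀ (k (extChartAt I' (f x) (f x))) = extChartAt I x x := by
    rw [hk0, hy0]
  have hin : ContMDiffAt I' 𝓘(ℝ, E) ∞ (fun z => y₀ + R₀ (k (extChartAt I' (f x) z))) (f x) :=
    ContMDiffAt.comp (g := fun w : E' => y₀ + R₀ w) (f := fun z => k (extChartAt I' (f x) z)) (f x)
      (ha.contMDiff.contMDiffAt) (hk.contMDiffAt.comp (f x) contMDiffAt_extChartAt)
  have hσ : ContMDiffAt I' I ∞ σ (f x) := by
    refine ContMDiffAt.comp (f x) ?_ hin
    rw [hpt]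
    exact contMDiffAt_chart_symm x (mem_extChartAt_target x)
  have hσx : σ (f x) = x := by
    simp only [σ]
    rw [hpt]
    exact extChartAt_to_inv x
  refine ⟨σ, hσ, hσx, ?_, ?_⟩
  · have hfσ : ContinuousAt (fun z => f (σ z)) (f x) :=
      ContinuousAt.comp (by rw [hσx]; exact hf.continuousAt) hσ.continuousAt
    have hs : ∀ᶠ z in 𝓝 (f x), f (σ z) ∈ (extChartAt I' (f x)).source := by
      refine hfσ.preimage_mem_nhds ?_
      change _ ∈ 𝓝 (f (σ (f x)))
      rw [hσx]
      exact extChartAt_source_mem_nhds (f x)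
    filter_upwards [hs, (continuousAt_extChartAt (I := I') (f x)).eventually hkev,
      extChartAt_source_mem_nhds (I := I') (f x)] with z hz hz' hzs
    exact (extChartAt I' (f x)).injOn hz hzs hz'
  · have hmf : HasMFDerivAt I' I σ (f x) R₀ := by
      refine hasMFDerivAt_of_written hσ.continuousAt ?_
      have h1 : HasFDerivAt (fun w => y₀ + R₀ (k w)) R₀ (extChartAt I' (f x) (f x)) := by
        have := (R₀.hasFDerivAt.comp _ hkd).const_add y₀
        exact this
      refine h1.congr_of_eventuallyEq ?_
      have h2 : ContinuousAt (fun w => y₀ + R₀ (k w)) (extChartAt I' (f x) (f x)) :=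
        h1.continuousAt
      have h3 : ∀ᶠ w in 𝓝 (extChartAt I' (f x) (f x)), y₀ + R₀ (k w) ∈ (extChartAt I x).target := by
        refine h2 ?_
        change (extChartAt I x).target ∈ 𝓝 (y₀ + R₀ (k (extChartAt I' (f x) (f x))))
        rw [hpt]
        exact extChartAt_target_mem_nhds x
      filter_upwards [h3, extChartAt_target_mem_nhds (I := I') (f x)] with w hw hw'
      change extChartAt I (σ (f x)) (σ ((extChartAt I' (f x)).symm w)) = _
      rw [hσx]
      change extChartAt I x ((extChartAt I x).symm
        (y₀ + R₀ (k (extChartAt I' (f x) ((extChartAt I' (f x)).symm w))))) = _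
      rw [(extChartAt I' (f x)).right_inv hw', (extChartAt I x).right_inv hw]
    intro v
    exact congrArg (fun T : E' →L[ℝ] E => T v) hmf.mfderiv

theorem exists_section_of_submersion {f : N → N'} (hf : IsSmoothSubmersion I I' f) (x : N) :
    ∃ σ : N' → N, ContMDiffAt I' I ∞ σ (f x) ∧ σ (f x) = x ∧ ∀ᶠ z in 𝓝 (f x), f (σ z) = z := by
  let D : E →L[ℝ] E' := mfderiv I I' f x
  obtain ⟨l, hl⟩ := (D : E →ₗ[ℝ] E').exists_rightInverse_of_surjective
    (LinearMap.range_eq_top.mpr (hf.2 x))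
  obtain ⟨σ, h1, h2, h3, -⟩ := exists_local_section (hf.1 x)
    (LinearMap.toContinuousLinearMap l : E' →L[ℝ] E)
    (fun v => congrArg (fun T : E' →ₗ[ℝ] E' => T v) hl)
  exact ⟨σ, h1, h2, h3⟩

/-- Smoothness descends along surjective submersions. -/
theorem contMDiff_of_comp_submersion {EX : Type*} [NormedAddCommGroup EX] [NormedSpace ℝ EX]
    {HX : Type*} [TopologicalSpace HX] {IX : ModelWithCorners ℝ EX HX} {X : Type*}
    [TopologicalSpace X] [ChartedSpace HX X] {f : N → N'} (hf : IsSmoothSubmersion I I' f)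
    (hs : Function.Surjective f) {g : N' → X} (hg : ContMDiff I IX ∞ (fun x => g (f x))) :
    ContMDiff I' IX ∞ g := by
  intro z
  obtain ⟨x, rfl⟩ := hs z
  obtain ⟨σ, h1, h2, h3⟩ := exists_section_of_submersion hf x
  have h4 : ContMDiffAt I' IX ∞ (fun z => g (f (σ z))) (f x) :=
    ContMDiffAt.comp (g := fun x => g (f x)) (f := σ) (f x) (hg _) h1
  refine h4.congr_of_eventuallyEq ?_
  filter_upwards [h3] with z hz using by rw [hz]

/-- A chart adapted to a submersion onto a vector space. -/
theorem exists_adapted_chart {f : N → E'} {U : Set N} (hU : IsOpen U) {x : N} (hx : x ∈ U)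
    (hf : ContMDiffOn I 𝓘(ℝ, E') ∞ f U) (hs : Function.Surjective (mfderiv I 𝓘(ℝ, E') f x))
    {K : Type*} [NormedAddCommGroup K] [NormedSpace ℝ K] [FiniteDimensional ℝ K]
    (hK : Module.finrank ℝ E = Module.finrank ℝ E' + Module.finrank ℝ K) :
    ∃ (Ψ : OpenPartialHomeomorph N (E' × K)) (Λ : E ≃L[ℝ] E' × K), x ∈ Ψ.source ∧ Ψ.source ⊆ U ∧
      (∀ y ∈ Ψ.source, (Ψ y).1 = f y) ∧ ContMDiffOn I 𝓘(ℝ, E' × K) ∞ Ψ Ψ.source ∧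
      ContMDiffOn 𝓘(ℝ, E' × K) I ∞ Ψ.symm Ψ.target ∧
      (∀ v, (Λ v).1 = (mfderiv I 𝓘(ℝ, E') f x : E →L[ℝ] E') v) ∧
      ∀ v, (mfderiv I 𝓘(ℝ, E' × K) Ψ x : E →L[ℝ] E' × K) v = Λ v := by
  have : CompleteSpace E := FiniteDimensional.complete ℝ E
  let D : E →L[ℝ] E' := mfderiv I 𝓘(ℝ, E') f x
  have hker : Module.finrank ℝ (LinearMap.ker D.toLinearMap) = Module.finrank ℝ K := by
    have h1 := LinearMap.finrank_range_add_finrank_ker D.toLinearMap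
    have h2 : LinearMap.range D.toLinearMap = ⊤ := LinearMap.range_eq_top.mpr hs
    rw [h2, finrank_top] at h1
    omega
  let e₀ := LinearEquiv.ofFinrankEq _ _ hker
  obtain ⟨P, hP⟩ := (LinearMap.ker D.toLinearMap).exists_isCompl
  let pr : E →ₗ[ℝ] LinearMap.ker D.toLinearMap := Submodule.projectionOnto _ P hP
  let q : E →L[ℝ] K := LinearMap.toContinuousLinearMap (e₀.toLinearMap.comp pr)
  have hbij : Function.Injective (D.prod q) := by
    rw [injective_iff_map_eq_zero]
    intro v hv
    have h1 : D v = 0 := congrArg Prod.fst hv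
    have h2 : e₀ (pr v) = 0 := congrArg Prod.snd hv
    have h3 : pr v = 0 := by simpa using h2
    have h4 : pr v = ⟨v, h1⟩ :=
      Submodule.projectionOnto_apply_left hP ⟨v, h1⟩
    rw [h3] at h4
    exact (congrArg Subtype.val h4).symm
  have hdim : Module.finrank ℝ E = Module.finrank ℝ (E' × K) := by
    rw [Module.finrank_prod, hK]
  let Λ : E ≃L[ℝ] E' × K :=
    (LinearEquiv.ofInjectiveOfFinrankEq (D.prod q).toLinearMap hbij hdim).toContinuousLinearEquiv
  have hΛ : ∀ v, Λ v = (D v, q v) := fun v => rfl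
  let g : N → E' × K := fun y => (f y, q (extChartAt I x y))
  let V : Set N := U ∩ (extChartAt I x).source
  have hVo : IsOpen V := hU.inter (isOpen_extChartAt_source x)
  have hgV : ContMDiffOn I 𝓘(ℝ, E' × K) ∞ g V := by
    refine ContMDiffOn.prodMk_space (hf.mono inter_subset_left) ?_
    refine (q.contMDiff.contMDiffOn (s := Set.univ)).comp
      ((contMDiffOn_extChartAt (x := x)).mono ?_) (fun _ _ => mem_univ _)
    intro y hy
    simpa using hy.2
  let T : Set E := (extChartAt I x).target ∩ (extChartAt I x).symm ⁻¹' V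
  have hTo : IsOpen T :=
    (continuousOn_extChartAt_symm x).isOpen_inter_preimage (isOpen_extChartAt_target x) hVo
  let h : E → E' × K := fun y => g ((extChartAt I x).symm y)
  have hh : ContDiffOn ℝ ∞ h T := by
    refine contMDiffOn_iff_contDiffOn.1 ?_
    exact hgV.comp ((contMDiffOn_extChartAt_symm x).mono inter_subset_left) (fun y hy => hy.2)
  have hxV : x ∈ V := ⟨hx, mem_extChartAt_source x⟩
  have hxT : extChartAt I x x ∈ T :=
    ⟨mem_extChartAt_target x, by simp only [mem_preimage, extChartAt_to_inv]; exact hxV⟩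
  have hfx : ContMDiffAt I 𝓘(ℝ, E') ∞ f x := hf.contMDiffAt (hU.mem_nhds hx)
  have hd : HasFDerivAt h (Λ : E →L[ℝ] E' × K) (extChartAt I x x) := by
    have h1 : HasFDerivAt (fun y => f ((extChartAt I x).symm y)) D (extChartAt I x x) :=
      hasFDerivAt_written hfx
    have h2 : HasFDerivAt (fun y => q (extChartAt I x ((extChartAt I x).symm y))) q
        (extChartAt I x x) := by
      refine q.hasFDerivAt.congr_of_eventuallyEq ?_
      filter_upwards [extChartAt_target_mem_nhds (I := I) x] with y hy
      rw [(extChartAt I x).right_inv hy]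
    exact h1.prodMk h2
  have hhx : ContDiffAt ℝ ∞ h (extChartAt I x x) := hh.contDiffAt (hTo.mem_nhds hxT)
  let Θ := hhx.toOpenPartialHomeomorph h hd (by simp)
  let T' : Set E := {y ∈ T | (fderiv ℝ h y).IsInvertible}
  have hT'o : IsOpen T' := by
    have hc : ContinuousOn (fderiv ℝ h) T := (hh.fderiv_of_isOpen (m := ∞) hTo (by simp)).continuousOn
    have := hc.isOpen_inter_preimage hTo
      (ContinuousLinearEquiv.isOpen (𝕜 := ℝ) (E := E) (F := E' × K))
    exact this
  let c : OpenPartialHomeomorph N E :=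
    (chartAt H x).trans I.toHomeomorph.toOpenPartialHomeomorph
  have hcc : ∀ y, c y = extChartAt I x y := fun y => rfl
  have hcs : ∀ y, c.symm y = (extChartAt I x).symm y := fun y => rfl
  have hcsrc : c.source = (extChartAt I x).source := by simp [c]
  have hctgt : c.target = (extChartAt I x).target := by
    rw [extChartAt_target]
    ext y
    simp [c, I.range_eq_univ]
  let Ψ := (c.trans (Θ.restrOpen T' hT'o))
  have hΘ : ∀ y, Θ y = h y := fun y => rfl
  have hΨ : ∀ y ∈ Ψ.source, Ψ y = g y := by
    intro y hy
    have hy1 : y ∈ (extChartAt I x).source := by rw [← hcsrc]; exact hy.1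
    change g ((extChartAt I x).symm (extChartAt I x y)) = g y
    rw [(extChartAt I x).left_inv hy1]
  have hsub : Ψ.source ⊆ V := by
    intro y hy
    have hy1 : y ∈ (extChartAt I x).source := by rw [← hcsrc]; exact hy.1
    have hy2 : extChartAt I x y ∈ T' := hy.2.2
    have := hy2.1.2
    rwa [mem_preimage, (extChartAt I x).left_inv hy1] at this
  have hxΨ : x ∈ Ψ.source := by
    refine ⟨(show x ∈ c.source by rw [hcsrc]; exact mem_extChartAt_source x), ?_, ?_⟩
    · exact hhx.mem_toOpenPartialHomeomorph_source hd (by simp)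
    · exact ⟨hxT, by change (fderiv ℝ h (extChartAt I x x)).IsInvertible; rw [hd.fderiv]; exact ⟨Λ, rfl⟩⟩
  have hgx : ContMDiffAt I 𝓘(ℝ, E' × K) ∞ g x := hgV.contMDiffAt (hVo.mem_nhds hxV)
  refine ⟨Ψ, Λ, hxΨ, fun y hy => (hsub hy).1, fun y hy => by rw [hΨ y hy], ?_, ?_, fun v => rfl, ?_⟩
  · exact (hgV.mono hsub).congr fun y hy => hΨ y hy
  · intro w hw
    have hw1 : w ∈ Θ.target := hw.1.1
    have hw2 : Θ.symm w ∈ T' := hw.1.2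
    obtain ⟨e, he⟩ := hw2.2
    have h1 : ContDiffAt ℝ ∞ Θ.symm w := by
      refine Θ.contDiffAt_symm hw1 (f₀' := e) ?_ ?_
      · rw [he]
        exact ((hh.contDiffAt (hTo.mem_nhds hw2.1)).differentiableAt (by simp)).hasFDerivAt
      · exact hh.contDiffAt (hTo.mem_nhds hw2.1)
    have h2 : ContMDiffAt 𝓘(ℝ, E' × K) I ∞ (fun w => (extChartAt I x).symm (Θ.symm w)) w :=
      ContMDiffAt.comp w (contMDiffAt_chart_symm x hw2.1.1) h1.contMDiffAt
    exact h2.contMDiffWithinAt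
  · intro v
    have h1 : mfderiv I 𝓘(ℝ, E' × K) Ψ x = mfderiv I 𝓘(ℝ, E' × K) g x := by
      refine Filter.EventuallyEq.mfderiv_eq ?_
      filter_upwards [Ψ.open_source.mem_nhds hxΨ] with y hy using hΨ y hy
    let D' : E →L[ℝ] E' × K := mfderiv I 𝓘(ℝ, E' × K) g x
    have h0 : HasFDerivAt h D' (extChartAt I x x) := hasFDerivAt_written hgx
    have h2 : D' = (Λ : E →L[ℝ] E' × K) := h0.unique hd
    have h3 := congrArg (fun T : E →L[ℝ] E' × K => T v) h2
    exact Eq.trans (congrArg (fun T : E →L[ℝ] E' × K => T v) h1) h3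

/-- Vectors in the kernel of the derivative of a submersion are velocities of curves in the fibre. -/
theorem exists_curve_in_fiber {f : N → N'} (hf : IsSmoothSubmersion I I' f) (x : N)
    {u : TangentSpace I x} (hu : mfderiv I I' f x u = 0) :
    ∃ c : ℝ → N, ContMDiff 𝓘(ℝ, ℝ) I ∞ c ∧ (∀ t, f (c t) = f x) ∧ c 0 = x ∧
      (mfderiv 𝓘(ℝ, ℝ) I c 0 (1 : ℝ) : E) = u := by
  let D : E →L[ℝ] E' := mfderiv I I' f x
  let K := LinearMap.ker D.toLinearMap
  have hK : Module.finrank ℝ E = Module.finrank ℝ E' + Module.finrank ℝ K := by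
    have h1 := LinearMap.finrank_range_add_finrank_ker D.toLinearMap
    have h2 : LinearMap.range D.toLinearMap = ⊤ := LinearMap.range_eq_top.mpr (hf.2 x)
    rw [h2, finrank_top] at h1
    exact h1.symm
  let U : Set N := f ⁻¹' (extChartAt I' (f x)).source
  have hU : IsOpen U := (isOpen_extChartAt_source _).preimage hf.1.continuous
  have hxU : x ∈ U := mem_extChartAt_source (f x)
  have hg : ContMDiffOn I 𝓘(ℝ, E') ∞ (fun y => extChartAt I' (f x) (f y)) U :=
    (contMDiffOn_extChartAt (x := f x)).comp hf.1.contMDiffOn (fun y hy => by simpa [U] using hy)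
  have hgd : ∀ v, (mfderiv I 𝓘(ℝ, E') (fun y => extChartAt I' (f x) (f y)) x : E →L[ℝ] E') v =
      D v := by
    have h1 : HasFDerivAt (writtenInExtChartAt I 𝓘(ℝ, E') x
        (fun y => extChartAt I' (f x) (f y))) D (extChartAt I x x) := hasFDerivAt_written (hf.1 x)
    let D' : E →L[ℝ] E' := mfderiv I 𝓘(ℝ, E') (fun y => extChartAt I' (f x) (f y)) x
    have h2 : HasFDerivAt (writtenInExtChartAt I 𝓘(ℝ, E') x
        (fun y => extChartAt I' (f x) (f y))) D' (extChartAt I x x) := hasFDerivAt_written (hg.contMDiffAt (hU.mem_nhds hxU))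
    intro v
    exact congrArg (fun T : E →L[ℝ] E' => T v) (h2.unique h1)
  obtain ⟨Ψ, Λ, hxΨ, hΨU, hΨ1, hΨs, hΨi, hΛ, hΨd⟩ := exists_adapted_chart (K := K) hU hxU hg
    (fun w => by
      obtain ⟨v, hv⟩ := hf.2 x w
      exact ⟨v, (hgd v).trans hv⟩) hK
  obtain ⟨ε, hε, hball⟩ := Metric.isOpen_iff.1 Ψ.open_target _ (Ψ.map_source hxΨ)
  let w : K := (Λ u).2
  let δ : ℝ := ε / (‖w‖ + 1)
  have hδ : 0 < δ := by positivity
  let γ : ℝ → E' × K := fun t => Ψ x + (δ * Real.sin (t / δ)) • ((0 : E'), w)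
  have hγ : ContDiff ℝ ∞ γ := by
    have h1 : ContDiff ℝ ∞ (fun t : ℝ => δ * Real.sin (t / δ)) :=
      contDiff_const.mul (Real.contDiff_sin.comp (contDiff_id.div_const δ))
    exact contDiff_const.add (ContDiff.smul (g := fun _ : ℝ => ((0 : E'), w)) h1 contDiff_const)
  have hγt : ∀ t, γ t ∈ Ψ.target := by
    intro t
    refine hball ?_
    rw [Metric.mem_ball, dist_eq_norm]
    have h1 : γ t - Ψ x = (δ * Real.sin (t / δ)) • ((0 : E'), w) := by simp [γ]
    rw [h1, norm_smul, Prod.norm_def]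
    simp only [norm_zero, norm_nonneg, sup_of_le_right]
    have h2 : ‖δ * Real.sin (t / δ)‖ ≤ δ := by
      rw [norm_mul, Real.norm_of_nonneg hδ.le]
      have : ‖Real.sin (t / δ)‖ ≤ 1 := Real.abs_sin_le_one _
      nlinarith
    calc ‖δ * Real.sin (t / δ)‖ * ‖w‖ ≤ δ * ‖w‖ := by gcongr
      _ < δ * (‖w‖ + 1) := by nlinarith [norm_nonneg w]
      _ = ε := by simp only [δ]; field_simp
  have hγd : HasFDerivAt γ ((ContinuousLinearMap.toSpanSingleton ℝ ((0 : E'), w))) 0 := by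
    have h1 : HasDerivAt (fun t : ℝ => δ * Real.sin (t / δ)) 1 0 := by
      have h2 : HasDerivAt (fun t : ℝ => t / δ) (1 / δ) 0 := (hasDerivAt_id 0).div_const δ
      have h3 := (h2.sin).const_mul δ
      have h4 : δ * (Real.cos (0 / δ) * (1 / δ)) = 1 := by simp [hδ.ne']
      rw [h4] at h3
      exact h3
    have h4 := (h1.smul_const ((0 : E'), w)).const_add (Ψ x)
    have h5 := h4.hasFDerivAt
    simp only [one_smul] at h5
    exact h5
  have hγ0 : γ 0 = Ψ x := by simp [γ]
  let c : ℝ → N := fun t => Ψ.symm (γ t)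
  have hc : ContMDiff 𝓘(ℝ, ℝ) I ∞ c := by
    intro t
    exact ContMDiffAt.comp t (hΨi.contMDiffAt (Ψ.open_target.mem_nhds (hγt t)))
      hγ.contMDiff.contMDiffAt
  have hc0 : c 0 = x := by simp only [c, hγ0, Ψ.left_inv hxΨ]
  have hΨc : ∀ t, Ψ (c t) = γ t := fun t => Ψ.right_inv (hγt t)
  refine ⟨c, hc, ?_, hc0, ?_⟩
  · intro t
    have hs : c t ∈ Ψ.source := Ψ.map_target (hγt t)
    have h1 : extChartAt I' (f x) (f (c t)) = extChartAt I' (f x) (f x) := by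
      rw [← hΨ1 _ hs, ← hΨ1 _ hxΨ, hΨc]
      simp [γ]
    exact (extChartAt I' (f x)).injOn (hΨU hs) (mem_extChartAt_source (f x)) h1
  · have h1 : MDifferentiableAt I 𝓘(ℝ, E' × K) Ψ (c 0) := by
      rw [hc0]
      exact (hΨs.contMDiffAt (Ψ.open_source.mem_nhds hxΨ)).mdifferentiableAt (by simp)
    have h2 := mfderiv_comp_apply (I := 𝓘(ℝ, ℝ)) (I' := I) (I'' := 𝓘(ℝ, E' × K)) 0 h1
      ((hc 0).mdifferentiableAt (by simp)) (1 : ℝ)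
    have h3 : (Ψ ∘ c) = γ := funext hΨc
    have h4 : Λ (mfderiv 𝓘(ℝ, ℝ) I c 0 (1 : ℝ) : E) = (0, w) := by
      rw [h3, mfderiv_eq_fderiv, hγd.fderiv] at h2
      have h5 : (mfderiv I 𝓘(ℝ, E' × K) Ψ (c 0) : E →L[ℝ] E' × K)
          (mfderiv 𝓘(ℝ, ℝ) I c 0 (1 : ℝ) : E) = Λ (mfderiv 𝓘(ℝ, ℝ) I c 0 (1 : ℝ) : E) := by
        have h6 : ∀ z, z = x → ∀ v : E,
            (mfderiv I 𝓘(ℝ, E' × K) Ψ z : E →L[ℝ] E' × K) v = Λ v := by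
          rintro z rfl v
          exact hΨd v
        exact h6 _ hc0 _
      refine h5.symm.trans (h2.symm.trans ?_)
      exact one_smul ℝ _
    have h6 : Λ u = (0, w) := by
      exact Prod.ext ((hΛ u).trans ((hgd u).trans hu)) rfl
    exact Λ.injective (h4.trans h6.symm)

end InverseFunction

/-! ### Differential forms of degree one and two -/

section Forms

variable {E : Type*} [NormedAddCommGroup E] [NormedSpace ℝ E] [FiniteDimensional ℝ E]
  {H : Type*} [TopologicalSpace H]
  {I : ModelWithCorners ℝ E H} [I.Boundaryless] {N : Type*} [TopologicalSpace N]
  [ChartedSpace H N] [IsManifold I ∞ N]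
  {E' : Type*} [NormedAddCommGroup E'] [NormedSpace ℝ E'] [FiniteDimensional ℝ E']
  {H' : Type*} [TopologicalSpace H']
  {I' : ModelWithCorners ℝ E' H'} [I'.Boundaryless] {N' : Type*} [TopologicalSpace N']
  [ChartedSpace H' N'] [IsManifold I' ∞ N']
  {EX : Type*} [NormedAddCommGroup EX] [NormedSpace ℝ EX] {HX : Type*} [TopologicalSpace HX]
  {IX : ModelWithCorners ℝ EX HX} {X : Type*} [TopologicalSpace X] [ChartedSpace HX X]
  {V : Type*} [NormedAddCommGroup V] [NormedSpace ℝ V]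
  {V' : Type*} [NormedAddCommGroup V'] [NormedSpace ℝ V']

theorem tangentMap_congr {f g : N → N'} {x : N} (h : f =ᶠ[𝓝 x] g) (v : TangentSpace I x) :
    tangentMap I I' f ⟨x, v⟩ = tangentMap I I' g ⟨x, v⟩ :=
  TotalSpace.ext h.eq_of_nhds
    (heq_of_eq (congrArg (fun T : E →L[ℝ] E' => T v) h.mfderiv_eq))

variable (I) in
/-- The coordinate vector field with components `a` in the chart at `b`. -/
noncomputable def chartFrame (b : N) (a : E) (y : E) : TangentBundle I N :=
  ⟨(extChartAt I b).symm y, mfderiv 𝓘(ℝ, E) I (extChartAt I b).symm y a⟩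

theorem contMDiffAt_chartFrame (b : N) (a : E) {y : E} (hy : y ∈ (extChartAt I b).target) :
    ContMDiffAt 𝓘(ℝ, E) I.tangent ∞ (chartFrame I b a) y := by
  have h : ContMDiffAt 𝓘(ℝ, E) (𝓘(ℝ, E)).tangent ∞
      (fun y : E => (⟨y, a⟩ : TangentBundle 𝓘(ℝ, E) E)) y :=
    contMDiffAt_vectorSpace_iff.2 ⟨contMDiffAt_id, contMDiffAt_const⟩
  exact contMDiffAt_tangentMap_comp (I := 𝓘(ℝ, E)) (I' := I) (g := (extChartAt I b).symm) h
    (contMDiffAt_chart_symm b hy)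

variable (I) in
/-- Components of a tangent vector in the chart at `b`. -/
noncomputable def chartVec (b : N) (z : TangentBundle I N) : E :=
  mfderiv I 𝓘(ℝ, E) (extChartAt I b) z.1 z.2

theorem contMDiffAt_chartVec {Z : X → TangentBundle I N} {x₀ : X}
    (hZ : ContMDiffAt IX I.tangent ∞ Z x₀) {b : N} (hb : (Z x₀).1 ∈ (chartAt H b).source) :
    ContMDiffAt IX 𝓘(ℝ, E) ∞ (fun x => chartVec I b (Z x)) x₀ :=
  ((contMDiffAt_vector_iff hb).1 hZ).2

theorem chartFrame_chartVec {b : N} {z : TangentBundle I N} (hz : z.1 ∈ (extChartAt I b).source) :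
    chartFrame I b (chartVec I b z) (extChartAt I b z.1) = z := by
  have h1 : MDifferentiableAt 𝓘(ℝ, E) I (extChartAt I b).symm (extChartAt I b z.1) :=
    (contMDiffAt_chart_symm b ((extChartAt I b).map_source hz)).mdifferentiableAt (by simp)
  have h2 : MDifferentiableAt I 𝓘(ℝ, E) (extChartAt I b) z.1 :=
    mdifferentiableAt_extChartAt (by simpa using hz)
  have h3 : tangentMap I I ((extChartAt I b).symm ∘ extChartAt I b) ⟨z.1, z.2⟩ =
      tangentMap I I (id : N → N) ⟨z.1, z.2⟩ := by
    refine tangentMap_congr ?_ _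
    filter_upwards [(isOpen_extChartAt_source (I := I) b).mem_nhds hz] with y hy
    exact (extChartAt I b).left_inv hy
  rw [tangentMap_id] at h3
  rw [tangentMap_comp_at (I' := 𝓘(ℝ, E)) _ h1 h2] at h3
  exact h3

theorem chartFrame_self (x : N) (u : TangentSpace I x) :
    chartFrame I x u (extChartAt I x x) = ⟨x, u⟩ := by
  have h : chartVec I x (⟨x, u⟩ : TangentBundle I N) = u :=
    DFunLike.congr_fun (mfderiv_extChartAt_self (I := I) (x := x)) u
  have := chartFrame_chartVec (I := I) (b := x) (z := ⟨x, u⟩) (mem_extChartAt_source x)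
  rwa [h] at this

variable (I) in
/-- The differential of a vector-valued function. -/
noncomputable def dVec (f : N → V) (x : N) : TangentSpace I x →L[ℝ] V := mfderiv I 𝓘(ℝ, V) f x

variable (I) in
/-- A smooth 1-form with values in a vector space. -/
def SmoothOneForm (θ : ∀ x : N, TangentSpace I x →L[ℝ] V) : Prop :=
  ContMDiff I.tangent 𝓘(ℝ, V) ∞ (fun z : TangentBundle I N => θ z.1 z.2)

variable (I) in
/-- The expression of a 1-form in the chart at `b`. -/
noncomputable def chartForm (θ : ∀ x : N, TangentSpace I x →L[ℝ] V) (b : N) (y : E) : E →L[ℝ] V :=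
  (θ ((extChartAt I b).symm y)).comp (mfderiv 𝓘(ℝ, E) I (extChartAt I b).symm y)

theorem extDerivOne_eq {θ : ∀ x : N, TangentSpace I x →L[ℝ] V} {x : N} {L : E →L[ℝ] E →L[ℝ] V}
    (h : HasFDerivAt (chartForm I θ x) L (extChartAt I x x)) (u v : TangentSpace I x) :
    extDerivOne I θ x u v = L u v - L v u := by
  have : fderiv ℝ (chartForm I θ x) (extChartAt I x x) = L := h.fderiv
  change fderiv ℝ (chartForm I θ x) (extChartAt I x x) u v -
    fderiv ℝ (chartForm I θ x) (extChartAt I x x) v u = _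
  rw [this]

namespace SmoothOneForm

variable {θ θ' : ∀ x : N, TangentSpace I x →L[ℝ] V}

theorem contDiffAt_chartForm (hθ : SmoothOneForm I θ) (b : N) {y : E}
    (hy : y ∈ (extChartAt I b).target) : ContDiffAt ℝ ∞ (chartForm I θ b) y :=
  have h : ContMDiffAt 𝓘(ℝ, E) 𝓘(ℝ, E →L[ℝ] V) ∞ (chartForm I θ b) y :=
    contMDiffAt_clm_of_apply fun a => (hθ (chartFrame I b a y)).comp y
      (contMDiffAt_chartFrame b a hy)
  h.contDiffAt

theorem hasFDerivAt (hθ : SmoothOneForm I θ) (x : N) :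
    HasFDerivAt (chartForm I θ x) (fderiv ℝ (chartForm I θ x) (extChartAt I x x))
      (extChartAt I x x) :=
  ((hθ.contDiffAt_chartForm x (mem_extChartAt_target x)).differentiableAt (by simp)).hasFDerivAt

theorem sum {ι : Type*} (s : Finset ι) {θ : ι → ∀ x : N, TangentSpace I x →L[ℝ] V}
    (hθ : ∀ i ∈ s, SmoothOneForm I (θ i)) : SmoothOneForm I (fun x => ∑ i ∈ s, θ i x) := by
  intro z
  have := contMDiffAt_sum (IX := I.tangent) s (f := fun i (z : TangentBundle I N) => θ i z.1 z.2)
    (x₀ := z) (fun i hi => hθ i hi z)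
  refine this.congr_of_eventuallyEq (Eventually.of_forall fun z => ?_)
  simp only [sum_apply]

theorem smul (hθ : SmoothOneForm I θ) {f : N → ℝ} (hf : ContMDiff I 𝓘(ℝ, ℝ) ∞ f) :
    SmoothOneForm I (fun x => f x • θ x) :=
  ContMDiff.smul (hf.comp (contMDiff_proj (TangentSpace I))) hθ

theorem pairing (hθ : SmoothOneForm I θ) {J : N → V →L[ℝ] V'}
    (hJ : ContMDiff I 𝓘(ℝ, V →L[ℝ] V') ∞ J) : SmoothOneForm I (fun x => (J x).comp (θ x)) :=
  ContMDiff.clm_apply (g := fun z : TangentBundle I N => J z.1)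
    (f := fun z : TangentBundle I N => θ z.1 z.2) (hJ.comp (contMDiff_proj (TangentSpace I))) hθ

theorem pullback {θ : ∀ x : N', TangentSpace I' x →L[ℝ] V} (hθ : SmoothOneForm I' θ) {f : N → N'}
    (hf : ContMDiff I I' ∞ f) :
    SmoothOneForm I (fun x => (θ (f x)).comp (mfderiv I I' f x)) :=
  ContMDiff.comp hθ (contMDiff_tangentMap' hf)

theorem extDerivOne_clm_comp (hθ : SmoothOneForm I θ) (T : V →L[ℝ] V') (x : N)
    (u v : TangentSpace I x) :
    extDerivOne I (fun x => T.comp (θ x)) x u v = T (extDerivOne I θ x u v) := by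
  have h : HasFDerivAt (chartForm I (fun x => T.comp (θ x)) x)
      (((ContinuousLinearMap.compL ℝ E V V') T).comp
        (fderiv ℝ (chartForm I θ x) (extChartAt I x x))) (extChartAt I x x) :=
    (((ContinuousLinearMap.compL ℝ E V V') T).hasFDerivAt.comp _ (hθ.hasFDerivAt x))
  rw [extDerivOne_eq h, extDerivOne_eq (hθ.hasFDerivAt x), map_sub]
  rfl

theorem extDerivOne_add (hθ : SmoothOneForm I θ) (hθ' : SmoothOneForm I θ') (x : N)
    (u v : TangentSpace I x) :
    extDerivOne I (fun x => θ x + θ' x) x u v = extDerivOne I θ x u v + extDerivOne I θ' x u v := by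
  have h0 : chartForm I (fun x => θ x + θ' x) x = chartForm I θ x + chartForm I θ' x := by
    funext y
    exact ContinuousLinearMap.add_comp _ _ _
  have h := (hθ.hasFDerivAt x).add (hθ'.hasFDerivAt x)
  rw [← h0] at h
  rw [extDerivOne_eq h, extDerivOne_eq (hθ.hasFDerivAt x), extDerivOne_eq (hθ'.hasFDerivAt x)]
  change (_ + _ - (_ + _) : V) = _
  exact add_sub_add_comm _ _ _ _

theorem extDerivOne_sum {ι : Type*} (s : Finset ι) {θ : ι → ∀ x : N, TangentSpace I x →L[ℝ] V}
    (hθ : ∀ i ∈ s, SmoothOneForm I (θ i)) (x : N) (u v : TangentSpace I x) :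
    extDerivOne I (fun x => ∑ i ∈ s, θ i x) x u v = ∑ i ∈ s, extDerivOne I (θ i) x u v := by
  classical
  induction s using Finset.induction_on with
  | empty =>
    have h0 : chartForm I (fun x : N => ∑ i ∈ (∅ : Finset ι), θ i x) x = fun _ => 0 := by
      funext y
      simp only [chartForm, Finset.sum_empty]
      exact ContinuousLinearMap.zero_comp _
    have h := hasFDerivAt_const (𝕜 := ℝ) (0 : E →L[ℝ] V) (extChartAt I x x)
    rw [← h0] at h
    rw [extDerivOne_eq h]
    exact sub_self (0 : V)
  | insert a s ha ih =>
    simp only [Finset.sum_insert ha]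
    rw [extDerivOne_add (hθ a (by simp)) (SmoothOneForm.sum s fun i hi => hθ i (by simp [hi])),
      ih fun i hi => hθ i (by simp [hi])]

theorem extDerivOne_pairing (hθ : SmoothOneForm I θ) {J : N → V →L[ℝ] V'}
    (hJ : ContMDiff I 𝓘(ℝ, V →L[ℝ] V') ∞ J) (x : N) (u v : TangentSpace I x) :
    extDerivOne I (fun x => (J x).comp (θ x)) x u v = J x (extDerivOne I θ x u v) +
      dVec I J x u (θ x v) - dVec I J x v (θ x u) := by
  let D : E →L[ℝ] V →L[ℝ] V' := mfderiv I 𝓘(ℝ, V →L[ℝ] V') J x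
  have hD : HasFDerivAt (fun y => J ((extChartAt I x).symm y)) D (extChartAt I x x) :=
    hasFDerivAt_written (hJ x)
  have h := hD.clm_comp (hθ.hasFDerivAt x)
  have h0 : ∀ w, chartForm I θ x (extChartAt I x x) w = θ x w := by
    intro w
    exact congrArg (fun z : TangentBundle I N => θ z.1 z.2) (chartFrame_self x w)
  rw [extDerivOne_eq (hθ.hasFDerivAt x), map_sub]
  refine (extDerivOne_eq (θ := fun x => (J x).comp (θ x)) h u v).trans ?_
  have hx : (extChartAt I x).symm (extChartAt I x x) = x := extChartAt_to_inv x
  have e : ∀ u v : E, (((ContinuousLinearMap.compL ℝ E V V')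
      (J ((extChartAt I x).symm (extChartAt I x x)))).comp
        (fderiv ℝ (chartForm I θ x) (extChartAt I x x)) +
      ((ContinuousLinearMap.compL ℝ E V V').flip
        (chartForm I θ x (extChartAt I x x))).comp D) u v =
      J x (fderiv ℝ (chartForm I θ x) (extChartAt I x x) u v) + D u (θ x v) := by
    intro u v
    refine congrArg₂ (· + ·) ?_ (congrArg (D u) (h0 v))
    exact congrArg (fun z => J z (fderiv ℝ (chartForm I θ x) (extChartAt I x x) u v)) hx
  refine (congrArg₂ (· - ·) (e u v) (e v u)).trans ?_
  change _ = _ + D u (θ x v) - D v (θ x u)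
  abel

theorem extDerivOne_smul (hθ : SmoothOneForm I θ) {f : N → ℝ} (hf : ContMDiff I 𝓘(ℝ, ℝ) ∞ f)
    (x : N) (u v : TangentSpace I x) :
    extDerivOne I (fun x => f x • θ x) x u v = f x • extDerivOne I θ x u v +
      dReal I f x u • θ x v - dReal I f x v • θ x u := by
  let D : E →L[ℝ] ℝ := mfderiv I 𝓘(ℝ, ℝ) f x
  have hD : HasFDerivAt (fun y => f ((extChartAt I x).symm y)) D (extChartAt I x x) :=
    hasFDerivAt_written (hf x)
  have h := hD.smul (hθ.hasFDerivAt x)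
  have h1 : chartForm I (fun x => f x • θ x) x =
      fun y => f ((extChartAt I x).symm y) • chartForm I θ x y := by
    funext y
    exact ContinuousLinearMap.smul_comp _ _ _
  have h0 : ∀ w, chartForm I θ x (extChartAt I x x) w = θ x w := by
    intro w
    exact congrArg (fun z : TangentBundle I N => θ z.1 z.2) (chartFrame_self x w)
  rw [extDerivOne_eq (hθ.hasFDerivAt x), smul_sub]
  refine (extDerivOne_eq (θ := fun x => f x • θ x) (by rw [h1]; exact h) u v).trans ?_
  have hx : (extChartAt I x).symm (extChartAt I x x) = x := extChartAt_to_inv x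
  have e : ∀ u v : E, (f ((extChartAt I x).symm (extChartAt I x x)) •
        (fderiv ℝ (chartForm I θ x) (extChartAt I x x)) +
      ContinuousLinearMap.smulRight D (chartForm I θ x (extChartAt I x x))) u v =
      f x • (fderiv ℝ (chartForm I θ x) (extChartAt I x x) u v) + D u • (θ x v) := by
    intro u v
    refine congrArg₂ (· + ·) ?_ (congrArg (D u • ·) (h0 v))
    exact congrArg (fun z => f z • (fderiv ℝ (chartForm I θ x) (extChartAt I x x) u v)) hx
  refine (congrArg₂ (· - ·) (e u v) (e v u)).trans ?_
  change _ = _ + D u • θ x v - D v • θ x u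
  abel

/-- The exterior derivative commutes with pull back. -/
theorem extDerivOne_pullback {θ : ∀ x : N', TangentSpace I' x →L[ℝ] V} (hθ : SmoothOneForm I' θ)
    {f : N → N'} {x : N} (hf : ContMDiffAt I I' ∞ f x) (u v : TangentSpace I x) :
    extDerivOne I (fun x => (θ (f x)).comp (mfderiv I I' f x)) x u v =
      extDerivOne I' θ (f x) (mfderiv I I' f x u) (mfderiv I I' f x v) := by
  let g : E → E' := writtenInExtChartAt I I' x f
  have hg : ContDiffAt ℝ ∞ g (extChartAt I x x) := contDiffAt_written hf
  let D : E →L[ℝ] E' := mfderiv I I' f x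
  have hgD : HasFDerivAt g D (extChartAt I x x) := hasFDerivAt_written hf
  have hg0 : g (extChartAt I x x) = extChartAt I' (f x) (f x) := by
    simp [g, writtenInExtChartAt]
  have hev : chartForm I (fun x => (θ (f x)).comp (mfderiv I I' f x)) x =ᶠ[𝓝 (extChartAt I x x)]
      fun y => (chartForm I' θ (f x) (g y)).comp (fderiv ℝ g y) := by
    have h1 : ∀ᶠ y in 𝓝 x, ContMDiffAt I I' 1 f y :=
      contMDiffAt_iff_contMDiffAt_nhds (by simp) |>.1
        (ContMDiffAt.of_le hf (m := 1) (by simp))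
    have h2 : ∀ᶠ y in 𝓝 x, f y ∈ (extChartAt I' (f x)).source :=
      hf.continuousAt.preimage_mem_nhds (extChartAt_source_mem_nhds _)
    have hc : ContinuousAt (extChartAt I x).symm (extChartAt I x x) :=
      continuousAt_extChartAt_symm x
    have hc' : Tendsto (extChartAt I x).symm (𝓝 (extChartAt I x x)) (𝓝 x) := by
      have := hc.tendsto
      rwa [extChartAt_to_inv] at this
    have h3 := hc'.eventually (h1.and h2.eventually_nhds)
    have h4 : ∀ᶠ y in 𝓝 (extChartAt I x x), ContDiffAt ℝ 1 g y :=
      ContDiffAt.eventually (hg.of_le (m := 1) (by simp)) (by simp)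
    filter_upwards [h3, h4, extChartAt_target_mem_nhds (I := I) x] with y hy hy4 hyt
    ext a
    have hφ : MDifferentiableAt 𝓘(ℝ, E) I (extChartAt I x).symm y :=
      (contMDiffAt_chart_symm x hyt).mdifferentiableAt (by simp)
    have hfy : MDifferentiableAt I I' f ((extChartAt I x).symm y) :=
      hy.1.mdifferentiableAt (by simp)
    have hgy : MDifferentiableAt 𝓘(ℝ, E) 𝓘(ℝ, E') g y :=
      (hy4.differentiableAt (by simp)).mdifferentiableAt
    have hgt : g y ∈ (extChartAt I' (f x)).target :=
      (extChartAt I' (f x)).map_source hy.2.self_of_nhds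
    have hφ' : MDifferentiableAt 𝓘(ℝ, E') I' (extChartAt I' (f x)).symm (g y) :=
      (contMDiffAt_chart_symm (f x) hgt).mdifferentiableAt (by simp)
    have key : tangentMap 𝓘(ℝ, E) I' (f ∘ (extChartAt I x).symm) ⟨y, a⟩ =
        tangentMap 𝓘(ℝ, E) I' ((extChartAt I' (f x)).symm ∘ g) ⟨y, a⟩ := by
      refine tangentMap_congr ?_ _
      have hyc : ContinuousAt (extChartAt I x).symm y := hφ.continuousAt
      filter_upwards [hyc.eventually hy.2] with w hw
      exact ((extChartAt I' (f x)).left_inv hw).symm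
    rw [tangentMap_comp_at (I' := I) _ hfy hφ, tangentMap_comp_at (I' := 𝓘(ℝ, E')) _ hφ' hgy] at key
    have key2 := congrArg (fun z : TangentBundle I' N' => θ z.1 z.2) key
    refine Eq.trans key2 ?_
    change θ _ (mfderiv 𝓘(ℝ, E') I' (extChartAt I' (f x)).symm (g y)
      (mfderiv 𝓘(ℝ, E) 𝓘(ℝ, E') g y a)) = _
    rw [mfderiv_eq_fderiv]
    rfl
  have hA := hθ.hasFDerivAt (f x)
  rw [← hg0] at hA
  have h2 : HasFDerivAt (fderiv ℝ g) (fderiv ℝ (fderiv ℝ g) (extChartAt I x x))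
      (extChartAt I x x) :=
    ((hg.fderiv_right (m := ∞) (by simp)).differentiableAt (by simp)).hasFDerivAt
  have h3 := ((hA.comp _ hgD).clm_comp h2).congr_of_eventuallyEq hev
  have hsym : IsSymmSndFDerivAt ℝ g (extChartAt I x x) :=
    hg.isSymmSndFDerivAt (by
      rw [minSmoothness_of_isRCLikeNormedField]; exact WithTop.coe_le_coe.2 le_top)
  rw [extDerivOne_eq h3, extDerivOne_eq (hθ.hasFDerivAt (f x))]
  have hs : fderiv ℝ (fderiv ℝ g) (extChartAt I x x) u v =
      fderiv ℝ (fderiv ℝ g) (extChartAt I x x) v u := hsym u v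
  let P := fderiv ℝ (chartForm I' θ (f x))
  let c := chartForm I' θ (f x) (g (extChartAt I x x))
  let T := fderiv ℝ (fderiv ℝ g) (extChartAt I x x)
  have e0 : ∀ u v : E, P (g (extChartAt I x x)) (D u) (fderiv ℝ g (extChartAt I x x) v) =
      P (extChartAt I' (f x) (f x)) (D u) (D v) := by
    intro u v
    rw [hg0, hgD.fderiv]
  change c (T u v) + P (g (extChartAt I x x)) (D u) (fderiv ℝ g (extChartAt I x x) v) -
    (c (T v u) + P (g (extChartAt I x x)) (D v) (fderiv ℝ g (extChartAt I x x) u)) =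
    P (extChartAt I' (f x) (f x)) (D u) (D v) - P (extChartAt I' (f x) (f x)) (D v) (D u)
  refine (congrArg₂ (· - ·) (congrArg₂ (· + ·) (congrArg c hs) (e0 u v))
    (congrArg (c (T v u) + ·) (e0 v u))).trans ?_
  exact add_sub_add_left_eq_sub _ _ _

theorem extDerivOne_vectorSpace {θ : E → E →L[ℝ] V} (x u v : E) :
    extDerivOne 𝓘(ℝ, E) (N := E) θ x u v = fderiv ℝ θ x u v - fderiv ℝ θ x v u := by
  have : chartForm 𝓘(ℝ, E) (N := E) θ x = θ := by
    funext y
    ext a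
    have h1 : ((extChartAt 𝓘(ℝ, E) x).symm : E → E) = id := by simp [chartAt_self_eq]
    change θ ((extChartAt 𝓘(ℝ, E) x).symm y)
      (mfderiv 𝓘(ℝ, E) 𝓘(ℝ, E) (extChartAt 𝓘(ℝ, E) x).symm y a) = _
    rw [h1, mfderiv_id]
    rfl
  change fderiv ℝ (chartForm 𝓘(ℝ, E) (N := E) θ x) (extChartAt 𝓘(ℝ, E) x x) u v -
    fderiv ℝ (chartForm 𝓘(ℝ, E) (N := E) θ x) (extChartAt 𝓘(ℝ, E) x x) v u = _
  rw [this]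
  simp [chartAt_self_eq]

theorem extDerivOne_chartFrame (hθ : SmoothOneForm I θ) (b : N) {y : E}
    (hy : y ∈ (extChartAt I b).target) (a a' : E) :
    extDerivOne I θ (chartFrame I b a y).1 (chartFrame I b a y).2 (chartFrame I b a' y).2 =
      fderiv ℝ (chartForm I θ b) y a a' - fderiv ℝ (chartForm I θ b) y a' a := by
  rw [← extDerivOne_vectorSpace]
  exact (hθ.extDerivOne_pullback (I := 𝓘(ℝ, E)) (contMDiffAt_chart_symm b hy) a a').symm

end SmoothOneForm

end Forms
/-! ### Covariant tensors of degree two -/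

section Tensors

variable {E : Type*} [NormedAddCommGroup E] [NormedSpace ℝ E] [FiniteDimensional ℝ E]
  {H : Type*} [TopologicalSpace H]
  {I : ModelWithCorners ℝ E H} [I.Boundaryless] {N : Type*} [TopologicalSpace N]
  [ChartedSpace H N] [IsManifold I ∞ N]
  {E' : Type*} [NormedAddCommGroup E'] [NormedSpace ℝ E'] [FiniteDimensional ℝ E']
  {H' : Type*} [TopologicalSpace H']
  {I' : ModelWithCorners ℝ E' H'} [I'.Boundaryless] {N' : Type*} [TopologicalSpace N']
  [ChartedSpace H' N'] [IsManifold I' ∞ N']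
  {EX : Type*} [NormedAddCommGroup EX] [NormedSpace ℝ EX] {HX : Type*} [TopologicalSpace HX]
  {IX : ModelWithCorners ℝ EX HX} {X : Type*} [TopologicalSpace X] [ChartedSpace HX X]
  {V : Type*} [NormedAddCommGroup V] [NormedSpace ℝ V]
  {V' : Type*} [NormedAddCommGroup V'] [NormedSpace ℝ V']

variable (I) in
/-- The components of a covariant 2-tensor in the chart at `b`. -/
noncomputable def chartTensor (β : ∀ x : N, TangentSpace I x → TangentSpace I x → V) (b : N)
    (y a a' : E) : V :=
  β ((extChartAt I b).symm y) (mfderiv 𝓘(ℝ, E) I (extChartAt I b).symm y a)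
    (mfderiv 𝓘(ℝ, E) I (extChartAt I b).symm y a')

variable (I) in
/-- A smooth covariant 2-tensor. -/
structure IsSmoothTensor (β : ∀ x : N, TangentSpace I x → TangentSpace I x → V) : Prop where
  add_left : ∀ x u u' v, β x (u + u') v = β x u v + β x u' v
  smul_left : ∀ x (c : ℝ) u v, β x (c • u) v = c • β x u v
  add_right : ∀ x u v v', β x u (v + v') = β x u v + β x u v'
  smul_right : ∀ x (c : ℝ) u v, β x u (c • v) = c • β x u v
  smooth : ∀ b a a', ∀ y ∈ (extChartAt I b).target,
    ContMDiffAt 𝓘(ℝ, E) 𝓘(ℝ, V) ∞ (fun y => chartTensor I β b y a a') y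

variable (I) in
/-- A smooth 2-form. -/
structure IsTwoForm (β : ∀ x : N, TangentSpace I x → TangentSpace I x → V) : Prop
    extends IsSmoothTensor I β where
  skew : ∀ x u v, β x u v = - β x v u

theorem tensor_congr (β : ∀ x : N, TangentSpace I x → TangentSpace I x → V) {p q : N}
    {u v : TangentSpace I p} {u' v' : TangentSpace I q}
    (hu : (⟨p, u⟩ : TangentBundle I N) = ⟨q, u'⟩) (hv : (⟨p, v⟩ : TangentBundle I N) = ⟨q, v'⟩) :
    β p u v = β q u' v' := by
  cases hu
  cases hv
  rfl

namespace IsSmoothTensor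

variable {β β' : ∀ x : N, TangentSpace I x → TangentSpace I x → V}

/-- The values of a tensor at a point as a continuous bilinear map. -/
noncomputable def bilin (hβ : IsSmoothTensor I β) (x : N) : E →L[ℝ] E →L[ℝ] V :=
  LinearMap.toContinuousLinearMap
    { toFun := fun u => LinearMap.toContinuousLinearMap
        { toFun := fun v => β x u v
          map_add' := hβ.add_right x u
          map_smul' := fun c v => hβ.smul_right x c u v }
      map_add' := fun u u' => by ext v; exact hβ.add_left x u u' v
      map_smul' := fun c u => by ext v; exact hβ.smul_left x c u v }

theorem zero_left (hβ : IsSmoothTensor I β) (x : N) (v : TangentSpace I x) : β x 0 v = 0 := by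
  have := hβ.smul_left x 0 0 v
  simpa using this

theorem neg_left (hβ : IsSmoothTensor I β) (x : N) (u v : TangentSpace I x) :
    β x (-u) v = -β x u v := by
  have := hβ.smul_left x (-1) u v
  simpa using this

theorem sub_left (hβ : IsSmoothTensor I β) (x : N) (u u' v : TangentSpace I x) :
    β x (u - u') v = β x u v - β x u' v := by
  rw [sub_eq_add_neg, hβ.add_left, hβ.neg_left, ← sub_eq_add_neg]

theorem contMDiffAt_apply (hβ : IsSmoothTensor I β) {f : X → N} {Z Z' : ∀ x, TangentSpace I (f x)}
    {x₀ : X} (hZ : ContMDiffAt IX I.tangent ∞ (fun x => (⟨f x, Z x⟩ : TangentBundle I N)) x₀)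
    (hZ' : ContMDiffAt IX I.tangent ∞ (fun x => (⟨f x, Z' x⟩ : TangentBundle I N)) x₀) :
    ContMDiffAt IX 𝓘(ℝ, V) ∞ (fun x => β (f x) (Z x) (Z' x)) x₀ := by
  have hf : ContMDiffAt IX I ∞ f x₀ := contMDiffAt_base hZ
  have hz := contMDiffAt_chartVec hZ (b := f x₀) (mem_chart_source _ _)
  have hz' := contMDiffAt_chartVec hZ' (b := f x₀) (mem_chart_source _ _)
  have hφ : ContMDiffAt IX 𝓘(ℝ, E) ∞ (fun x => extChartAt I (f x₀) (f x)) x₀ :=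
    contMDiffAt_extChartAt.comp x₀ hf
  let e := Module.finBasis ℝ E
  let T : E → E →L[ℝ] E →L[ℝ] V := fun y =>
    (hβ.bilin ((extChartAt I (f x₀)).symm y)).bilinearComp
      (mfderiv 𝓘(ℝ, E) I (extChartAt I (f x₀)).symm y : E →L[ℝ] E)
      (mfderiv 𝓘(ℝ, E) I (extChartAt I (f x₀)).symm y : E →L[ℝ] E)
  have hT : ∀ y ∈ (extChartAt I (f x₀)).target,
      ContMDiffAt 𝓘(ℝ, E) 𝓘(ℝ, E →L[ℝ] E →L[ℝ] V) ∞ T y := fun y hy =>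
    contMDiffAt_clm_of_apply fun a => contMDiffAt_clm_of_apply fun a' =>
      hβ.smooth (f x₀) a a' y hy
  have hmain : ContMDiffAt IX 𝓘(ℝ, V) ∞ (fun x => T (extChartAt I (f x₀) (f x))
      (chartVec I (f x₀) ⟨f x, Z x⟩) (chartVec I (f x₀) ⟨f x, Z' x⟩)) x₀ :=
    (((hT _ (mem_extChartAt_target _)).comp x₀ hφ).clm_apply hz).clm_apply hz'
  refine hmain.congr_of_eventuallyEq ?_
  filter_upwards [hf.continuousAt.eventually
    ((isOpen_extChartAt_source (I := I) (f x₀)).mem_nhds (mem_extChartAt_source _))] with x hx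
  exact (tensor_congr β (chartFrame_chartVec (z := ⟨f x, Z x⟩) hx)
    (chartFrame_chartVec (z := ⟨f x, Z' x⟩) hx)).symm

theorem add (hβ : IsSmoothTensor I β) (hβ' : IsSmoothTensor I β') :
    IsSmoothTensor I (fun x u v => β x u v + β' x u v) where
  add_left x u u' v := by simp only [hβ.add_left, hβ'.add_left]; abel
  smul_left x c u v := by simp only [hβ.smul_left, hβ'.smul_left, smul_add]
  add_right x u u' v := by simp only [hβ.add_right, hβ'.add_right]; abel
  smul_right x c u v := by simp only [hβ.smul_right, hβ'.smul_right, smul_add]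
  smooth b a a' y hy := (hβ.smooth b a a' y hy).add (hβ'.smooth b a a' y hy)

theorem clm_comp (hβ : IsSmoothTensor I β) (T : V →L[ℝ] V') :
    IsSmoothTensor I (fun x u v => T (β x u v)) where
  add_left x u u' v := by simp only [hβ.add_left, map_add]
  smul_left x c u v := by simp only [hβ.smul_left, map_smul]
  add_right x u u' v := by simp only [hβ.add_right, map_add]
  smul_right x c u v := by simp only [hβ.smul_right, map_smul]
  smooth b a a' y hy := T.contMDiff.contMDiffAt.comp y (hβ.smooth b a a' y hy)

theorem pairing (hβ : IsSmoothTensor I β) {J : N → V →L[ℝ] V'}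
    (hJ : ContMDiff I 𝓘(ℝ, V →L[ℝ] V') ∞ J) : IsSmoothTensor I (fun x u v => J x (β x u v)) where
  add_left x u u' v := by simp only [hβ.add_left, map_add]
  smul_left x c u v := by simp only [hβ.smul_left, map_smul]
  add_right x u u' v := by simp only [hβ.add_right, map_add]
  smul_right x c u v := by simp only [hβ.smul_right, map_smul]
  smooth b a a' y hy :=
    ((hJ _).comp y (contMDiffAt_chart_symm b hy)).clm_apply (hβ.smooth b a a' y hy)

theorem flip (hβ : IsSmoothTensor I β) : IsSmoothTensor I (fun x u v => β x v u) where
  add_left x u u' v := hβ.add_right x v u u'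
  smul_left x c u v := hβ.smul_right x c v u
  add_right x u v v' := hβ.add_left x v v' u
  smul_right x c u v := hβ.smul_left x c v u
  smooth b a a' y hy := hβ.smooth b a' a y hy

/-- Pull back of a tensor by smooth vector bundle maps. -/
theorem bundlePullback {β : ∀ x : N', TangentSpace I' x → TangentSpace I' x → V}
    (hβ : IsSmoothTensor I' β) {f : N → N'}
    {Φ Φ' : ∀ x : N, TangentSpace I x → TangentSpace I' (f x)}
    (hadd : ∀ x u v, Φ x (u + v) = Φ x u + Φ x v)
    (hsmul : ∀ x (c : ℝ) u, Φ x (c • u) = c • Φ x u)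
    (hΦ : ContMDiff I.tangent I'.tangent ∞
      (fun z : TangentBundle I N => (⟨f z.1, Φ z.1 z.2⟩ : TangentBundle I' N')))
    (hadd' : ∀ x u v, Φ' x (u + v) = Φ' x u + Φ' x v)
    (hsmul' : ∀ x (c : ℝ) u, Φ' x (c • u) = c • Φ' x u)
    (hΦ' : ContMDiff I.tangent I'.tangent ∞
      (fun z : TangentBundle I N => (⟨f z.1, Φ' z.1 z.2⟩ : TangentBundle I' N'))) :
    IsSmoothTensor I (fun x u v => β (f x) (Φ x u) (Φ' x v)) where
  add_left x u u' v := by simp only [hadd, hβ.add_left]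
  smul_left x c u v := by simp only [hsmul, hβ.smul_left]
  add_right x u u' v := by simp only [hadd', hβ.add_right]
  smul_right x c u v := by simp only [hsmul', hβ.smul_right]
  smooth b a a' y hy :=
    hβ.contMDiffAt_apply
      (f := fun y => f (chartFrame I b a y).1)
      (Z := fun y => Φ (chartFrame I b a y).1 (chartFrame I b a y).2)
      (Z' := fun y => Φ' (chartFrame I b a' y).1 (chartFrame I b a' y).2)
      ((hΦ _).comp y (contMDiffAt_chartFrame b a hy))
      ((hΦ' _).comp y (contMDiffAt_chartFrame b a' hy))

theorem pullback {β : ∀ x : N', TangentSpace I' x → TangentSpace I' x → V}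
    (hβ : IsSmoothTensor I' β) {f : N → N'} (hf : ContMDiff I I' ∞ f) :
    IsSmoothTensor I (fun x u v => β (f x) (mfderiv I I' f x u) (mfderiv I I' f x v)) :=
  hβ.bundlePullback (fun x u v => map_add _ u v) (fun x c u => map_smul _ c u)
    (contMDiff_tangentMap' hf) (fun x u v => map_add _ u v) (fun x c u => map_smul _ c u)
    (contMDiff_tangentMap' hf)

theorem sub (hβ : IsSmoothTensor I β) (hβ' : IsSmoothTensor I β') :
    IsSmoothTensor I (fun x u v => β x u v - β' x u v) where
  add_left x u u' v := by simp only [hβ.add_left, hβ'.add_left]; abel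
  smul_left x c u v := by simp only [hβ.smul_left, hβ'.smul_left, smul_sub]
  add_right x u u' v := by simp only [hβ.add_right, hβ'.add_right]; abel
  smul_right x c u v := by simp only [hβ.smul_right, hβ'.smul_right, smul_sub]
  smooth b a a' y hy := (hβ.smooth b a a' y hy).sub (hβ'.smooth b a a' y hy)

theorem sum {ι : Type*} (s : Finset ι) {β : ι → ∀ x : N, TangentSpace I x → TangentSpace I x → V}
    (hβ : ∀ i ∈ s, IsSmoothTensor I (β i)) : IsSmoothTensor I (fun x u v => ∑ i ∈ s, β i x u v) where
  add_left x u u' v := by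
    rw [← Finset.sum_add_distrib]
    exact Finset.sum_congr rfl fun i hi => (hβ i hi).add_left x u u' v
  smul_left x c u v := by
    rw [Finset.smul_sum]
    exact Finset.sum_congr rfl fun i hi => (hβ i hi).smul_left x c u v
  add_right x u u' v := by
    rw [← Finset.sum_add_distrib]
    exact Finset.sum_congr rfl fun i hi => (hβ i hi).add_right x u u' v
  smul_right x c u v := by
    rw [Finset.smul_sum]
    exact Finset.sum_congr rfl fun i hi => (hβ i hi).smul_right x c u v
  smooth b a a' y hy := contMDiffAt_sum s fun i hi => (hβ i hi).smooth b a a' y hy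

theorem smul_vec (hβ : IsSmoothTensor I β) {J : N → ℝ} (hJ : ContMDiff I 𝓘(ℝ, ℝ) ∞ J) :
    IsSmoothTensor I (fun x u v => J x • β x u v) where
  add_left x u u' v := by simp only [hβ.add_left, smul_add]
  smul_left x c u v := by simp only [hβ.smul_left, smul_comm c]
  add_right x u u' v := by simp only [hβ.add_right, smul_add]
  smul_right x c u v := by simp only [hβ.smul_right, smul_comm c]
  smooth b a a' y hy :=
    ((hJ _).comp y (contMDiffAt_chart_symm b hy)).smul (hβ.smooth b a a' y hy)

/-- Multiplication of a real valued tensor with a vector valued function. -/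
theorem smul_fun {β : ∀ x : N, TangentSpace I x → TangentSpace I x → ℝ} (hβ : IsSmoothTensor I β)
    {ζ : N → V} (hζ : ContMDiff I 𝓘(ℝ, V) ∞ ζ) : IsSmoothTensor I (fun x u v => β x u v • ζ x) where
  add_left x u u' v := by simp only [hβ.add_left, add_smul]
  smul_left x c u v := by simp only [hβ.smul_left, smul_eq_mul, mul_smul]
  add_right x u u' v := by simp only [hβ.add_right, add_smul]
  smul_right x c u v := by simp only [hβ.smul_right, smul_eq_mul, mul_smul]
  smooth b a a' y hy :=
    (hβ.smooth b a a' y hy).smul ((hζ _).comp y (contMDiffAt_chart_symm b hy))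

end IsSmoothTensor

theorem SmoothOneForm.isTwoForm_extDerivOne {θ : ∀ x : N, TangentSpace I x →L[ℝ] V}
    (hθ : SmoothOneForm I θ) : IsTwoForm I (fun x u v => extDerivOne I θ x u v) where
  add_left x u u' v := by
    rw [extDerivOne_eq (hθ.hasFDerivAt x), extDerivOne_eq (hθ.hasFDerivAt x),
      extDerivOne_eq (hθ.hasFDerivAt x)]
    let P := fderiv ℝ (chartForm I θ x) (extChartAt I x x)
    have h1 : ∀ u u' v : E, P (u + u') v - P v (u + u') = P u v - P v u + (P u' v - P v u') := by
      intro u u' v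
      rw [map_add, map_add, add_apply]
      abel
    exact h1 u u' v
  smul_left x c u v := by
    rw [extDerivOne_eq (hθ.hasFDerivAt x), extDerivOne_eq (hθ.hasFDerivAt x)]
    let P := fderiv ℝ (chartForm I θ x) (extChartAt I x x)
    have h1 : ∀ u v : E, P (c • u) v - P v (c • u) = c • (P u v - P v u) := by
      intro u v
      rw [map_smul, map_smul, smul_sub]
      rfl
    exact h1 u v
  add_right x v u u' := by
    rw [extDerivOne_eq (hθ.hasFDerivAt x), extDerivOne_eq (hθ.hasFDerivAt x),
      extDerivOne_eq (hθ.hasFDerivAt x)]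
    let P := fderiv ℝ (chartForm I θ x) (extChartAt I x x)
    have h1 : ∀ u u' v : E, P v (u + u') - P (u + u') v = P v u - P u v + (P v u' - P u' v) := by
      intro u u' v
      rw [map_add, map_add, add_apply]
      abel
    exact h1 u u' v
  smul_right x c v u := by
    rw [extDerivOne_eq (hθ.hasFDerivAt x), extDerivOne_eq (hθ.hasFDerivAt x)]
    let P := fderiv ℝ (chartForm I θ x) (extChartAt I x x)
    have h1 : ∀ u v : E, P v (c • u) - P (c • u) v = c • (P v u - P u v) := by
      intro u v
      rw [map_smul, map_smul, smul_sub]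
      rfl
    exact h1 u v
  smooth b a a' y hy := by
    have h1 : ContDiffAt ℝ ∞ (fderiv ℝ (chartForm I θ b)) y :=
      (hθ.contDiffAt_chartForm b hy).fderiv_right (m := ∞) (by simp)
    have h2 : ContDiffAt ℝ ∞ (fun y => fderiv ℝ (chartForm I θ b) y a a' -
        fderiv ℝ (chartForm I θ b) y a' a) y :=
      ((h1.clm_apply contDiffAt_const).clm_apply contDiffAt_const).sub
        ((h1.clm_apply contDiffAt_const).clm_apply contDiffAt_const)
    refine h2.contMDiffAt.congr_of_eventuallyEq ?_
    filter_upwards [(isOpen_extChartAt_target (I := I) b).mem_nhds hy] with z hz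
    exact hθ.extDerivOne_chartFrame b hz a a'
  skew x u v := (neg_sub _ _).symm

namespace IsTwoForm

variable {β β' : ∀ x : N, TangentSpace I x → TangentSpace I x → V}

theorem antisymm {β : ∀ x : N, TangentSpace I x → TangentSpace I x → V} (hβ : IsSmoothTensor I β) :
    IsTwoForm I (fun x u v => β x u v - β x v u) :=
  ⟨hβ.sub hβ.flip, fun _ _ _ => (neg_sub _ _).symm⟩

theorem add (hβ : IsTwoForm I β) (hβ' : IsTwoForm I β') :
    IsTwoForm I (fun x u v => β x u v + β' x u v) :=
  ⟨hβ.toIsSmoothTensor.add hβ'.toIsSmoothTensor, fun x u v => by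
    rw [hβ.skew x u v, hβ'.skew x u v, neg_add]⟩

theorem sub (hβ : IsTwoForm I β) (hβ' : IsTwoForm I β') :
    IsTwoForm I (fun x u v => β x u v - β' x u v) :=
  ⟨hβ.toIsSmoothTensor.sub hβ'.toIsSmoothTensor, fun x u v => by
    rw [hβ.skew x u v, hβ'.skew x u v]; abel⟩

theorem neg (hβ : IsTwoForm I β) : IsTwoForm I (fun x u v => - β x u v) :=
  ⟨hβ.toIsSmoothTensor.clm_comp (-ContinuousLinearMap.id ℝ V), fun x u v => by
    rw [hβ.skew x u v]⟩

theorem sum {ι : Type*} (s : Finset ι) {β : ι → ∀ x : N, TangentSpace I x → TangentSpace I x → V}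
    (hβ : ∀ i ∈ s, IsTwoForm I (β i)) : IsTwoForm I (fun x u v => ∑ i ∈ s, β i x u v) :=
  ⟨IsSmoothTensor.sum s fun i hi => (hβ i hi).toIsSmoothTensor, fun x u v => by
    rw [← Finset.sum_neg_distrib]
    exact Finset.sum_congr rfl fun i hi => (hβ i hi).skew x u v⟩

theorem clm_comp (hβ : IsTwoForm I β) (T : V →L[ℝ] V') : IsTwoForm I (fun x u v => T (β x u v)) :=
  ⟨hβ.toIsSmoothTensor.clm_comp T, fun x u v => by rw [hβ.skew x u v, map_neg]⟩

theorem pairing (hβ : IsTwoForm I β) {J : N → V →L[ℝ] V'}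
    (hJ : ContMDiff I 𝓘(ℝ, V →L[ℝ] V') ∞ J) : IsTwoForm I (fun x u v => J x (β x u v)) :=
  ⟨hβ.toIsSmoothTensor.pairing hJ, fun x u v => by rw [hβ.skew x u v, map_neg]⟩

theorem smul_vec (hβ : IsTwoForm I β) {J : N → ℝ} (hJ : ContMDiff I 𝓘(ℝ, ℝ) ∞ J) :
    IsTwoForm I (fun x u v => J x • β x u v) :=
  ⟨hβ.toIsSmoothTensor.smul_vec hJ, fun x u v => by rw [hβ.skew x u v, smul_neg]⟩

theorem smul_fun {β : ∀ x : N, TangentSpace I x → TangentSpace I x → ℝ} (hβ : IsTwoForm I β)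
    {ζ : N → V} (hζ : ContMDiff I 𝓘(ℝ, V) ∞ ζ) : IsTwoForm I (fun x u v => β x u v • ζ x) :=
  ⟨hβ.toIsSmoothTensor.smul_fun hζ, fun x u v => by rw [hβ.skew x u v, neg_smul]⟩

theorem bundlePullback {β : ∀ x : N', TangentSpace I' x → TangentSpace I' x → V}
    (hβ : IsTwoForm I' β) {f : N → N'} {Φ : ∀ x : N, TangentSpace I x → TangentSpace I' (f x)}
    (hadd : ∀ x u v, Φ x (u + v) = Φ x u + Φ x v)
    (hsmul : ∀ x (c : ℝ) u, Φ x (c • u) = c • Φ x u)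
    (hΦ : ContMDiff I.tangent I'.tangent ∞
      (fun z : TangentBundle I N => (⟨f z.1, Φ z.1 z.2⟩ : TangentBundle I' N'))) :
    IsTwoForm I (fun x u v => β (f x) (Φ x u) (Φ x v)) :=
  ⟨hβ.toIsSmoothTensor.bundlePullback hadd hsmul hΦ hadd hsmul hΦ, fun _ _ _ => hβ.skew _ _ _⟩

theorem pullback {β : ∀ x : N', TangentSpace I' x → TangentSpace I' x → V}
    (hβ : IsTwoForm I' β) {f : N → N'} (hf : ContMDiff I I' ∞ f) :
    IsTwoForm I (fun x u v => β (f x) (mfderiv I I' f x u) (mfderiv I I' f x v)) :=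
  ⟨hβ.toIsSmoothTensor.pullback hf, fun _ _ _ => hβ.skew _ _ _⟩

/-- Descent of basic 2-forms along a surjective submersion. -/
theorem exists_descent {f : N → N'} (hf : IsSmoothSubmersion I I' f) (hs : Function.Surjective f)
    (hβ : IsTwoForm I β)
    (hbas : ∀ x y u v u' v', f x = f y → (mfderiv I I' f x u : E') = mfderiv I I' f y u' →
      (mfderiv I I' f x v : E') = mfderiv I I' f y v' → β x u v = β y u' v') :
    ∃ β' : ∀ x : N', TangentSpace I' x → TangentSpace I' x → V, IsTwoForm I' β' ∧
      ∀ x u v, β' (f x) (mfderiv I I' f x u) (mfderiv I I' f x v) = β x u v := by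
  choose r hr using hs
  have hlift : ∀ (z : N') (u : TangentSpace I' z), ∃ w : TangentSpace I (r z),
      (mfderiv I I' f (r z) w : E') = u := fun z u => hf.2 (r z) u
  choose l hl using hlift
  let β' : ∀ x : N', TangentSpace I' x → TangentSpace I' x → V := fun z u v =>
    β (r z) (l z u) (l z v)
  have key : ∀ x u v, β' (f x) (mfderiv I I' f x u) (mfderiv I I' f x v) = β x u v := fun x u v =>
    hbas _ _ _ _ _ _ (hr (f x)) (hl _ _) (hl _ _)
  have key' : ∀ z x u v u' v', f x = z → (mfderiv I I' f x u' : E') = u →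
      (mfderiv I I' f x v' : E') = v → β' z u v = β x u' v' := by
    rintro z x u v u' v' rfl rfl rfl
    exact key x u' v'
  have hl' : ∀ (z : N') (u : E'), (mfderiv I I' f (r z) (l z u) : E') = u := fun z u => hl z u
  refine ⟨β', ⟨⟨?_, ?_, ?_, ?_, ?_⟩, ?_⟩, key⟩
  · intro z u u' v
    rw [key' z (r z) (u + u') v (l z u + l z u') (l z v) (hr z) ?_ (hl' z v), hβ.add_left]
    exact (map_add (mfderiv I I' f (r z)) _ _).trans (congrArg₂ (· + ·) (hl' z u) (hl' z u'))
  · intro z c u v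
    rw [key' z (r z) (c • u) v (c • l z u) (l z v) (hr z) ?_ (hl' z v), hβ.smul_left]
    exact (map_smul (mfderiv I I' f (r z)) _ _).trans (congrArg (c • ·) (hl' z u))
  · intro z v u u'
    rw [key' z (r z) v (u + u') (l z v) (l z u + l z u') (hr z) (hl' z v) ?_, hβ.add_right]
    exact (map_add (mfderiv I I' f (r z)) _ _).trans (congrArg₂ (· + ·) (hl' z u) (hl' z u'))
  · intro z c v u
    rw [key' z (r z) v (c • u) (l z v) (c • l z u) (hr z) (hl' z v) ?_, hβ.smul_right]
    exact (map_smul (mfderiv I I' f (r z)) _ _).trans (congrArg (c • ·) (hl' z u))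
  · intro b a a' y hy
    have hz : f (r ((extChartAt I' b).symm y)) = (extChartAt I' b).symm y := hr _
    obtain ⟨σ, hσ, -, hσf⟩ := exists_section_of_submersion hf (r ((extChartAt I' b).symm y))
    rw [hz] at hσ hσf
    have hZ : ∀ a : E', ContMDiffAt 𝓘(ℝ, E') I.tangent ∞
        (fun y => tangentMap I' I σ (chartFrame I' b a y)) y := fun a =>
      contMDiffAt_tangentMap_comp (contMDiffAt_chartFrame b a hy) hσ
    refine (hβ.contMDiffAt_apply (f := fun y => σ ((extChartAt I' b).symm y))
      (Z := fun y => mfderiv I' I σ ((extChartAt I' b).symm y)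
        (mfderiv 𝓘(ℝ, E') I' (extChartAt I' b).symm y a))
      (Z' := fun y => mfderiv I' I σ ((extChartAt I' b).symm y)
        (mfderiv 𝓘(ℝ, E') I' (extChartAt I' b).symm y a')) (hZ a) (hZ a')).congr_of_eventuallyEq ?_
    have hc := (contMDiffAt_chart_symm b hy).continuousAt
    have hσ1 : ∀ᶠ z in 𝓝 ((extChartAt I' b).symm y), ContMDiffAt I' I 1 σ z :=
      contMDiffAt_iff_contMDiffAt_nhds (by simp) |>.1 (ContMDiffAt.of_le hσ (m := 1) (by simp))
    filter_upwards [hc.eventually (hσf.eventually_nhds), hc.eventually hσ1] with w hw hw1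
    have hD : ∀ v : E', (mfderiv I I' f (σ ((extChartAt I' b).symm w))
        (mfderiv I' I σ ((extChartAt I' b).symm w) v) : E') = v := by
      intro v
      have h1 := mfderiv_comp_apply (I := I') (I' := I) (I'' := I') ((extChartAt I' b).symm w)
        ((hf.1 (σ ((extChartAt I' b).symm w))).mdifferentiableAt (by simp))
        (hw1.mdifferentiableAt (by simp)) v
      have h0 : f ∘ σ =ᶠ[𝓝 ((extChartAt I' b).symm w)] (id : N' → N') := hw
      have h2 : mfderiv I' I' (f ∘ σ) ((extChartAt I' b).symm w) =
          mfderiv I' I' (id : N' → N') ((extChartAt I' b).symm w) := h0.mfderiv_eq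
      have h3 := congrArg (fun T : E' →L[ℝ] E' => T v) h2
      rw [mfderiv_id] at h3
      exact h1.symm.trans h3
    exact key' _ _ _ _ _ _ hw.self_of_nhds (hD _) (hD _)
  · intro z u v
    exact hβ.skew _ _ _

end IsTwoForm

/-- Descent of basic 1-forms along a surjective submersion. -/
theorem SmoothOneForm.exists_descent {f : N → N'} (hf : IsSmoothSubmersion I I' f)
    (hs : Function.Surjective f) {θ : ∀ x : N, TangentSpace I x →L[ℝ] V} (hθ : SmoothOneForm I θ)
    (hbas : ∀ x y u u', f x = f y → (mfderiv I I' f x u : E') = mfderiv I I' f y u' →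
      θ x u = θ y u') :
    ∃ θ' : ∀ x : N', TangentSpace I' x →L[ℝ] V, SmoothOneForm I' θ' ∧
      ∀ x u, θ' (f x) (mfderiv I I' f x u) = θ x u := by
  choose r hr using hs
  have hlift : ∀ (z : N') (u : TangentSpace I' z), ∃ w : TangentSpace I (r z),
      (mfderiv I I' f (r z) w : E') = u := fun z u => hf.2 (r z) u
  choose l hl using hlift
  have hl' : ∀ (z : N') (u : E'), (mfderiv I I' f (r z) (l z u) : E') = u := fun z u => hl z u
  let L : N' → E' →ₗ[ℝ] V := fun z =>
      { toFun := fun u => θ (r z) (l z u)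
        map_add' := fun u u' => by
          rw [← map_add]
          refine hbas _ _ _ _ rfl ((hl' z _).trans ?_)
          exact ((map_add (mfderiv I I' f (r z)) _ _).trans
            (congrArg₂ (· + ·) (hl' z u) (hl' z u'))).symm
        map_smul' := fun c u => by
          rw [← map_smul]
          refine hbas _ _ _ _ rfl ((hl' z _).trans ?_)
          exact ((map_smul (mfderiv I I' f (r z)) _ _).trans (congrArg (c • ·) (hl' z u))).symm }
  let L' : N' → E' →L[ℝ] V := fun z => LinearMap.toContinuousLinearMap (L z)
  let θ' : ∀ x : N', TangentSpace I' x →L[ℝ] V := L'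
  have key : ∀ x u, θ' (f x) (mfderiv I I' f x u) = θ x u := fun x u =>
    hbas _ _ _ _ (hr (f x)) (hl _ _)
  refine ⟨θ', ?_, key⟩
  intro z₀
  have hz : f (r z₀.1) = z₀.1 := hr _
  obtain ⟨σ, hσ, -, hσf⟩ := exists_section_of_submersion hf (r z₀.1)
  rw [hz] at hσ hσf
  have h0 : ContMDiffAt I'.tangent I.tangent ∞ (fun z => tangentMap I' I σ z) z₀ :=
    contMDiffAt_tangentMap_comp contMDiffAt_id hσ
  refine ((hθ _).comp z₀ h0).congr_of_eventuallyEq ?_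
  have hc : ContinuousAt (fun z : TangentBundle I' N' => z.1) z₀ :=
    (FiberBundle.continuous_proj E' (TangentSpace I' : N' → Type _)).continuousAt
  have hσ1 : ∀ᶠ z in 𝓝 z₀.1, ContMDiffAt I' I 1 σ z :=
    contMDiffAt_iff_contMDiffAt_nhds (by simp) |>.1 (ContMDiffAt.of_le hσ (m := 1) (by simp))
  filter_upwards [hc.eventually (hσf.eventually_nhds), hc.eventually hσ1] with w hw hw1
  have hD : (mfderiv I I' f (σ w.1) (mfderiv I' I σ w.1 w.2) : E') = w.2 := by
    have h1 := mfderiv_comp_apply (I := I') (I' := I) (I'' := I') w.1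
      ((hf.1 (σ w.1)).mdifferentiableAt (by simp)) (hw1.mdifferentiableAt (by simp)) w.2
    have h0 : f ∘ σ =ᶠ[𝓝 w.1] (id : N' → N') := hw
    have h2 : mfderiv I' I' (f ∘ σ) w.1 = mfderiv I' I' (id : N' → N') w.1 := h0.mfderiv_eq
    have h3 := congrArg (fun T : E' →L[ℝ] E' => T w.2) h2
    rw [mfderiv_id] at h3
    exact h1.symm.trans h3
  have hfin : ∀ z x (u : TangentSpace I' z) u', f x = z → (mfderiv I I' f x u' : E') = u →
      θ' z u = θ x u' := by
    rintro z x u u' rfl rfl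
    exact key x u'
  exact hfin _ _ _ _ hw.self_of_nhds hD

end Tensors
/-! ### Differential forms as alternating maps -/

section AlternatingForms

variable {E : Type*} [NormedAddCommGroup E] [NormedSpace ℝ E] [FiniteDimensional ℝ E]
  {H : Type*} [TopologicalSpace H]
  {I : ModelWithCorners ℝ E H} [I.Boundaryless] {N : Type*} [TopologicalSpace N]
  [ChartedSpace H N] [IsManifold I ∞ N]

/-- The alternating map of a skew-symmetric bilinear map. -/
noncomputable def altOfBilin (B : E →L[ℝ] E →L[ℝ] ℝ) (h : ∀ u v, B u v = - B v u) :
    E [⋀^Fin 2]→L[ℝ] ℝ :=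
  { toFun := fun m => B (m 0) (m 1)
    map_update_add' := by
      intro _ m i x y
      fin_cases i <;> simp [Function.update]
    map_update_smul' := by
      intro _ m i c x
      fin_cases i <;> simp [Function.update]
    cont := by fun_prop
    map_eq_zero_of_eq' := by
      intro m i j hij hne
      have h1 : ∀ u, B u u = 0 := fun u => by linarith [h u u]
      have h2 : m 0 = m 1 := by
        fin_cases i <;> fin_cases j
        · exact absurd rfl hne
        · exact hij
        · exact hij.symm
        · exact absurd rfl hne
      change B (m 0) (m 1) = 0
      rw [h2]
      exact h1 _ }

/-- Evaluation of alternating 2-maps on a pair of vectors. -/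
noncomputable def evalTwo (a b : E) : (E [⋀^Fin 2]→L[ℝ] ℝ) →ₗ[ℝ] ℝ where
  toFun A := A ![a, b]
  map_add' _ _ := rfl
  map_smul' _ _ := rfl

theorem alt_ext_basis {A B : E [⋀^Fin 2]→L[ℝ] ℝ}
    (h : ∀ i j, A ![Module.finBasis ℝ E i, Module.finBasis ℝ E j] =
      B ![Module.finBasis ℝ E i, Module.finBasis ℝ E j]) : A = B := by
  apply ContinuousAlternatingMap.toAlternatingMap_injective
  refine Module.Basis.ext_alternating (Module.finBasis ℝ E) fun v _ => ?_
  have : (fun i => Module.finBasis ℝ E (v i)) =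
      ![Module.finBasis ℝ E (v 0), Module.finBasis ℝ E (v 1)] := by
    funext i
    fin_cases i <;> rfl
  rw [this]
  exact h _ _

/-- The components of an alternating 2-map. -/
noncomputable def altComponents : (E [⋀^Fin 2]→L[ℝ] ℝ) →ₗ[ℝ]
    (Fin (Module.finrank ℝ E) → Fin (Module.finrank ℝ E) → ℝ) :=
  LinearMap.pi fun i => LinearMap.pi fun j =>
    evalTwo (Module.finBasis ℝ E i) (Module.finBasis ℝ E j)

theorem altComponents_injective :
    Function.Injective (altComponents (E := E)) := fun _ _ h =>
  alt_ext_basis fun i j => congrFun (congrFun h i) j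

instance finiteDimensional_alt : FiniteDimensional ℝ (E [⋀^Fin 2]→L[ℝ] ℝ) :=
  FiniteDimensional.of_injective altComponents altComponents_injective

/-- The alternating maps of a smooth 2-form, in the model space. -/
noncomputable def IsTwoForm.altField
    {β : ∀ x : N, TangentSpace I x → TangentSpace I x → ℝ} (hβ : IsTwoForm I β) (x : N) :
    E [⋀^Fin 2]→L[ℝ] ℝ :=
  altOfBilin (hβ.bilin x) (hβ.skew x)

/-- A smooth 2-form as a field of alternating maps. -/
noncomputable def IsTwoForm.toDForm
    {β : ∀ x : N, TangentSpace I x → TangentSpace I x → ℝ} (hβ : IsTwoForm I β) : DForm I N 2 :=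
  hβ.altField

theorem inChart_two_apply (Φ : DForm I N 2) (b : N) (y a a' : E) :
    DForm.inChart I Φ b y ![a, a'] =
      chartTensor I (fun x u v => Φ x ![u, v]) b y a a' := by
  refine congrArg (Φ ((extChartAt I b).symm y)) ?_
  funext i
  fin_cases i <;> rfl

theorem isSmooth_of_chartTensor {Φ : DForm I N 2}
    (h : ∀ b a a', ∀ y ∈ (extChartAt I b).target,
      ContMDiffAt 𝓘(ℝ, E) 𝓘(ℝ, ℝ) ∞ (chartTensor I (fun x u v => Φ x ![u, v]) b · a a') y) :
    DForm.IsSmooth I Φ := by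
  intro b y hy
  let T : (E [⋀^Fin 2]→L[ℝ] ℝ) →L[ℝ]
      (Fin (Module.finrank ℝ E) → Fin (Module.finrank ℝ E) → ℝ) :=
    LinearMap.toContinuousLinearMap altComponents
  have hc : ContMDiffAt 𝓘(ℝ, E) 𝓘(ℝ, Fin (Module.finrank ℝ E) → Fin (Module.finrank ℝ E) → ℝ) ∞
      (fun y => fun i j => chartTensor I (fun x u v => Φ x ![u, v]) b y
        (Module.finBasis ℝ E i) (Module.finBasis ℝ E j)) y :=
    contMDiffAt_pi_space.2 fun i => contMDiffAt_pi_space.2 fun j => h b _ _ y hy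
  have := contMDiffAt_of_injective (B := fun _ : E => T) (z := DForm.inChart I Φ b)
    contMDiffAt_const hc altComponents_injective (Eventually.of_forall fun y => by
      funext i j
      exact inChart_two_apply Φ b y _ _)
  exact this.contDiffAt.contDiffWithinAt

theorem IsTwoForm.isSmooth_toDForm
    {β : ∀ x : N, TangentSpace I x → TangentSpace I x → ℝ} (hβ : IsTwoForm I β) :
    DForm.IsSmooth I hβ.toDForm :=
  isSmooth_of_chartTensor fun b a a' y hy => hβ.smooth b a a' y hy

theorem hasMFDerivAt_self_chart_symm (x : N) :
    (mfderiv 𝓘(ℝ, E) I (extChartAt I x).symm (extChartAt I x x) : E →L[ℝ] E) =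
      ContinuousLinearMap.id ℝ E := by
  ext u
  have h := chartFrame_self (I := I) x u
  have key : ∀ (p : N) (w : TangentSpace I p), (⟨p, w⟩ : TangentBundle I N) = ⟨x, u⟩ →
      (w : E) = u := by
    intro p w h
    cases h
    rfl
  exact key _ _ h

/-- The exterior derivative of a form on a manifold. -/
noncomputable def extDerivForm {n : ℕ} (Φ : DForm I N n) : DForm I N (n + 1) :=
  fun x => (extDeriv (DForm.inChart I Φ x) (extChartAt I x x) : E [⋀^Fin (n + 1)]→L[ℝ] ℝ)

theorem inChart_change {n : ℕ} (Φ : DForm I N n) (b c : N) {y : E}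
    (hy : y ∈ (extChartAt I b).target) (hc : (extChartAt I b).symm y ∈ (extChartAt I c).source) :
    let τ : E → E := fun z => extChartAt I c ((extChartAt I b).symm z)
    ∀ᶠ z in 𝓝 y, DForm.inChart I Φ b z =
      (DForm.inChart I Φ c (τ z)).compContinuousLinearMap (fderiv ℝ τ z) := by
  intro τ
  have hcont := (contMDiffAt_chart_symm b hy).continuousAt
  filter_upwards [(isOpen_extChartAt_target (I := I) b).mem_nhds hy,
    hcont.eventually ((isOpen_extChartAt_source (I := I) c).mem_nhds hc)] with z hz hzc
  have h1 : MDifferentiableAt 𝓘(ℝ, E) I (extChartAt I b).symm z :=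
    (contMDiffAt_chart_symm b hz).mdifferentiableAt (by simp)
  have hzc : (extChartAt I b).symm z ∈ (extChartAt I c).source := hzc
  have h2 : MDifferentiableAt I 𝓘(ℝ, E) (extChartAt I c) ((extChartAt I b).symm z) :=
    mdifferentiableAt_extChartAt (by rwa [← extChartAt_source I])
  have hτz : τ z ∈ (extChartAt I c).target := (extChartAt I c).map_source hzc
  have h3 : MDifferentiableAt 𝓘(ℝ, E) I (extChartAt I c).symm (τ z) :=
    (contMDiffAt_chart_symm c hτz).mdifferentiableAt (by simp)
  have hτ : MDifferentiableAt 𝓘(ℝ, E) 𝓘(ℝ, E) τ z := h2.comp z h1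
  have key : ∀ a : E, tangentMap 𝓘(ℝ, E) I (extChartAt I b).symm ⟨z, a⟩ =
      tangentMap 𝓘(ℝ, E) I ((extChartAt I c).symm ∘ τ) ⟨z, a⟩ := by
    intro a
    refine tangentMap_congr ?_ _
    filter_upwards [h1.continuousAt.eventually ((isOpen_extChartAt_source (I := I) c).mem_nhds hzc)]
      with w hw
    exact ((extChartAt I c).left_inv hw).symm
  have hpt : ∀ (p q : N) (S T : E →L[ℝ] E), p = q → S = T →
      ((Φ p).compContinuousLinearMap (S : E →L[ℝ] TangentSpace I p) : E [⋀^Fin n]→L[ℝ] ℝ) =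
      (Φ q).compContinuousLinearMap (T : E →L[ℝ] TangentSpace I q) := by
    rintro p q S T rfl rfl
    rfl
  have hlin : (mfderiv 𝓘(ℝ, E) I (extChartAt I b).symm z : E →L[ℝ] E) =
      (mfderiv 𝓘(ℝ, E) I (extChartAt I c).symm (τ z) : E →L[ℝ] E).comp (fderiv ℝ τ z) := by
    ext a
    have h4 := key a
    rw [tangentMap_comp_at (I' := 𝓘(ℝ, E)) _ h3 hτ] at h4
    have hsnd : ∀ (p q : N) (w : TangentSpace I p) (w' : TangentSpace I q),
        (⟨p, w⟩ : TangentBundle I N) = ⟨q, w'⟩ → (w : E) = w' := by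
      intro p q w w' h
      cases h
      rfl
    have h5 := hsnd _ _ _ _ h4
    refine h5.trans ?_
    change (mfderiv 𝓘(ℝ, E) I (extChartAt I c).symm (τ z) : E →L[ℝ] E)
      (mfderiv 𝓘(ℝ, E) 𝓘(ℝ, E) τ z a) = _
    rw [mfderiv_eq_fderiv]
    rfl
  refine (hpt _ _ _ _ ((extChartAt I c).left_inv hzc).symm hlin).trans ?_
  ext m
  rfl

theorem inChart_extDerivForm {n : ℕ} {Φ : DForm I N n} (hΦ : DForm.IsSmooth I Φ) (b : N) {y : E}
    (hy : y ∈ (extChartAt I b).target) :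
    DForm.inChart I (extDerivForm Φ) b y = extDeriv (DForm.inChart I Φ b) y := by
  let p := (extChartAt I b).symm y
  have hp : p ∈ (extChartAt I p).source := mem_extChartAt_source p
  let τ : E → E := fun z => extChartAt I p ((extChartAt I b).symm z)
  have hev : DForm.inChart I Φ b =ᶠ[𝓝 y] fun z =>
    (DForm.inChart I Φ p (τ z)).compContinuousLinearMap (fderiv ℝ τ z) := inChart_change Φ b p hy hp
  have hτ : ContDiffAt ℝ ∞ τ y := by
    have : ContMDiffAt 𝓘(ℝ, E) 𝓘(ℝ, E) ∞ τ y :=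
      (contMDiffAt_extChartAt (x := p)).comp y (contMDiffAt_chart_symm b hy)
    exact this.contDiffAt
  have hd : DifferentiableAt ℝ (DForm.inChart I Φ p) (τ y) :=
    (((hΦ p).contDiffAt ((isOpen_extChartAt_target p).mem_nhds (mem_extChartAt_target p))
      ).differentiableAt (by simp))
  rw [hev.extDeriv_eq, extDeriv_pullback hd hτ (by
    rw [minSmoothness_of_isRCLikeNormedField]; exact WithTop.coe_le_coe.2 le_top)]
  have hlin : (mfderiv 𝓘(ℝ, E) I (extChartAt I b).symm y : E →L[ℝ] E) = fderiv ℝ τ y := by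
    have h1 : MDifferentiableAt 𝓘(ℝ, E) I (extChartAt I b).symm y :=
      (contMDiffAt_chart_symm b hy).mdifferentiableAt (by simp)
    have h2 : MDifferentiableAt I 𝓘(ℝ, E) (extChartAt I p) p :=
      mdifferentiableAt_extChartAt (by simp)
    ext a
    have h3 := mfderiv_comp_apply (I := 𝓘(ℝ, E)) (I' := I) (I'' := 𝓘(ℝ, E)) y h2 h1 a
    have h4 := DFunLike.congr_fun (mfderiv_extChartAt_self (I := I) (x := p))
      (mfderiv 𝓘(ℝ, E) I (extChartAt I b).symm y a)
    have h5 := h3.trans h4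
    have h6 : mfderiv 𝓘(ℝ, E) 𝓘(ℝ, E) (extChartAt I p ∘ (extChartAt I b).symm) y a =
        fderiv ℝ τ y a := by
      rw [mfderiv_eq_fderiv]
      rfl
    exact h5.symm.trans h6
  exact congrArg (fun T : E →L[ℝ] E =>
    (extDeriv (DForm.inChart I Φ p) (τ y)).compContinuousLinearMap T) hlin

theorem isSmooth_extDerivForm {n : ℕ} {Φ : DForm I N n} (hΦ : DForm.IsSmooth I Φ) :
    DForm.IsSmooth I (extDerivForm Φ) := by
  intro b
  have h1 : ContDiffOn ℝ ∞ (extDeriv (DForm.inChart I Φ b)) (extChartAt I b).target := by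
    have h2 := (hΦ b).fderiv_of_isOpen (m := ∞) (isOpen_extChartAt_target b) (by simp)
    exact (ContinuousAlternatingMap.alternatizeUncurryFinCLM ℝ E ℝ).contDiff.comp_contDiffOn h2
  exact h1.congr fun y hy => inChart_extDerivForm hΦ b hy

theorem isClosed_extDerivForm {n : ℕ} {Φ : DForm I N n} (hΦ : DForm.IsSmooth I Φ) :
    DForm.IsClosedForm I (extDerivForm Φ) := by
  intro b y hy
  have hev : DForm.inChart I (extDerivForm Φ) b =ᶠ[𝓝 y] extDeriv (DForm.inChart I Φ b) := by
    filter_upwards [(isOpen_extChartAt_target (I := I) b).mem_nhds hy] with z hz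
    exact inChart_extDerivForm hΦ b hz
  rw [hev.extDeriv_eq]
  exact extDeriv_extDeriv_apply ((hΦ b).contDiffAt ((isOpen_extChartAt_target b).mem_nhds hy)) (by
    rw [minSmoothness_of_isRCLikeNormedField]; exact WithTop.coe_le_coe.2 le_top)

end AlternatingForms
/-! ### Differentials of functions -/

section Differentials

variable {E : Type*} [NormedAddCommGroup E] [NormedSpace ℝ E] [FiniteDimensional ℝ E]
  {H : Type*} [TopologicalSpace H]
  {I : ModelWithCorners ℝ E H} [I.Boundaryless] {N : Type*} [TopologicalSpace N]
  [ChartedSpace H N] [IsManifold I ∞ N]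
  {E' : Type*} [NormedAddCommGroup E'] [NormedSpace ℝ E'] [FiniteDimensional ℝ E']
  {H' : Type*} [TopologicalSpace H']
  {I' : ModelWithCorners ℝ E' H'} [I'.Boundaryless] {N' : Type*} [TopologicalSpace N']
  [ChartedSpace H' N'] [IsManifold I' ∞ N']
  {V : Type*} [NormedAddCommGroup V] [NormedSpace ℝ V]

theorem dVec_comp {g : N' → V} {f : N → N'} {x : N} (hg : MDifferentiableAt I' 𝓘(ℝ, V) g (f x))
    (hf : MDifferentiableAt I I' f x) (u : TangentSpace I x) :
    dVec I (fun x => g (f x)) x u = dVec I' g (f x) (mfderiv I I' f x u) :=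
  mfderiv_comp_apply (I := I) (I' := I') (I'' := 𝓘(ℝ, V)) x hg hf u

theorem dReal_comp {g : N' → ℝ} {f : N → N'} {x : N} (hg : MDifferentiableAt I' 𝓘(ℝ, ℝ) g (f x))
    (hf : MDifferentiableAt I I' f x) (u : TangentSpace I x) :
    dReal I (fun x => g (f x)) x u = dReal I' g (f x) (mfderiv I I' f x u) :=
  mfderiv_comp_apply (I := I) (I' := I') (I'' := 𝓘(ℝ, ℝ)) x hg hf u

theorem dVec_congr {g g' : N → V} {x : N} (h : g =ᶠ[𝓝 x] g') (u : TangentSpace I x) :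
    dVec I g x u = dVec I g' x u := by
  have h1 : mfderiv I 𝓘(ℝ, V) g x = mfderiv I 𝓘(ℝ, V) g' x := h.mfderiv_eq
  exact congrArg (fun T : E →L[ℝ] V => T u) h1

theorem fderiv_chart {g : N → V} {b : N} {y a : E} (hy : y ∈ (extChartAt I b).target)
    (hg : MDifferentiableAt I 𝓘(ℝ, V) g ((extChartAt I b).symm y)) :
    fderiv ℝ (fun y => g ((extChartAt I b).symm y)) y a =
      dVec I g (chartFrame I b a y).1 (chartFrame I b a y).2 := by
  have h := dVec_comp (I := 𝓘(ℝ, E)) (I' := I) (g := g) (f := (extChartAt I b).symm) hg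
    ((contMDiffAt_chart_symm b hy).mdifferentiableAt (by simp)) a
  refine Eq.trans ?_ h
  change _ = mfderiv 𝓘(ℝ, E) 𝓘(ℝ, V) (fun y => g ((extChartAt I b).symm y)) y a
  rw [mfderiv_eq_fderiv]
  rfl

theorem smoothOneForm_dVec {g : N → V} (hg : ContMDiff I 𝓘(ℝ, V) ∞ g) :
    SmoothOneForm I (dVec I g) := fun z =>
  (contMDiffAt_vectorSpace_iff.1 (contMDiff_tangentMap' hg z)).2

theorem smoothOneForm_dReal {g : N → ℝ} (hg : ContMDiff I 𝓘(ℝ, ℝ) ∞ g) :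
    SmoothOneForm I (dReal I g) := smoothOneForm_dVec hg

theorem dReal_add {f g : N → ℝ} {x : N} (hf : MDifferentiableAt I 𝓘(ℝ, ℝ) f x)
    (hg : MDifferentiableAt I 𝓘(ℝ, ℝ) g x) (u : TangentSpace I x) :
    dReal I (f + g) x u = dReal I f x u + dReal I g x u := by
  have := congrArg (fun T : E →L[ℝ] ℝ => T u) (mfderiv_add hf hg)
  exact this

theorem dReal_smul {f : N → ℝ} {x : N} (hf : MDifferentiableAt I 𝓘(ℝ, ℝ) f x) (c : ℝ)
    (u : TangentSpace I x) : dReal I (c • f) x u = c * dReal I f x u := by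
  have := congrArg (fun T : E →L[ℝ] ℝ => T u) (const_smul_mfderiv hf c)
  exact this

theorem dReal_mul {f g : N → ℝ} {x : N} (hf : MDifferentiableAt I 𝓘(ℝ, ℝ) f x)
    (hg : MDifferentiableAt I 𝓘(ℝ, ℝ) g x) (u : TangentSpace I x) :
    dReal I (f * g) x u = f x * dReal I g x u + g x * dReal I f x u := by
  have := congrArg (fun T : E →L[ℝ] ℝ => T u) (hf.hasMFDerivAt.mul hg.hasMFDerivAt).mfderiv
  exact this

/-- Every covector is the differential of a global smooth function. -/
theorem exists_dReal_eq [T2Space N] (x : N) (ℓ : E →L[ℝ] ℝ) :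
    ∃ f : N → ℝ, ContMDiff I 𝓘(ℝ, ℝ) ∞ f ∧ ∀ u : E, dReal I f x u = ℓ u := by
  obtain ⟨χ⟩ : Nonempty (SmoothBumpFunction I x) := inferInstance
  refine ⟨fun y => χ y • ℓ (extChartAt I x y), χ.contMDiff_smul ?_, fun u => ?_⟩
  · exact ℓ.contMDiff.comp_contMDiffOn contMDiffOn_extChartAt
  · have h1 : (fun y => χ y • ℓ (extChartAt I x y)) =ᶠ[𝓝 x] fun y => ℓ (extChartAt I x y) := by
      filter_upwards [χ.eventuallyEq_one] with y hy
      rw [hy]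
      exact one_smul ℝ _
    have h2 := dVec_congr (I := I) h1 u
    have h3 := dVec_comp (g := fun w => ℓ w) (f := extChartAt I x) (x := x) (I' := 𝓘(ℝ, E))
      (ℓ.contMDiff.mdifferentiableAt one_ne_zero)
      (mdifferentiableAt_extChartAt (mem_chart_source H x)) u
    have h4 := DFunLike.congr_fun (mfderiv_extChartAt_self (I := I) (x := x)) u
    have h5 : dVec 𝓘(ℝ, E) (fun w => ℓ w) (extChartAt I x x) (u : E) = ℓ u := by
      change mfderiv 𝓘(ℝ, E) 𝓘(ℝ, ℝ) ℓ (extChartAt I x x) u = ℓ u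
      rw [mfderiv_eq_fderiv, ℓ.fderiv]
      rfl
    refine h2.trans (h3.trans (Eq.trans ?_ h5))
    exact congrArg (fun w => dVec 𝓘(ℝ, E) (fun w => ℓ w) (extChartAt I x x) w) h4

end Differentials

/-! ### The bracket of a 2-form nondegenerate on the level sets of a submersion -/

section Bracket

variable {E : Type*} [NormedAddCommGroup E] [NormedSpace ℝ E] [FiniteDimensional ℝ E]
  {H : Type*} [TopologicalSpace H]
  {I : ModelWithCorners ℝ E H} [I.Boundaryless] {N : Type*} [TopologicalSpace N]
  [ChartedSpace H N] [IsManifold I ∞ N]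
  {k : ℕ} {Jb : Fin k → N → ℝ} {Ω : ∀ x : N, TangentSpace I x → TangentSpace I x → ℝ}
  {br : (N → ℝ) → (N → ℝ) → N → ℝ}

variable (I) in
/-- The vectors tangent to the level sets of the functions `Jb i`. -/
noncomputable def levelDist (Jb : Fin k → N → ℝ) (x : N) : Submodule ℝ (TangentSpace I x) :=
  ⨅ i, LinearMap.ker (dReal I (Jb i) x).toLinearMap

theorem mem_levelDist {x : N} {u : TangentSpace I x} :
    u ∈ levelDist I Jb x ↔ ∀ i, dReal I (Jb i) x u = 0 := by
  simp only [levelDist, Submodule.mem_iInf, LinearMap.mem_ker]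
  rfl

variable (I) in
/-- A bracket defined by a 2-form which is nondegenerate on the level sets of independent
functions. -/
structure IsLevelBracket (Jb : Fin k → N → ℝ)
    (Ω : ∀ x : N, TangentSpace I x → TangentSpace I x → ℝ)
    (br : (N → ℝ) → (N → ℝ) → N → ℝ) : Prop where
  J_smooth : ∀ i, ContMDiff I 𝓘(ℝ, ℝ) ∞ (Jb i)
  J_indep : ∀ x, LinearIndependent ℝ (fun i => dReal I (Jb i) x)
  twoForm : IsTwoForm I Ω
  nondeg : ∀ x, ∀ u ∈ levelDist I Jb x, (∀ v ∈ levelDist I Jb x, Ω x u v = 0) → u = 0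
  ham : ∀ f : N → ℝ, ContMDiff I 𝓘(ℝ, ℝ) ∞ f → ∀ x, ∃ X ∈ levelDist I Jb x,
    (∀ v ∈ levelDist I Jb x, Ω x X v = dReal I f x v) ∧
    ∀ g : N → ℝ, ContMDiff I 𝓘(ℝ, ℝ) ∞ g → br g f x = dReal I g x X

namespace IsLevelBracket

variable [T2Space N]

theorem existsUnique_ham (h : IsLevelBracket I Jb Ω br) {f : N → ℝ} (hf : ContMDiff I 𝓘(ℝ, ℝ) ∞ f) (x : N) :
    ∃! X : TangentSpace I x, ∀ g : N → ℝ, ContMDiff I 𝓘(ℝ, ℝ) ∞ g → dReal I g x X = br g f x := by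
  obtain ⟨X, -, -, hX⟩ := h.ham f hf x
  refine ⟨X, fun g hg => (hX g hg).symm, fun Y hY => ?_⟩
  have h1 : ∀ ℓ : E →L[ℝ] ℝ, ℓ (Y : E) = ℓ (X : E) := by
    intro ℓ
    obtain ⟨g, hg, hgℓ⟩ := exists_dReal_eq (I := I) x ℓ
    exact ((hgℓ Y).symm.trans ((hY g hg).trans (hX g hg))).trans (hgℓ X)
  exact (SeparatingDual.eq_iff_forall_dual_eq (R := ℝ) (V := E)).2 h1

theorem bracketHam_spec (h : IsLevelBracket I Jb Ω br) {f : N → ℝ} (hf : ContMDiff I 𝓘(ℝ, ℝ) ∞ f) (x : N) :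
    bracketHam I br f x ∈ levelDist I Jb x ∧
    (∀ v ∈ levelDist I Jb x, Ω x (bracketHam I br f x) v = dReal I f x v) ∧
    ∀ g : N → ℝ, ContMDiff I 𝓘(ℝ, ℝ) ∞ g → br g f x = dReal I g x (bracketHam I br f x) := by
  obtain ⟨X, hX1, hX2, hX3⟩ := h.ham f hf x
  have hu := h.existsUnique_ham hf x
  have h1 : ∀ g : N → ℝ, ContMDiff I 𝓘(ℝ, ℝ) ∞ g →
      dReal I g x (bracketHam I br f x) = br g f x := Classical.epsilon_spec hu.exists
  have h2 : bracketHam I br f x = X := hu.unique h1 fun g hg => (hX3 g hg).symm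
  rw [h2]
  exact ⟨hX1, hX2, hX3⟩

theorem bracketHam_mem (h : IsLevelBracket I Jb Ω br) {f : N → ℝ} (hf : ContMDiff I 𝓘(ℝ, ℝ) ∞ f) (x : N) :
    bracketHam I br f x ∈ levelDist I Jb x := (h.bracketHam_spec hf x).1

theorem omega_bracketHam (h : IsLevelBracket I Jb Ω br) {f : N → ℝ} (hf : ContMDiff I 𝓘(ℝ, ℝ) ∞ f) {x : N} {v : TangentSpace I x}
    (hv : v ∈ levelDist I Jb x) : Ω x (bracketHam I br f x) v = dReal I f x v :=
  (h.bracketHam_spec hf x).2.1 v hv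

theorem br_eq (h : IsLevelBracket I Jb Ω br) {f g : N → ℝ} (hf : ContMDiff I 𝓘(ℝ, ℝ) ∞ f) (hg : ContMDiff I 𝓘(ℝ, ℝ) ∞ g) (x : N) :
    br g f x = dReal I g x (bracketHam I br f x) := (h.bracketHam_spec hf x).2.2 g hg

theorem br_eq_omega (h : IsLevelBracket I Jb Ω br) {f g : N → ℝ} (hf : ContMDiff I 𝓘(ℝ, ℝ) ∞ f) (hg : ContMDiff I 𝓘(ℝ, ℝ) ∞ g)
    (x : N) : br f g x = Ω x (bracketHam I br f x) (bracketHam I br g x) := by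
  rw [h.omega_bracketHam hf (h.bracketHam_mem hg x), h.br_eq hg hf]

theorem charDistribution_eq (h : IsLevelBracket I Jb Ω br) (x : N) : charDistribution I br x = levelDist I Jb x := by
  refine le_antisymm (Submodule.span_le.2 ?_) fun v hv => ?_
  · rintro X ⟨f, hf, rfl⟩
    exact h.bracketHam_mem hf x
  · obtain ⟨f, hf, hfv⟩ := exists_dReal_eq (I := I) x (h.twoForm.bilin x v)
    have h1 : bracketHam I br f x - v = 0 := by
      refine h.nondeg x _ (Submodule.sub_mem _ (h.bracketHam_mem hf x) hv) fun w hw => ?_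
      rw [h.twoForm.sub_left, h.omega_bracketHam hf hw]
      exact sub_eq_zero.2 (hfv w)
    rw [← sub_eq_zero.1 h1]
    exact Submodule.subset_span ⟨f, hf, rfl⟩

/-- The hamiltonian vector fields are smooth. -/
theorem contMDiff_bracketHam (h : IsLevelBracket I Jb Ω br) {f : N → ℝ} (hf : ContMDiff I 𝓘(ℝ, ℝ) ∞ f) :
    ContMDiff I I.tangent ∞ (fun x => (⟨x, bracketHam I br f x⟩ : TangentBundle I N)) := by
  intro b
  have hex : ∀ x, ∃ c : Fin k → ℝ, ∀ v : TangentSpace I x,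
      Ω x (bracketHam I br f x) v + ∑ i, c i * dReal I (Jb i) x v = dReal I f x v := by
    intro x
    let df : E →L[ℝ] ℝ := dReal I f x
    let dJ : Fin k → E →L[ℝ] ℝ := fun i => dReal I (Jb i) x
    let L : E →ₗ[ℝ] ℝ := df.toLinearMap -
      (h.twoForm.bilin x (bracketHam I br f x)).toLinearMap
    have h1 : (⨅ i, LinearMap.ker (dJ i).toLinearMap) ≤
        LinearMap.ker L := by
      intro v hv
      rw [LinearMap.mem_ker]
      exact sub_eq_zero.2 (h.omega_bracketHam hf hv).symm
    obtain ⟨c, hc⟩ := (Submodule.mem_span_range_iff_exists_fun ℝ).1 (mem_span_of_iInf_ker_le_ker h1)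
    refine ⟨c, fun v => ?_⟩
    have h2 : ∀ v : E, ∑ i, c i * dJ i v = L v := by
      intro v
      rw [← hc]
      simp only [LinearMap.sum_apply, LinearMap.smul_apply, smul_eq_mul]
      rfl
    have h4 : ∑ i, c i * dReal I (Jb i) x v = dReal I f x v - Ω x (bracketHam I br f x) v := h2 v
    rw [h4]
    ring
  choose c hc using hex
  let φ := extChartAt I b
  let T : E → E →L[ℝ] E →L[ℝ] ℝ := fun y =>
    (h.twoForm.bilin (φ.symm y)).bilinearComp
      (mfderiv 𝓘(ℝ, E) I φ.symm y : E →L[ℝ] E) (mfderiv 𝓘(ℝ, E) I φ.symm y : E →L[ℝ] E)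
  have hT : ContMDiffAt 𝓘(ℝ, E) 𝓘(ℝ, E →L[ℝ] E →L[ℝ] ℝ) ∞ T (φ b) :=
    contMDiffAt_clm_of_apply fun a => contMDiffAt_clm_of_apply fun a' =>
      h.twoForm.smooth b a a' _ (mem_extChartAt_target b)
  let θ : Fin k → E → E →L[ℝ] ℝ := fun i => chartForm I (dReal I (Jb i)) b
  have hθ : ∀ i, ContMDiffAt 𝓘(ℝ, E) 𝓘(ℝ, E →L[ℝ] ℝ) ∞ (θ i) (φ b) := fun i =>
    ((smoothOneForm_dReal (h.J_smooth i)).contDiffAt_chartForm b (mem_extChartAt_target b)).contMDiffAt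
  let B : E → (E × (Fin k → ℝ)) →L[ℝ] ((E →L[ℝ] ℝ) × (Fin k → ℝ)) := fun y =>
    (((T y).comp (ContinuousLinearMap.fst ℝ E (Fin k → ℝ))) +
      ∑ i, ((ContinuousLinearMap.proj i).comp
        (ContinuousLinearMap.snd ℝ E (Fin k → ℝ))).smulRight (θ i y)).prod
    (ContinuousLinearMap.pi fun i => (θ i y).comp (ContinuousLinearMap.fst ℝ E (Fin k → ℝ)))
  have hBap : ∀ y w d, B y (w, d) = (T y w + ∑ i, d i • θ i y, fun i => θ i y w) := by
    intro y w d
    refine Prod.ext ?_ rfl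
    simp [B, sum_apply]
  have hB : ContMDiffAt 𝓘(ℝ, E) 𝓘(ℝ, (E × (Fin k → ℝ)) →L[ℝ] ((E →L[ℝ] ℝ) × (Fin k → ℝ))) ∞ B
      (φ b) := by
    refine contMDiffAt_clm_of_apply fun a => ?_
    obtain ⟨w, d⟩ := a
    have e1 : (fun y => B y (w, d)) = fun y => (T y w + ∑ i, d i • θ i y, fun i => θ i y w) :=
      funext fun y => hBap y w d
    have e2 : ContMDiffAt 𝓘(ℝ, E) 𝓘(ℝ, E →L[ℝ] ℝ) ∞ (fun y => T y w) (φ b) :=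
      hT.clm_apply contMDiffAt_const
    have e3 : ContMDiffAt 𝓘(ℝ, E) 𝓘(ℝ, E →L[ℝ] ℝ) ∞ (fun y => ∑ i, d i • θ i y) (φ b) :=
      contMDiffAt_sum _ fun i _ =>
        (contMDiffAt_const (I' := 𝓘(ℝ, ℝ)) (c := d i)).smul (hθ i)
    have e4 : ContMDiffAt 𝓘(ℝ, E) 𝓘(ℝ, Fin k → ℝ) ∞ (fun y => fun i => θ i y w) (φ b) :=
      contMDiffAt_pi_space.2 fun i => (hθ i).clm_apply contMDiffAt_const
    rw [e1]
    exact (e2.add e3).prodMk_space e4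
  let z : E → E × (Fin k → ℝ) := fun y =>
    (chartVec I b ⟨φ.symm y, bracketHam I br f (φ.symm y)⟩, c (φ.symm y))
  let C : E → (E →L[ℝ] ℝ) × (Fin k → ℝ) := fun y => (chartForm I (dReal I f) b y, 0)
  have hC : ContMDiffAt 𝓘(ℝ, E) 𝓘(ℝ, (E →L[ℝ] ℝ) × (Fin k → ℝ)) ∞ C (φ b) :=
    ContMDiffAt.prodMk_space ((smoothOneForm_dReal hf).contDiffAt_chartForm b
      (mem_extChartAt_target b)).contMDiffAt contMDiffAt_const
  let Dφ : E → E →L[ℝ] E := fun y => mfderiv 𝓘(ℝ, E) I φ.symm y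
  have hfr : ∀ y ∈ φ.target, ∀ u : TangentSpace I (φ.symm y),
        Dφ y (chartVec I b ⟨φ.symm y, u⟩) = u := by
    intro y hy u
    have h1 := chartFrame_chartVec (I := I) (b := b) (z := ⟨φ.symm y, u⟩) (φ.map_target hy)
    have h2 : φ (φ.symm y) = y := φ.right_inv hy
    have hsnd : ∀ (p q : N) (w : TangentSpace I p) (w' : TangentSpace I q),
        (⟨p, w⟩ : TangentBundle I N) = ⟨q, w'⟩ → (w : E) = w' := by
      intro p q w w' h
      cases h
      rfl
    have h3 : chartFrame I b (chartVec I b ⟨φ.symm y, u⟩) (φ (φ.symm y)) = ⟨φ.symm y, u⟩ := h1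
    rw [h2] at h3
    exact hsnd _ _ _ _ h3
  have hz : ∀ᶠ y in 𝓝 (φ b), B y (z y) = C y := by
    filter_upwards [(isOpen_extChartAt_target (I := I) b).mem_nhds (mem_extChartAt_target b)]
      with y hy
    change B y (_, _) = _
    rw [hBap]
    have h1 := hfr y hy (bracketHam I br f (φ.symm y))
    refine Prod.ext ?_ ?_
    · refine ContinuousLinearMap.ext fun a => ?_
      have h2 : ∀ w : E, w = bracketHam I br f (φ.symm y) →
          h.twoForm.bilin (φ.symm y) w (mfderiv 𝓘(ℝ, E) I φ.symm y a) +
          ∑ i, c (φ.symm y) i * θ i y a = chartForm I (dReal I f) b y a := by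
        rintro w rfl
        exact hc _ _
      have h3 := h2 _ h1
      simp only [add_apply, sum_apply, smul_apply, smul_eq_mul]
      exact h3
    · funext i
      have h2 := mem_levelDist.1 (h.bracketHam_mem hf (φ.symm y)) i
      exact (congrArg (fun w : E => (dReal I (Jb i) (φ.symm y) : E →L[ℝ] ℝ) w) h1).trans h2
  have hinj : Function.Injective (B (φ b)) := by
    rw [injective_iff_map_eq_zero]
    rintro ⟨w, d⟩ hwd
    rw [hBap] at hwd
    have hid := hasMFDerivAt_self_chart_symm (I := I) b
    have hpt : φ.symm (φ b) = b := extChartAt_to_inv b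
    have hθb : ∀ i a, θ i (φ b) a = dReal I (Jb i) b a := by
      intro i a
      exact congrArg (fun z : TangentBundle I N => dReal I (Jb i) z.1 z.2) (chartFrame_self b a)
    have hTb : ∀ a a', T (φ b) a a' = Ω b a a' := by
      intro a a'
      exact tensor_congr Ω (chartFrame_self b a) (chartFrame_self b a')
    have h2 : ∀ i, dReal I (Jb i) b w = 0 := fun i =>
      (hθb i w).symm.trans (congrFun (congrArg Prod.snd hwd) i)
    have h1 : ∀ a : E, Ω b w a + ∑ i, d i * dReal I (Jb i) b a = 0 := by
      intro a
      have h3 : (T (φ b) w + ∑ i, d i • θ i (φ b)) a = 0 :=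
        congrArg (fun T : E →L[ℝ] ℝ => T a) (congrArg Prod.fst hwd)
      rw [add_apply, sum_apply] at h3
      exact (congrArg₂ (· + ·) (hTb w a)
        (Finset.sum_congr rfl fun i _ => congrArg (d i * ·) (hθb i a))).symm.trans h3
    have hw : w = 0 := by
      refine h.nondeg b w (mem_levelDist.2 h2) fun v hv => ?_
      have h3 := h1 v
      rw [Finset.sum_eq_zero fun i _ => by rw [mem_levelDist.1 hv i, mul_zero], add_zero] at h3
      exact h3
    subst hw
    have hd : d = 0 := by
      have h3 : ∑ i, d i • dReal I (Jb i) b = 0 := by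
        ext a
        have h4 := h1 a
        have h5 : Ω b (0 : E) a = 0 := h.twoForm.zero_left b a
        rw [h5, zero_add] at h4
        simp only [sum_apply, smul_apply, smul_eq_mul]
        exact h4
      funext i
      exact Fintype.linearIndependent_iff.1 (h.J_indep b) d h3 i
    rw [hd]
    rfl
  have hzs := contMDiffAt_of_injective hB hC hinj hz
  have hz1 : ContMDiffAt 𝓘(ℝ, E) 𝓘(ℝ, E) ∞ (fun y => (z y).1) (φ b) :=
    (ContinuousLinearMap.fst ℝ E (Fin k → ℝ)).contMDiff.contMDiffAt.comp _ hzs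
  refine (contMDiffAt_vector_iff (b := b) (mem_chart_source _ _)).2 ⟨contMDiffAt_id, ?_⟩
  refine (ContMDiffAt.comp b hz1 contMDiffAt_extChartAt).congr_of_eventuallyEq ?_
  filter_upwards [extChartAt_source_mem_nhds (I := I) b] with x hx
  have h1 : φ.symm (φ x) = x := φ.left_inv hx
  change _ = chartVec I b ⟨φ.symm (φ x), bracketHam I br f (φ.symm (φ x))⟩
  rw [h1]
  rfl

theorem contMDiff_br (h : IsLevelBracket I Jb Ω br) {f g : N → ℝ} (hf : ContMDiff I 𝓘(ℝ, ℝ) ∞ f) (hg : ContMDiff I 𝓘(ℝ, ℝ) ∞ g) :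
    ContMDiff I 𝓘(ℝ, ℝ) ∞ (br f g) := by
  have h1 : br f g = fun x => dReal I f x (bracketHam I br g x) := funext fun x => h.br_eq hg hf x
  rw [h1]
  exact (smoothOneForm_dReal hf).comp (h.contMDiff_bracketHam hg)

theorem br_skew (h : IsLevelBracket I Jb Ω br) {f g : N → ℝ} (hf : ContMDiff I 𝓘(ℝ, ℝ) ∞ f) (hg : ContMDiff I 𝓘(ℝ, ℝ) ∞ g) :
    br f g = - br g f := by
  funext x
  rw [Pi.neg_apply, h.br_eq_omega hf hg, h.br_eq_omega hg hf, h.twoForm.skew]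

end IsLevelBracket

end Bracket
section Jacobi

variable {E : Type*} [NormedAddCommGroup E] [NormedSpace ℝ E]

/-- A function differentiated along a Lie bracket of vector fields. -/
theorem fderiv_lieBracket {F : E → ℝ} {V W : E → E} {y : E} (hF : ContDiffAt ℝ ∞ F y)
    (hV : DifferentiableAt ℝ V y) (hW : DifferentiableAt ℝ W y) :
    fderiv ℝ F y (VectorField.lieBracket ℝ V W y) =
      fderiv ℝ (fun z => fderiv ℝ F z (W z)) y (V y) -
        fderiv ℝ (fun z => fderiv ℝ F z (V z)) y (W y) := by
  have h1 : DifferentiableAt ℝ (fderiv ℝ F) y :=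
    (hF.fderiv_right (m := ∞) (by simp)).differentiableAt (by simp)
  have h2 : IsSymmSndFDerivAt ℝ F y := hF.isSymmSndFDerivAt (by
    rw [minSmoothness_of_isRCLikeNormedField]; exact WithTop.coe_le_coe.2 le_top)
  rw [fderiv_clm_apply h1 hW, fderiv_clm_apply h1 hV]
  simp only [VectorField.lieBracket, map_sub, add_apply, ContinuousLinearMap.comp_apply,
    ContinuousLinearMap.flip_apply]
  rw [h2 (V y) (W y)]
  ring

theorem extDeriv_two_apply {Ω : E → E [⋀^Fin 2]→L[ℝ] ℝ} {X Y Z : E → E} {y : E}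
    (hΩ : DifferentiableAt ℝ Ω y) (hX : DifferentiableAt ℝ X y) (hY : DifferentiableAt ℝ Y y)
    (hZ : DifferentiableAt ℝ Z y) :
    extDeriv Ω y ![X y, Y y, Z y] =
      fderiv ℝ (fun z => Ω z ![Y z, Z z]) y (X y) - fderiv ℝ (fun z => Ω z ![X z, Z z]) y (Y y) +
      fderiv ℝ (fun z => Ω z ![X z, Y z]) y (Z y) -
      (Ω y ![VectorField.lieBracket ℝ X Y y, Z y] - Ω y ![VectorField.lieBracket ℝ X Z y, Y y] +
        Ω y ![VectorField.lieBracket ℝ Y Z y, X y]) := by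
  have hV : ∀ i, DifferentiableAt ℝ (fun z => (![X z, Y z, Z z] : Fin 3 → E) i) y := by
    intro i
    fin_cases i
    · exact hX
    · exact hY
    · exact hZ
  have h : extDeriv Ω y ![X y, Y y, Z y] =
      (∑ i : Fin 3, (-1) ^ i.val • fderiv ℝ (fun z => Ω z (i.removeNth ![X z, Y z, Z z])) y
        ((![X y, Y y, Z y] : Fin 3 → E) i)) -
      ∑ i : Fin 2, ∑ j ∈ Finset.Ici i, (-1) ^ (i + j : ℕ) • Ω y (Matrix.vecCons
        (VectorField.lieBracket ℝ (fun z => (![X z, Y z, Z z] : Fin 3 → E) i.castSucc)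
          (fun z => (![X z, Y z, Z z] : Fin 3 → E) j.succ) y)
        (j.removeNth <| i.castSucc.removeNth ![X y, Y y, Z y])) :=
    extDeriv_apply_vectorField (V := fun i z => (![X z, Y z, Z z] : Fin 3 → E) i) hΩ hV
  have r0 : ∀ a b c : E, (0 : Fin 3).removeNth ![a, b, c] = ![b, c] := by
    intro a b c
    funext i
    fin_cases i <;> rfl
  have r1 : ∀ a b c : E, (1 : Fin 3).removeNth ![a, b, c] = ![a, c] := by
    intro a b c
    funext i
    fin_cases i <;> rfl
  have r2 : ∀ a b c : E, (2 : Fin 3).removeNth ![a, b, c] = ![a, b] := by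
    intro a b c
    funext i
    fin_cases i <;> rfl
  have s0 : ∀ a b : E, (0 : Fin 2).removeNth ![a, b] = ![b] := by
    intro a b
    funext i
    fin_cases i
    rfl
  have s1 : ∀ a b : E, (1 : Fin 2).removeNth ![a, b] = ![a] := by
    intro a b
    funext i
    fin_cases i
    rfl
  rw [h]
  have f1 : (Finset.Ici (0 : Fin 2)) = {0, 1} := rfl
  have f2 : (Finset.Ici (1 : Fin 2)) = {1} := rfl
  have v0 : ∀ a b c : E, (![a, b, c] : Fin 3 → E) 0 = a := fun _ _ _ => rfl
  have v1 : ∀ a b c : E, (![a, b, c] : Fin 3 → E) 1 = b := fun _ _ _ => rfl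
  have v2 : ∀ a b c : E, (![a, b, c] : Fin 3 → E) 2 = c := fun _ _ _ => rfl
  have v3 : ∀ a b c : E, (![a, b, c] : Fin 3 → E) (Fin.succ 0) = b := fun _ _ _ => rfl
  have v4 : ∀ a b c : E, (![a, b, c] : Fin 3 → E) (Fin.succ 1) = c := fun _ _ _ => rfl
  simp only [Fin.sum_univ_three, Fin.sum_univ_two, f1, f2, Finset.sum_pair (zero_ne_one' (Fin 2)),
    Finset.sum_singleton, r0, r1, r2, s0, s1, Fin.castSucc_zero, Fin.castSucc_one, v0, v1, v2, v3,
    v4]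
  norm_num
  ring

end Jacobi

section TwistedPoisson

variable {E : Type*} [NormedAddCommGroup E] [NormedSpace ℝ E] [FiniteDimensional ℝ E]
  {H : Type*} [TopologicalSpace H]
  {I : ModelWithCorners ℝ E H} [I.Boundaryless] {N : Type*} [TopologicalSpace N]
  [ChartedSpace H N] [IsManifold I ∞ N] [T2Space N]
  {k : ℕ} {Jb : Fin k → N → ℝ} {Ω : ∀ x : N, TangentSpace I x → TangentSpace I x → ℝ}
  {br : (N → ℝ) → (N → ℝ) → N → ℝ}

namespace IsLevelBracket

theorem jacobi (h : IsLevelBracket I Jb Ω br) {f g l : N → ℝ} (hf : ContMDiff I 𝓘(ℝ, ℝ) ∞ f)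
    (hg : ContMDiff I 𝓘(ℝ, ℝ) ∞ g) (hl : ContMDiff I 𝓘(ℝ, ℝ) ∞ l) (x : N) :
    br f (br g l) x + br g (br l f) x + br l (br f g) x =
      extDerivForm h.twoForm.toDForm x
        ![bracketHam I br f x, bracketHam I br g x, bracketHam I br l x] := by
  let φ := extChartAt I x
  let c : (N → ℝ) → E → ℝ := fun F y => F (φ.symm y)
  let V : (N → ℝ) → E → E := fun F y => chartVec I x ⟨φ.symm y, bracketHam I br F (φ.symm y)⟩
  have hx0 : φ.symm (φ x) = x := extChartAt_to_inv x
  have hV : ∀ {F}, ContMDiff I 𝓘(ℝ, ℝ) ∞ F → DifferentiableAt ℝ (V F) (φ x) := by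
    intro F hF
    have h1 : ContMDiffAt 𝓘(ℝ, E) I.tangent ∞
        (fun y => (⟨φ.symm y, bracketHam I br F (φ.symm y)⟩ : TangentBundle I N)) (φ x) :=
      (h.contMDiff_bracketHam hF _).comp (φ x) (contMDiffAt_chart_symm x (mem_extChartAt_target x))
    have h2 : φ.symm (φ x) ∈ (chartAt H x).source := by
      rw [hx0]
      exact mem_chart_source H x
    have h3 : ContMDiffAt 𝓘(ℝ, E) 𝓘(ℝ, E) ∞ (V F) (φ x) := contMDiffAt_chartVec h1 h2
    exact h3.contDiffAt.differentiableAt (by simp)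
  have hcs : ∀ {F}, ContMDiff I 𝓘(ℝ, ℝ) ∞ F → ContDiffAt ℝ ∞ (c F) (φ x) := fun {F} hF =>
    ((hF _).comp (φ x) (contMDiffAt_chart_symm x (mem_extChartAt_target x))).contDiffAt
  have hfr : ∀ y ∈ φ.target, ∀ u : TangentSpace I (φ.symm y),
      chartFrame I x (chartVec I x ⟨φ.symm y, u⟩) y = ⟨φ.symm y, u⟩ := by
    intro y hy u
    have h1 := chartFrame_chartVec (I := I) (b := x) (z := ⟨φ.symm y, u⟩) (φ.map_target hy)
    have h2 : φ (φ.symm y) = y := φ.right_inv hy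
    have h3 : chartFrame I x (chartVec I x ⟨φ.symm y, u⟩) (φ (φ.symm y)) = ⟨φ.symm y, u⟩ := h1
    rwa [h2] at h3
  have hd : ∀ {F G}, ContMDiff I 𝓘(ℝ, ℝ) ∞ F → ContMDiff I 𝓘(ℝ, ℝ) ∞ G → ∀ y ∈ φ.target,
      fderiv ℝ (c G) y (V F y) = c (br G F) y := by
    intro F G hF hG y hy
    rw [fderiv_chart hy ((hG _).mdifferentiableAt (by simp))]
    refine Eq.trans ?_ (h.br_eq hF hG (φ.symm y)).symm
    exact congrArg (fun z : TangentBundle I N => dReal I G z.1 z.2) (hfr y hy _)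
  have hJ : ∀ {F}, ContMDiff I 𝓘(ℝ, ℝ) ∞ F → ∀ i, ∀ y ∈ φ.target,
      fderiv ℝ (c (Jb i)) y (V F y) = 0 := by
    intro F hF i y hy
    rw [fderiv_chart hy ((h.J_smooth i _).mdifferentiableAt (by simp))]
    refine Eq.trans ?_ (mem_levelDist.1 (h.bracketHam_mem hF (φ.symm y)) i)
    exact congrArg (fun z : TangentBundle I N => dReal I (Jb i) z.1 z.2) (hfr y hy _)
  let w := DForm.inChart I h.twoForm.toDForm x
  have hw : ∀ y a a', w y ![a, a'] = chartTensor I Ω x y a a' := fun y a a' =>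
    inChart_two_apply h.twoForm.toDForm x y a a'
  have hwV : ∀ {F}, ContMDiff I 𝓘(ℝ, ℝ) ∞ F → ∀ y ∈ φ.target, ∀ a,
      (∀ i, fderiv ℝ (c (Jb i)) y a = 0) → w y ![V F y, a] = fderiv ℝ (c F) y a := by
    intro F hF y hy a ha
    rw [hw, fderiv_chart hy ((hF _).mdifferentiableAt (by simp))]
    have h1 : (chartFrame I x a y).2 ∈ levelDist I Jb (φ.symm y) := by
      refine mem_levelDist.2 fun i => ?_
      have h2 := ha i
      rwa [fderiv_chart hy ((h.J_smooth i _).mdifferentiableAt (by simp))] at h2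
    refine Eq.trans ?_ (h.omega_bracketHam hF h1)
    exact tensor_congr Ω (hfr y hy _) rfl
  have hwVV : ∀ {F G}, ContMDiff I 𝓘(ℝ, ℝ) ∞ F → ContMDiff I 𝓘(ℝ, ℝ) ∞ G → ∀ y ∈ φ.target,
      w y ![V F y, V G y] = c (br F G) y := by
    intro F G hF hG y hy
    rw [hwV hF y hy _ fun i => hJ hG i y hy, hd hG hF y hy]
  have hT : ∀ᶠ y in 𝓝 (φ x), y ∈ φ.target :=
    (isOpen_extChartAt_target (I := I) x).mem_nhds (mem_extChartAt_target x)
  have hdw : ∀ {F G}, ContMDiff I 𝓘(ℝ, ℝ) ∞ F → ContMDiff I 𝓘(ℝ, ℝ) ∞ G → ∀ {K},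
      ContMDiff I 𝓘(ℝ, ℝ) ∞ K → fderiv ℝ (fun z => w z ![V F z, V G z]) (φ x) (V K (φ x)) =
        br (br F G) K x := by
    intro F G hF hG K hK
    have h1 : (fun z => w z ![V F z, V G z]) =ᶠ[𝓝 (φ x)] c (br F G) := by
      filter_upwards [hT] with y hy using hwVV hF hG y hy
    rw [h1.fderiv_eq, hd hK (h.contMDiff_br hF hG) _ (mem_extChartAt_target x)]
    exact congrArg (br (br F G) K) hx0
  have hdd : ∀ {F G K}, ContMDiff I 𝓘(ℝ, ℝ) ∞ F → ContMDiff I 𝓘(ℝ, ℝ) ∞ G →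
      ContMDiff I 𝓘(ℝ, ℝ) ∞ K →
      fderiv ℝ (fun z => fderiv ℝ (c F) z (V G z)) (φ x) (V K (φ x)) = br (br F G) K x := by
    intro F G K hF hG hK
    have h1 : (fun z => fderiv ℝ (c F) z (V G z)) =ᶠ[𝓝 (φ x)] c (br F G) := by
      filter_upwards [hT] with y hy using hd hG hF y hy
    rw [h1.fderiv_eq, hd hK (h.contMDiff_br hF hG) _ (mem_extChartAt_target x)]
    exact congrArg (br (br F G) K) hx0
  have hbrJ : ∀ {F G}, ContMDiff I 𝓘(ℝ, ℝ) ∞ F → ContMDiff I 𝓘(ℝ, ℝ) ∞ G → ∀ i,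
      fderiv ℝ (c (Jb i)) (φ x) (VectorField.lieBracket ℝ (V F) (V G) (φ x)) = 0 := by
    intro F G hF hG i
    have h1 : ∀ {F}, ContMDiff I 𝓘(ℝ, ℝ) ∞ F →
        (fun z => fderiv ℝ (c (Jb i)) z (V F z)) =ᶠ[𝓝 (φ x)] fun _ => 0 := by
      intro F hF
      filter_upwards [hT] with y hy using hJ hF i y hy
    rw [fderiv_lieBracket (hcs (h.J_smooth i)) (hV hF) (hV hG), (h1 hF).fderiv_eq,
      (h1 hG).fderiv_eq]
    simp
  have hskew : ∀ y a b, w y ![a, b] = - w y ![b, a] := by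
    intro y a b
    rw [hw, hw]
    exact h.twoForm.skew _ _ _
  have hbr : ∀ {F G K}, ContMDiff I 𝓘(ℝ, ℝ) ∞ F → ContMDiff I 𝓘(ℝ, ℝ) ∞ G →
      ContMDiff I 𝓘(ℝ, ℝ) ∞ K →
      w (φ x) ![VectorField.lieBracket ℝ (V F) (V G) (φ x), V K (φ x)] =
        br (br K F) G x - br (br K G) F x := by
    intro F G K hF hG hK
    rw [hskew, hwV hK _ (mem_extChartAt_target x) _ (hbrJ hF hG),
      fderiv_lieBracket (hcs hK) (hV hF) (hV hG), hdd hK hG hF, hdd hK hF hG]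
    ring
  have hVx : ∀ {F}, V F (φ x) = bracketHam I br F x := by
    intro F
    have h1 : chartVec I x (⟨x, bracketHam I br F x⟩ : TangentBundle I N) = bracketHam I br F x :=
      DFunLike.congr_fun (mfderiv_extChartAt_self (I := I) (x := x)) (bracketHam I br F x)
    refine Eq.trans ?_ h1
    change chartVec I x ⟨φ.symm (φ x), bracketHam I br F (φ.symm (φ x))⟩ = _
    rw [hx0]
  have hwd : DifferentiableAt ℝ w (φ x) :=
    ((h.twoForm.isSmooth_toDForm x).contDiffAt ((isOpen_extChartAt_target x).mem_nhds
      (mem_extChartAt_target x))).differentiableAt (by simp)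
  have hmain := extDeriv_two_apply hwd (hV hf) (hV hg) (hV hl)
  have hgoal : extDerivForm h.twoForm.toDForm x
        ![bracketHam I br f x, bracketHam I br g x, bracketHam I br l x] =
      extDeriv w (φ x) ![V f (φ x), V g (φ x), V l (φ x)] := by
    rw [hVx, hVx, hVx]
    rfl
  have hsk : ∀ {F G}, ContMDiff I 𝓘(ℝ, ℝ) ∞ F → ContMDiff I 𝓘(ℝ, ℝ) ∞ G →
      br F G x = - br G F x := fun hF hG => congrFun (h.br_skew hF hG) x
  have hsk2 : ∀ {F G K}, ContMDiff I 𝓘(ℝ, ℝ) ∞ F → ContMDiff I 𝓘(ℝ, ℝ) ∞ G →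
      ContMDiff I 𝓘(ℝ, ℝ) ∞ K → br (br F G) K x = - br K (br F G) x :=
    fun hF hG hK => hsk (h.contMDiff_br hF hG) hK
  have hsk3 : ∀ {F G K}, ContMDiff I 𝓘(ℝ, ℝ) ∞ F → ContMDiff I 𝓘(ℝ, ℝ) ∞ G →
      ContMDiff I 𝓘(ℝ, ℝ) ∞ K → br K (br F G) x = - br K (br G F) x := by
    intro F G K hF hG hK
    have h1 := h.br_eq (h.contMDiff_br hG hF) hK x
    have h2 := hsk2 hG hF hK
    have h3 := hsk2 hF hG hK
    have h4 : br (br F G) K x = - br (br G F) K x := by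
      have hn : ContMDiff I 𝓘(ℝ, ℝ) ∞ (-br G F) := (h.contMDiff_br hG hF).neg
      rw [h.br_skew hF hG, h.br_eq hK hn, h.br_eq hK (h.contMDiff_br hG hF)]
      have h5 := dReal_smul ((h.contMDiff_br hG hF x).mdifferentiableAt (by simp)) (-1)
        (bracketHam I br K x)
      simpa using h5
    linarith
  rw [hgoal, hmain, hdw hg hl hf, hdw hf hl hg, hdw hf hg hl, hbr hf hg hl, hbr hf hl hg,
    hbr hg hl hf, hsk2 hg hl hf, hsk2 hf hl hg, hsk2 hf hg hl, hsk2 hl hf hg, hsk2 hl hg hf,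
    hsk2 hg hf hl, hsk3 hl hg hf, hsk3 hg hf hl, hsk3 hf hl hg]
  ring

theorem isTwistedPoisson (h : IsLevelBracket I Jb Ω br) : IsTwistedPoisson I br where
  smooth _ _ hf hg := h.contMDiff_br hf hg
  skew _ _ hf hg := h.br_skew hf hg
  add_left f g l hf hg hl := by
    funext x
    rw [Pi.add_apply, h.br_eq hl (hf.add hg), h.br_eq hl hf, h.br_eq hl hg]
    exact dReal_add ((hf x).mdifferentiableAt (by simp)) ((hg x).mdifferentiableAt (by simp)) _
  smul_left a f g hf hg := by
    funext x
    have h1 : ContMDiff I 𝓘(ℝ, ℝ) ∞ (a • f) := (contMDiff_const (I' := 𝓘(ℝ, ℝ)) (c := a)).smul hf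
    rw [Pi.smul_apply, h.br_eq hg h1, h.br_eq hg hf]
    exact dReal_smul ((hf x).mdifferentiableAt (by simp)) a _
  leibniz f g l hf hg hl := by
    funext x
    rw [Pi.add_apply, Pi.mul_apply, Pi.mul_apply, h.br_eq hl (hf.mul hg), h.br_eq hl hf,
      h.br_eq hl hg]
    have h1 := dReal_mul ((hf x).mdifferentiableAt (by simp)) ((hg x).mdifferentiableAt (by simp))
      (bracketHam I br l x)
    refine h1.trans ?_
    ring
  jacobi := ⟨extDerivForm h.twoForm.toDForm, isSmooth_extDerivForm h.twoForm.isSmooth_toDForm,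
    isClosed_extDerivForm h.twoForm.isSmooth_toDForm, fun _ _ _ hf hg hl x => h.jacobi hf hg hl x⟩

end IsLevelBracket

end TwistedPoisson
/-! ### Level sets of submersions -/

section LevelSets

variable {E : Type*} [NormedAddCommGroup E] [NormedSpace ℝ E] [FiniteDimensional ℝ E]
  {H : Type*} [TopologicalSpace H]
  {I : ModelWithCorners ℝ E H} [I.Boundaryless] {N : Type*} [TopologicalSpace N]
  [ChartedSpace H N] [IsManifold I ∞ N]
  {F : Type*} [NormedAddCommGroup F] [NormedSpace ℝ F] [FiniteDimensional ℝ F]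
  {K : Type*} [NormedAddCommGroup K] [NormedSpace ℝ K] [FiniteDimensional ℝ K]

open Classical in
/-- The chart of a level set induced by an adapted chart of the ambient manifold. -/
noncomputable def sliceChart (A : Set N) (Ψ : OpenPartialHomeomorph N (F × K)) (c : F) (a : A)
    (h1 : ∀ x ∈ Ψ.source, (x ∈ A ↔ (Ψ x).1 = c)) : OpenPartialHomeomorph A K where
  toFun p := (Ψ p.1).2
  invFun w := if h : (c, w) ∈ Ψ.target then ⟨Ψ.symm (c, w), (h1 _ (Ψ.map_target h)).2 (by
    rw [Ψ.right_inv h])⟩ else a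
  source := Subtype.val ⁻¹' Ψ.source
  target := {w | (c, w) ∈ Ψ.target}
  map_source' := by
    intro p hp
    have h2 := (h1 _ hp).1 p.2
    have h3 : Ψ p.1 = (c, (Ψ p.1).2) := Prod.ext h2 rfl
    change (c, (Ψ p.1).2) ∈ Ψ.target
    rw [← h3]
    exact Ψ.map_source hp
  map_target' := by
    intro w hw
    have hw' : (c, w) ∈ Ψ.target := hw
    rw [dif_pos hw']
    exact Ψ.map_target hw'
  left_inv' := by
    intro p hp
    have h2 := (h1 _ hp).1 p.2
    have h3 : (c, (Ψ p.1).2) = Ψ p.1 := Prod.ext h2.symm rfl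
    have h4 : (c, (Ψ p.1).2) ∈ Ψ.target := by
      rw [h3]
      exact Ψ.map_source hp
    rw [dif_pos h4]
    refine Subtype.ext ?_
    change Ψ.symm (c, (Ψ p.1).2) = p.1
    rw [h3]
    exact Ψ.left_inv hp
  right_inv' := by
    intro w hw
    have hw' : (c, w) ∈ Ψ.target := hw
    rw [dif_pos hw']
    change (Ψ (Ψ.symm (c, w))).2 = w
    rw [Ψ.right_inv hw']
  open_source := Ψ.open_source.preimage continuous_subtype_val
  open_target := Ψ.open_target.preimage (Continuous.prodMk_right c)
  continuousOn_toFun := by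
    have h2 : ContinuousOn (fun p : A => Ψ p.1) (Subtype.val ⁻¹' Ψ.source) :=
      Ψ.continuousOn.comp continuous_subtype_val.continuousOn fun p hp => hp
    exact continuous_snd.comp_continuousOn h2
  continuousOn_invFun := by
    rw [Topology.IsInducing.subtypeVal.continuousOn_iff]
    have h2 : ContinuousOn (fun w => Ψ.symm (c, w)) {w | (c, w) ∈ Ψ.target} :=
      Ψ.symm.continuousOn.comp (Continuous.prodMk_right c).continuousOn fun w hw => hw
    refine h2.congr fun w hw => ?_
    have hw' : (c, w) ∈ Ψ.target := hw
    simp only [Function.comp, dif_pos hw']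

open Classical in
theorem sliceChart_symm {A : Set N} {Ψ : OpenPartialHomeomorph N (F × K)} {c : F} {a : A}
    {h1 : ∀ x ∈ Ψ.source, (x ∈ A ↔ (Ψ x).1 = c)} {w : K} (hw : (c, w) ∈ Ψ.target) :
    ((sliceChart A Ψ c a h1).symm w : N) = Ψ.symm (c, w) := by
  change ((dite _ _ _ : A) : N) = _
  rw [dif_pos hw]

/-- A set which locally is a regular level set is an embedded submanifold. -/
theorem exists_levelSet_structure {A : Set N} {f : N → F} {c : F} {r : ℕ} {U : Set N}
    (hU : IsOpen U) (hAU : A ⊆ U) (hAc : ∀ x ∈ U, (x ∈ A ↔ f x = c))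
    (hf : ContMDiff I 𝓘(ℝ, F) ∞ f)
    (hs : ∀ a ∈ A, Function.Surjective (mfderiv I 𝓘(ℝ, F) f a))
    (hr : A.Nonempty → Module.finrank ℝ E = Module.finrank ℝ F + r) :
    ∃ cs : ChartedSpace (EuclideanSpace ℝ (Fin r)) A, IsManifold (𝓡 r) ∞ A ∧
      IsSmoothImmersion (𝓡 r) I (Subtype.val : A → N) ∧
      ∀ (a : A) (v : TangentSpace I a.1), dVec I f a.1 v = 0 →
        ∃ w : TangentSpace (𝓡 r) a, mfderiv (𝓡 r) I (Subtype.val : A → N) a w = v := by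
  have hex : ∀ a : A, ∃ Ψ : OpenPartialHomeomorph N (F × EuclideanSpace ℝ (Fin r)),
      a.1 ∈ Ψ.source ∧ Ψ.source ⊆ U ∧ (∀ y ∈ Ψ.source, (Ψ y).1 = f y) ∧
      ContMDiffOn I 𝓘(ℝ, F × EuclideanSpace ℝ (Fin r)) ∞ Ψ Ψ.source ∧
      ContMDiffOn 𝓘(ℝ, F × EuclideanSpace ℝ (Fin r)) I ∞ Ψ.symm Ψ.target := by
    intro a
    obtain ⟨Ψ, Λ, h1, h2, h3, h4, h5, -⟩ := exists_adapted_chart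
      (K := EuclideanSpace ℝ (Fin r)) hU (hAU a.2) hf.contMDiffOn (hs a.1 a.2)
      (by rw [hr ⟨a.1, a.2⟩, finrank_euclideanSpace_fin])
    exact ⟨Ψ, h1, h2, h3, h4, h5⟩
  choose Ψ hΨa hΨU hΨf hΨs hΨi using hex
  have hsl : ∀ a : A, ∀ x ∈ (Ψ a).source, (x ∈ A ↔ (Ψ a x).1 = c) := fun a x hx => by
    rw [hΨf a x hx]
    exact hAc x (hΨU a hx)
  let ch : A → OpenPartialHomeomorph A (EuclideanSpace ℝ (Fin r)) := fun a =>
    sliceChart A (Ψ a) c a (hsl a)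
  let cs : ChartedSpace (EuclideanSpace ℝ (Fin r)) A :=
    { atlas := range ch
      chartAt := ch
      mem_chart_source := hΨa
      chart_mem_atlas := fun a => mem_range_self a }
  have hchart : ∀ a : A, chartAt (EuclideanSpace ℝ (Fin r)) a = ch a := fun a => rfl
  have hsymm : ∀ (a : A) (w), w ∈ (ch a).target → ContMDiffAt (𝓡 r) I ∞
      (fun w => ((ch a).symm w : N)) w := by
    intro a w hw
    have h1 : ContMDiffAt 𝓘(ℝ, EuclideanSpace ℝ (Fin r)) 𝓘(ℝ, F × EuclideanSpace ℝ (Fin r)) ∞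
        (fun w => (c, w)) w := contMDiffAt_const.prodMk_space contMDiffAt_id
    have h2 : ContMDiffAt (𝓡 r) I ∞ (fun w => (Ψ a).symm (c, w)) w :=
      ContMDiffAt.comp w ((hΨi a).contMDiffAt ((Ψ a).open_target.mem_nhds hw)) h1
    refine h2.congr_of_eventuallyEq ?_
    filter_upwards [(ch a).open_target.mem_nhds hw] with z hz
    exact sliceChart_symm hz
  have hman : IsManifold (𝓡 r) ∞ A := by
    refine isManifold_of_contDiffOn (𝓡 r) ∞ A ?_
    rintro _ _ ⟨a, rfl⟩ ⟨b, rfl⟩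
    simp only [modelWithCornersSelf_coe, modelWithCornersSelf_coe_symm, Function.id_comp,
      Function.comp_id, preimage_id, range_id, inter_univ]
    intro w hw
    have hw1 : w ∈ (ch a).target := hw.1
    have hw2 : ((ch a).symm w : N) ∈ (Ψ b).source := hw.2
    have h1 : ContMDiffAt (𝓡 r) 𝓘(ℝ, F × EuclideanSpace ℝ (Fin r)) ∞
        (fun w => Ψ b ((ch a).symm w : N)) w :=
      ContMDiffAt.comp w ((hΨs b).contMDiffAt ((Ψ b).open_source.mem_nhds hw2)) (hsymm a w hw1)
    have h2 : ContDiffAt ℝ ∞ (fun w => (Ψ b ((ch a).symm w : N)).2) w := h1.contDiffAt.snd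
    exact h2.contDiffWithinAt
  have hval : ContMDiff (𝓡 r) I ∞ (Subtype.val : A → N) := by
    intro a
    have h1 : ContMDiffAt (𝓡 r) (𝓡 r) ∞ (extChartAt (𝓡 r) a) a := contMDiffAt_extChartAt
    have h2 : extChartAt (𝓡 r) a a ∈ (ch a).target := (ch a).map_source (hΨa a)
    refine (ContMDiffAt.comp a (hsymm a _ h2) h1).congr_of_eventuallyEq ?_
    filter_upwards [(ch a).open_source.mem_nhds (hΨa a)] with p hp
    exact (congrArg Subtype.val ((ch a).left_inv hp)).symm
  have hinj : ∀ a : A, Function.Injective (mfderiv (𝓡 r) I (Subtype.val : A → N) a) := by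
    intro a
    rw [injective_iff_map_eq_zero]
    intro v hv
    have h1 : ContMDiffAt I 𝓘(ℝ, EuclideanSpace ℝ (Fin r)) ∞ (fun x => (Ψ a x).2) a.1 :=
      (ContinuousLinearMap.snd ℝ F (EuclideanSpace ℝ (Fin r))).contMDiff.contMDiffAt.comp a.1
        ((hΨs a).contMDiffAt ((Ψ a).open_source.mem_nhds (hΨa a)))
    have h2 := dVec_comp (I := 𝓡 r) (I' := I) (g := fun x => (Ψ a x).2)
      (f := (Subtype.val : A → N)) (x := a) (h1.mdifferentiableAt (by simp))
      ((hval a).mdifferentiableAt (by simp)) v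
    rw [hv, map_zero] at h2
    have h3 := DFunLike.congr_fun (mfderiv_extChartAt_self (I := 𝓡 r) (x := a)) v
    exact h3.symm.trans h2
  refine ⟨cs, hman, ⟨hval, hinj⟩, fun a v hv => ?_⟩
  let D : EuclideanSpace ℝ (Fin r) →L[ℝ] E := mfderiv (𝓡 r) I (Subtype.val : A → N) a
  let L : E →L[ℝ] F := dVec I f a.1
  have h1 : LinearMap.range D.toLinearMap ≤ LinearMap.ker L.toLinearMap := by
    rintro _ ⟨w, rfl⟩
    have h2 := dVec_comp (I := 𝓡 r) (I' := I) (g := f)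
      (f := (Subtype.val : A → N)) (x := a) ((hf a.1).mdifferentiableAt (by simp))
      ((hval a).mdifferentiableAt (by simp)) w
    have h3 : (fun x : A => f x.1) = fun _ => c := funext fun x => (hAc x.1 (hAU x.2)).1 x.2
    have h4 : dVec (𝓡 r) (fun x : A => f x.1) a w = 0 := by
      rw [h3]
      have h5 : mfderiv (𝓡 r) 𝓘(ℝ, F) (fun _ : A => c) a = 0 := mfderiv_const
      exact congrArg (fun T : EuclideanSpace ℝ (Fin r) →L[ℝ] F => T w) h5
    exact h2.symm.trans h4
  have h2 : Module.finrank ℝ (LinearMap.range D.toLinearMap) =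
      Module.finrank ℝ (LinearMap.ker L.toLinearMap) := by
    have e1 := LinearMap.finrank_range_add_finrank_ker L.toLinearMap
    have e2 : LinearMap.range L.toLinearMap = ⊤ := LinearMap.range_eq_top.mpr (hs a.1 a.2)
    have e3 : Module.finrank ℝ (LinearMap.range D.toLinearMap) = r := by
      have e5 : Function.Injective D.toLinearMap := hinj a
      rw [LinearMap.finrank_range_of_inj e5, finrank_euclideanSpace_fin]
    rw [e2, finrank_top] at e1
    have e4 := hr ⟨a.1, a.2⟩
    omega
  have h3 := Submodule.eq_of_le_of_finrank_eq h1 h2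
  have h4 : (v : E) ∈ LinearMap.range D.toLinearMap := by
    rw [h3]
    exact hv
  exact h4

end LevelSets

/-! ### Integral manifolds of level set distributions -/

section Leaves

/-- A smooth function with vanishing differential on a connected manifold is constant. -/
theorem eq_of_dVec_eq_zero {E : Type*} [NormedAddCommGroup E] [NormedSpace ℝ E]
    [FiniteDimensional ℝ E] {H : Type*} [TopologicalSpace H]
    {I : ModelWithCorners ℝ E H} [I.Boundaryless] {N : Type*} [TopologicalSpace N]
    [ChartedSpace H N] [IsManifold I ∞ N] [PreconnectedSpace N] {f : N → ℝ}
    (hf : ContMDiff I 𝓘(ℝ, ℝ) ∞ f) (h0 : ∀ x (u : TangentSpace I x), dVec I f x u = 0) (x y : N) :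
    f x = f y := by
  have hloc : IsLocallyConstant f := by
    rw [IsLocallyConstant.iff_eventually_eq]
    intro x
    obtain ⟨ε, hε, hball⟩ := Metric.isOpen_iff.1 (isOpen_extChartAt_target (I := I) x) _
      (mem_extChartAt_target x)
    have h1 : ∀ z ∈ Metric.ball (extChartAt I x x) ε,
        HasFDerivAt (fun y => f ((extChartAt I x).symm y)) (0 : E →L[ℝ] ℝ) z := by
      intro z hz
      have h2 : ContMDiffAt 𝓘(ℝ, E) 𝓘(ℝ, ℝ) ∞ (fun y => f ((extChartAt I x).symm y)) z :=
        (hf _).comp z (contMDiffAt_chart_symm x (hball hz))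
      have h3 := (h2.contDiffAt.differentiableAt (by simp)).hasFDerivAt
      have h4 : fderiv ℝ (fun y => f ((extChartAt I x).symm y)) z = 0 := by
        ext a
        rw [fderiv_chart (hball hz) ((hf _).mdifferentiableAt (by simp))]
        exact h0 _ _
      rwa [h4] at h3
    have h2 : ∀ z ∈ Metric.ball (extChartAt I x x) ε,
        f ((extChartAt I x).symm z) = f x := by
      intro z hz
      have h3 := (convex_ball (extChartAt I x x) ε).is_const_of_fderivWithin_eq_zero
        (fun w hw => (h1 w hw).differentiableAt.differentiableWithinAt)
        (fun w hw => ((h1 w hw).hasFDerivWithinAt.fderivWithin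
          (Metric.isOpen_ball.uniqueDiffWithinAt hw))) hz (Metric.mem_ball_self hε)
      rw [h3, extChartAt_to_inv]
    have hc := continuousAt_extChartAt (I := I) x
    filter_upwards [hc.eventually (Metric.ball_mem_nhds _ hε), extChartAt_source_mem_nhds (I := I) x]
      with z hz hzs
    have h3 := h2 _ hz
    rwa [(extChartAt I x).left_inv hzs] at h3
  exact hloc.apply_eq_of_preconnectedSpace x y

variable {E : Type*} [NormedAddCommGroup E] [NormedSpace ℝ E] [FiniteDimensional ℝ E]
  {H : Type*} [TopologicalSpace H]
  {I : ModelWithCorners ℝ E H} [I.Boundaryless] {N : Type*} [TopologicalSpace N]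
  [ChartedSpace H N] [IsManifold I ∞ N]
  {k : ℕ} {Jb : Fin k → N → ℝ} {Ω : ∀ x : N, TangentSpace I x → TangentSpace I x → ℝ}
  {br : (N → ℝ) → (N → ℝ) → N → ℝ}

theorem dVec_pi {f : Fin k → N → ℝ} (hf : ∀ i, ContMDiff I 𝓘(ℝ, ℝ) ∞ (f i)) (x : N)
    (u : TangentSpace I x) : dVec I (fun x i => f i x) x u = fun i => dReal I (f i) x u := by
  have h1 : ContMDiff I 𝓘(ℝ, Fin k → ℝ) ∞ (fun x i => f i x) := contMDiff_pi_space.2 hf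
  funext i
  have h2 := dVec_comp (I := I) (I' := 𝓘(ℝ, Fin k → ℝ)) (g := fun w : Fin k → ℝ => w i)
    (f := fun x i => f i x) (x := x)
    ((ContinuousLinearMap.proj (R := ℝ) (φ := fun _ : Fin k => ℝ) i).contMDiff.mdifferentiableAt
      one_ne_zero) ((h1 x).mdifferentiableAt (by simp)) u
  refine Eq.trans ?_ h2.symm
  let P : (Fin k → ℝ) →L[ℝ] ℝ := ContinuousLinearMap.proj (R := ℝ) (φ := fun _ : Fin k => ℝ) i
  have h3 : ∀ p w : Fin k → ℝ, dVec 𝓘(ℝ, Fin k → ℝ) (fun w : Fin k → ℝ => w i) p w = w i := by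
    intro p w
    change mfderiv 𝓘(ℝ, Fin k → ℝ) 𝓘(ℝ, ℝ) P p w = P w
    rw [mfderiv_eq_fderiv, P.fderiv]
    rfl
  exact (h3 _ _).symm

theorem surjective_of_linearIndependent {W : Type*} [NormedAddCommGroup W] [NormedSpace ℝ W]
    [FiniteDimensional ℝ W] {ℓ : Fin k → W →L[ℝ] ℝ} (h : LinearIndependent ℝ ℓ) :
    Function.Surjective (fun w i => ℓ i w) := by
  let L : W →ₗ[ℝ] Fin k → ℝ := LinearMap.pi fun i => (ℓ i).toLinearMap
  have h1 : LinearMap.range L = ⊤ := by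
    by_contra hne
    obtain ⟨g, hg0, hg⟩ := Submodule.exists_le_ker_of_lt_top _ (lt_top_iff_ne_top.2 hne)
    refine hg0 (LinearMap.pi_ext' fun i => LinearMap.ext_ring ?_)
    have h2 : ∑ i, g (Pi.single i 1) • ℓ i = 0 := by
      ext w
      have h3 : g (L w) = 0 := hg ⟨w, rfl⟩
      have h4 : L w = ∑ i, ℓ i w • Pi.single i (1 : ℝ) := by
        funext j
        simp [L, Finset.sum_apply, Pi.single_apply]
      rw [h4, map_sum] at h3
      simp only [map_smul, smul_eq_mul] at h3
      simp only [sum_apply, smul_apply, smul_eq_mul]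
      exact (Finset.sum_congr rfl fun i _ => mul_comm _ _).trans h3
    simpa using Fintype.linearIndependent_iff.1 h _ h2 i
  exact LinearMap.range_eq_top.1 h1

theorem surjective_dVec {f : Fin k → N → ℝ} (hf : ∀ i, ContMDiff I 𝓘(ℝ, ℝ) ∞ (f i)) {x : N}
    (h : LinearIndependent ℝ fun i => dReal I (f i) x) :
    Function.Surjective (mfderiv I 𝓘(ℝ, Fin k → ℝ) (fun x i => f i x) x) := by
  intro w
  obtain ⟨u, hu⟩ := surjective_of_linearIndependent (W := E) (ℓ := fun i => dReal I (f i) x) h w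
  exact ⟨u, (dVec_pi hf x u).trans hu⟩

/-- Regular level sets of independent functions. -/
theorem exists_structure_of_independent {f : Fin k → N → ℝ}
    (hf : ∀ i, ContMDiff I 𝓘(ℝ, ℝ) ∞ (f i))
    (h : ∀ x, LinearIndependent ℝ fun i => dReal I (f i) x) {A U : Set N} {c : Fin k → ℝ}
    (hU : IsOpen U) (hAU : A ⊆ U) (hAc : ∀ x ∈ U, (x ∈ A ↔ ∀ i, f i x = c i)) :
    ∃ cs : ChartedSpace (EuclideanSpace ℝ (Fin (Module.finrank ℝ E - k))) A,
      IsManifold (𝓡 (Module.finrank ℝ E - k)) ∞ A ∧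
      IsSmoothImmersion (𝓡 (Module.finrank ℝ E - k)) I (Subtype.val : A → N) ∧
      ∀ (a : A) (v : TangentSpace I a.1), (∀ i, dReal I (f i) a.1 v = 0) →
        ∃ w : TangentSpace (𝓡 (Module.finrank ℝ E - k)) a,
          mfderiv (𝓡 (Module.finrank ℝ E - k)) I (Subtype.val : A → N) a w = v := by
  obtain ⟨cs, h1, h2, h3⟩ := exists_levelSet_structure (I := I) (A := A) (f := fun x i => f i x)
    (c := c) (r := Module.finrank ℝ E - k) hU hAU (fun x hx => by rw [hAc x hx, funext_iff])
    (contMDiff_pi_space.2 hf) (fun a _ => surjective_dVec hf (h a)) (by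
      rintro ⟨x, hx⟩
      have h1 : Fintype.card (Fin k) ≤ Module.finrank ℝ (E →L[ℝ] ℝ) :=
        LinearIndependent.fintype_card_le_finrank (R := ℝ) (M := E →L[ℝ] ℝ) (h x)
      have h2 : Module.finrank ℝ (E →L[ℝ] ℝ) = Module.finrank ℝ E := by
        rw [← LinearEquiv.finrank_eq (LinearMap.toContinuousLinearMap : (E →ₗ[ℝ] ℝ) ≃ₗ[ℝ] _)]
        exact Subspace.dual_finrank_eq
      rw [h2, Fintype.card_fin] at h1
      rw [Module.finrank_fin_fun]
      omega)
  exact ⟨cs, h1, h2, fun a v hv => h3 a v (by rw [dVec_pi hf]; exact funext hv)⟩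

namespace IsLevelBracket

variable [T2Space N]

theorem isLeaf_iff (h : IsLevelBracket I Jb Ω br) (L : Set N) :
    IsLeaf I br L ↔ ∃ c : Fin k → ℝ, ∃ x ∈ ⋂ i, Jb i ⁻¹' {c i},
      L = connectedComponentIn (⋂ i, Jb i ⁻¹' {c i}) x := by
  have hmem : ∀ (c : Fin k → ℝ) x, x ∈ (⋂ i, Jb i ⁻¹' {c i}) ↔ ∀ i, Jb i x = c i := by
    intro c x
    simp
  have hint : ∀ (c : Fin k → ℝ) x, x ∈ (⋂ i, Jb i ⁻¹' {c i}) → IsIntegralManifold I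
      (charDistribution I br) (connectedComponentIn (⋂ i, Jb i ⁻¹' {c i}) x) := by
    intro c x hx
    obtain ⟨O, hO, hOL⟩ : ∃ O : Set N, IsOpen O ∧
        connectedComponentIn (⋂ i, Jb i ⁻¹' {c i}) x = (⋂ i, Jb i ⁻¹' {c i}) ∩ O := by
      obtain ⟨cs, -, -, -⟩ := exists_structure_of_independent h.J_smooth h.J_indep
        (A := ⋂ i, Jb i ⁻¹' {c i}) (c := c) isOpen_univ (subset_univ _) fun x _ => hmem c x
      have hlc : LocallyConnectedSpace (⋂ i, Jb i ⁻¹' {c i} : Set N) :=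
        ChartedSpace.locallyConnectedSpace
          (EuclideanSpace ℝ (Fin (Module.finrank ℝ E - k))) _
      have h1 : IsOpen (connectedComponent (⟨x, hx⟩ : (⋂ i, Jb i ⁻¹' {c i} : Set N))) :=
        isOpen_connectedComponent
      obtain ⟨O, hO, hO2⟩ := isOpen_induced_iff.1 h1
      refine ⟨O, hO, ?_⟩
      rw [connectedComponentIn_eq_image hx, ← hO2, Subtype.image_preimage_coe]
    obtain ⟨cs, h1, h2, h3⟩ := exists_structure_of_independent h.J_smooth h.J_indep
      (A := connectedComponentIn (⋂ i, Jb i ⁻¹' {c i}) x) (c := c) hO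
      (by rw [hOL]; exact inter_subset_right)
      (fun y hy => by rw [hOL, mem_inter_iff, hmem]; simp [hy])
    refine ⟨_, inferInstance, cs, ⟨h1, ?_, Subtype.val_injective, h2, fun p => ?_⟩⟩
    · exact isConnected_iff_connectedSpace.1 (isConnected_connectedComponentIn_iff.2 hx)
    · rw [h.charDistribution_eq]
      refine le_antisymm ?_ ?_
      · rintro _ ⟨w, rfl⟩
        refine mem_levelDist.2 fun i => ?_
        have h4 := dReal_comp (I := 𝓡 (Module.finrank ℝ E - k)) (I' := I) (g := Jb i)
          (f := (Subtype.val : connectedComponentIn (⋂ i, Jb i ⁻¹' {c i}) x → N)) (x := p)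
          ((h.J_smooth i _).mdifferentiableAt (by simp)) ((h2.1 p).mdifferentiableAt (by simp)) w
        have h5 : (fun y : connectedComponentIn (⋂ i, Jb i ⁻¹' {c i}) x => Jb i y.1) =
            fun _ => c i := funext fun y => (hmem c y.1).1 (connectedComponentIn_subset _ _ y.2) i
        refine h4.symm.trans ?_
        rw [h5]
        have h6 : mfderiv (𝓡 (Module.finrank ℝ E - k)) 𝓘(ℝ, ℝ)
          (fun _ : connectedComponentIn (⋂ i, Jb i ⁻¹' {c i}) x => c i) p = 0 := mfderiv_const
        exact congrArg (fun T : EuclideanSpace ℝ (Fin (Module.finrank ℝ E - k)) →L[ℝ] ℝ => T w) h6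
      · intro v hv
        exact h3 p v (mem_levelDist.1 hv)
  have hsub : ∀ L' : Set N, IsIntegralManifold I (charDistribution I br) L' →
      ∃ x ∈ L', ∃ c : Fin k → ℝ, x ∈ (⋂ i, Jb i ⁻¹' {c i}) ∧
        L' ⊆ connectedComponentIn (⋂ i, Jb i ⁻¹' {c i}) x := by
    rintro L' ⟨r, t, cs, h1⟩
    letI := t
    letI := cs
    haveI := h1.isManifold
    haveI := h1.connected
    obtain ⟨x⟩ : Nonempty L' := inferInstance
    refine ⟨x.1, x.2, fun i => Jb i x.1, by simp, ?_⟩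
    have hc : ∀ i (y : L'), Jb i y.1 = Jb i x.1 := by
      intro i y
      refine eq_of_dVec_eq_zero (I := 𝓡 r) (f := fun y : L' => Jb i y.1)
        ((h.J_smooth i).comp h1.immersion.1) (fun y u => ?_) y x
      have h2 := dVec_comp (I := 𝓡 r) (I' := I) (g := Jb i) (f := (Subtype.val : L' → N)) (x := y)
        ((h.J_smooth i _).mdifferentiableAt (by simp))
        ((h1.immersion.1 y).mdifferentiableAt (by simp)) u
      rw [h2]
      have h3 : mfderiv (𝓡 r) I (Subtype.val : L' → N) y u ∈ charDistribution I br y.1 := by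
        rw [← h1.tangent y]
        exact ⟨u, rfl⟩
      rw [h.charDistribution_eq] at h3
      exact mem_levelDist.1 h3 i
    have hrange : IsPreconnected L' := by
      have h2 := isPreconnected_range h1.immersion.1.continuous
      rwa [Subtype.range_coe] at h2
    exact hrange.subset_connectedComponentIn x.2 fun y hy => (hmem _ y).2 fun i => hc i ⟨y, hy⟩
  constructor
  · rintro ⟨hL, hmax⟩
    obtain ⟨x, -, c, hx, hsubL⟩ := hsub L hL
    exact ⟨c, x, hx, le_antisymm hsubL (hmax (hint c x hx) hsubL)⟩
  · rintro ⟨c, x, hx, rfl⟩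
    refine ⟨hint c x hx, fun L' hL' hle => ?_⟩
    obtain ⟨x', hx', c', hxc', hsubL⟩ := hsub L' hL'
    have hxL' : x ∈ L' := hle (mem_connectedComponentIn hx)
    have h1 : x ∈ connectedComponentIn (⋂ i, Jb i ⁻¹' {c' i}) x' := hsubL hxL'
    have h2 : c' = c := by
      funext i
      rw [← (hmem c x).1 hx i, ← (hmem c' x).1 (connectedComponentIn_subset _ _ h1) i]
    subst h2
    rw [← connectedComponentIn_eq h1]
    exact hsubL

end IsLevelBracket

end Leaves
/-! ### Cotangent bundles -/

section Cotangent

variable {E : Type*} [NormedAddCommGroup E] [NormedSpace ℝ E] [FiniteDimensional ℝ E]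
  {Q : Type*} [TopologicalSpace Q] [ChartedSpace E Q] [IsManifold 𝓘(ℝ, E) ∞ Q]
  {EX : Type*} [NormedAddCommGroup EX] [NormedSpace ℝ EX] {HX : Type*} [TopologicalSpace HX]
  {IX : ModelWithCorners ℝ EX HX} {X : Type*} [TopologicalSpace X] [ChartedSpace HX X]

variable (E Q) in
/-- A shortcut for instance search. -/
noncomputable scoped instance topologicalSpaceCotBundle : TopologicalSpace (CotBundle E Q) := inferInstance

/-- The components of a covector in the chart at `b`. -/
noncomputable def covectorCoord (b : Q) (α : CotBundle E Q) : E →L[ℝ] ℝ :=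
  (α.2 : E →L[ℝ] ℝ).comp
    (mfderiv 𝓘(ℝ, E) 𝓘(ℝ, E) (extChartAt 𝓘(ℝ, E) b).symm (extChartAt 𝓘(ℝ, E) b α.1) : E →L[ℝ] E)

theorem inCoordinates_covector {b : Q} {α : CotBundle E Q} (hα : α.1 ∈ (chartAt E b).source) :
    ContinuousLinearMap.inCoordinates E (TangentSpace 𝓘(ℝ, E) : Q → Type _) ℝ (Trivial Q ℝ)
      b α.1 b α.1 α.2 = covectorCoord b α := by
  rw [ContinuousLinearMap.inCoordinates_eq (show α.1 ∈
    (trivializationAt E (TangentSpace 𝓘(ℝ, E) : Q → Type _) b).baseSet from hα)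
    (show α.1 ∈ (trivializationAt ℝ (Trivial Q ℝ) b).baseSet from trivial)]
  · refine ContinuousLinearMap.ext fun a => ?_
    have h := DFunLike.congr_fun (TangentBundle.symmL_trivializationAt (I := 𝓘(ℝ, E)) hα) a
    simp only [modelWithCornersSelf_coe, range_id, mfderivWithin_univ] at h
    rw [← Trivialization.symm_continuousLinearEquivAt_eq' _ (show α.1 ∈
      (trivializationAt E (TangentSpace 𝓘(ℝ, E) : Q → Type _) b).baseSet from hα)] at h
    exact congrArg (fun w : E => (α.2 : E →L[ℝ] ℝ) w) h

theorem contMDiffAt_cotangent_iff {f : X → CotBundle E Q} {x₀ : X} {b : Q}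
    (hb : (f x₀).1 ∈ (chartAt E b).source) :
    ContMDiffAt IX (cotModel E) ∞ f x₀ ↔ ContMDiffAt IX 𝓘(ℝ, E) ∞ (fun x => (f x).1) x₀ ∧
      ContMDiffAt IX 𝓘(ℝ, E →L[ℝ] ℝ) ∞ (fun x => covectorCoord b (f x)) x₀ := by
  rw [(trivializationAt (E →L[ℝ] ℝ) (fun q : Q => TangentSpace 𝓘(ℝ, E) q →L[ℝ] ℝ) b).contMDiffAt_iff
    (by rw [Trivialization.mem_source]; exact ⟨hb, trivial⟩)]
  refine and_congr_right fun h1 => ?_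
  have hev : ∀ᶠ x in 𝓝 x₀, (f x).1 ∈ (chartAt E b).source :=
    h1.continuousAt ((chartAt E b).open_source.mem_nhds hb)
  refine Filter.EventuallyEq.contMDiffAt_iff ?_
  filter_upwards [hev] with x hx
  exact inCoordinates_covector hx

theorem extChartAt_cotangent (α β : CotBundle E Q) (hβ : β.1 ∈ (chartAt E α.1).source) :
    extChartAt (cotModel E) α β = (extChartAt 𝓘(ℝ, E) α.1 β.1, covectorCoord α.1 β) := by
  rw [FiberBundle.extChartAt]
  exact Prod.ext rfl (inCoordinates_covector hβ)

theorem covectorCoord_self (α : CotBundle E Q) : covectorCoord α.1 α = α.2 := by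
  refine ContinuousLinearMap.ext fun a => ?_
  exact congrArg (fun T : E →L[ℝ] E => (α.2 : E →L[ℝ] ℝ) (T a)) (hasMFDerivAt_self_chart_symm α.1)

theorem covectorCoord_chartVec {b : Q} {α : CotBundle E Q} (hb : α.1 ∈ (chartAt E b).source)
    (w : TangentSpace 𝓘(ℝ, E) α.1) : covectorCoord b α (chartVec 𝓘(ℝ, E) b ⟨α.1, w⟩) = α.2 w := by
  have h := chartFrame_chartVec (I := 𝓘(ℝ, E)) (b := b) (z := ⟨α.1, w⟩) (by simpa using hb)
  have key : ∀ (p q : Q) (w w' : E), (⟨p, w⟩ : TangentBundle 𝓘(ℝ, E) Q) = ⟨q, w'⟩ → w = w' := by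
    intro p q w w' h
    cases h
    rfl
  exact congrArg (fun w : E => (α.2 : E →L[ℝ] ℝ) w) (key _ _ _ _ h)

theorem contMDiff_cotProj :
    ContMDiff (cotModel E) 𝓘(ℝ, E) ∞ (fun α : CotBundle E Q => α.1) :=
  fun α => ((contMDiffAt_cotangent_iff (IX := cotModel E) (f := fun β : CotBundle E Q => β)
    (mem_chart_source E α.1)).1 contMDiffAt_id).1

/-- Local components of a smooth covector field along a map. -/
theorem contMDiffAt_pairing {f : X → CotBundle E Q} {x₀ : X}
    (hf : ContMDiffAt IX (cotModel E) ∞ f x₀) {Z : ∀ x, TangentSpace 𝓘(ℝ, E) (f x).1}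
    (hZ : ContMDiffAt IX (𝓘(ℝ, E)).tangent ∞
      (fun x => (⟨(f x).1, Z x⟩ : TangentBundle 𝓘(ℝ, E) Q)) x₀) :
    ContMDiffAt IX 𝓘(ℝ, ℝ) ∞ (fun x => (f x).2 (Z x)) x₀ := by
  have hb : (f x₀).1 ∈ (chartAt E (f x₀).1).source := mem_chart_source _ _
  have h1 := (contMDiffAt_cotangent_iff hb).1 hf
  have h2 := contMDiffAt_chartVec hZ hb
  refine (h1.2.clm_apply h2).congr_of_eventuallyEq ?_
  filter_upwards [h1.1.continuousAt ((chartAt E _).open_source.mem_nhds hb)] with x hx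
  exact (covectorCoord_chartVec hx (Z x)).symm

/-- A covector field along a map is smooth if its values on coordinate vector fields are. -/
theorem contMDiffAt_cotangent_of_frame {f : X → CotBundle E Q} {x₀ : X}
    (hf : ContMDiffAt IX 𝓘(ℝ, E) ∞ (fun x => (f x).1) x₀)
    (h : ∀ Z : ∀ q : Q, TangentSpace 𝓘(ℝ, E) q, ContMDiffAt 𝓘(ℝ, E) (𝓘(ℝ, E)).tangent ∞
      (fun q => (⟨q, Z q⟩ : TangentBundle 𝓘(ℝ, E) Q)) (f x₀).1 →
      ContMDiffAt IX 𝓘(ℝ, ℝ) ∞ (fun x => (f x).2 (Z (f x).1)) x₀) :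
    ContMDiffAt IX (cotModel E) ∞ f x₀ := by
  have hb : (f x₀).1 ∈ (chartAt E (f x₀).1).source := mem_chart_source _ _
  refine (contMDiffAt_cotangent_iff hb).2 ⟨hf, contMDiffAt_clm_of_apply fun a => ?_⟩
  set b := (f x₀).1 with hbdef
  let Z : ∀ q : Q, TangentSpace 𝓘(ℝ, E) q := fun q =>
    (mfderiv 𝓘(ℝ, E) 𝓘(ℝ, E) (extChartAt 𝓘(ℝ, E) b).symm (extChartAt 𝓘(ℝ, E) b q) a : E)
  refine h Z ?_
  have h1 : ContMDiffAt 𝓘(ℝ, E) (𝓘(ℝ, E)).tangent ∞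
      (fun q => chartFrame 𝓘(ℝ, E) b a (extChartAt 𝓘(ℝ, E) b q)) b :=
    (contMDiffAt_chartFrame (I := 𝓘(ℝ, E)) b a (mem_extChartAt_target b)).comp b
      (contMDiffAt_extChartAt' hb)
  refine h1.congr_of_eventuallyEq ?_
  filter_upwards [(isOpen_extChartAt_source (I := 𝓘(ℝ, E)) b).mem_nhds (mem_extChartAt_source b)]
    with q hq
  exact TotalSpace.ext ((extChartAt 𝓘(ℝ, E) b).left_inv hq).symm HEq.rfl

theorem proj_mem_chart_source {α β : CotBundle E Q}
    (hβ : β ∈ (extChartAt (cotModel E) α).source) : β.1 ∈ (chartAt E α.1).source := by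
  rw [extChartAt_source, FiberBundle.chartedSpace_chartAt, OpenPartialHomeomorph.trans_source]
    at hβ
  exact ((Trivialization.mem_source _).1 hβ.1).1

theorem extChartAt_cotangent_symm {α : CotBundle E Q} {y : E × (E →L[ℝ] ℝ)}
    (hy : y ∈ (extChartAt (cotModel E) α).target) :
    extChartAt 𝓘(ℝ, E) α.1 ((extChartAt (cotModel E) α).symm y).1 = y.1 ∧
      covectorCoord α.1 ((extChartAt (cotModel E) α).symm y) = y.2 := by
  have h := (extChartAt (cotModel E) α).right_inv hy
  rw [extChartAt_cotangent α _ (proj_mem_chart_source ((extChartAt (cotModel E) α).map_target hy))]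
    at h
  exact ⟨congrArg Prod.fst h, congrArg Prod.snd h⟩

theorem mfderiv_cotProj (α : CotBundle E Q) (v : E × (E →L[ℝ] ℝ)) :
    (mfderiv (cotModel E) 𝓘(ℝ, E) (fun β : CotBundle E Q => β.1) α :
      (E × (E →L[ℝ] ℝ)) →L[ℝ] E) v = v.1 := by
  have h : HasMFDerivAt (cotModel E) 𝓘(ℝ, E) (fun β : CotBundle E Q => β.1) α
      (ContinuousLinearMap.fst ℝ E (E →L[ℝ] ℝ)) := by
    refine hasMFDerivAt_of_written contMDiff_cotProj.continuous.continuousAt ?_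
    refine (ContinuousLinearMap.fst ℝ E (E →L[ℝ] ℝ)).hasFDerivAt.congr_of_eventuallyEq ?_
    filter_upwards [(isOpen_extChartAt_target (I := cotModel E) α).mem_nhds
      (mem_extChartAt_target α)] with y hy
    exact (extChartAt_cotangent_symm hy).1
  rw [h.mfderiv]
  rfl

theorem smoothOneForm_liouville :
    SmoothOneForm (cotModel E) (fun α : CotBundle E Q => liouville E α) := by
  intro z
  refine contMDiffAt_pairing (f := fun z : TangentBundle (cotModel E) (CotBundle E Q) => z.1)
    (Z := fun z => mfderiv (cotModel E) 𝓘(ℝ, E) (fun β : CotBundle E Q => β.1) z.1 z.2) ?_ ?_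
  · exact contMDiffAt_base contMDiffAt_id
  · exact contMDiff_tangentMap' contMDiff_cotProj z

theorem chartForm_liouville {α : CotBundle E Q} {y : E × (E →L[ℝ] ℝ)}
    (hy : y ∈ (extChartAt (cotModel E) α).target) (v : E × (E →L[ℝ] ℝ)) :
    chartForm (cotModel E) (fun β : CotBundle E Q => liouville E β) α y v = y.2 v.1 := by
  set β := (extChartAt (cotModel E) α).symm y with hβ
  have hβs : β.1 ∈ (chartAt E α.1).source :=
    proj_mem_chart_source ((extChartAt (cotModel E) α).map_target hy)
  have h1 : MDifferentiableAt 𝓘(ℝ, E × (E →L[ℝ] ℝ)) (cotModel E)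
      (extChartAt (cotModel E) α).symm y :=
    (contMDiffAt_chart_symm α hy).mdifferentiableAt (by simp)
  have h2 : MDifferentiableAt (cotModel E) 𝓘(ℝ, E) (fun β : CotBundle E Q => β.1) β :=
    contMDiff_cotProj.mdifferentiableAt (by simp)
  have h3 : MDifferentiableAt 𝓘(ℝ, E) 𝓘(ℝ, E) (extChartAt 𝓘(ℝ, E) α.1) β.1 :=
    mdifferentiableAt_extChartAt hβs
  let W : TangentSpace 𝓘(ℝ, E) β.1 :=
    mfderiv (cotModel E) 𝓘(ℝ, E) (fun β : CotBundle E Q => β.1) β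
      (mfderiv 𝓘(ℝ, E × (E →L[ℝ] ℝ)) (cotModel E) (extChartAt (cotModel E) α).symm y v)
  have h4 : chartVec 𝓘(ℝ, E) α.1 ⟨β.1, W⟩ = v.1 := by
    have e1 := mfderiv_comp_apply (I := 𝓘(ℝ, E × (E →L[ℝ] ℝ))) (I' := cotModel E) (I'' := 𝓘(ℝ, E))
      (g := fun β : CotBundle E Q => β.1) y h2 h1 v
    have e2 := mfderiv_comp_apply (I := 𝓘(ℝ, E × (E →L[ℝ] ℝ))) (I' := 𝓘(ℝ, E)) (I'' := 𝓘(ℝ, E))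
      (f := fun y => ((extChartAt (cotModel E) α).symm y).1) y h3 (h2.comp y h1) v
    have e3 : ((extChartAt 𝓘(ℝ, E) α.1) ∘ fun y => ((extChartAt (cotModel E) α).symm y).1)
        =ᶠ[𝓝 y] (Prod.fst : E × (E →L[ℝ] ℝ) → E) := by
      filter_upwards [(isOpen_extChartAt_target (I := cotModel E) α).mem_nhds hy] with z hz
      exact (extChartAt_cotangent_symm hz).1
    have e4 : (mfderiv 𝓘(ℝ, E × (E →L[ℝ] ℝ)) 𝓘(ℝ, E)
        ((extChartAt 𝓘(ℝ, E) α.1) ∘ fun y => ((extChartAt (cotModel E) α).symm y).1) y :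
        E × (E →L[ℝ] ℝ) →L[ℝ] E) v = v.1 := by
      rw [e3.mfderiv_eq, mfderiv_eq_fderiv, fderiv_fst]
      rfl
    refine Eq.trans ?_ (e2.symm.trans e4)
    exact congrArg (fun w : E => (mfderiv 𝓘(ℝ, E) 𝓘(ℝ, E) (extChartAt 𝓘(ℝ, E) α.1) β.1 :
      E →L[ℝ] E) w) e1.symm
  have h5 := covectorCoord_chartVec hβs W
  rw [h4, (extChartAt_cotangent_symm hy).2] at h5
  exact h5.symm

/-- The bilinear form `(u, v) ↦ p(u)(b(v))`. -/
noncomputable def pairForm {G E F : Type*} [NormedAddCommGroup G] [NormedSpace ℝ G]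
    [NormedAddCommGroup E] [NormedSpace ℝ E] [NormedAddCommGroup F] [NormedSpace ℝ F]
    (p : G →L[ℝ] (E →L[ℝ] F)) (b : G →L[ℝ] E) : G →L[ℝ] G →L[ℝ] F :=
  ((ContinuousLinearMap.compL ℝ G E F).flip b).comp p

theorem pairForm_apply {G E F : Type*} [NormedAddCommGroup G] [NormedSpace ℝ G]
    [NormedAddCommGroup E] [NormedSpace ℝ E] [NormedAddCommGroup F] [NormedSpace ℝ F]
    (p : G →L[ℝ] (E →L[ℝ] F)) (b : G →L[ℝ] E) (u v : G) : pairForm p b u v = p u (b v) := rfl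

theorem canonicalTwoForm_apply (α : CotBundle E Q) (u v : E × (E →L[ℝ] ℝ)) :
    canonicalTwoForm E α u v = v.2 u.1 - u.2 v.1 := by
  have h : HasFDerivAt (chartForm (cotModel E) (fun β : CotBundle E Q => liouville E β) α)
      (pairForm (ContinuousLinearMap.snd ℝ E (E →L[ℝ] ℝ)) (ContinuousLinearMap.fst ℝ E (E →L[ℝ] ℝ)))
      (extChartAt (cotModel E) α α) := by
    refine (ContinuousLinearMap.hasFDerivAt _).congr_of_eventuallyEq ?_
    filter_upwards [(isOpen_extChartAt_target (I := cotModel E) α).mem_nhds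
      (mem_extChartAt_target α)] with y hy
    exact ContinuousLinearMap.ext fun v => chartForm_liouville hy v
  have h1 := extDerivOne_eq h u v
  rw [pairForm_apply, pairForm_apply] at h1
  refine (congrArg Neg.neg h1).trans ?_
  exact neg_sub _ _

theorem isTwoForm_canonical :
    IsTwoForm (cotModel E) (fun α : CotBundle E Q => canonicalTwoForm E α) :=
  smoothOneForm_liouville.isTwoForm_extDerivOne.neg

/-- The sum of the canonical 2-form and a semibasic 2-form is nondegenerate. -/
theorem eq_zero_of_canonical_add_semibasic (α : CotBundle E Q)
    {β : TangentSpace (cotModel E) α → TangentSpace (cotModel E) α → ℝ}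
    (hl : ∀ u v, mfderiv (cotModel E) 𝓘(ℝ, E) (fun β : CotBundle E Q => β.1) α u = 0 → β u v = 0)
    (hr : ∀ u v, mfderiv (cotModel E) 𝓘(ℝ, E) (fun β : CotBundle E Q => β.1) α v = 0 → β u v = 0)
    {u : TangentSpace (cotModel E) α} (h : ∀ v, canonicalTwoForm E α u v + β u v = 0) : u = 0 := by
  let u' : E × (E →L[ℝ] ℝ) := u
  have h1 : u'.1 = 0 := by
    by_contra hne
    obtain ⟨g, -, hg⟩ := exists_dual_vector ℝ u'.1 (norm_ne_zero_iff.2 hne)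
    have e2 : β u' ((0 : E), g) = 0 := hr u' ((0 : E), g) (mfderiv_cotProj α _)
    have e3 : canonicalTwoForm E α u' ((0 : E), g) + β u' ((0 : E), g) = 0 := h ((0 : E), g)
    rw [canonicalTwoForm_apply α u' ((0 : E), g), e2] at e3
    simp only [map_zero, sub_zero, add_zero] at e3
    rw [hg] at e3
    exact hne (norm_eq_zero.1 (by exact_mod_cast e3))
  have h2 : u'.2 = 0 := by
    refine ContinuousLinearMap.ext fun a => ?_
    have e3 : canonicalTwoForm E α u' (a, (0 : E →L[ℝ] ℝ)) + β u' (a, (0 : E →L[ℝ] ℝ)) = 0 :=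
      h (a, (0 : E →L[ℝ] ℝ))
    have e4 : β u' (a, (0 : E →L[ℝ] ℝ)) = 0 :=
      hl u' (a, (0 : E →L[ℝ] ℝ)) ((mfderiv_cotProj α u').trans h1)
    rw [canonicalTwoForm_apply, e4] at e3
    simpa using e3
  exact Prod.ext h1 h2

/-- Translation of a covector in its fibre. -/
def cotShift (α : CotBundle E Q) (β : E →L[ℝ] ℝ) : CotBundle E Q :=
  let a : E →L[ℝ] ℝ := α.2
  ⟨α.1, a + β⟩

theorem cotShift_apply (α : CotBundle E Q) (β : E →L[ℝ] ℝ) (w : E) :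
    ((cotShift α β).2 : E →L[ℝ] ℝ) w = (α.2 : E →L[ℝ] ℝ) w + β w := rfl

theorem cotShift_zero (α : CotBundle E Q) : cotShift α 0 = α :=
  TotalSpace.ext rfl (heq_of_eq (ContinuousLinearMap.ext fun w =>
    add_zero ((α.2 : E →L[ℝ] ℝ) w)))

theorem contMDiff_cotShift (α : CotBundle E Q) (β : E →L[ℝ] ℝ) :
    ContMDiff 𝓘(ℝ, ℝ) (cotModel E) ∞ (fun t : ℝ => cotShift α (t • β)) := by
  intro t
  refine contMDiffAt_cotangent_of_frame contMDiffAt_const fun Z _ => ?_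
  let z : E := Z α.1
  let a : E →L[ℝ] ℝ := α.2
  have : ContDiff ℝ ∞ (fun t : ℝ => a z + t * β z) := by fun_prop
  exact this.contMDiff t

/-- The velocity of the affine line `t ↦ α + t β`. -/
theorem mfderiv_cotShift (α : CotBundle E Q) (β : E →L[ℝ] ℝ) :
    (mfderiv 𝓘(ℝ, ℝ) (cotModel E) (fun t : ℝ => cotShift α (t • β)) 0 :
      ℝ →L[ℝ] E × (E →L[ℝ] ℝ)) 1 = ((0 : E), β) := by
  have h0 : cotShift α ((0 : ℝ) • β) = α := by rw [zero_smul, cotShift_zero]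
  have h : HasMFDerivAt 𝓘(ℝ, ℝ) (cotModel E) (fun t : ℝ => cotShift α (t • β)) 0
      ((ContinuousLinearMap.id ℝ ℝ).smulRight ((0 : E), β)) := by
    refine hasMFDerivAt_of_written (contMDiff_cotShift α β).continuous.continuousAt ?_
    let a : E →L[ℝ] ℝ := α.2
    have h1 : HasFDerivAt (fun t : ℝ => (extChartAt 𝓘(ℝ, E) α.1 α.1, a) + t • ((0 : E), β)) ((ContinuousLinearMap.id ℝ ℝ).smulRight ((0 : E), β)) 0 :=
      ((hasFDerivAt_id (0 : ℝ)).smul_const ((0 : E), β)).const_add _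
    refine h1.congr_of_eventuallyEq (Eventually.of_forall fun t => ?_)
    have h2 := extChartAt_cotangent (cotShift α ((0 : ℝ) • β)) (cotShift α (t • β))
      (mem_chart_source E α.1)
    refine h2.trans (Prod.ext ?_ ?_)
    · change extChartAt 𝓘(ℝ, E) α.1 α.1 = extChartAt 𝓘(ℝ, E) α.1 α.1 + t • (0 : E)
      rw [smul_zero, add_zero]
    · exact covectorCoord_self (cotShift α (t • β))
  rw [h.mfderiv]
  exact one_smul ℝ _

end Cotangent

/-! ### Derivatives as maps of model spaces -/

section ModelDerivative

variable {E : Type*} [NormedAddCommGroup E] [NormedSpace ℝ E] {H : Type*} [TopologicalSpace H]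
  {I : ModelWithCorners ℝ E H} {N : Type*} [TopologicalSpace N] [ChartedSpace H N]
  {E' : Type*} [NormedAddCommGroup E'] [NormedSpace ℝ E'] {H' : Type*} [TopologicalSpace H']
  {I' : ModelWithCorners ℝ E' H'} {N' : Type*} [TopologicalSpace N'] [ChartedSpace H' N']
  {E'' : Type*} [NormedAddCommGroup E''] [NormedSpace ℝ E''] {H'' : Type*} [TopologicalSpace H'']
  {I'' : ModelWithCorners ℝ E'' H''} {N'' : Type*} [TopologicalSpace N''] [ChartedSpace H'' N'']

variable (I I') in
/-- The derivative of a map of manifolds, as a linear map between the model spaces. -/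
noncomputable def mder (f : N → N') (x : N) : E →L[ℝ] E' := mfderiv I I' f x

theorem mder_comp {g : N' → N''} {f : N → N'} {x : N} (hg : ContMDiffAt I' I'' ∞ g (f x))
    (hf : ContMDiffAt I I' ∞ f x) (v : E) :
    mder I I'' (fun x => g (f x)) x v = mder I' I'' g (f x) (mder I I' f x v) :=
  mfderiv_comp_apply (I := I) (I' := I') (I'' := I'') x (hg.mdifferentiableAt (by simp))
    (hf.mdifferentiableAt (by simp)) v

theorem mder_congr {f g : N → N'} {x : N} (h : f =ᶠ[𝓝 x] g) : mder I I' f x = mder I I' g x :=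
  h.mfderiv_eq

theorem mder_id (x : N) : mder I I (fun x : N => x) x = ContinuousLinearMap.id ℝ E :=
  mfderiv_id

theorem mder_const (c : N') (x : N) : mder I I' (fun _ : N => c) x = 0 :=
  mfderiv_const

theorem contMDiff_mder {X : Type*} {EX : Type*} [NormedAddCommGroup EX] [NormedSpace ℝ EX]
    {HX : Type*} [TopologicalSpace HX] {IX : ModelWithCorners ℝ EX HX} [TopologicalSpace X]
    [ChartedSpace HX X] [IsManifold I ∞ N] [IsManifold I' ∞ N'] {g : N → N'} {f : X → N}
    {Z : X → E} {x₀ : X} (hg : ContMDiff I I' ∞ g)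
    (hZ : ContMDiffAt IX I.tangent ∞ (fun x => (⟨f x, Z x⟩ : TangentBundle I N)) x₀) :
    ContMDiffAt IX I'.tangent ∞
      (fun x => (⟨g (f x), mder I I' g (f x) (Z x)⟩ : TangentBundle I' N')) x₀ :=
  (contMDiff_tangentMap' hg _).comp x₀ hZ

/-- A smooth injective map on a Lie group which intertwines left translations with smooth maps is
an immersion. -/
theorem injective_mder_of_equivariant {EG : Type*} [NormedAddCommGroup EG] [NormedSpace ℝ EG]
    [CompleteSpace EG] {G : Type*} [TopologicalSpace G] [ChartedSpace EG G] [Group G]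
    [LieGroup 𝓘(ℝ, EG) ∞ G] {φ : G → N} [IsManifold I ∞ N] [BoundarylessManifold I N]
    (hφ : ContMDiff 𝓘(ℝ, EG) I ∞ φ)
    (hinj : Function.Injective φ)
    (heq : ∀ h : G, ∃ A : N → N, ContMDiff I I ∞ A ∧ ∀ x, φ (h * x) = A (φ x)) :
    Function.Injective (mder 𝓘(ℝ, EG) I φ 1) := by
  rw [injective_iff_map_eq_zero]
  intro ξ hξ
  have hL : LieGroup 𝓘(ℝ, EG) (minSmoothness ℝ 3) G := LieGroup.of_le (m := minSmoothness ℝ 3)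
    (n := ∞) (by rw [minSmoothness_of_isRCLikeNormedField]; exact WithTop.coe_le_coe.2 le_top)
  let X : ∀ g : G, TangentSpace 𝓘(ℝ, EG) g := fun g => mulInvariantVectorField (I := 𝓘(ℝ, EG)) ξ g
  have hX : ContMDiff 𝓘(ℝ, EG) (𝓘(ℝ, EG)).tangent 1
      (fun g => (⟨g, X g⟩ : TangentBundle 𝓘(ℝ, EG) G)) :=
    (contMDiff_mulInvariantVectorField (I := 𝓘(ℝ, EG)) (G := G) ξ).of_le
      (by rw [minSmoothness_of_isRCLikeNormedField]; exact one_le_two)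
  have hφX : ∀ g, mder 𝓘(ℝ, EG) I φ g (X g) = 0 := by
    intro g
    obtain ⟨A, hA, hAφ⟩ := heq g
    have hl : ContMDiff 𝓘(ℝ, EG) 𝓘(ℝ, EG) ∞ (fun x : G => g * x) := contMDiff_mul_left
    have e1 := mder_comp (I := 𝓘(ℝ, EG)) (I' := 𝓘(ℝ, EG)) (I'' := I) (x := (1 : G)) (g := φ)
      (f := fun x => g * x) (hφ _) (hl _) ξ
    have e2 := mder_comp (I := 𝓘(ℝ, EG)) (I' := I) (I'' := I) (x := (1 : G)) (g := A)
      (f := φ) (hA _) (hφ _) ξ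
    simp only [hAφ] at e1
    rw [e2, hξ, map_zero] at e1
    have e3 : mder 𝓘(ℝ, EG) I φ (g * 1) (X g) = 0 := e1.symm
    rwa [mul_one] at e3
  obtain ⟨γ, hγ0, hγ⟩ := exists_isMIntegralCurveAt_of_contMDiffAt_boundaryless (t₀ := (0 : ℝ))
    (hX.contMDiffAt (x := (1 : G)))
  have hγ' : IsMIntegralCurveAt (I := I) (fun t => φ (γ t)) (fun _ => 0) 0 := by
    filter_upwards [hγ] with t ht
    have := ((hφ (γ t)).mdifferentiableAt (by simp)).hasMFDerivAt.comp t ht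
    refine this.congr_mfderiv ?_
    refine ContinuousLinearMap.ext fun a : ℝ => ?_
    have e : ∀ w : EG, mder 𝓘(ℝ, EG) I φ (γ t) w = 0 →
        mder 𝓘(ℝ, EG) I φ (γ t) (a • w) = a • (0 : E) := fun w hw => by rw [map_smul, hw]
    exact e _ (hφX (γ t))
  have hc : IsMIntegralCurveAt (I := I) (fun _ : ℝ => φ 1) (fun _ => 0) 0 := by
    refine Eventually.of_forall fun t => ?_
    refine (hasMFDerivAt_const (φ 1) t).congr_mfderiv ?_
    refine ContinuousLinearMap.ext fun a : ℝ => ?_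
    exact (smul_zero (A := E) a).symm
  have hz : ContMDiffAt I I.tangent 1 (fun x : N => (⟨x, 0⟩ : TangentBundle I N)) (φ (γ 0)) :=
    ((contMDiff_zeroSection ℝ (TangentSpace I : N → Type _)).of_le le_rfl).contMDiffAt
  have hu := isMIntegralCurveAt_eventuallyEq_of_contMDiffAt_boundaryless hz hγ' hc
    (by simp [hγ0])
  have hγc : γ =ᶠ[𝓝 0] fun _ => (1 : G) := by
    filter_upwards [hu] with t ht
    exact hinj ht
  have h1 := hγ.hasMFDerivAt.mfderiv
  rw [hγc.mfderiv_eq, mfderiv_const, hγ0] at h1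
  have h2 : (0 : EG) = (1 : ℝ) • (X 1 : EG) :=
    congrArg (fun T : ℝ →L[ℝ] EG => T 1) h1
  have h3 : (X 1 : EG) = ξ := by
    have : mder 𝓘(ℝ, EG) 𝓘(ℝ, EG) (fun x : G => 1 * x) 1 ξ = ξ := by
      simp only [one_mul]
      rw [mder_id]
      rfl
    exact this
  rw [one_smul, h3] at h2
  exact h2.symm

end ModelDerivative

/-! ### Smooth actions -/

section Action

variable {E : Type*} [NormedAddCommGroup E] [NormedSpace ℝ E]
  {Q : Type*} [TopologicalSpace Q] [ChartedSpace E Q] [IsManifold 𝓘(ℝ, E) ∞ Q]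
  {EG : Type*} [NormedAddCommGroup EG] [NormedSpace ℝ EG]
  {G : Type*} [TopologicalSpace G] [ChartedSpace EG G] [Group G] [LieGroup 𝓘(ℝ, EG) ∞ G]
  [MulAction G Q] [ContMDiffSMul 𝓘(ℝ, EG) 𝓘(ℝ, E) ∞ G Q]
  {EX : Type*} [NormedAddCommGroup EX] [NormedSpace ℝ EX] {HX : Type*} [TopologicalSpace HX]
  {IX : ModelWithCorners ℝ EX HX} {X : Type*} [TopologicalSpace X] [ChartedSpace HX X]

variable (E) in
/-- The tangent lift of an action. -/
noncomputable def tanAct (g : G) (q : Q) : E →L[ℝ] E := mder 𝓘(ℝ, E) 𝓘(ℝ, E) (fun x : Q => g • x) q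

variable (E EG G) in
/-- The infinitesimal generators, as a linear map of model spaces. -/
noncomputable def gen (q : Q) : EG →L[ℝ] E := mder 𝓘(ℝ, EG) 𝓘(ℝ, E) (fun g : G => g • q) 1

variable (EG) in
/-- The adjoint action. -/
noncomputable def adAct (g : G) : EG →L[ℝ] EG :=
  mder 𝓘(ℝ, EG) 𝓘(ℝ, EG) (fun x : G => g * x * g⁻¹) 1

theorem contMDiff_act {E : Type*} [NormedAddCommGroup E] [NormedSpace ℝ E]
    {Q : Type*} [TopologicalSpace Q] [ChartedSpace E Q] (EG : Type*) [NormedAddCommGroup EG]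
    [NormedSpace ℝ EG] {G : Type*} [TopologicalSpace G] [ChartedSpace EG G] [Group G]
    [MulAction G Q] [ContMDiffSMul 𝓘(ℝ, EG) 𝓘(ℝ, E) ∞ G Q] (g : G) :
    ContMDiff 𝓘(ℝ, E) 𝓘(ℝ, E) ∞ (fun x : Q => g • x) :=
  (contMDiff_smul (I := 𝓘(ℝ, EG)) (I' := 𝓘(ℝ, E)) (n := ∞)).comp
    (contMDiff_const.prodMk contMDiff_id)

variable (E EG) in
theorem contMDiff_orbit (q : Q) : ContMDiff 𝓘(ℝ, EG) 𝓘(ℝ, E) ∞ (fun g : G => g • q) :=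
  (contMDiff_smul (I := 𝓘(ℝ, EG)) (I' := 𝓘(ℝ, E)) (n := ∞)).comp
    (contMDiff_id.prodMk contMDiff_const)

theorem tanAct_mul {E : Type*} [NormedAddCommGroup E] [NormedSpace ℝ E]
    {Q : Type*} [TopologicalSpace Q] [ChartedSpace E Q] (EG : Type*) [NormedAddCommGroup EG]
    [NormedSpace ℝ EG] {G : Type*} [TopologicalSpace G] [ChartedSpace EG G] [Group G]
    [MulAction G Q] [ContMDiffSMul 𝓘(ℝ, EG) 𝓘(ℝ, E) ∞ G Q] (g h : G) (q : Q) (v : E) :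
    tanAct E (g * h) q v = tanAct E g (h • q) (tanAct E h q v) := by
  rw [tanAct, tanAct, tanAct, ← mder_comp (contMDiff_act EG g _) (contMDiff_act EG h _)]
  simp only [mul_smul]

theorem tanAct_one (q : Q) (v : E) : tanAct E (1 : G) q v = v := by
  rw [tanAct]
  simp only [one_smul]
  rw [mder_id]
  rfl

theorem tanAct_inv_tanAct {E : Type*} [NormedAddCommGroup E] [NormedSpace ℝ E]
    {Q : Type*} [TopologicalSpace Q] [ChartedSpace E Q] (EG : Type*) [NormedAddCommGroup EG]
    [NormedSpace ℝ EG] {G : Type*} [TopologicalSpace G] [ChartedSpace EG G] [Group G]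
    [MulAction G Q] [ContMDiffSMul 𝓘(ℝ, EG) 𝓘(ℝ, E) ∞ G Q] [IsManifold 𝓘(ℝ, E) ∞ Q] (g : G) (q : Q) (v : E) :
    tanAct E g⁻¹ (g • q) (tanAct E g q v) = v := by
  rw [← tanAct_mul EG, inv_mul_cancel, tanAct_one]

theorem tanAct_tanAct_inv {E : Type*} [NormedAddCommGroup E] [NormedSpace ℝ E]
    {Q : Type*} [TopologicalSpace Q] [ChartedSpace E Q] (EG : Type*) [NormedAddCommGroup EG]
    [NormedSpace ℝ EG] {G : Type*} [TopologicalSpace G] [ChartedSpace EG G] [Group G]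
    [MulAction G Q] [ContMDiffSMul 𝓘(ℝ, EG) 𝓘(ℝ, E) ∞ G Q] [IsManifold 𝓘(ℝ, E) ∞ Q] (g : G) (q : Q) (v : E) :
    tanAct E g q (tanAct E g⁻¹ (g • q) v) = v := by
  have h := tanAct_mul EG g g⁻¹ (g • q) v
  rw [inv_smul_smul, mul_inv_cancel, tanAct_one] at h
  exact h.symm

theorem contMDiff_conj (g : G) : ContMDiff 𝓘(ℝ, EG) 𝓘(ℝ, EG) ∞ (fun x : G => g * x * g⁻¹) :=
  (contMDiff_mul_right (a := g⁻¹)).comp (contMDiff_mul_left (a := g))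

theorem tanAct_gen (g : G) (q : Q) (ξ : EG) :
    tanAct E g q (gen E EG G q ξ) = gen E EG G (g • q) (adAct EG g ξ) := by
  have e1 := mder_comp (I := 𝓘(ℝ, EG)) (I' := 𝓘(ℝ, E)) (I'' := 𝓘(ℝ, E)) (x := (1 : G))
    (g := fun x : Q => g • x) (f := fun h : G => h • q) (contMDiff_act EG g _)
    (contMDiff_orbit E EG q _) ξ
  have e2 := mder_comp (I := 𝓘(ℝ, EG)) (I' := 𝓘(ℝ, EG)) (I'' := 𝓘(ℝ, E)) (x := (1 : G))
    (g := fun h : G => h • g • q) (f := fun h : G => g * h * g⁻¹)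
    (contMDiff_orbit E EG (g • q) _) (contMDiff_conj g _) ξ
  rw [mul_one, mul_inv_cancel] at e2
  rw [one_smul] at e1
  simp only [mul_smul, inv_smul_smul] at e2
  exact e1.symm.trans e2

/-- The tangent map of the action `G × Q → Q`. -/
theorem contMDiffAt_mder_smul {g : X → G} {q : X → Q} {ξ : X → EG} {v : X → E} {x₀ : X}
    (hξ : ContMDiffAt IX (𝓘(ℝ, EG)).tangent ∞
      (fun x => (⟨g x, ξ x⟩ : TangentBundle 𝓘(ℝ, EG) G)) x₀)
    (hv : ContMDiffAt IX (𝓘(ℝ, E)).tangent ∞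
      (fun x => (⟨q x, v x⟩ : TangentBundle 𝓘(ℝ, E) Q)) x₀) :
    ContMDiffAt IX (𝓘(ℝ, E)).tangent ∞ (fun x => (⟨g x • q x,
      mder 𝓘(ℝ, EG) 𝓘(ℝ, E) (fun h : G => h • q x) (g x) (ξ x) + tanAct E (g x) (q x) (v x)⟩ :
        TangentBundle 𝓘(ℝ, E) Q)) x₀ := by
  have h1 := (contMDiff_equivTangentBundleProd_symm (n := ∞) (I := 𝓘(ℝ, EG)) (M := G)
    (I' := 𝓘(ℝ, E)) (M' := Q)).contMDiffAt.comp x₀ (hξ.prodMk hv)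
  have hs : ContMDiff (𝓘(ℝ, EG).prod 𝓘(ℝ, E)) 𝓘(ℝ, E) ∞ (fun p : G × Q => p.1 • p.2) :=
    contMDiff_smul
  have h2 := (contMDiff_tangentMap' hs _).comp x₀ h1
  refine h2.congr_of_eventuallyEq (Eventually.of_forall fun x => ?_)
  refine TotalSpace.ext rfl (heq_of_eq ?_)
  exact Eq.symm (mfderiv_prod_eq_add_apply (p := (g x, q x)) (v := ((ξ x, v x) : EG × E))
    (hs.mdifferentiableAt (x := (g x, q x)) (by simp)))

theorem contMDiffAt_tanAct {g : X → G} {q : X → Q} {v : X → E} {x₀ : X}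
    (hg : ContMDiffAt IX 𝓘(ℝ, EG) ∞ g x₀)
    (hv : ContMDiffAt IX (𝓘(ℝ, E)).tangent ∞
      (fun x => (⟨q x, v x⟩ : TangentBundle 𝓘(ℝ, E) Q)) x₀) :
    ContMDiffAt IX (𝓘(ℝ, E)).tangent ∞
      (fun x => (⟨g x • q x, tanAct E (g x) (q x) (v x)⟩ : TangentBundle 𝓘(ℝ, E) Q)) x₀ := by
  have hz : ContMDiff 𝓘(ℝ, EG) (𝓘(ℝ, EG)).tangent ∞
      (fun h : G => (⟨h, (0 : EG)⟩ : TangentBundle 𝓘(ℝ, EG) G)) :=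
    contMDiff_zeroSection ℝ (TangentSpace 𝓘(ℝ, EG) : G → Type _)
  have := contMDiffAt_mder_smul (ξ := fun _ => (0 : EG)) ((hz _).comp x₀ hg) hv
  simpa using this

theorem contMDiffAt_gen [FiniteDimensional ℝ EG] {q : X → Q} {ξ : X → EG} {x₀ : X}
    (hq : ContMDiffAt IX 𝓘(ℝ, E) ∞ q x₀) (hξ : ContMDiffAt IX 𝓘(ℝ, EG) ∞ ξ x₀) :
    ContMDiffAt IX (𝓘(ℝ, E)).tangent ∞
      (fun x => (⟨q x, gen E EG G (q x) (ξ x)⟩ : TangentBundle 𝓘(ℝ, E) Q)) x₀ := by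
  have hz : ContMDiff 𝓘(ℝ, E) (𝓘(ℝ, E)).tangent ∞
      (fun h : Q => (⟨h, (0 : E)⟩ : TangentBundle 𝓘(ℝ, E) Q)) :=
    contMDiff_zeroSection ℝ (TangentSpace 𝓘(ℝ, E) : Q → Type _)
  have h1 : ContMDiffAt IX (𝓘(ℝ, EG)).tangent ∞
      (fun x => (⟨1, ξ x⟩ : TangentBundle 𝓘(ℝ, EG) G)) x₀ := by
    refine (contMDiffAt_vector_iff (b := (1 : G)) (mem_chart_source _ _)).2
      ⟨contMDiffAt_const, ?_⟩
    exact (ContinuousLinearMap.contMDiff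
      (mder 𝓘(ℝ, EG) 𝓘(ℝ, EG) (extChartAt 𝓘(ℝ, EG) (1 : G)) 1)).contMDiffAt.comp x₀ hξ
  have h2 := contMDiffAt_mder_smul (G := G) h1 ((hz _).comp x₀ hq)
  refine h2.congr_of_eventuallyEq (Eventually.of_forall fun x => ?_)
  have key : ∀ (p p' : Q) (w w' : E), p = p' → w = w' →
      (⟨p, w⟩ : TangentBundle 𝓘(ℝ, E) Q) = ⟨p', w'⟩ := by
    rintro p _ w _ rfl rfl
    rfl
  exact key _ _ _ _ (one_smul G (q x)).symm (by simp [gen])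

end Action

/-! ### Free and proper actions -/

section FreeAction

variable {E : Type*} [NormedAddCommGroup E] [NormedSpace ℝ E] [FiniteDimensional ℝ E]
  {Q : Type*} [TopologicalSpace Q] [ChartedSpace E Q] [IsManifold 𝓘(ℝ, E) ∞ Q] [T2Space Q]
  {EG : Type*} [NormedAddCommGroup EG] [NormedSpace ℝ EG] [FiniteDimensional ℝ EG]
  {G : Type*} [TopologicalSpace G] [ChartedSpace EG G] [Group G] [LieGroup 𝓘(ℝ, EG) ∞ G]
  [MulAction G Q] [ContMDiffSMul 𝓘(ℝ, EG) 𝓘(ℝ, E) ∞ G Q]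
  {EX : Type*} [NormedAddCommGroup EX] [NormedSpace ℝ EX] {HX : Type*} [TopologicalSpace HX]
  {IX : ModelWithCorners ℝ EX HX} {X : Type*} [TopologicalSpace X] [ChartedSpace HX X]

theorem injective_orbitMap (hfree : ∀ (g : G) (q : Q), g • q = q → g = 1) (q : Q) :
    Function.Injective (fun g : G => g • q) := by
  intro g h hgh
  have : (h⁻¹ * g) • q = q := by
    rw [mul_smul]
    exact (congrArg (fun x => h⁻¹ • x) hgh).trans (inv_smul_smul h q)
  exact (inv_mul_eq_one.1 (hfree _ _ this)).symm

theorem injective_gen (hfree : ∀ (g : G) (q : Q), g • q = q → g = 1) (q : Q) :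
    Function.Injective (gen E EG G q) := by
  have : CompleteSpace EG := FiniteDimensional.complete ℝ EG
  exact injective_mder_of_equivariant (contMDiff_orbit E EG q) (injective_orbitMap hfree q)
    fun h => ⟨fun x => h • x, contMDiff_act EG h, fun x => mul_smul h x q⟩

theorem isSmoothImmersion_orbitMap (hfree : ∀ (g : G) (q : Q), g • q = q → g = 1) (q : Q) :
    IsSmoothImmersion 𝓘(ℝ, EG) 𝓘(ℝ, E) (fun g : G => g • q) := by
  refine ⟨contMDiff_orbit E EG q, fun h => ?_⟩
  have key : Function.Injective (mder 𝓘(ℝ, EG) 𝓘(ℝ, E) (fun g : G => g • q) h) := by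
    have hr : ∀ a : G, ContMDiff 𝓘(ℝ, EG) 𝓘(ℝ, EG) ∞ (fun x : G => x * a) :=
      fun a => contMDiff_mul_right
    have e1 : ∀ ξ, mder 𝓘(ℝ, EG) 𝓘(ℝ, E) (fun g : G => g • q) h ξ = gen E EG G (h • q)
        (mder 𝓘(ℝ, EG) 𝓘(ℝ, EG) (fun x : G => x * h⁻¹) h ξ) := by
      intro ξ
      have := mder_comp (I := 𝓘(ℝ, EG)) (I' := 𝓘(ℝ, EG)) (I'' := 𝓘(ℝ, E)) (x := h)
        (g := fun x : G => x • h • q) (f := fun x : G => x * h⁻¹) (contMDiff_orbit E EG (h • q) _)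
        (hr h⁻¹ _) ξ
      simp only [mul_smul, inv_smul_smul, mul_inv_cancel] at this
      exact this
    have e2 : ∀ ξ, mder 𝓘(ℝ, EG) 𝓘(ℝ, EG) (fun x : G => x * h) (h * h⁻¹)
        (mder 𝓘(ℝ, EG) 𝓘(ℝ, EG) (fun x : G => x * h⁻¹) h ξ) = ξ := by
      intro ξ
      have := mder_comp (I := 𝓘(ℝ, EG)) (I' := 𝓘(ℝ, EG)) (I'' := 𝓘(ℝ, EG)) (x := h)
        (g := fun x : G => x * h) (f := fun x : G => x * h⁻¹) (hr h _) (hr h⁻¹ _) ξ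
      simp only [inv_mul_cancel_right] at this
      rw [mder_id] at this
      exact this.symm
    intro ξ ξ' hξ
    rw [e1, e1] at hξ
    have := injective_gen hfree (h • q) hξ
    rw [← e2 ξ, this, e2 ξ']
  exact key

theorem isEmbedding_orbitMap [ProperSMul G Q] (hfree : ∀ (g : G) (q : Q), g • q = q → g = 1)
    (q : Q) (hc : Continuous (fun g : G => g • q)) : IsEmbedding (fun g : G => g • q) := by
  have h1 : IsClosedEmbedding (fun g : G => (g, q)) :=
    IsClosedEmbedding.of_continuous_injective_isClosedMap (by fun_prop)
      (fun a b h => congrArg Prod.fst h) (isClosedMap_prodMk_right q)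
  have h2 : IsProperMap (fun g : G => (g • q, q)) :=
    (ProperSMul.isProperMap_smul_pair (G := G) (X := Q)).comp h1.isProperMap
  have h3 : IsEmbedding (fun g : G => (g • q, q)) :=
    (IsClosedEmbedding.of_continuous_injective_isClosedMap h2.continuous
      (fun a b h => injective_orbitMap hfree q (congrArg Prod.fst h)) h2.isClosedMap).isEmbedding
  exact IsEmbedding.of_comp hc (by fun_prop : Continuous fun y : Q => (y, q)) h3

theorem exists_orbit_lift [ProperSMul G Q] (hfree : ∀ (g : G) (q : Q), g • q = q → g = 1) (q : Q)
    {c : X → Q} (hc : ContMDiff IX 𝓘(ℝ, E) ∞ c) (hcq : ∀ x, ∃ g : G, g • q = c x) :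
    ∃ g : X → G, ContMDiff IX 𝓘(ℝ, EG) ∞ g ∧ ∀ x, g x • q = c x := by
  choose g hg using hcq
  have hfg : (fun x => g x • q) = c := funext hg
  have hcont : Continuous g := by
    rw [(isEmbedding_orbitMap hfree q
      (contMDiff_orbit E EG q).continuous).isInducing.continuous_iff]
    change Continuous (fun x => g x • q)
    rw [hfg]
    exact hc.continuous
  refine ⟨g, fun x => ?_, hg⟩
  refine contMDiffAt_of_comp_immersion (isSmoothImmersion_orbitMap (E := E) (EG := EG) hfree q)
    hcont.continuousAt ?_
  rw [hfg]
  exact hc x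

end FreeAction

/-! ### The quotient by a normal subgroup -/

section PartialQuotient

variable {E : Type*} [NormedAddCommGroup E] [NormedSpace ℝ E] [FiniteDimensional ℝ E]
  {Q : Type*} [TopologicalSpace Q] [ChartedSpace E Q] [IsManifold 𝓘(ℝ, E) ∞ Q] [T2Space Q]
  {EG : Type*} [NormedAddCommGroup EG] [NormedSpace ℝ EG] [FiniteDimensional ℝ EG]
  {G : Type*} [TopologicalSpace G] [ChartedSpace EG G] [Group G] [LieGroup 𝓘(ℝ, EG) ∞ G]
  [MulAction G Q] [ContMDiffSMul 𝓘(ℝ, EG) 𝓘(ℝ, E) ∞ G Q] {GW : Subgroup G} [GW.Normal]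
  {EQ : Type*} [NormedAddCommGroup EQ] [NormedSpace ℝ EQ] [FiniteDimensional ℝ EQ]
  [ChartedSpace EQ (QT Q GW)] [IsManifold 𝓘(ℝ, EQ) ∞ (QT Q GW)]
  {EF : Type*} [NormedAddCommGroup EF] [NormedSpace ℝ EF] [FiniteDimensional ℝ EF]
  [ChartedSpace EF (G ⧸ GW)] [LieGroup 𝓘(ℝ, EF) ∞ (G ⧸ GW)]

theorem piQ_surjective : Function.Surjective (piQ (Q := Q) GW) := Quotient.mk''_surjective

theorem piQ_eq_iff {q q' : Q} : piQ GW q = piQ GW q' ↔ ∃ w ∈ GW, w • q = q' := by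
  rw [piQ, piQ, Quotient.eq'', MulAction.orbitRel_apply]
  constructor
  · rintro ⟨w, hw⟩
    exact ⟨(w : G)⁻¹, GW.inv_mem w.2, by rw [← hw]; exact inv_smul_smul (w : G) q'⟩
  · rintro ⟨w, hw, rfl⟩
    exact ⟨⟨w⁻¹, GW.inv_mem hw⟩, inv_smul_smul w q⟩

theorem FAct_mk (g : G) (q : Q) : FAct GW (g : G ⧸ GW) (piQ GW q) = piQ GW (g • q) := rfl

theorem FAct_mul (h h' : G ⧸ GW) (x : QT Q GW) : FAct GW (h * h') x = FAct GW h (FAct GW h' x) := by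
  obtain ⟨g, rfl⟩ := QuotientGroup.mk_surjective h
  obtain ⟨g', rfl⟩ := QuotientGroup.mk_surjective h'
  obtain ⟨q, rfl⟩ := piQ_surjective x
  rw [FAct_mk, FAct_mk, ← QuotientGroup.mk_mul, FAct_mk, mul_smul]

theorem contMDiff_FAct (hQT : IsSmoothSubmersion 𝓘(ℝ, E) 𝓘(ℝ, EQ) (piQ (Q := Q) GW)) 
    (hsm : ∀ g : G, ContMDiff 𝓘(ℝ, E) 𝓘(ℝ, E) ∞ (fun q : Q => g • q)) (h : G ⧸ GW) :
    ContMDiff 𝓘(ℝ, EQ) 𝓘(ℝ, EQ) ∞ (fun x : QT Q GW => FAct GW h x) := by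
  obtain ⟨g, rfl⟩ := QuotientGroup.mk_surjective h
  exact contMDiff_of_comp_submersion hQT piQ_surjective (hQT.1.comp (hsm g))

theorem contMDiff_FAct_orbit (hQT : IsSmoothSubmersion 𝓘(ℝ, E) 𝓘(ℝ, EQ) (piQ (Q := Q) GW))
    (hF : IsSmoothSubmersion 𝓘(ℝ, EG) 𝓘(ℝ, EF) (fun g : G => (g : G ⧸ GW))) (x : QT Q GW) :
    ContMDiff 𝓘(ℝ, EF) 𝓘(ℝ, EQ) ∞ (fun h : G ⧸ GW => FAct GW h x) := by
  obtain ⟨q, rfl⟩ := piQ_surjective x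
  exact contMDiff_of_comp_submersion hF QuotientGroup.mk_surjective
    (hQT.1.comp (contMDiff_orbit E EG q))

theorem mder_piQ_tanAct (hQT : IsSmoothSubmersion 𝓘(ℝ, E) 𝓘(ℝ, EQ) (piQ (Q := Q) GW)) 
    (hsm : ∀ g : G, ContMDiff 𝓘(ℝ, E) 𝓘(ℝ, E) ∞ (fun q : Q => g • q)) (g : G) (q : Q) (v : E) :
    mder 𝓘(ℝ, E) 𝓘(ℝ, EQ) (piQ (Q := Q) GW) (g • q) (tanAct E g q v) =
      mder 𝓘(ℝ, EQ) 𝓘(ℝ, EQ) (fun x : QT Q GW => FAct GW (g : G ⧸ GW) x) (piQ GW q)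
        (mder 𝓘(ℝ, E) 𝓘(ℝ, EQ) (piQ (Q := Q) GW) q v) :=
  (mder_comp (I := 𝓘(ℝ, E)) (I' := 𝓘(ℝ, E)) (I'' := 𝓘(ℝ, EQ)) (x := q) (g := piQ GW)
    (f := fun q => g • q) (hQT.1 _) (hsm g _) v).symm.trans
  (mder_comp (I := 𝓘(ℝ, E)) (I' := 𝓘(ℝ, EQ)) (I'' := 𝓘(ℝ, EQ)) (x := q)
    (g := fun x : QT Q GW => FAct GW (g : G ⧸ GW) x) (f := piQ GW)
    (contMDiff_FAct hQT hsm _ _) (hQT.1 _) v)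

theorem mder_piQ_gen (hQT : IsSmoothSubmersion 𝓘(ℝ, E) 𝓘(ℝ, EQ) (piQ (Q := Q) GW))
    (hF : IsSmoothSubmersion 𝓘(ℝ, EG) 𝓘(ℝ, EF) (fun g : G => (g : G ⧸ GW))) (q : Q) (ξ : EG) :
    mder 𝓘(ℝ, E) 𝓘(ℝ, EQ) (piQ (Q := Q) GW) q (gen E EG G q ξ) =
      infGenF GW EQ EF (piQ GW q) (mder 𝓘(ℝ, EG) 𝓘(ℝ, EF) (fun g : G => (g : G ⧸ GW)) 1 ξ) := by
  have e1 := mder_comp (I := 𝓘(ℝ, EG)) (I' := 𝓘(ℝ, E)) (I'' := 𝓘(ℝ, EQ)) (x := (1 : G))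
    (g := piQ GW) (f := fun g : G => g • q) (hQT.1 _) (contMDiff_orbit E EG q _) ξ
  have e2 := mder_comp (I := 𝓘(ℝ, EG)) (I' := 𝓘(ℝ, EF)) (I'' := 𝓘(ℝ, EQ)) (x := (1 : G))
    (g := fun h : G ⧸ GW => FAct GW h (piQ GW q)) (f := fun g : G => (g : G ⧸ GW))
    (contMDiff_FAct_orbit hQT hF _ _) (hF.1 _) ξ
  rw [one_smul] at e1
  exact e1.symm.trans e2

theorem injective_infGenF (hfree : ∀ (g : G) (q : Q), g • q = q → g = 1)
    (hQT : IsSmoothSubmersion 𝓘(ℝ, E) 𝓘(ℝ, EQ) (piQ (Q := Q) GW))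
    (hF : IsSmoothSubmersion 𝓘(ℝ, EG) 𝓘(ℝ, EF) (fun g : G => (g : G ⧸ GW))) (x : QT Q GW) :
    Function.Injective (infGenF GW EQ EF x) := by
  have : CompleteSpace EF := FiniteDimensional.complete ℝ EF
  refine injective_mder_of_equivariant (contMDiff_FAct_orbit hQT hF x) ?_ fun h =>
    ⟨fun x => FAct GW h x, contMDiff_FAct hQT (fun g => contMDiff_act EG g) h,
      fun y => FAct_mul h y x⟩
  intro h h' hh
  obtain ⟨g, rfl⟩ := QuotientGroup.mk_surjective h
  obtain ⟨g', rfl⟩ := QuotientGroup.mk_surjective h'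
  obtain ⟨q, rfl⟩ := piQ_surjective x
  obtain ⟨w, hw, hwq⟩ := piQ_eq_iff.1 hh
  rw [smul_smul] at hwq
  have hg : w * g = g' := injective_orbitMap hfree q hwq
  rw [QuotientGroup.eq, ← hg]
  have := Subgroup.Normal.conj_mem ‹GW.Normal› w hw g⁻¹
  simpa [mul_assoc] using this

end PartialQuotient

/-! ### Splittings of the tangent bundle -/

theorem exists_connection {E EG : Type*} [NormedAddCommGroup E] [NormedSpace ℝ E]
    [FiniteDimensional ℝ E] [NormedAddCommGroup EG] [NormedSpace ℝ EG] {T : EG →L[ℝ] E}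
    (hT : Function.Injective T) {K R : Submodule ℝ E} (hKR : IsCompl K R)
    (hR : R ≤ LinearMap.range T.toLinearMap) :
    ∃ A : E →L[ℝ] EG, ∀ v, T (A v) ∈ R ∧ v - T (A v) ∈ K := by
  let P : E →ₗ[ℝ] R := Submodule.projectionOnto R K hKR.symm
  let e := LinearEquiv.ofInjective T.toLinearMap hT
  let A : E →ₗ[ℝ] EG := e.symm.toLinearMap.comp ((Submodule.inclusion hR).comp P)
  have hA : ∀ v, T (A v) = (P v : E) := by
    intro v
    have := LinearEquiv.ofInjective_symm_apply (f := T.toLinearMap) (h := hT)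
      (Submodule.inclusion hR (P v))
    exact this
  refine ⟨LinearMap.toContinuousLinearMap A, fun v => ?_⟩
  have h1 : (LinearMap.toContinuousLinearMap A) v = A v := rfl
  rw [h1, hA]
  refine ⟨(P v).2, ?_⟩
  have h2 : P (v - (P v : E)) = 0 := by
    have h3 : P (P v : E) = P v := Submodule.projectionOnto_apply_left hKR.symm (P v)
    rw [map_sub, h3, sub_self]
  exact (Submodule.projectionOnto_apply_eq_zero_iff hKR.symm).1 h2

theorem cot_ext {E : Type*} [NormedAddCommGroup E] [NormedSpace ℝ E] {Q : Type*}
    [TopologicalSpace Q] [ChartedSpace E Q] [IsManifold 𝓘(ℝ, E) ∞ Q] {α β : CotBundle E Q} (h1 : α.1 = β.1)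
    (h2 : ∀ v : E, (α.2 : E →L[ℝ] ℝ) v = (β.2 : E →L[ℝ] ℝ) v) : α = β := by
  obtain ⟨p, a⟩ := α
  obtain ⟨q, b⟩ := β
  obtain rfl : p = q := h1
  exact congrArg (TotalSpace.mk p) (ContinuousLinearMap.ext h2)

section Splittings

variable {E : Type*} [NormedAddCommGroup E] [NormedSpace ℝ E] [FiniteDimensional ℝ E]
  {Q : Type*} [TopologicalSpace Q] [ChartedSpace E Q] [IsManifold 𝓘(ℝ, E) ∞ Q] [T2Space Q]
  {EG : Type*} [NormedAddCommGroup EG] [NormedSpace ℝ EG] [FiniteDimensional ℝ EG]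
  {G : Type*} [TopologicalSpace G] [ChartedSpace EG G] [Group G] [LieGroup 𝓘(ℝ, EG) ∞ G]
  [MulAction G Q] [ContMDiffSMul 𝓘(ℝ, EG) 𝓘(ℝ, E) ∞ G Q]
  {S : NHData E Q EG} {GW : Subgroup G} [GW.Normal]
  {EM : Type*} [NormedAddCommGroup EM] [NormedSpace ℝ EM] [ChartedSpace EM S.M]
  {EQ : Type*} [NormedAddCommGroup EQ] [NormedSpace ℝ EQ] [FiniteDimensional ℝ EQ]
  [ChartedSpace EQ (QT Q GW)] [IsManifold 𝓘(ℝ, EQ) ∞ (QT Q GW)]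
  {EF : Type*} [NormedAddCommGroup EF] [NormedSpace ℝ EF] [FiniteDimensional ℝ EF]
  [ChartedSpace EF (G ⧸ GW)] [LieGroup 𝓘(ℝ, EF) ∞ (G ⧸ GW)]

variable (S) in
/-- The constraint distribution, as subspaces of the model space. -/
def subD (q : Q) : Submodule ℝ E := S.D q

variable (S) in
/-- The vertical complement of the constraints, as subspaces of the model space. -/
def subW (q : Q) : Submodule ℝ E := S.W q

variable (S) in
/-- The horizontal distribution, as subspaces of the model space. -/
def subHor (q : Q) : Submodule ℝ E := S.Hor q

variable (S) in
/-- The metric, as bilinear forms on the model space. -/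
noncomputable def met (q : Q) : E →L[ℝ] E →L[ℝ] ℝ := S.κ.inner q

variable (S G) in
/-- The form `A_W`. -/
noncomputable def formW (q : Q) : E →L[ℝ] EG := S.AW G q

variable (S G) in
/-- The connection form. -/
noncomputable def formV (q : Q) : E →L[ℝ] EG := S.A G q

variable (S G) in
/-- The projection onto `D` along `W`. -/
noncomputable def prD (q : Q) : E →L[ℝ] E :=
  ContinuousLinearMap.id ℝ E - (gen E EG G q).comp (formW G S q)

variable (S G) in
/-- The projection onto `Hor` along the vertical space. -/
noncomputable def prHor (q : Q) : E →L[ℝ] E :=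
  ContinuousLinearMap.id ℝ E - (gen E EG G q).comp (formV G S q)

theorem prD_apply (q : Q) (v : E) : prD G S q v = v - gen E EG G q (formW G S q v) := rfl

theorem prHor_apply (q : Q) (v : E) : prHor G S q v = v - gen E EG G q (formV G S q v) := rfl

theorem met_symm (q : Q) (v w : E) : met S q v w = met S q w v := S.κ.symm q v w

theorem met_pos (q : Q) {v : E} (hv : v ≠ 0) : 0 < met S q v v := S.κ.pos q v hv

theorem eq_zero_of_met (q : Q) {v : E} (hv : met S q v v = 0) : v = 0 := by
  by_contra h
  exact (met_pos q h).ne' hv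

theorem gen_injective (q : Q) (hS : S.IsAdmissible GW EM) : Function.Injective (gen E EG G q) :=
  injective_gen hS.free q

theorem isCompl_DW (hS : S.IsAdmissible GW EM) (q : Q) : IsCompl (subD S q) (subW S q) :=
  hS.W_compl q

theorem subW_le (hS : S.IsAdmissible GW EM) (q : Q) :
    subW S q ≤ LinearMap.range (gen E EG G q).toLinearMap := hS.W_vertical q

theorem isCompl_Hor (hS : S.IsAdmissible GW EM) (q : Q) :
    IsCompl (subHor S q) (LinearMap.range (gen E EG G q).toLinearMap) := hS.Hor_compl q

theorem subHor_le (hS : S.IsAdmissible GW EM) (q : Q) : subHor S q ≤ subD S q := hS.Hor_le q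

theorem formW_spec (hS : S.IsAdmissible GW EM) (q : Q) (v : E) :
    gen E EG G q (formW G S q v) ∈ subW S q ∧ prD G S q v ∈ subD S q := by
  have h : ∃ A : E →L[ℝ] EG, ∀ v, gen E EG G q (A v) ∈ subW S q ∧
      v - gen E EG G q (A v) ∈ subD S q :=
    exists_connection (gen_injective q hS) (isCompl_DW hS q) (subW_le hS q)
  exact Classical.epsilon_spec h v

theorem prD_mem (hS : S.IsAdmissible GW EM) (q : Q) (v : E) : prD G S q v ∈ subD S q :=
  (formW_spec hS q v).2

theorem formV_spec (hS : S.IsAdmissible GW EM) (q : Q) (v : E) : prHor G S q v ∈ subHor S q := by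
  have h : ∃ A : E →L[ℝ] EG, ∀ v,
      gen E EG G q (A v) ∈ LinearMap.range (gen E EG G q).toLinearMap ∧
      v - gen E EG G q (A v) ∈ subHor S q :=
    exists_connection (gen_injective q hS) (isCompl_Hor hS q) le_rfl
  exact (Classical.epsilon_spec h v).2

theorem formW_eq (hS : S.IsAdmissible GW EM) {q : Q} {v : E} {ξ : EG}
    (h1 : gen E EG G q ξ ∈ subW S q) (h2 : v - gen E EG G q ξ ∈ subD S q) :
    formW G S q v = ξ := by
  refine gen_injective q hS (sub_eq_zero.1 ?_)
  have h3 := (subW S q).sub_mem (formW_spec hS q v).1 h1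
  have h4 := (subD S q).sub_mem h2 (prD_mem hS q v)
  rw [prD_apply, sub_sub_sub_cancel_left] at h4
  exact Submodule.disjoint_def.1 (isCompl_DW hS q).disjoint _ h4 h3

theorem formV_eq (hS : S.IsAdmissible GW EM) {q : Q} {v : E} {ξ : EG}
    (h2 : v - gen E EG G q ξ ∈ subHor S q) : formV G S q v = ξ := by
  refine gen_injective q hS (sub_eq_zero.1 ?_)
  have h3 : gen E EG G q (formV G S q v) - gen E EG G q ξ ∈
      LinearMap.range (gen E EG G q).toLinearMap := ⟨formV G S q v - ξ, map_sub _ _ _⟩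
  have h4 := (subHor S q).sub_mem h2 (formV_spec hS q v)
  rw [prHor_apply, sub_sub_sub_cancel_left] at h4
  exact Submodule.disjoint_def.1 (isCompl_Hor hS q).disjoint _ h4 h3

theorem formW_of_mem (hS : S.IsAdmissible GW EM) {q : Q} {v : E} (hv : v ∈ subD S q) :
    formW G S q v = 0 :=
  formW_eq hS (by rw [map_zero]; exact zero_mem _) (by rwa [map_zero, sub_zero])

theorem prD_of_mem (hS : S.IsAdmissible GW EM) {q : Q} {v : E} (hv : v ∈ subD S q) :
    prD G S q v = v := by
  rw [prD_apply, formW_of_mem hS hv, map_zero, sub_zero]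

theorem prD_of_mem_W (hS : S.IsAdmissible GW EM) {q : Q} {v : E} (hv : v ∈ subW S q) :
    prD G S q v = 0 := by
  obtain ⟨ξ, hξ⟩ := subW_le hS q hv
  have hξ : gen E EG G q ξ = v := hξ
  rw [prD_apply, formW_eq hS (ξ := ξ) (by rwa [hξ]) (by rw [hξ, sub_self]; exact zero_mem _), hξ,
    sub_self]

theorem formV_gen (hS : S.IsAdmissible GW EM) (q : Q) (ξ : EG) :
    formV G S q (gen E EG G q ξ) = ξ := formV_eq hS (by rw [sub_self]; exact zero_mem _)

theorem prHor_gen (hS : S.IsAdmissible GW EM) (q : Q) (ξ : EG) :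
    prHor G S q (gen E EG G q ξ) = 0 := by
  rw [prHor_apply, formV_gen hS, sub_self]

theorem mem_subW_iff (hS : S.IsAdmissible GW EM)
    (hQT : IsSmoothSubmersion 𝓘(ℝ, E) 𝓘(ℝ, EQ) (piQ (Q := Q) GW)) {q : Q} {v : E} :
    v ∈ subW S q ↔ mder 𝓘(ℝ, E) 𝓘(ℝ, EQ) (piQ (Q := Q) GW) q v = 0 := by
  have hW : ∀ v : E, v ∈ subW S q ↔ ∃ c : ℝ → Q, ContMDiff 𝓘(ℝ, ℝ) 𝓘(ℝ, E) ∞ c ∧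
      (∀ t, c t ∈ MulAction.orbit GW q) ∧ c 0 = q ∧ mder 𝓘(ℝ, ℝ) 𝓘(ℝ, E) c 0 1 = v := fun v =>
    Set.ext_iff.1 (hS.W_orbit q) v
  rw [hW]
  constructor
  · rintro ⟨c, hc, hcq, hc0, rfl⟩
    have h1 := mder_comp (I := 𝓘(ℝ, ℝ)) (I' := 𝓘(ℝ, E)) (I'' := 𝓘(ℝ, EQ)) (x := (0 : ℝ))
      (g := piQ GW) (f := c) (hQT.1 _) (hc _) 1
    have h2 : (fun t => piQ GW (c t)) = fun _ => piQ GW q := by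
      funext t
      obtain ⟨w, hw⟩ := hcq t
      exact (piQ_eq_iff.2 ⟨w.1, w.2, hw⟩).symm
    rw [h2, mder_const, hc0] at h1
    exact h1.symm
  · intro hv
    obtain ⟨c, hc, hcf, hc0, hcv⟩ := exists_curve_in_fiber hQT q (u := v) hv
    refine ⟨c, hc, fun t => ?_, hc0, hcv⟩
    obtain ⟨w, hw, hwq⟩ := piQ_eq_iff.1 (hcf t).symm
    exact ⟨⟨w, hw⟩, hwq⟩

theorem gen_mem_subW_iff (hS : S.IsAdmissible GW EM)
    (hQT : IsSmoothSubmersion 𝓘(ℝ, E) 𝓘(ℝ, EQ) (piQ (Q := Q) GW))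
    (hF : IsSmoothSubmersion 𝓘(ℝ, EG) 𝓘(ℝ, EF) (fun g : G => (g : G ⧸ GW))) {q : Q} {ξ : EG} :
    gen E EG G q ξ ∈ subW S q ↔ mder 𝓘(ℝ, EG) 𝓘(ℝ, EF) (fun g : G => (g : G ⧸ GW)) 1 ξ = 0 := by
  rw [mem_subW_iff hS hQT, mder_piQ_gen hQT hF]
  constructor
  · intro h
    exact injective_infGenF hS.free hQT hF (piQ GW q) (h.trans (map_zero _).symm)
  · intro h
    rw [h, map_zero]

/-! #### Equivariance -/

theorem potential_smul (hS : S.IsAdmissible GW EM) (g : G) (q : Q) : S.U (g • q) = S.U q := by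
  have h := hS.lagrangian_inv g q 0
  have e : ∀ w : E, w = 0 → S.lagrangian (g • q) w = S.lagrangian q (0 : E) → S.U (g • q) = S.U q := by
    rintro w rfl h
    have h : (1 / 2) * met S (g • q) 0 0 - S.U (g • q) = (1 / 2) * met S q 0 0 - S.U q := h
    simp only [map_zero] at h
    linarith
  exact e _ (map_zero (tanAct E g q)) h

theorem met_tanAct (hS : S.IsAdmissible GW EM) (g : G) (q : Q) (v w : E) :
    met S (g • q) (tanAct E g q v) (tanAct E g q w) = met S q v w := by
  have h : ∀ v : E, met S (g • q) (tanAct E g q v) (tanAct E g q v) = met S q v v := by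
    intro v
    have h : (1 / 2) * met S (g • q) (tanAct E g q v) (tanAct E g q v) - S.U (g • q) =
        (1 / 2) * met S q v v - S.U q := hS.lagrangian_inv g q v
    rw [potential_smul hS] at h
    linarith
  have h1 := h (v + w)
  simp only [map_add, add_apply] at h1
  rw [h v, h w, met_symm _ (tanAct E g q w), met_symm _ w v] at h1
  linarith

theorem tanAct_mem_D (hS : S.IsAdmissible GW EM) (g : G) {q : Q} {v : E} (hv : v ∈ subD S q) :
    tanAct E g q v ∈ subD S (g • q) := by
  have h : subD S (g • q) = (subD S q).map (tanAct E g q).toLinearMap := hS.D_inv g q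
  rw [h]
  exact ⟨v, hv, rfl⟩

theorem tanAct_mem_Hor (hS : S.IsAdmissible GW EM) (g : G) {q : Q} {v : E} (hv : v ∈ subHor S q) :
    tanAct E g q v ∈ subHor S (g • q) := by
  have h : subHor S (g • q) = (subHor S q).map (tanAct E g q).toLinearMap := hS.Hor_inv g q
  rw [h]
  exact ⟨v, hv, rfl⟩

theorem tanAct_mem_W (hS : S.IsAdmissible GW EM)
    (hQT : IsSmoothSubmersion 𝓘(ℝ, E) 𝓘(ℝ, EQ) (piQ (Q := Q) GW)) (g : G) {q : Q} {v : E}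
    (hv : v ∈ subW S q) : tanAct E g q v ∈ subW S (g • q) := by
  rw [mem_subW_iff hS hQT] at hv ⊢
  rw [mder_piQ_tanAct hQT (fun g => contMDiff_act EG g), hv, map_zero]

theorem formV_tanAct (hS : S.IsAdmissible GW EM) (g : G) (q : Q) (v : E) :
    formV G S (g • q) (tanAct E g q v) = adAct EG g (formV G S q v) := by
  refine formV_eq hS ?_
  rw [← tanAct_gen, ← map_sub]
  exact tanAct_mem_Hor hS g (formV_spec hS q v)

theorem prHor_tanAct (hS : S.IsAdmissible GW EM) (g : G) (q : Q) (v : E) :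
    prHor G S (g • q) (tanAct E g q v) = tanAct E g q (prHor G S q v) := by
  rw [prHor_apply, formV_tanAct hS, ← tanAct_gen, ← map_sub, prHor_apply]

theorem formW_tanAct (hS : S.IsAdmissible GW EM)
    (hQT : IsSmoothSubmersion 𝓘(ℝ, E) 𝓘(ℝ, EQ) (piQ (Q := Q) GW)) (g : G) (q : Q) (v : E) :
    formW G S (g • q) (tanAct E g q v) = adAct EG g (formW G S q v) := by
  refine formW_eq hS ?_ ?_
  · rw [← tanAct_gen]
    exact tanAct_mem_W hS hQT g (formW_spec hS q v).1
  · rw [← tanAct_gen, ← map_sub]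
    exact tanAct_mem_D hS g (prD_mem hS q v)

theorem prD_tanAct (hS : S.IsAdmissible GW EM)
    (hQT : IsSmoothSubmersion 𝓘(ℝ, E) 𝓘(ℝ, EQ) (piQ (Q := Q) GW)) (g : G) (q : Q) (v : E) :
    prD G S (g • q) (tanAct E g q v) = tanAct E g q (prD G S q v) := by
  rw [prD_apply, formW_tanAct hS hQT, ← tanAct_gen, ← map_sub, prD_apply]

/-! #### The constraint manifold -/

/-- The covector underlying a point of the constraint manifold. -/
def cov (m : S.M) : E →L[ℝ] ℝ := m.1.2

/-- The point of the constraint manifold corresponding to a velocity in `D`. -/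
noncomputable def mkM (q : Q) (v : E) (hv : v ∈ subD S q) : S.M := ⟨⟨q, met S q v⟩, v, hv, rfl⟩

theorem cov_mkM (q : Q) (v : E) (hv : v ∈ subD S q) (w : E) :
    cov (mkM q v hv) w = met S q v w := rfl

theorem exists_mkM (m : S.M) : ∃ v, ∃ hv : v ∈ subD S m.1.1, m = mkM m.1.1 v hv := by
  obtain ⟨⟨q, a⟩, v, hv, h⟩ := m
  refine ⟨v, hv, Subtype.ext ?_⟩
  exact congrArg (TotalSpace.mk q) h

theorem mem_M_of_met {α : CotBundle E Q} {v : E} (hv : v ∈ subD S α.1)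
    (h : ∀ w : E, (α.2 : E →L[ℝ] ℝ) w = met S α.1 v w) :
    ∃ v ∈ S.D α.1, α.2 = S.κ.inner α.1 v := ⟨v, hv, ContinuousLinearMap.ext h⟩

theorem M_ext {m m' : S.M} (h1 : m.1.1 = m'.1.1)
    (h2 : ∀ v ∈ subD S m.1.1, cov m v = cov m' v) : m = m' := by
  obtain ⟨v, hv, hm⟩ := exists_mkM m
  obtain ⟨v', hv', hm'⟩ := exists_mkM m'
  refine Subtype.ext (cot_ext h1 fun w => ?_)
  have e : ∀ w, cov m w = met S m.1.1 v w := fun w => by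
    conv_lhs => rw [hm]
    rfl
  have e' : ∀ w, cov m' w = met S m.1.1 v' w := fun w => by
    conv_lhs => rw [hm']
    rw [h1]
    rfl
  have hv'' : v' ∈ subD S m.1.1 := h1 ▸ hv'
  have h3 := h2 (v - v') ((subD S _).sub_mem hv hv'')
  rw [e, e', ← sub_eq_zero, ← sub_apply, ← map_sub] at h3
  have h4 : v = v' := sub_eq_zero.1 (eq_zero_of_met _ h3)
  exact (e w).trans ((by rw [h4] : met S m.1.1 v w = met S m.1.1 v' w).trans (e' w).symm)

variable (S) in
theorem met_surjective (q : Q) (β : E →L[ℝ] ℝ) : ∃ v, ∀ w, met S q v w = β w := by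
  have h1 : Function.Injective (met S q) := by
    rw [injective_iff_map_eq_zero]
    intro v hv
    exact eq_zero_of_met q (by rw [hv]; rfl)
  have h2 : Function.Surjective (met S q : E →ₗ[ℝ] E →L[ℝ] ℝ) :=
    (LinearMap.injective_iff_surjective_of_finrank_eq_finrank
      (f := (met S q : E →ₗ[ℝ] E →L[ℝ] ℝ)) (by
        rw [← LinearEquiv.finrank_eq (LinearMap.toContinuousLinearMap (𝕜 := ℝ) (E := E) (F' := ℝ))]
        exact (Subspace.dual_finrank_eq (K := ℝ) (V := E)).symm)).1 h1
  obtain ⟨v, hv⟩ := h2 β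
  exact ⟨v, fun w => congrArg (fun T : E →L[ℝ] ℝ => T w) hv⟩

theorem legendreInv_spec (α : CotBundle E Q) (w : E) :
    met S α.1 (S.legendreInv α) w = (α.2 : E →L[ℝ] ℝ) w := by
  have h : ∃ v : E, ∀ w, met S α.1 v w = (α.2 : E →L[ℝ] ℝ) w := met_surjective S α.1 α.2
  exact Classical.epsilon_spec h w

theorem met_left_injective (q : Q) {v v' : E} (h : ∀ w, met S q v w = met S q v' w) : v = v' := by
  refine sub_eq_zero.1 (eq_zero_of_met (S := S) q ?_)
  rw [ContinuousLinearMap.map_sub (met S q) v v', sub_apply, h, sub_self]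

/-- The Legendre transform of a point of the constraint manifold. -/
noncomputable def vel (m : S.M) : E := S.legendreInv m.1

theorem met_vel (m : S.M) (w : E) : met S m.1.1 (vel m) w = cov m w := legendreInv_spec m.1 w

theorem vel_mem (m : S.M) : vel m ∈ subD S m.1.1 := by
  obtain ⟨v, hv, hm⟩ := exists_mkM m
  have : vel m = v := met_left_injective (S := S) m.1.1 fun w => by
    rw [met_vel]
    conv_lhs => rw [hm]
    rfl
  rwa [this]

/-- The action on the constraint manifold. -/
noncomputable def actM (hS : S.IsAdmissible GW EM) (g : G) (m : S.M) : S.M :=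
  ⟨cotLift E g m.1, mem_M_of_met (v := tanAct E g m.1.1 (vel m)) (tanAct_mem_D hS g (vel_mem m))
    fun w => by
      change cov m (tanAct E g⁻¹ (g • m.1.1) w) = met S (g • m.1.1) (tanAct E g m.1.1 (vel m)) w
      conv_rhs => rw [← tanAct_tanAct_inv EG g m.1.1 w]
      rw [met_tanAct hS, met_vel]⟩

theorem actM_base (hS : S.IsAdmissible GW EM) (g : G) (m : S.M) : (actM hS g m).1.1 = g • m.1.1 :=
  rfl

theorem cov_actM (hS : S.IsAdmissible GW EM) (g : G) (m : S.M) (v : E) :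
    cov (actM hS g m) (tanAct E g m.1.1 v) = cov m v := by
  change cov m (tanAct E g⁻¹ (g • m.1.1) (tanAct E g m.1.1 v)) = cov m v
  rw [tanAct_inv_tanAct EG]

theorem vel_actM (hS : S.IsAdmissible GW EM) (g : G) (m : S.M) :
    vel (actM hS g m) = tanAct E g m.1.1 (vel m) := by
  refine met_left_injective (S := S) (g • m.1.1) fun w => ?_
  rw [← tanAct_tanAct_inv EG g m.1.1 w, met_tanAct hS, met_vel, ← cov_actM hS g]
  exact met_vel (actM hS g m) _

theorem sameOrbit_iff (hS : S.IsAdmissible GW EM) {m m' : S.M} :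
    S.SameOrbit G m m' ↔ ∃ g : G, m' = actM hS g m :=
  exists_congr fun g => (Subtype.ext_iff (a1 := m') (a2 := actM hS g m)).symm

theorem actM_mul (hS : S.IsAdmissible GW EM) (g h : G) (m : S.M) :
    actM hS (g * h) m = actM hS g (actM hS h m) := by
  refine M_ext (mul_smul g h m.1.1) fun v _ => ?_
  have e1 := cov_actM hS (g * h) m (tanAct E (g * h)⁻¹ ((g * h) • m.1.1) v)
  rw [tanAct_tanAct_inv EG] at e1
  have e2 := cov_actM hS g (actM hS h m)
    (tanAct E h m.1.1 (tanAct E (g * h)⁻¹ ((g * h) • m.1.1) v))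
  have e3 := tanAct_mul EG g h m.1.1 (tanAct E (g * h)⁻¹ ((g * h) • m.1.1) v)
  rw [tanAct_tanAct_inv EG] at e3
  rw [e1, ← cov_actM hS h m, ← e2]
  exact congrArg _ e3.symm

theorem actM_one (hS : S.IsAdmissible GW EM) (m : S.M) : actM hS (1 : G) m = m := by
  refine M_ext (one_smul G m.1.1) fun v _ => ?_
  have e := cov_actM hS (1 : G) m v
  rwa [tanAct_one] at e

theorem rho_eq_iff (hS : S.IsAdmissible GW EM) {m m' : S.M} :
    S.rho G m = S.rho G m' ↔ ∃ g : G, m' = actM hS g m := by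
  have heq : Equivalence (S.SameOrbit G) := by
    refine ⟨fun m => (sameOrbit_iff hS).2 ⟨1, (actM_one hS m).symm⟩, fun h => ?_, fun h h' => ?_⟩
    · obtain ⟨g, rfl⟩ := (sameOrbit_iff hS).1 h
      exact (sameOrbit_iff hS).2 ⟨g⁻¹, by rw [← actM_mul, inv_mul_cancel, actM_one]⟩
    · obtain ⟨g, rfl⟩ := (sameOrbit_iff hS).1 h
      obtain ⟨g', rfl⟩ := (sameOrbit_iff hS).1 h'
      exact (sameOrbit_iff hS).2 ⟨g' * g, by rw [actM_mul]⟩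
  rw [NHData.rho, NHData.rho, Quot.eq, heq.eqvGen_iff]
  exact sameOrbit_iff hS

theorem rho_actM (hS : S.IsAdmissible GW EM) (g : G) (m : S.M) :
    S.rho G (actM hS g m) = S.rho G m := ((rho_eq_iff hS).2 ⟨g, rfl⟩).symm

theorem rho_surjective : Function.Surjective (S.rho G) := Quot.mk_surjective

theorem momentum_eq (m : S.M) (ξ : EG) : S.momentum G m ξ = cov m (gen E EG G m.1.1 ξ) := rfl

theorem momentum_actM (hS : S.IsAdmissible GW EM) (g : G) (m : S.M) (ξ : EG) :
    S.momentum G (actM hS g m) (adAct EG g ξ) = S.momentum G m ξ := by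
  rw [momentum_eq, momentum_eq, actM_base, ← tanAct_gen, cov_actM]

theorem J_actM (hS : S.IsAdmissible GW EM) (g : G) (m : S.M) (i : Fin S.k) :
    S.J G i (actM hS g m) = S.J G i m :=
  (hS.J_inv i m _ ((sameOrbit_iff hS).2 ⟨g, rfl⟩)).symm

theorem zeta_mem (hS : S.IsAdmissible GW EM) (i : Fin S.k) (q : Q) :
    gen E EG G q (S.ζ i q) ∈ subD S q := hS.ζ_mem i q

theorem zeta_smul (hS : S.IsAdmissible GW EM) (i : Fin S.k) (g : G) (q : Q) :
    S.ζ i (g • q) = adAct EG g (S.ζ i q) := by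
  have h1 := zeta_mem hS i (g • q)
  have h2 := tanAct_mem_D hS g (zeta_mem hS i q)
  rw [tanAct_gen] at h2
  have h3 := (subD S (g • q)).sub_mem h1 h2
  refine gen_injective (g • q) hS (sub_eq_zero.1 (eq_zero_of_met (S := S) (g • q) ?_))
  have h4 := tanAct_mem_D hS g⁻¹ h3
  rw [inv_smul_smul] at h4
  have e := J_actM hS g (mkM q _ h4) i
  have e1 : ∀ ξ, cov (actM hS g (mkM q _ h4)) (gen E EG G (g • q) ξ) =
      met S (g • q) (gen E EG G (g • q) (S.ζ i (g • q)) -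
        gen E EG G (g • q) (adAct EG g (S.ζ i q))) (gen E EG G (g • q) ξ) := by
    intro ξ
    have e3 := cov_actM hS g (mkM q _ h4) (tanAct E g⁻¹ (g • q) (gen E EG G (g • q) ξ))
    have e4 := met_tanAct hS g q (tanAct E g⁻¹ (g • q) (gen E EG G (g • q) (S.ζ i (g • q)) -
        gen E EG G (g • q) (adAct EG g (S.ζ i q)))) (tanAct E g⁻¹ (g • q) (gen E EG G (g • q) ξ))
    rw [cov_mkM, ← e4] at e3
    simp only [tanAct_tanAct_inv EG] at e3
    exact (congrArg _ (tanAct_tanAct_inv EG g q _).symm).trans e3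
  have e5 := momentum_actM hS g (mkM q _ h4) (S.ζ i q)
  have e6 : S.momentum G (actM hS g (mkM q _ h4)) (S.ζ i (g • q)) =
    S.momentum G (actM hS g (mkM q _ h4)) (adAct EG g (S.ζ i q)) := e.trans e5.symm
  rw [momentum_eq, momentum_eq] at e6
  have e7 := (e1 (S.ζ i (g • q))).symm.trans (e6.trans (e1 (adAct EG g (S.ζ i q))))
  rw [map_sub, sub_eq_zero]
  exact e7

end Splittings

/-! ### Smooth vector fields along maps -/

section SmoothVec

variable {EX : Type*} [NormedAddCommGroup EX] [NormedSpace ℝ EX] {HX : Type*} [TopologicalSpace HX]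
  {IX : ModelWithCorners ℝ EX HX} {X : Type*} [TopologicalSpace X] [ChartedSpace HX X]
  {E : Type*} [NormedAddCommGroup E] [NormedSpace ℝ E] {H : Type*} [TopologicalSpace H]
  {I : ModelWithCorners ℝ E H} {N : Type*} [TopologicalSpace N] [ChartedSpace H N]
  [IsManifold I ∞ N]
  {E' : Type*} [NormedAddCommGroup E'] [NormedSpace ℝ E'] {H' : Type*} [TopologicalSpace H']
  {I' : ModelWithCorners ℝ E' H'} {N' : Type*} [TopologicalSpace N'] [ChartedSpace H' N']
  [IsManifold I' ∞ N']

variable (IX I) in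
/-- The vector field `v` along `b` is smooth at `x₀`. -/
def SmoothVecAt (b : X → N) (v : X → E) (x₀ : X) : Prop :=
  ContMDiffAt IX I.tangent ∞ (fun x => (⟨b x, v x⟩ : TangentBundle I N)) x₀

namespace SmoothVecAt

variable {b : X → N} {v w : X → E} {x₀ : X}

theorem base (h : SmoothVecAt IX I b v x₀) : ContMDiffAt IX I ∞ b x₀ := contMDiffAt_base h

theorem add (h : SmoothVecAt IX I b v x₀) (h' : SmoothVecAt IX I b w x₀) :
    SmoothVecAt IX I b (fun x => v x + w x) x₀ := contMDiffAt_vector_add h h'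

theorem sub (h : SmoothVecAt IX I b v x₀) (h' : SmoothVecAt IX I b w x₀) :
    SmoothVecAt IX I b (fun x => v x - w x) x₀ := contMDiffAt_vector_sub h h'

theorem smul {c : X → ℝ} (hc : ContMDiffAt IX 𝓘(ℝ, ℝ) ∞ c x₀) (h : SmoothVecAt IX I b v x₀) :
    SmoothVecAt IX I b (fun x => c x • v x) x₀ := contMDiffAt_vector_smul hc h

theorem sum {ι : Type*} (s : Finset ι) {v : ι → X → E} (hb : ContMDiffAt IX I ∞ b x₀)
    (h : ∀ i ∈ s, SmoothVecAt IX I b (v i) x₀) :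
    SmoothVecAt IX I b (fun x => ∑ i ∈ s, v i x) x₀ := contMDiffAt_vector_sum s hb h

theorem congr (h : SmoothVecAt IX I b v x₀) (hw : ∀ᶠ x in 𝓝 x₀, w x = v x) :
    SmoothVecAt IX I b w x₀ := by
  refine ContMDiffAt.congr_of_eventuallyEq h ?_
  filter_upwards [hw] with x hx
  rw [hx]

theorem mder {g : N → N'} (h : SmoothVecAt IX I b v x₀) (hg : ContMDiff I I' ∞ g) :
    SmoothVecAt IX I' (fun x => g (b x)) (fun x => NHReduction.mder I I' g (b x) (v x)) x₀ :=
  contMDiff_mder hg h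

theorem comp {v : N' → E} {b : N' → N} {f : X → N'} (h : SmoothVecAt I' I b v (f x₀))
    (hf : ContMDiffAt IX I' ∞ f x₀) :
    SmoothVecAt IX I (fun x => b (f x)) (fun x => v (f x)) x₀ :=
  ContMDiffAt.comp x₀ h hf

end SmoothVecAt

/-- The solution of a smooth family of injective linear equations in the tangent spaces is
smooth. -/
theorem contMDiffAt_solve [I.Boundaryless] [FiniteDimensional ℝ E] {F : Type*} [NormedAddCommGroup F]
    [NormedSpace ℝ F] [FiniteDimensional ℝ F] {b : X → N} {B : X → F →L[ℝ] E} {T : X → E}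
    {z : X → F} {x₀ : X} (hB : ∀ a, SmoothVecAt IX I b (fun x => B x a) x₀)
    (hT : SmoothVecAt IX I b T x₀) (hinj : Function.Injective (B x₀))
    (h : ∀ᶠ x in 𝓝 x₀, B x (z x) = T x) : ContMDiffAt IX 𝓘(ℝ, F) ∞ z x₀ := by
  let L : N → E →L[ℝ] E := fun q => NHReduction.mder I 𝓘(ℝ, E) (extChartAt I (b x₀)) q
  have hb : b x₀ ∈ (chartAt H (b x₀)).source := mem_chart_source _ _
  have hL : ∀ v : X → E, SmoothVecAt IX I b v x₀ →
      ContMDiffAt IX 𝓘(ℝ, E) ∞ (fun x => L (b x) (v x)) x₀ := fun v hv =>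
    contMDiffAt_chartVec hv hb
  have hL0 : ∀ v, L (b x₀) v = v := fun v =>
    DFunLike.congr_fun (mfderiv_extChartAt_self (I := I) (x := b x₀)) v
  refine contMDiffAt_of_injective (B := fun x => (L (b x)).comp (B x))
    (c := fun x => L (b x) (T x)) (contMDiffAt_clm_of_apply fun a => hL _ (hB a)) (hL _ hT) ?_ ?_
  · intro a a' haa
    refine hinj ?_
    have : L (b x₀) (B x₀ a) = L (b x₀) (B x₀ a') := haa
    rwa [hL0, hL0] at this
  · filter_upwards [h] with x hx
    rw [ContinuousLinearMap.comp_apply, hx]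

/-- The linear map with given columns. -/
noncomputable def colMap {F : Type*} [NormedAddCommGroup F] [NormedSpace ℝ F] {r : ℕ}
    (X : Fin r → F) : (Fin r → ℝ) →L[ℝ] F :=
  ∑ j, (ContinuousLinearMap.proj (R := ℝ) (φ := fun _ : Fin r => ℝ) j).smulRight (X j)

theorem colMap_apply {F : Type*} [NormedAddCommGroup F] [NormedSpace ℝ F] {r : ℕ}
    (X : Fin r → F) (c : Fin r → ℝ) : colMap X c = ∑ j, c j • X j := by
  simp [colMap, sum_apply]

theorem colMap_injective {F : Type*} [NormedAddCommGroup F] [NormedSpace ℝ F] {r : ℕ}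
    {X : Fin r → F} (h : LinearIndependent ℝ X) : Function.Injective (colMap X) := by
  rw [injective_iff_map_eq_zero]
  intro c hc
  rw [colMap_apply] at hc
  exact funext (Fintype.linearIndependent_iff.1 h c hc)

theorem exists_colMap_eq {F : Type*} [NormedAddCommGroup F] [NormedSpace ℝ F] {r : ℕ}
    {X : Fin r → F} {v : F} (h : v ∈ Submodule.span ℝ (Set.range X)) : ∃ c, colMap X c = v := by
  obtain ⟨c, hc⟩ := (Submodule.mem_span_range_iff_exists_fun ℝ).1 h
  exact ⟨c, (colMap_apply X c).trans hc⟩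

theorem smoothVecAt_colMap {r : ℕ} {b : X → N} {V : Fin r → X → E} {c : X → Fin r → ℝ} {x₀ : X}
    (hb : ContMDiffAt IX I ∞ b x₀) (hV : ∀ j, SmoothVecAt IX I b (V j) x₀)
    (hc : ContMDiffAt IX 𝓘(ℝ, Fin r → ℝ) ∞ c x₀) :
    SmoothVecAt IX I b (fun x => colMap (fun j => V j x) (c x)) x₀ := by
  simp only [colMap_apply]
  refine SmoothVecAt.sum _ hb fun j _ => SmoothVecAt.smul ?_ (hV j)
  exact ((ContinuousLinearMap.proj (R := ℝ) (φ := fun _ : Fin r => ℝ) j).contMDiff).contMDiffAt.comp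
    x₀ hc

end SmoothVec

/-! ### Smoothness of the splittings -/

section SmoothSplittings

variable {E : Type*} [NormedAddCommGroup E] [NormedSpace ℝ E] [FiniteDimensional ℝ E]
  {Q : Type*} [TopologicalSpace Q] [ChartedSpace E Q] [IsManifold 𝓘(ℝ, E) ∞ Q] [T2Space Q]
  {EG : Type*} [NormedAddCommGroup EG] [NormedSpace ℝ EG] [FiniteDimensional ℝ EG]
  {G : Type*} [TopologicalSpace G] [ChartedSpace EG G] [Group G] [LieGroup 𝓘(ℝ, EG) ∞ G]
  [MulAction G Q] [ContMDiffSMul 𝓘(ℝ, EG) 𝓘(ℝ, E) ∞ G Q]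
  {S : NHData E Q EG} {GW : Subgroup G} [GW.Normal]
  {EM : Type*} [NormedAddCommGroup EM] [NormedSpace ℝ EM] [ChartedSpace EM S.M]
  {EQ : Type*} [NormedAddCommGroup EQ] [NormedSpace ℝ EQ] [FiniteDimensional ℝ EQ]
  [ChartedSpace EQ (QT Q GW)] [IsManifold 𝓘(ℝ, EQ) ∞ (QT Q GW)]
  {EF : Type*} [NormedAddCommGroup EF] [NormedSpace ℝ EF] [FiniteDimensional ℝ EF]
  [ChartedSpace EF (G ⧸ GW)] [LieGroup 𝓘(ℝ, EF) ∞ (G ⧸ GW)]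
  {EX : Type*} [NormedAddCommGroup EX] [NormedSpace ℝ EX] {HX : Type*} [TopologicalSpace HX]
  {IX : ModelWithCorners ℝ EX HX} {X : Type*} [TopologicalSpace X] [ChartedSpace HX X]

theorem smoothVecAt_gen {q : X → Q} {ξ : X → EG} {x₀ : X} (hq : ContMDiffAt IX 𝓘(ℝ, E) ∞ q x₀)
    (hξ : ContMDiffAt IX 𝓘(ℝ, EG) ∞ ξ x₀) :
    SmoothVecAt IX 𝓘(ℝ, E) q (fun x => gen E EG G (q x) (ξ x)) x₀ := contMDiffAt_gen hq hξ

theorem exists_frame {Δ : ∀ q : Q, Submodule ℝ (TangentSpace 𝓘(ℝ, E) q)}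
    (h : IsSmoothDistribution 𝓘(ℝ, E) Δ) (q₀ : Q) :
    ∃ (r : ℕ) (V : Fin r → Q → E), (∀ j, SmoothVecAt 𝓘(ℝ, E) 𝓘(ℝ, E) (fun q => q) (V j) q₀) ∧
      ∀ᶠ q in 𝓝 q₀, LinearIndependent ℝ (fun j => V j q) ∧
        (Submodule.span ℝ (Set.range fun j => V j q) : Submodule ℝ E) = Δ q := by
  obtain ⟨r, hr⟩ := h
  obtain ⟨A, V, hA, hq, hV, hV'⟩ := hr q₀
  refine ⟨r, V, fun j => (hV j).contMDiffAt (hA.mem_nhds hq), ?_⟩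
  filter_upwards [hA.mem_nhds hq] with q hq
  exact hV' q hq

theorem smoothTensor_met (S : NHData E Q EG) :
    IsSmoothTensor 𝓘(ℝ, E) (fun (q : Q) (u v : E) => met S q u v) where
  add_left q u u' v := congrArg (fun T : E →L[ℝ] ℝ => T v) (map_add (met S q) u u')
  smul_left q c u v := congrArg (fun T : E →L[ℝ] ℝ => T v) (map_smul (met S q) c u)
  add_right q u v v' := map_add (met S q u) v v'
  smul_right q c u v := map_smul (met S q u) c v
  smooth b a a' y hy := by
    have h1 := contMDiffAt_chartFrame (I := 𝓘(ℝ, E)) b a hy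
    have h2 := contMDiffAt_chartFrame (I := 𝓘(ℝ, E)) b a' hy
    have h3 := ContMDiffAt.clm_bundle_apply₂ (F₁ := E) (F₂ := E) (F₃ := ℝ)
      (E₁ := fun q : Q => TangentSpace 𝓘(ℝ, E) q) (E₂ := fun q : Q => TangentSpace 𝓘(ℝ, E) q)
      (E₃ := Trivial Q ℝ) (b := fun y => (chartFrame 𝓘(ℝ, E) b a y).1)
      ((S.κ.contMDiff _).comp y (contMDiffAt_base h1)) h1 h2
    exact (contMDiffAt_totalSpace.1 h3).2

end SmoothSplittings

section SmoothSplittings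

variable {EX : Type*} [NormedAddCommGroup EX] [NormedSpace ℝ EX] {HX : Type*} [TopologicalSpace HX]
  {IX : ModelWithCorners ℝ EX HX} {X : Type*} [TopologicalSpace X] [ChartedSpace HX X]
  {E : Type*} [NormedAddCommGroup E] [NormedSpace ℝ E] [FiniteDimensional ℝ E]
  {Q : Type*} [TopologicalSpace Q] [ChartedSpace E Q] [IsManifold 𝓘(ℝ, E) ∞ Q] [T2Space Q]
  {EG : Type*} [NormedAddCommGroup EG] [NormedSpace ℝ EG] [FiniteDimensional ℝ EG]
  {G : Type*} [TopologicalSpace G] [ChartedSpace EG G] [Group G] [LieGroup 𝓘(ℝ, EG) ∞ G]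
  [MulAction G Q] [ContMDiffSMul 𝓘(ℝ, EG) 𝓘(ℝ, E) ∞ G Q]
  {S : NHData E Q EG} {GW : Subgroup G} [GW.Normal]
  {EM : Type*} [NormedAddCommGroup EM] [NormedSpace ℝ EM] [ChartedSpace EM S.M]
  {EQ : Type*} [NormedAddCommGroup EQ] [NormedSpace ℝ EQ] [FiniteDimensional ℝ EQ]
  [ChartedSpace EQ (QT Q GW)] [IsManifold 𝓘(ℝ, EQ) ∞ (QT Q GW)]
  {EF : Type*} [NormedAddCommGroup EF] [NormedSpace ℝ EF] [FiniteDimensional ℝ EF]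
  [ChartedSpace EF (G ⧸ GW)] [LieGroup 𝓘(ℝ, EF) ∞ (G ⧸ GW)]

/-- The component in a subspace `𝔥` of the Lie algebra, for a smooth splitting of the tangent
spaces. -/
theorem contMDiffAt_component (𝔥 : Submodule ℝ EG) {K : ∀ q : Q, Submodule ℝ E}
    (hK : IsSmoothDistribution 𝓘(ℝ, E) (N := Q) K) {A : Q → E →L[ℝ] EG}
    (hA : ∀ q v, A q v ∈ 𝔥) (hAK : ∀ q v, v - gen E EG G q (A q v) ∈ K q)
    (hd : ∀ q, ∀ ξ ∈ 𝔥, gen E EG G q ξ ∈ K q → ξ = 0) {b : X → Q} {T : X → E} {x₀ : X}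
    (hT : SmoothVecAt IX 𝓘(ℝ, E) b T x₀) :
    ContMDiffAt IX 𝓘(ℝ, EG) ∞ (fun x => A (b x) (T x)) x₀ := by
  obtain ⟨r, V, hV, hspan⟩ := exists_frame hK (b x₀)
  have hev := hT.base.continuousAt.eventually hspan
  have hc : ∀ x, ∃ c : Fin r → ℝ,
      (Submodule.span ℝ (Set.range fun j => V j (b x)) : Submodule ℝ E) = K (b x) →
      colMap (fun j => V j (b x)) c = T x - gen E EG G (b x) (A (b x) (T x)) := by
    intro x
    by_cases h : (Submodule.span ℝ (Set.range fun j => V j (b x)) : Submodule ℝ E) = K (b x)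
    · have h1 := hAK (b x) (T x)
      rw [← h] at h1
      obtain ⟨c, hc⟩ := exists_colMap_eq h1
      exact ⟨c, fun _ => hc⟩
    · exact ⟨0, fun h' => absurd h' h⟩
  choose c hc using hc
  let B : X → ((Fin r → ℝ) × 𝔥) →L[ℝ] E := fun x =>
    (colMap fun j => V j (b x)).comp (ContinuousLinearMap.fst ℝ _ _) +
      ((gen E EG G (b x)).comp 𝔥.subtypeL).comp (ContinuousLinearMap.snd ℝ _ _)
  have hB : ∀ x a, B x a = colMap (fun j => V j (b x)) a.1 + gen E EG G (b x) (a.2 : EG) :=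
    fun x a => rfl
  have hz : ContMDiffAt IX 𝓘(ℝ, (Fin r → ℝ) × 𝔥) ∞
      (fun x => ((c x, ⟨A (b x) (T x), hA _ _⟩) : (Fin r → ℝ) × 𝔥)) x₀ := by
    refine contMDiffAt_solve (I := 𝓘(ℝ, E)) (b := b) (B := B) (T := T) ?_ hT ?_ ?_
    · intro a
      exact SmoothVecAt.add (smoothVecAt_colMap hT.base (fun j => (hV j).comp hT.base)
        contMDiffAt_const) (smoothVecAt_gen hT.base contMDiffAt_const)
    · rw [injective_iff_map_eq_zero]
      rintro ⟨a, ξ⟩ h0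
      rw [hB] at h0
      obtain ⟨h1, h2⟩ := hev.self_of_nhds
      have h3 : gen E EG G (b x₀) (ξ : EG) ∈ K (b x₀) := by
        rw [← h2, eq_neg_of_add_eq_zero_right h0, colMap_apply]
        exact neg_mem (Submodule.sum_mem _ fun j _ =>
          Submodule.smul_mem _ _ (Submodule.subset_span ⟨j, rfl⟩))
      have h4 : (ξ : EG) = 0 := hd _ _ ξ.2 h3
      simp only [h4, map_zero, add_zero] at h0
      have h5 : a = 0 := colMap_injective h1 (h0.trans (map_zero _).symm)
      exact Prod.ext h5 (Subtype.ext h4)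
    · filter_upwards [hev] with x hx
      rw [hB, hc x hx.2]
      exact sub_add_cancel _ _
  exact (((𝔥.subtypeL).comp (ContinuousLinearMap.snd ℝ (Fin r → ℝ) 𝔥)).contMDiff).contMDiffAt.comp
    x₀ hz

theorem contMDiffAt_formV (hS : S.IsAdmissible GW EM) {b : X → Q} {T : X → E} {x₀ : X}
    (hT : SmoothVecAt IX 𝓘(ℝ, E) b T x₀) :
    ContMDiffAt IX 𝓘(ℝ, EG) ∞ (fun x => formV G S (b x) (T x)) x₀ := by
  refine contMDiffAt_component (G := G) ⊤ hS.Hor_smooth (fun _ _ => trivial)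
    (fun q v => formV_spec hS q v) (fun q ξ _ h => ?_) hT
  have h1 := (isCompl_Hor hS q).disjoint.le_bot ⟨h, ⟨ξ, rfl⟩⟩
  exact gen_injective q hS (((Submodule.mem_bot ℝ).1 h1).trans (map_zero _).symm)

theorem contMDiffAt_formW (hS : S.IsAdmissible GW EM)
    (hQT : IsSmoothSubmersion 𝓘(ℝ, E) 𝓘(ℝ, EQ) (piQ (Q := Q) GW))
    (hF : IsSmoothSubmersion 𝓘(ℝ, EG) 𝓘(ℝ, EF) (fun g : G => (g : G ⧸ GW)))
    {b : X → Q} {T : X → E} {x₀ : X} (hT : SmoothVecAt IX 𝓘(ℝ, E) b T x₀) :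
    ContMDiffAt IX 𝓘(ℝ, EG) ∞ (fun x => formW G S (b x) (T x)) x₀ := by
  refine contMDiffAt_component (G := G)
    (LinearMap.ker (mder 𝓘(ℝ, EG) 𝓘(ℝ, EF) (fun g : G => (g : G ⧸ GW)) 1).toLinearMap)
    hS.D_smooth (fun q v => ?_) (fun q v => prD_mem hS q v) (fun q ξ hξ h => ?_) hT
  · exact LinearMap.mem_ker.2 ((gen_mem_subW_iff hS hQT hF).1 (formW_spec hS q v).1)
  · have h2 := (gen_mem_subW_iff hS hQT hF (q := q)).2 (LinearMap.mem_ker.1 hξ)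
    have h1 := (isCompl_DW hS q).disjoint.le_bot ⟨h, h2⟩
    exact gen_injective q hS (((Submodule.mem_bot ℝ).1 h1).trans (map_zero _).symm)

theorem smoothVecAt_tangentBundle (z : TangentBundle 𝓘(ℝ, E) Q) :
    SmoothVecAt (𝓘(ℝ, E)).tangent 𝓘(ℝ, E) (fun z : TangentBundle 𝓘(ℝ, E) Q => z.1)
      (fun z => z.2) z := contMDiffAt_id

theorem smoothOneForm_formV (hS : S.IsAdmissible GW EM) :
    SmoothOneForm 𝓘(ℝ, E) (fun q : Q => S.A G q) := fun z =>
  contMDiffAt_formV hS (smoothVecAt_tangentBundle z)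

theorem smoothOneForm_formW (hS : S.IsAdmissible GW EM)
    (hQT : IsSmoothSubmersion 𝓘(ℝ, E) 𝓘(ℝ, EQ) (piQ (Q := Q) GW))
    (hF : IsSmoothSubmersion 𝓘(ℝ, EG) 𝓘(ℝ, EF) (fun g : G => (g : G ⧸ GW))) :
    SmoothOneForm 𝓘(ℝ, E) (fun q : Q => S.AW G q) := fun z =>
  contMDiffAt_formW hS hQT hF (smoothVecAt_tangentBundle z)

theorem SmoothVecAt.prHor (hS : S.IsAdmissible GW EM) {b : X → Q} {T : X → E} {x₀ : X}
    (hT : SmoothVecAt IX 𝓘(ℝ, E) b T x₀) :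
    SmoothVecAt IX 𝓘(ℝ, E) b (fun x => NHReduction.prHor G S (b x) (T x)) x₀ :=
  hT.sub (smoothVecAt_gen hT.base (contMDiffAt_formV hS hT))

theorem SmoothVecAt.prD (hS : S.IsAdmissible GW EM)
    (hQT : IsSmoothSubmersion 𝓘(ℝ, E) 𝓘(ℝ, EQ) (piQ (Q := Q) GW))
    (hF : IsSmoothSubmersion 𝓘(ℝ, EG) 𝓘(ℝ, EF) (fun g : G => (g : G ⧸ GW)))
    {b : X → Q} {T : X → E} {x₀ : X} (hT : SmoothVecAt IX 𝓘(ℝ, E) b T x₀) :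
    SmoothVecAt IX 𝓘(ℝ, E) b (fun x => NHReduction.prD G S (b x) (T x)) x₀ :=
  hT.sub (smoothVecAt_gen hT.base (contMDiffAt_formW hS hQT hF hT))

/-! ### Vectors of `D` determined by the metric, or by their projection to the quotient -/

theorem exists_colMap_frame {r : ℕ} {V : Fin r → Q → E} {K : Q → Submodule ℝ E} {b : X → Q}
    {v : X → E} {x₀ : X}
    (hev : ∀ᶠ x in 𝓝 x₀, (Submodule.span ℝ (Set.range fun j => V j (b x)) : Submodule ℝ E) =
      K (b x)) (hv : ∀ᶠ x in 𝓝 x₀, v x ∈ K (b x)) :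
    ∃ c : X → Fin r → ℝ, ∀ᶠ x in 𝓝 x₀, colMap (fun j => V j (b x)) (c x) = v x := by
  have hc : ∀ x, ∃ c : Fin r → ℝ,
      v x ∈ (Submodule.span ℝ (Set.range fun j => V j (b x)) : Submodule ℝ E) →
      colMap (fun j => V j (b x)) c = v x := by
    intro x
    by_cases h : v x ∈ (Submodule.span ℝ (Set.range fun j => V j (b x)) : Submodule ℝ E)
    · obtain ⟨c, hc⟩ := exists_colMap_eq h
      exact ⟨c, fun _ => hc⟩
    · exact ⟨0, fun h' => absurd h' h⟩
  choose c hc using hc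
  refine ⟨c, ?_⟩
  filter_upwards [hev, hv] with x h1 h2
  exact hc x (by rw [h1]; exact h2)

theorem colMap_mem {r : ℕ} {X : Fin r → E} {K : Submodule ℝ E}
    (h : (Submodule.span ℝ (Set.range X) : Submodule ℝ E) = K) (c : Fin r → ℝ) :
    colMap X c ∈ K := by
  rw [← h, colMap_apply]
  exact Submodule.sum_mem _ fun j _ => Submodule.smul_mem _ _ (Submodule.subset_span ⟨j, rfl⟩)

/-- A section of `D` whose pairings with the sections of `D` are smooth is smooth. -/
theorem smoothVecAt_of_met (hD : IsSmoothDistribution 𝓘(ℝ, E) S.D) {b : X → Q} {v : X → E}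
    {β : X → E →L[ℝ] ℝ} {x₀ : X} (hb : ContMDiffAt IX 𝓘(ℝ, E) ∞ b x₀)
    (hβ : ∀ Z : Q → E, SmoothVecAt 𝓘(ℝ, E) 𝓘(ℝ, E) (fun q => q) Z (b x₀) →
      ContMDiffAt IX 𝓘(ℝ, ℝ) ∞ (fun x => β x (Z (b x))) x₀)
    (hv : ∀ᶠ x in 𝓝 x₀, v x ∈ subD S (b x))
    (hvβ : ∀ᶠ x in 𝓝 x₀, ∀ d ∈ subD S (b x), met S (b x) (v x) d = β x d) :
    SmoothVecAt IX 𝓘(ℝ, E) b v x₀ := by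
  obtain ⟨r, V, hV, hspan⟩ := exists_frame hD (b x₀)
  have hev := hb.continuousAt.eventually hspan
  obtain ⟨c, hc⟩ := exists_colMap_frame (K := subD S) (hev.mono fun x hx => hx.2) hv
  have hVb : ∀ j, SmoothVecAt IX 𝓘(ℝ, E) b (fun x => V j (b x)) x₀ := fun j => (hV j).comp hb
  let B : X → (Fin r → ℝ) →L[ℝ] (Fin r → ℝ) := fun x =>
    ContinuousLinearMap.pi fun i =>
      ((met S (b x)).flip (V i (b x))).comp (colMap fun j => V j (b x))
  have hB : ∀ x a i, B x a i = met S (b x) (colMap (fun j => V j (b x)) a) (V i (b x)) :=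
    fun _ _ _ => rfl
  have hcs : ContMDiffAt IX 𝓘(ℝ, Fin r → ℝ) ∞ c x₀ := by
    refine contMDiffAt_of_injective (B := B) (c := fun x i => β x (V i (b x)))
      (contMDiffAt_clm_of_apply fun a => ?_) ?_ ?_ ?_
    · refine contMDiffAt_pi_space.2 fun i => ?_
      exact (smoothTensor_met S).contMDiffAt_apply
        (smoothVecAt_colMap hb hVb contMDiffAt_const) (hVb i)
    · exact contMDiffAt_pi_space.2 fun i => hβ _ (hV i)
    · rw [injective_iff_map_eq_zero]
      intro a ha
      have h1 : met S (b x₀) (colMap (fun j => V j (b x₀)) a) (colMap (fun j => V j (b x₀)) a)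
          = 0 := by
        conv_lhs => enter [2]; rw [colMap_apply]
        rw [map_sum]
        refine Finset.sum_eq_zero fun i _ => ?_
        rw [map_smul, ← hB, ha]
        exact smul_zero _
      exact colMap_injective hev.self_of_nhds.1 ((eq_zero_of_met _ h1).trans (map_zero _).symm)
    · filter_upwards [hc, hvβ, hev] with x h1 h2 h3
      funext i
      rw [hB, h1]
      refine h2 _ ?_
      have h4 : (Submodule.span ℝ (Set.range fun j => V j (b x)) : Submodule ℝ E) = subD S (b x) :=
        h3.2
      rw [← h4]
      exact Submodule.subset_span ⟨i, rfl⟩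
  exact (smoothVecAt_colMap hb hVb hcs).congr (hc.mono fun x hx => hx.symm)

/-- A section of `D` with smooth projection to the quotient is smooth. -/
theorem smoothVecAt_of_mder_piQ (hS : S.IsAdmissible GW EM)
    (hQT : IsSmoothSubmersion 𝓘(ℝ, E) 𝓘(ℝ, EQ) (piQ (Q := Q) GW))
    {b : X → Q} {v : X → E} {x₀ : X} (hb : ContMDiffAt IX 𝓘(ℝ, E) ∞ b x₀)
    (hv : ∀ᶠ x in 𝓝 x₀, v x ∈ subD S (b x))
    (hw : SmoothVecAt IX 𝓘(ℝ, EQ) (fun x => piQ GW (b x))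
      (fun x => mder 𝓘(ℝ, E) 𝓘(ℝ, EQ) (piQ (Q := Q) GW) (b x) (v x)) x₀) :
    SmoothVecAt IX 𝓘(ℝ, E) b v x₀ := by
  obtain ⟨r, V, hV, hspan⟩ := exists_frame hS.D_smooth (b x₀)
  have hev := hb.continuousAt.eventually hspan
  obtain ⟨c, hc⟩ := exists_colMap_frame (K := subD S) (hev.mono fun x hx => hx.2) hv
  have hVb : ∀ j, SmoothVecAt IX 𝓘(ℝ, E) b (fun x => V j (b x)) x₀ := fun j => (hV j).comp hb
  have hcs : ContMDiffAt IX 𝓘(ℝ, Fin r → ℝ) ∞ c x₀ := by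
    refine contMDiffAt_solve (I := 𝓘(ℝ, EQ)) (b := fun x => piQ GW (b x))
      (B := fun x => (mder 𝓘(ℝ, E) 𝓘(ℝ, EQ) (piQ (Q := Q) GW) (b x)).comp
        (colMap fun j => V j (b x))) (fun a => ?_) hw ?_ ?_
    · exact (smoothVecAt_colMap hb hVb contMDiffAt_const).mder hQT.1
    · rw [injective_iff_map_eq_zero]
      intro a ha
      obtain ⟨h1, h2⟩ := hev.self_of_nhds
      have h3 := (mem_subW_iff hS hQT).2 ha
      have h4 : colMap (fun j => V j (b x₀)) a ∈ subD S (b x₀) := colMap_mem h2 a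
      have h5 := (isCompl_DW hS (b x₀)).disjoint.le_bot ⟨h4, h3⟩
      exact colMap_injective h1 (((Submodule.mem_bot ℝ).1 h5).trans (map_zero _).symm)
    · filter_upwards [hc] with x hx
      rw [ContinuousLinearMap.comp_apply, hx]
  exact (smoothVecAt_colMap hb hVb hcs).congr (hc.mono fun x hx => hx.symm)

theorem exists_lift_mem_D (hS : S.IsAdmissible GW EM)
    (hQT : IsSmoothSubmersion 𝓘(ℝ, E) 𝓘(ℝ, EQ) (piQ (Q := Q) GW)) (q : Q) (w : EQ) :
    ∃ v ∈ subD S q, mder 𝓘(ℝ, E) 𝓘(ℝ, EQ) (piQ (Q := Q) GW) q v = w := by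
  obtain ⟨v, hv⟩ : ∃ v : E, mder 𝓘(ℝ, E) 𝓘(ℝ, EQ) (piQ (Q := Q) GW) q v = w := hQT.2 q w
  refine ⟨prD G S q v, prD_mem hS q v, ?_⟩
  rw [prD_apply, map_sub, (mem_subW_iff hS hQT).1 (formW_spec hS q v).1, sub_zero]
  exact hv

theorem mder_piQ_injOn (hS : S.IsAdmissible GW EM)
    (hQT : IsSmoothSubmersion 𝓘(ℝ, E) 𝓘(ℝ, EQ) (piQ (Q := Q) GW)) {q : Q} {v : E}
    (hv : v ∈ subD S q) (h : mder 𝓘(ℝ, E) 𝓘(ℝ, EQ) (piQ (Q := Q) GW) q v = 0) : v = 0 :=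
  (Submodule.mem_bot ℝ).1
    ((isCompl_DW hS q).disjoint.le_bot ⟨hv, (mem_subW_iff hS hQT).2 h⟩)

variable (S) in
theorem exists_sharp (q : Q) (β : E →L[ℝ] ℝ) :
    ∃ v ∈ subD S q, ∀ d ∈ subD S q, met S q v d = β d := by
  let f : subD S q →ₗ[ℝ] Module.Dual ℝ (subD S q) :=
    { toFun := fun v => (met S q v).toLinearMap.comp (subD S q).subtype
      map_add' := fun v w => LinearMap.ext fun d =>
        congrArg (fun T : E →L[ℝ] ℝ => T (d : E)) (map_add (met S q) (v : E) (w : E))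
      map_smul' := fun c v => LinearMap.ext fun d =>
        congrArg (fun T : E →L[ℝ] ℝ => T (d : E)) (map_smul (met S q) c (v : E)) }
  have hf : ∀ v d : subD S q, f v d = met S q v d := fun _ _ => rfl
  have hinj : Function.Injective f := by
    rw [injective_iff_map_eq_zero]
    intro v hv
    have h1 := hf v v
    rw [hv] at h1
    exact Subtype.ext (eq_zero_of_met q h1.symm)
  have hfr : Module.finrank ℝ (subD S q) = Module.finrank ℝ (Module.Dual ℝ (subD S q)) :=
    (Subspace.dual_finrank_eq).symm
  obtain ⟨v, hv⟩ := (LinearMap.injective_iff_surjective_of_finrank_eq_finrank hfr).1 hinj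
    (β.toLinearMap.comp (subD S q).subtype)
  exact ⟨v, v.2, fun d hd => DFunLike.congr_fun hv ⟨d, hd⟩⟩

theorem contMDiffAt_met_cov {b : X → Q} {v : X → E} {x₀ : X}
    (hv : SmoothVecAt IX 𝓘(ℝ, E) b v x₀) :
    ContMDiffAt IX (cotModel E) ∞ (fun x => (⟨b x, met S (b x) (v x)⟩ : CotBundle E Q)) x₀ :=
  contMDiffAt_cotangent_of_frame hv.base fun _ hZ =>
    (smoothTensor_met S).contMDiffAt_apply hv (hZ.comp x₀ hv.base)

end SmoothSplittings

section ConstraintManifold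

variable {EX : Type*} [NormedAddCommGroup EX] [NormedSpace ℝ EX] {HX : Type*} [TopologicalSpace HX]
  {IX : ModelWithCorners ℝ EX HX} {X : Type*} [TopologicalSpace X] [ChartedSpace HX X]
  {E : Type*} [NormedAddCommGroup E] [NormedSpace ℝ E] [FiniteDimensional ℝ E]
  {Q : Type*} [TopologicalSpace Q] [ChartedSpace E Q] [IsManifold 𝓘(ℝ, E) ∞ Q] [T2Space Q]
  {EG : Type*} [NormedAddCommGroup EG] [NormedSpace ℝ EG] [FiniteDimensional ℝ EG]
  {G : Type*} [TopologicalSpace G] [ChartedSpace EG G] [Group G] [LieGroup 𝓘(ℝ, EG) ∞ G]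
  [MulAction G Q] [ContMDiffSMul 𝓘(ℝ, EG) 𝓘(ℝ, E) ∞ G Q]
  {S : NHData E Q EG} {GW : Subgroup G} [GW.Normal]
  {EM : Type*} [NormedAddCommGroup EM] [NormedSpace ℝ EM] [FiniteDimensional ℝ EM]
  [ChartedSpace EM S.M] [IsManifold 𝓘(ℝ, EM) ∞ S.M]
  {EN : Type*} [NormedAddCommGroup EN] [NormedSpace ℝ EN] [FiniteDimensional ℝ EN]
  [ChartedSpace EN (S.MG G)] [IsManifold 𝓘(ℝ, EN) ∞ (S.MG G)]

theorem contMDiffAt_constraint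
    (hM : IsSmoothImmersion 𝓘(ℝ, EM) (cotModel E) (Subtype.val : S.M → CotBundle E Q))
    {f : X → S.M} {x₀ : X} (hf : ContMDiffAt IX (cotModel E) ∞ (fun x => (f x).1) x₀) :
    ContMDiffAt IX 𝓘(ℝ, EM) ∞ f x₀ :=
  contMDiffAt_of_comp_immersion hM
    (Topology.IsInducing.subtypeVal.continuousAt_iff.2 hf.continuousAt) hf

theorem contMDiff_tau
    (hM : IsSmoothImmersion 𝓘(ℝ, EM) (cotModel E) (Subtype.val : S.M → CotBundle E Q)) :
    ContMDiff 𝓘(ℝ, EM) 𝓘(ℝ, E) ∞ S.tau := contMDiff_cotProj.comp hM.1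

theorem contMDiffAt_cov
    (hM : IsSmoothImmersion 𝓘(ℝ, EM) (cotModel E) (Subtype.val : S.M → CotBundle E Q))
    {f : X → S.M} {Z : X → E} {x₀ : X} (hf : ContMDiffAt IX 𝓘(ℝ, EM) ∞ f x₀)
    (hZ : SmoothVecAt IX 𝓘(ℝ, E) (fun x => (f x).1.1) Z x₀) :
    ContMDiffAt IX 𝓘(ℝ, ℝ) ∞ (fun x => cov (f x) (Z x)) x₀ :=
  contMDiffAt_pairing (f := fun x => (f x).1) ((hM.1 _).comp x₀ hf) hZ

variable (EG G) in
/-- The canonical momentum map. -/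
noncomputable def momMap (m : S.M) : EG →L[ℝ] ℝ := (cov m).comp (gen E EG G m.1.1)

theorem momMap_apply (m : S.M) (ξ : EG) : momMap EG G m ξ = cov m (gen E EG G m.1.1 ξ) := rfl

theorem contMDiff_momMap
    (hM : IsSmoothImmersion 𝓘(ℝ, EM) (cotModel E) (Subtype.val : S.M → CotBundle E Q)) :
    ContMDiff 𝓘(ℝ, EM) 𝓘(ℝ, EG →L[ℝ] ℝ) ∞ (momMap EG G : S.M → EG →L[ℝ] ℝ) := fun m =>
  contMDiffAt_clm_of_apply fun _ => contMDiffAt_cov hM contMDiffAt_id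
    (smoothVecAt_gen (contMDiff_tau hM m) contMDiffAt_const)

theorem contMDiff_zeta_tau (hS : S.IsAdmissible GW EM)
    (hM : IsSmoothImmersion 𝓘(ℝ, EM) (cotModel E) (Subtype.val : S.M → CotBundle E Q))
    (i : Fin S.k) : ContMDiff 𝓘(ℝ, EM) 𝓘(ℝ, EG) ∞ (fun m : S.M => S.ζ i m.1.1) :=
  (hS.ζ_smooth i).comp (contMDiff_tau hM)

theorem contMDiff_J (hS : S.IsAdmissible GW EM)
    (hM : IsSmoothImmersion 𝓘(ℝ, EM) (cotModel E) (Subtype.val : S.M → CotBundle E Q))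
    (i : Fin S.k) : ContMDiff 𝓘(ℝ, EM) 𝓘(ℝ, ℝ) ∞ (S.J G i) := fun m =>
  contMDiffAt_cov hM contMDiffAt_id (smoothVecAt_gen (contMDiff_tau hM m)
    (contMDiff_zeta_tau hS hM i m))

theorem smoothVecAt_vel (hD : IsSmoothDistribution 𝓘(ℝ, E) S.D)
    (hM : IsSmoothImmersion 𝓘(ℝ, EM) (cotModel E) (Subtype.val : S.M → CotBundle E Q))
    {f : X → S.M} {x₀ : X} (hf : ContMDiffAt IX 𝓘(ℝ, EM) ∞ f x₀) :
    SmoothVecAt IX 𝓘(ℝ, E) (fun x => (f x).1.1) (fun x => vel (f x)) x₀ := by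
  have hb : ContMDiffAt IX 𝓘(ℝ, E) ∞ (fun x => (f x).1.1) x₀ :=
    ContMDiffAt.comp (g := S.tau) (f := f) x₀ (contMDiff_tau hM (f x₀)) hf
  refine smoothVecAt_of_met (S := S) hD (β := fun x => cov (f x)) hb (fun Z hZ => ?_)
    (Eventually.of_forall fun x => vel_mem (f x))
    (Eventually.of_forall fun x d _ => met_vel (f x) d)
  exact contMDiffAt_cov hM hf
    (SmoothVecAt.comp (b := fun q : Q => q) (f := fun x => (f x).1.1) hZ hb)

theorem contMDiffAt_mkM
    (hM : IsSmoothImmersion 𝓘(ℝ, EM) (cotModel E) (Subtype.val : S.M → CotBundle E Q))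
    {b : X → Q} {v : X → E} {x₀ : X} (hv : SmoothVecAt IX 𝓘(ℝ, E) b v x₀)
    (hm : ∀ x, v x ∈ subD S (b x)) :
    ContMDiffAt IX 𝓘(ℝ, EM) ∞ (fun x => mkM (b x) (v x) (hm x)) x₀ :=
  contMDiffAt_constraint hM (contMDiffAt_met_cov hv)

theorem actM_eq_mkM (hS : S.IsAdmissible GW EM) (g : G) (m : S.M) :
    actM hS g m = mkM (g • m.1.1) (tanAct E g m.1.1 (vel m)) (tanAct_mem_D hS g (vel_mem m)) := by
  refine M_ext (actM_base hS g m) fun w _ => ?_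
  rw [cov_mkM, ← vel_actM hS]
  exact (met_vel (actM hS g m) w).symm

theorem contMDiffAt_actM (hS : S.IsAdmissible GW EM)
    (hM : IsSmoothImmersion 𝓘(ℝ, EM) (cotModel E) (Subtype.val : S.M → CotBundle E Q))
    {g : X → G} {f : X → S.M} {x₀ : X} (hg : ContMDiffAt IX 𝓘(ℝ, EG) ∞ g x₀)
    (hf : ContMDiffAt IX 𝓘(ℝ, EM) ∞ f x₀) :
    ContMDiffAt IX 𝓘(ℝ, EM) ∞ (fun x => actM hS (g x) (f x)) x₀ := by
  simp only [actM_eq_mkM]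
  exact contMDiffAt_mkM hM
    (contMDiffAt_tanAct (E := E) hg (smoothVecAt_vel hS.D_smooth hM hf)) _

theorem contMDiff_actM (hS : S.IsAdmissible GW EM)
    (hM : IsSmoothImmersion 𝓘(ℝ, EM) (cotModel E) (Subtype.val : S.M → CotBundle E Q)) (g : G) :
    ContMDiff 𝓘(ℝ, EM) 𝓘(ℝ, EM) ∞ (actM hS g) := fun _ =>
  contMDiffAt_actM hS hM contMDiffAt_const contMDiffAt_id

theorem contMDiff_orbitM (hS : S.IsAdmissible GW EM)
    (hM : IsSmoothImmersion 𝓘(ℝ, EM) (cotModel E) (Subtype.val : S.M → CotBundle E Q)) (m : S.M) :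
    ContMDiff 𝓘(ℝ, EG) 𝓘(ℝ, EM) ∞ (fun g : G => actM hS g m) := fun _ =>
  contMDiffAt_actM hS hM contMDiffAt_id contMDiffAt_const

variable (EM) in
/-- The derivative of `τ`, as a linear map of model spaces. -/
noncomputable def dtauE (m : S.M) : EM →L[ℝ] E := mder 𝓘(ℝ, EM) 𝓘(ℝ, E) S.tau m

variable (EM) in
/-- The derivative of the inclusion of the constraint manifold. -/
noncomputable def dval (m : S.M) : EM →L[ℝ] E × (E →L[ℝ] ℝ) :=
  mder 𝓘(ℝ, EM) (cotModel E) (Subtype.val : S.M → CotBundle E Q) m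

theorem dval_fst
    (hM : IsSmoothImmersion 𝓘(ℝ, EM) (cotModel E) (Subtype.val : S.M → CotBundle E Q))
    (m : S.M) (u : EM) : (dval EM m u).1 = dtauE EM m u := by
  refine (mfderiv_cotProj m.1 (dval EM m u)).symm.trans ?_
  exact (mder_comp (I := 𝓘(ℝ, EM)) (I' := cotModel E) (I'' := 𝓘(ℝ, E))
    (g := fun β : CotBundle E Q => β.1) (f := (Subtype.val : S.M → CotBundle E Q))
    (contMDiff_cotProj _) (hM.1 m) u).symm

theorem OmegaM_apply (m : S.M) (u v : EM) :
    S.OmegaM EM m u v = (dval EM m v).2 (dval EM m u).1 - (dval EM m u).2 (dval EM m v).1 :=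
  canonicalTwoForm_apply m.1 (dval EM m u) (dval EM m v)

/-- The infinitesimal generators of the action on the constraint manifold. -/
noncomputable def genM (hS : S.IsAdmissible GW EM) (m : S.M) : EG →L[ℝ] EM :=
  mder 𝓘(ℝ, EG) 𝓘(ℝ, EM) (fun g : G => actM hS g m) 1

theorem mder_at_one {g : G → S.M} {m : S.M} {E' : Type*} [NormedAddCommGroup E'] [NormedSpace ℝ E']
    {H' : Type*} [TopologicalSpace H'] {I' : ModelWithCorners ℝ E' H'} {N' : Type*}
    [TopologicalSpace N'] [ChartedSpace H' N'] {f : S.M → N'} (hf : ContMDiff 𝓘(ℝ, EM) I' ∞ f)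
    (hg : ContMDiff 𝓘(ℝ, EG) 𝓘(ℝ, EM) ∞ g) (hg1 : g 1 = m) (ξ : EG) :
    mder 𝓘(ℝ, EM) I' f m (mder 𝓘(ℝ, EG) 𝓘(ℝ, EM) g 1 ξ) =
      mder 𝓘(ℝ, EG) I' (fun h => f (g h)) 1 ξ := by
  subst hg1
  exact (mder_comp (hf _) (hg 1) ξ).symm

theorem dtauE_genM (hS : S.IsAdmissible GW EM)
    (hM : IsSmoothImmersion 𝓘(ℝ, EM) (cotModel E) (Subtype.val : S.M → CotBundle E Q))
    (m : S.M) (ξ : EG) : dtauE EM m (genM hS m ξ) = gen E EG G m.1.1 ξ :=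
  mder_at_one (contMDiff_tau hM) (contMDiff_orbitM hS hM m) (actM_one hS m) ξ

theorem mder_rho_genM (hS : S.IsAdmissible GW EM)
    (hM : IsSmoothImmersion 𝓘(ℝ, EM) (cotModel E) (Subtype.val : S.M → CotBundle E Q))
    (hMG : IsSmoothSubmersion 𝓘(ℝ, EM) 𝓘(ℝ, EN) (S.rho G)) (m : S.M) (ξ : EG) :
    mder 𝓘(ℝ, EM) 𝓘(ℝ, EN) (S.rho G) m (genM hS m ξ) = 0 := by
  refine (mder_at_one hMG.1 (contMDiff_orbitM hS hM m) (actM_one hS m) ξ).trans ?_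
  simp only [rho_actM hS, mder_const]
  rfl

theorem exists_genM_of_curve [ProperSMul G Q] (hS : S.IsAdmissible GW EM)
    (hM : IsSmoothImmersion 𝓘(ℝ, EM) (cotModel E) (Subtype.val : S.M → CotBundle E Q))
    {m : S.M} {c : ℝ → S.M} (hc : ContMDiff 𝓘(ℝ, ℝ) 𝓘(ℝ, EM) ∞ c) (hc0 : c 0 = m)
    (h : ∀ t, ∃ g : G, c t = actM hS g m) :
    ∃ ξ, mder 𝓘(ℝ, ℝ) 𝓘(ℝ, EM) c 0 1 = genM hS m ξ := by
  choose γ hγ using h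
  obtain ⟨g, hg, hgq⟩ := exists_orbit_lift (E := E) (EG := EG) (G := G) hS.free m.1.1
    (c := fun t => S.tau (c t)) ((contMDiff_tau hM).comp hc)
    (fun t => ⟨γ t, by rw [hγ t]; exact (actM_base hS _ m).symm⟩)
  have hgγ : ∀ t, g t = γ t := fun t => injective_orbitMap hS.free m.1.1 (by
    change g t • m.1.1 = γ t • m.1.1
    rw [hgq, hγ t]
    exact actM_base hS _ m)
  have hg0 : g 0 = 1 := injective_orbitMap hS.free m.1.1 (by
    change g 0 • m.1.1 = (1 : G) • m.1.1
    rw [hgq, hc0, one_smul]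
    rfl)
  have hcg : c = fun t => actM hS (g t) m := funext fun t => by rw [hγ t, hgγ t]
  refine ⟨mder 𝓘(ℝ, ℝ) 𝓘(ℝ, EG) g 0 1, ?_⟩
  rw [hcg]
  refine (mder_comp (I := 𝓘(ℝ, ℝ)) (I' := 𝓘(ℝ, EG)) (I'' := 𝓘(ℝ, EM)) (x := (0 : ℝ))
    (g := fun h : G => actM hS h m) (f := g) (contMDiff_orbitM hS hM m _) (hg 0) 1).trans ?_
  rw [hg0]
  rfl

theorem exists_genM_of_mder_rho [ProperSMul G Q] (hS : S.IsAdmissible GW EM)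
    (hM : IsSmoothImmersion 𝓘(ℝ, EM) (cotModel E) (Subtype.val : S.M → CotBundle E Q))
    (hMG : IsSmoothSubmersion 𝓘(ℝ, EM) 𝓘(ℝ, EN) (S.rho G)) {m : S.M} {u : EM}
    (hu : mder 𝓘(ℝ, EM) 𝓘(ℝ, EN) (S.rho G) m u = 0) : ∃ ξ, u = genM hS m ξ := by
  obtain ⟨c, hc, hcf, hc0, hcu⟩ := exists_curve_in_fiber hMG m (u := u) hu
  obtain ⟨ξ, hξ⟩ := exists_genM_of_curve hS hM hc hc0 fun t => (rho_eq_iff hS).1 (hcf t).symm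
  exact ⟨ξ, hcu.symm.trans hξ⟩

theorem mder_rho_actM (hS : S.IsAdmissible GW EM)
    (hM : IsSmoothImmersion 𝓘(ℝ, EM) (cotModel E) (Subtype.val : S.M → CotBundle E Q))
    (hMG : IsSmoothSubmersion 𝓘(ℝ, EM) 𝓘(ℝ, EN) (S.rho G)) (g : G) (m : S.M) (u : EM) :
    mder 𝓘(ℝ, EM) 𝓘(ℝ, EN) (S.rho G) (actM hS g m) (mder 𝓘(ℝ, EM) 𝓘(ℝ, EM) (actM hS g) m u) =
      mder 𝓘(ℝ, EM) 𝓘(ℝ, EN) (S.rho G) m u := by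
  refine (mder_comp (hMG.1 _) (contMDiff_actM hS hM g m) u).symm.trans ?_
  simp only [rho_actM hS]

theorem dtauE_actM (hS : S.IsAdmissible GW EM)
    (hM : IsSmoothImmersion 𝓘(ℝ, EM) (cotModel E) (Subtype.val : S.M → CotBundle E Q))
    (g : G) (m : S.M) (u : EM) :
    dtauE EM (actM hS g m) (mder 𝓘(ℝ, EM) 𝓘(ℝ, EM) (actM hS g) m u) =
      tanAct E g m.1.1 (dtauE EM m u) := by
  refine (mder_comp (contMDiff_tau hM _) (contMDiff_actM hS hM g m) u).symm.trans ?_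
  exact mder_comp (I := 𝓘(ℝ, EM)) (I' := 𝓘(ℝ, E)) (I'' := 𝓘(ℝ, E)) (x := m)
    (g := fun q : Q => g • q) (f := S.tau) (contMDiff_act EG g _) (contMDiff_tau hM m) u

/-- Tangent vectors of the constraint manifold with the same image in the orbit space. -/
theorem exists_of_mder_rho_eq [ProperSMul G Q] (hS : S.IsAdmissible GW EM)
    (hM : IsSmoothImmersion 𝓘(ℝ, EM) (cotModel E) (Subtype.val : S.M → CotBundle E Q))
    (hMG : IsSmoothSubmersion 𝓘(ℝ, EM) 𝓘(ℝ, EN) (S.rho G)) {g : G} {m : S.M} {u u' : EM}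
    (hu : mder 𝓘(ℝ, EM) 𝓘(ℝ, EN) (S.rho G) m u =
      mder 𝓘(ℝ, EM) 𝓘(ℝ, EN) (S.rho G) (actM hS g m) u') :
    ∃ ξ, dtauE EM (actM hS g m) u' = tanAct E g m.1.1 (dtauE EM m u) + gen E EG G (g • m.1.1) ξ := by
  rw [← mder_rho_actM hS hM hMG g] at hu
  obtain ⟨ξ, hξ⟩ := exists_genM_of_mder_rho hS hM hMG
    (u := u' - mder 𝓘(ℝ, EM) 𝓘(ℝ, EM) (actM hS g) m u)
    (by rw [map_sub, hu, sub_self])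
  refine ⟨ξ, ?_⟩
  rw [eq_add_of_sub_eq hξ, map_add, dtauE_genM hS hM, dtauE_actM hS hM, add_comm]
  rfl

end ConstraintManifold

/-! ### The velocity of the nonholonomic vector field -/

section Dynamics

variable {E : Type*} [NormedAddCommGroup E] [NormedSpace ℝ E] [FiniteDimensional ℝ E]
  {Q : Type*} [TopologicalSpace Q] [ChartedSpace E Q] [IsManifold 𝓘(ℝ, E) ∞ Q] [T2Space Q]
  {EG : Type*} [NormedAddCommGroup EG] [NormedSpace ℝ EG] [FiniteDimensional ℝ EG]
  {S : NHData E Q EG}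
  {EM : Type*} [NormedAddCommGroup EM] [NormedSpace ℝ EM] [FiniteDimensional ℝ EM]
  [ChartedSpace EM S.M] [IsManifold 𝓘(ℝ, EM) ∞ S.M]

theorem hamiltonian_eq (m : S.M) :
    S.hamiltonian m.1 = (1 / 2) * met S m.1.1 (vel m) (vel m) + S.U m.1.1 := rfl

theorem contMDiff_hamiltonian (hD : IsSmoothDistribution 𝓘(ℝ, E) S.D)
    (hU : ContMDiff 𝓘(ℝ, E) 𝓘(ℝ, ℝ) ∞ S.U)
    (hM : IsSmoothImmersion 𝓘(ℝ, EM) (cotModel E) (Subtype.val : S.M → CotBundle E Q)) :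
    ContMDiff 𝓘(ℝ, EM) 𝓘(ℝ, ℝ) ∞ (fun m : S.M => S.hamiltonian m.1) := by
  intro m
  have hv := smoothVecAt_vel (X := S.M) hD hM (f := fun m => m) (x₀ := m) contMDiffAt_id
  exact (contMDiffAt_const.mul ((smoothTensor_met S).contMDiffAt_apply hv hv)).add
    (ContMDiffAt.comp m (hU _) (contMDiff_tau hM m))

theorem vel_mkM (q : Q) (v : E) (hv : v ∈ subD S q) : vel (mkM q v hv) = v :=
  met_left_injective (S := S) q fun w => met_vel (mkM q v hv) w

/-- The vertical curve through `m` in the direction of `w`. -/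
noncomputable def vertCurve (m : S.M) (w : E) (hw : w ∈ subD S m.1.1) (t : ℝ) : S.M :=
  mkM m.1.1 (vel m + t • w) (add_mem (vel_mem m) (Submodule.smul_mem _ t hw))

theorem vertCurve_val (m : S.M) (w : E) (hw : w ∈ subD S m.1.1) (t : ℝ) :
    (vertCurve m w hw t).1 = cotShift m.1 (t • met S m.1.1 w) := by
  refine cot_ext rfl fun x => ?_
  rw [cotShift_apply]
  refine (DFunLike.congr_fun (map_add (met S m.1.1) (vel m) (t • w)) x).trans ?_
  rw [map_smul]
  exact congrArg (· + _) (met_vel m x)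

theorem contMDiff_vertCurve
    (hM : IsSmoothImmersion 𝓘(ℝ, EM) (cotModel E) (Subtype.val : S.M → CotBundle E Q))
    (m : S.M) (w : E) (hw : w ∈ subD S m.1.1) :
    ContMDiff 𝓘(ℝ, ℝ) 𝓘(ℝ, EM) ∞ (vertCurve m w hw) := fun t =>
  contMDiffAt_constraint hM (by
    simp only [vertCurve_val]
    exact contMDiff_cotShift _ _ t)

theorem vertCurve_zero (m : S.M) (w : E) (hw : w ∈ subD S m.1.1) : vertCurve m w hw 0 = m :=
  Subtype.ext (by rw [vertCurve_val, zero_smul, cotShift_zero])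

variable (EM) in
/-- The vertical vector at `m` in the direction of `w`. -/
noncomputable def vertVec (m : S.M) (w : E) (hw : w ∈ subD S m.1.1) : EM :=
  mder 𝓘(ℝ, ℝ) 𝓘(ℝ, EM) (vertCurve m w hw) 0 1

theorem mder_at_zero {N : Type*} [TopologicalSpace N] [ChartedSpace EM N] {c : ℝ → N} {m : N}
    {E' : Type*} [NormedAddCommGroup E'] [NormedSpace ℝ E']
    {H' : Type*} [TopologicalSpace H'] {I' : ModelWithCorners ℝ E' H'} {N' : Type*}
    [TopologicalSpace N'] [ChartedSpace H' N'] {f : N → N'} (hf : ContMDiff 𝓘(ℝ, EM) I' ∞ f)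
    (hc : ContMDiff 𝓘(ℝ, ℝ) 𝓘(ℝ, EM) ∞ c) (hc0 : c 0 = m) :
    mder 𝓘(ℝ, EM) I' f m (mder 𝓘(ℝ, ℝ) 𝓘(ℝ, EM) c 0 1) =
      mder 𝓘(ℝ, ℝ) I' (fun t => f (c t)) 0 1 := by
  subst hc0
  exact (mder_comp (hf _) (hc 0) 1).symm

theorem dval_vertVec
    (hM : IsSmoothImmersion 𝓘(ℝ, EM) (cotModel E) (Subtype.val : S.M → CotBundle E Q))
    (m : S.M) (w : E) (hw : w ∈ subD S m.1.1) :
    dval EM m (vertVec EM m w hw) = (0, met S m.1.1 w) := by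
  refine (mder_at_zero hM.1 (contMDiff_vertCurve hM m w hw) (vertCurve_zero m w hw)).trans ?_
  simp only [vertCurve_val]
  exact mfderiv_cotShift m.1 (met S m.1.1 w)

theorem dReal_hamiltonian_vertVec (hD : IsSmoothDistribution 𝓘(ℝ, E) S.D)
    (hU : ContMDiff 𝓘(ℝ, E) 𝓘(ℝ, ℝ) ∞ S.U)
    (hM : IsSmoothImmersion 𝓘(ℝ, EM) (cotModel E) (Subtype.val : S.M → CotBundle E Q))
    (m : S.M) (w : E) (hw : w ∈ subD S m.1.1) :
    dReal 𝓘(ℝ, EM) (fun m : S.M => S.hamiltonian m.1) m (vertVec EM m w hw) =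
      met S m.1.1 w (vel m) := by
  refine (mder_at_zero (contMDiff_hamiltonian hD hU hM) (contMDiff_vertCurve hM m w hw)
    (vertCurve_zero m w hw)).trans ?_
  have h1 : ∀ t, S.hamiltonian (vertCurve m w hw t).1 =
      S.hamiltonian m.1 + t * met S m.1.1 w (vel m) + t ^ 2 * ((1 / 2) * met S m.1.1 w w) := by
    intro t
    rw [hamiltonian_eq, hamiltonian_eq]
    have h2 : vel (vertCurve m w hw t) = vel m + t • w := vel_mkM _ _ _
    rw [h2]
    change (1 / 2) * met S m.1.1 (vel m + t • w) (vel m + t • w) + S.U m.1.1 = _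
    rw [map_add (met S m.1.1), map_smul (met S m.1.1)]
    simp only [add_apply, smul_apply, map_add, map_smul, smul_eq_mul]
    rw [met_symm m.1.1 w (vel m)]
    ring
  have h3 : HasDerivAt (fun t : ℝ => S.hamiltonian m.1 + t * met S m.1.1 w (vel m) +
      t ^ 2 * ((1 / 2) * met S m.1.1 w w)) (met S m.1.1 w (vel m)) 0 := by
    have := (((hasDerivAt_id (0 : ℝ)).mul_const (met S m.1.1 w (vel m))).const_add
      (S.hamiltonian m.1)).add (((hasDerivAt_id (0 : ℝ)).pow 2).mul_const
        ((1 / 2) * met S m.1.1 w w))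
    refine (this.congr_deriv (by simp)).congr_of_eventuallyEq (Eventually.of_forall fun t => ?_)
    simp [one_div]
  simp only [h1]
  have h4 : mder 𝓘(ℝ, ℝ) 𝓘(ℝ, ℝ) (fun t : ℝ => S.hamiltonian m.1 + t * met S m.1.1 w (vel m) +
      t ^ 2 * ((1 / 2) * met S m.1.1 w w)) 0 = _ := h3.hasFDerivAt.hasMFDerivAt.mfderiv
  rw [h4]
  simp

theorem dtauE_of_isHam (hD : IsSmoothDistribution 𝓘(ℝ, E) S.D)
    (hU : ContMDiff 𝓘(ℝ, E) 𝓘(ℝ, ℝ) ∞ S.U)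
    (hM : IsSmoothImmersion 𝓘(ℝ, EM) (cotModel E) (Subtype.val : S.M → CotBundle E Q))
    {m : S.M} {X : EM}
    (hX : S.IsHam EM (S.OmegaM EM) (fun m => S.hamiltonian m.1) m X) : dtauE EM m X = vel m := by
  have h1 : ∀ w ∈ subD S m.1.1, met S m.1.1 w (dtauE EM m X) = met S m.1.1 w (vel m) := by
    intro w hw
    have h2 := dval_vertVec (EM := EM) hM m w hw
    have hv0 : dtauE EM m (vertVec EM m w hw) = 0 := by rw [← dval_fst hM, h2]
    have hC : dtauE EM m (vertVec EM m w hw) ∈ subD S m.1.1 := by rw [hv0]; exact zero_mem _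
    have h3 := hX.2 (vertVec EM m w hw) hC
    rw [dReal_hamiltonian_vertVec hD hU hM] at h3
    rw [← h3, OmegaM_apply, h2, dval_fst hM]
    simp
  refine sub_eq_zero.1 (eq_zero_of_met (S := S) m.1.1 ?_)
  have h4 : dtauE EM m X - vel m ∈ subD S m.1.1 := sub_mem hX.1 (vel_mem m)
  rw [map_sub, h1 _ h4, sub_self]

end Dynamics

section GaugeForms

variable {EX : Type*} [NormedAddCommGroup EX] [NormedSpace ℝ EX] {HX : Type*} [TopologicalSpace HX]
  {IX : ModelWithCorners ℝ EX HX} {X : Type*} [TopologicalSpace X] [ChartedSpace HX X]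
  {E : Type*} [NormedAddCommGroup E] [NormedSpace ℝ E] [FiniteDimensional ℝ E]
  {Q : Type*} [TopologicalSpace Q] [ChartedSpace E Q] [IsManifold 𝓘(ℝ, E) ∞ Q] [T2Space Q]
  {EG : Type*} [NormedAddCommGroup EG] [NormedSpace ℝ EG] [FiniteDimensional ℝ EG]
  {G : Type*} [TopologicalSpace G] [ChartedSpace EG G] [Group G] [LieGroup 𝓘(ℝ, EG) ∞ G]
  [MulAction G Q] [ContMDiffSMul 𝓘(ℝ, EG) 𝓘(ℝ, E) ∞ G Q]
  {S : NHData E Q EG} {GW : Subgroup G} [GW.Normal]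
  {EM : Type*} [NormedAddCommGroup EM] [NormedSpace ℝ EM] [FiniteDimensional ℝ EM]
  [ChartedSpace EM S.M] [IsManifold 𝓘(ℝ, EM) ∞ S.M]
  {EQ : Type*} [NormedAddCommGroup EQ] [NormedSpace ℝ EQ] [FiniteDimensional ℝ EQ]
  [ChartedSpace EQ (QT Q GW)] [IsManifold 𝓘(ℝ, EQ) ∞ (QT Q GW)]
  {EF : Type*} [NormedAddCommGroup EF] [NormedSpace ℝ EF] [FiniteDimensional ℝ EF]
  [ChartedSpace EF (G ⧸ GW)] [LieGroup 𝓘(ℝ, EF) ∞ (G ⧸ GW)]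

/-! ### The forms `Y` -/

theorem dReal_J_zero (hS : S.IsAdmissible GW EM)
    (hM : IsSmoothImmersion 𝓘(ℝ, EM) (cotModel E) (Subtype.val : S.M → CotBundle E Q))
    {m : S.M} (hm : momMap EG G m = 0) (i : Fin S.k) (u : EM) :
    dReal 𝓘(ℝ, EM) (S.J G i) m u = dVec 𝓘(ℝ, EM) (momMap EG G) m u (S.ζ i m.1.1) := by
  have h1 : HasMFDerivAt 𝓘(ℝ, EM) 𝓘(ℝ, EG →L[ℝ] ℝ) (momMap EG G) m
      (mfderiv 𝓘(ℝ, EM) 𝓘(ℝ, EG →L[ℝ] ℝ) (momMap EG G) m) :=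
    ((contMDiff_momMap hM m).mdifferentiableAt (by simp)).hasMFDerivAt
  have h2 : HasMFDerivAt 𝓘(ℝ, EM) 𝓘(ℝ, EG) (fun m : S.M => S.ζ i m.1.1) m
      (mfderiv 𝓘(ℝ, EM) 𝓘(ℝ, EG) (fun m : S.M => S.ζ i m.1.1) m) :=
    ((contMDiff_zeta_tau hS hM i m).mdifferentiableAt (by simp)).hasMFDerivAt
  have h3 := (isBoundedBilinearMap_apply (𝕜 := ℝ) (E := EG) (F := ℝ)).hasFDerivAt
    (momMap EG G m, S.ζ i m.1.1)
  have h0 := HasMFDerivAt.prodMk h1 h2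
  rw [← modelWithCornersSelf_prod, chartedSpaceSelf_prod] at h0
  have h4 := HasMFDerivAt.comp m (I := 𝓘(ℝ, EM)) (I' := 𝓘(ℝ, (EG →L[ℝ] ℝ) × EG))
    (I'' := 𝓘(ℝ, ℝ)) (f := fun m => (momMap EG G m, S.ζ i m.1.1))
    (g := fun p : (EG →L[ℝ] ℝ) × EG => p.1 p.2) h3.hasMFDerivAt h0
  have h5 : mfderiv 𝓘(ℝ, EM) 𝓘(ℝ, ℝ) (S.J G i) m = _ := h4.mfderiv
  have h6 : dReal 𝓘(ℝ, EM) (S.J G i) m u =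
      momMap EG G m (mder 𝓘(ℝ, EM) 𝓘(ℝ, EG) (fun m : S.M => S.ζ i m.1.1) m u) +
        dVec 𝓘(ℝ, EM) (momMap EG G) m u (S.ζ i m.1.1) := DFunLike.congr_fun h5 u
  rw [h6, hm]
  simp

theorem linearIndependent_zeta (hS : S.IsAdmissible GW EM)
    (hM : IsSmoothImmersion 𝓘(ℝ, EM) (cotModel E) (Subtype.val : S.M → CotBundle E Q)) (q : Q) :
    LinearIndependent ℝ (fun i => S.ζ i q) := by
  have hm : momMap EG G (mkM (S := S) q 0 (zero_mem _)) = 0 := by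
    ext ξ
    rw [momMap_apply, cov_mkM, map_zero]
    rfl
  refine Fintype.linearIndependent_iff.2 fun c hc => ?_
  refine Fintype.linearIndependent_iff.1 (hS.J_indep (mkM (S := S) q 0 (zero_mem _))) c ?_
  refine ContinuousLinearMap.ext fun u => ?_
  rw [sum_apply]
  refine Eq.trans (b := dVec 𝓘(ℝ, EM) (momMap EG G) (mkM (S := S) q 0 (zero_mem _)) u
    (∑ i, c i • S.ζ i q)) ?_ ?_
  · rw [map_sum]
    refine Finset.sum_congr rfl fun i _ => ?_
    rw [map_smul]
    exact congrArg (c i • ·) (dReal_J_zero hS hM hm i u)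
  · rw [hc, map_zero]
    rfl

theorem exists_zeta_coeff (hS : S.IsAdmissible GW EM)
    (hM : IsSmoothImmersion 𝓘(ℝ, EM) (cotModel E) (Subtype.val : S.M → CotBundle E Q)) {q : Q}
    {ξ : EG} (hξ : gen E EG G q ξ ∈ subD S q) : ∃ c, colMap (fun i => S.ζ i q) c = ξ := by
  refine exists_colMap_eq ?_
  let K : Submodule ℝ EG := (subD S q).comap (gen E EG G q).toLinearMap
  have h1 : Submodule.span ℝ (Set.range fun i => S.ζ i q) ≤ K := by
    rw [Submodule.span_le]
    rintro _ ⟨i, rfl⟩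
    exact zeta_mem hS i q
  have h2 : Module.finrank ℝ K = S.k := by
    have h3 : Module.finrank ℝ
        (subD S q ⊓ LinearMap.range (gen E EG G q).toLinearMap : Submodule ℝ E) = S.k :=
      hS.rank_S q
    rw [← h3, inf_comm, ← Submodule.map_comap_eq]
    exact (Submodule.equivMapOfInjective _ (gen_injective q hS) K).finrank_eq
  have h4 : Module.finrank ℝ (Submodule.span ℝ (Set.range fun i => S.ζ i q)) = S.k := by
    rw [finrank_span_eq_card (linearIndependent_zeta hS hM q), Fintype.card_fin]
  rw [Submodule.eq_of_le_of_finrank_eq h1 (h4.trans h2.symm)]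
  exact hξ

variable (S G) in
/-- The forms `Y^i`. -/
noncomputable def formY (i : Fin S.k) (q : Q) : E →L[ℝ] ℝ := S.Y G i q

theorem formV_prD_mem (hS : S.IsAdmissible GW EM) (q : Q) (v : E) :
    gen E EG G q (formV G S q (prD G S q v)) ∈ subD S q := by
  have h1 := sub_mem (prD_mem hS q v) (subHor_le hS q (formV_spec hS q (prD G S q v)))
  rwa [prHor_apply, sub_sub_cancel] at h1

theorem formY_spec (hS : S.IsAdmissible GW EM)
    (hM : IsSmoothImmersion 𝓘(ℝ, EM) (cotModel E) (Subtype.val : S.M → CotBundle E Q))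
    (i : Fin S.k) (q : Q) :
    (∀ v ∈ subHor S q, formY G S i q v = 0) ∧ (∀ v ∈ subW S q, formY G S i q v = 0) ∧
      ∀ j, formY G S i q (gen E EG G q (S.ζ j q)) = if i = j then 1 else 0 := by
  have hinj := colMap_injective (linearIndependent_zeta hS hM q)
  obtain ⟨L, hL⟩ := LinearMap.exists_leftInverse_of_injective
    (colMap fun i => S.ζ i q).toLinearMap (LinearMap.ker_eq_bot.2 hinj)
  have hLj : ∀ j, L (S.ζ j q) = Pi.single j 1 := by
    intro j
    have h1 := DFunLike.congr_fun hL (Pi.single j (1 : ℝ))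
    have h2 : colMap (fun i => S.ζ i q) (Pi.single j (1 : ℝ)) = S.ζ j q := by
      rw [colMap_apply, Finset.sum_eq_single j]
      · simp
      · intro b _ hb
        simp [hb]
      · simp
    rw [← h2]
    exact h1
  have hex : ∃ θ : E →L[ℝ] ℝ, (∀ v ∈ subHor S q, θ v = 0) ∧ (∀ v ∈ subW S q, θ v = 0) ∧
      ∀ j, θ (gen E EG G q (S.ζ j q)) = if i = j then 1 else 0 := by
    refine ⟨((ContinuousLinearMap.proj (R := ℝ) (φ := fun _ : Fin S.k => ℝ) i).comp
      L.toContinuousLinearMap).comp ((formV G S q).comp (prD G S q)), ?_, ?_, ?_⟩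
    · intro v hv
      change L (formV G S q (prD G S q v)) i = 0
      rw [prD_of_mem hS (subHor_le hS q hv),
        formV_eq hS (ξ := 0) (by rw [map_zero, sub_zero]; exact hv), map_zero]
      rfl
    · intro v hv
      change L (formV G S q (prD G S q v)) i = 0
      rw [prD_of_mem_W hS hv, map_zero, map_zero]
      rfl
    · intro j
      change L (formV G S q (prD G S q (gen E EG G q (S.ζ j q)))) i = _
      rw [prD_of_mem hS (zeta_mem hS j q), formV_gen hS, hLj, Pi.single_apply]
  exact Classical.epsilon_spec hex

theorem prD_eq_add (q : Q) (hS : S.IsAdmissible GW EM) (v : E) :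
    prD G S q v = prHor G S q v + gen E EG G q (formV G S q (prD G S q v)) := by
  have h1 : prHor G S q (prD G S q v) = prHor G S q v := by
    conv_lhs => rw [prD_apply, map_sub, prHor_gen hS, sub_zero]
  rw [← h1, prHor_apply q (prD G S q v), sub_add_cancel]

theorem colMap_formY (hS : S.IsAdmissible GW EM)
    (hM : IsSmoothImmersion 𝓘(ℝ, EM) (cotModel E) (Subtype.val : S.M → CotBundle E Q))
    (q : Q) (v : E) :
    colMap (fun i => S.ζ i q) (fun i => formY G S i q v) = formV G S q (prD G S q v) := by
  obtain ⟨c, hc⟩ := exists_zeta_coeff hS hM (formV_prD_mem hS q v)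
  rw [← hc]
  congr 1
  funext i
  obtain ⟨h1, h2, h3⟩ := formY_spec hS hM i q
  have h4 : v = gen E EG G q (formW G S q v) + (prHor G S q v +
      ∑ j, c j • gen E EG G q (S.ζ j q)) := by
    have h5 : gen E EG G q (formV G S q (prD G S q v)) = ∑ j, c j • gen E EG G q (S.ζ j q) := by
      rw [← hc, colMap_apply, map_sum]
      exact Finset.sum_congr rfl fun j _ => map_smul _ _ _
    rw [← h5, ← prD_eq_add q hS, prD_apply, add_sub_cancel]
  rw [h4, map_add, map_add, h2 _ (formW_spec hS q v).1, h1 _ (formV_spec hS q v), map_sum, zero_add,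
    zero_add]
  simp only [map_smul, h3, smul_eq_mul]
  simp

theorem prD_eq (hS : S.IsAdmissible GW EM)
    (hM : IsSmoothImmersion 𝓘(ℝ, EM) (cotModel E) (Subtype.val : S.M → CotBundle E Q))
    (q : Q) (v : E) :
    prD G S q v = prHor G S q v + ∑ i, formY G S i q v • gen E EG G q (S.ζ i q) := by
  rw [prD_eq_add q hS, ← colMap_formY hS hM, colMap_apply, map_sum]
  simp only [map_smul]

theorem formY_tanAct (hS : S.IsAdmissible GW EM)
    (hM : IsSmoothImmersion 𝓘(ℝ, EM) (cotModel E) (Subtype.val : S.M → CotBundle E Q))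
    (hQT : IsSmoothSubmersion 𝓘(ℝ, E) 𝓘(ℝ, EQ) (piQ (Q := Q) GW))
    (i : Fin S.k) (g : G) (q : Q) (v : E) :
    formY G S i (g • q) (tanAct E g q v) = formY G S i q v := by
  refine congrFun (colMap_injective (linearIndependent_zeta hS hM (g • q))
    (a₁ := fun i => formY G S i (g • q) (tanAct E g q v)) (a₂ := fun i => formY G S i q v) ?_) i
  rw [colMap_formY hS hM, prD_tanAct hS hQT, formV_tanAct hS, ← colMap_formY hS hM, colMap_apply,
    colMap_apply, map_sum]
  simp only [map_smul, zeta_smul hS]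

theorem contMDiffAt_formY (hS : S.IsAdmissible GW EM)
    (hM : IsSmoothImmersion 𝓘(ℝ, EM) (cotModel E) (Subtype.val : S.M → CotBundle E Q))
    (hQT : IsSmoothSubmersion 𝓘(ℝ, E) 𝓘(ℝ, EQ) (piQ (Q := Q) GW))
    (hF : IsSmoothSubmersion 𝓘(ℝ, EG) 𝓘(ℝ, EF) (fun g : G => (g : G ⧸ GW)))
    (i : Fin S.k) {b : X → Q} {T : X → E} {x₀ : X} (hT : SmoothVecAt IX 𝓘(ℝ, E) b T x₀) :
    ContMDiffAt IX 𝓘(ℝ, ℝ) ∞ (fun x => formY G S i (b x) (T x)) x₀ := by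
  have h1 : ContMDiffAt IX 𝓘(ℝ, Fin S.k → ℝ) ∞ (fun x i => formY G S i (b x) (T x)) x₀ := by
    refine contMDiffAt_of_injective (B := fun x => colMap fun i => S.ζ i (b x))
      (c := fun x => formV G S (b x) (prD G S (b x) (T x)))
      (contMDiffAt_clm_of_apply fun a => ?_) (contMDiffAt_formV hS (hT.prD hS hQT hF))
      (colMap_injective (linearIndependent_zeta hS hM (b x₀)))
      (Eventually.of_forall fun x => colMap_formY hS hM (b x) (T x))
    simp only [colMap_apply]
    refine contMDiffAt_sum _ fun j _ => ?_
    have h2 : ContMDiffAt IX 𝓘(ℝ, EG) ∞ (fun x => S.ζ j (b x)) x₀ :=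
      ContMDiffAt.comp x₀ (hS.ζ_smooth j (b x₀)) hT.base
    have h3 : ContMDiffAt IX 𝓘(ℝ, ℝ) ∞ (fun _ : X => a j) x₀ := contMDiffAt_const
    exact h3.smul h2
  exact contMDiffAt_pi_space.1 h1 i

theorem smoothOneForm_Y (hS : S.IsAdmissible GW EM)
    (hM : IsSmoothImmersion 𝓘(ℝ, EM) (cotModel E) (Subtype.val : S.M → CotBundle E Q))
    (hQT : IsSmoothSubmersion 𝓘(ℝ, E) 𝓘(ℝ, EQ) (piQ (Q := Q) GW))
    (hF : IsSmoothSubmersion 𝓘(ℝ, EG) 𝓘(ℝ, EF) (fun g : G => (g : G ⧸ GW)))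
    (i : Fin S.k) : SmoothOneForm 𝓘(ℝ, E) (fun q : Q => S.Y G i q) := fun z =>
  contMDiffAt_formY hS hM hQT hF i (smoothVecAt_tangentBundle z)

/-! ### The curvatures -/

theorem isTwoForm_KW (hS : S.IsAdmissible GW EM)
    (hQT : IsSmoothSubmersion 𝓘(ℝ, E) 𝓘(ℝ, EQ) (piQ (Q := Q) GW))
    (hF : IsSmoothSubmersion 𝓘(ℝ, EG) 𝓘(ℝ, EF) (fun g : G => (g : G ⧸ GW))) :
    IsTwoForm 𝓘(ℝ, E) (fun (q : Q) u v => S.KW G q u v) :=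
  (smoothOneForm_formW hS hQT hF).isTwoForm_extDerivOne.bundlePullback (f := fun q : Q => q)
    (fun q u v => map_add (prD G S q) u v) (fun q c u => map_smul (prD G S q) c u)
    (fun z => SmoothVecAt.prD hS hQT hF (smoothVecAt_tangentBundle z))

theorem isTwoForm_KV (hS : S.IsAdmissible GW EM) :
    IsTwoForm 𝓘(ℝ, E) (fun (q : Q) u v => S.KV G q u v) :=
  (smoothOneForm_formV hS).isTwoForm_extDerivOne.bundlePullback (f := fun q : Q => q)
    (fun q u v => map_add (prHor G S q) u v) (fun q c u => map_smul (prHor G S q) c u)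
    (fun z => SmoothVecAt.prHor hS (smoothVecAt_tangentBundle z))

theorem isTwoForm_dDY (hS : S.IsAdmissible GW EM)
    (hM : IsSmoothImmersion 𝓘(ℝ, EM) (cotModel E) (Subtype.val : S.M → CotBundle E Q))
    (hQT : IsSmoothSubmersion 𝓘(ℝ, E) 𝓘(ℝ, EQ) (piQ (Q := Q) GW))
    (hF : IsSmoothSubmersion 𝓘(ℝ, EG) 𝓘(ℝ, EF) (fun g : G => (g : G ⧸ GW))) (i : Fin S.k) :
    IsTwoForm 𝓘(ℝ, E) (fun (q : Q) u v => S.dDY G i q u v) :=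
  (smoothOneForm_Y hS hM hQT hF i).isTwoForm_extDerivOne.bundlePullback (f := fun q : Q => q)
    (fun q u v => map_add (prD G S q) u v) (fun q c u => map_smul (prD G S q) c u)
    (fun z => SmoothVecAt.prD hS hQT hF (smoothVecAt_tangentBundle z))

theorem isTwoForm_sigma (hS : S.IsAdmissible GW EM)
    (hM : IsSmoothImmersion 𝓘(ℝ, EM) (cotModel E) (Subtype.val : S.M → CotBundle E Q))
    (hQT : IsSmoothSubmersion 𝓘(ℝ, E) 𝓘(ℝ, EQ) (piQ (Q := Q) GW))
    (hF : IsSmoothSubmersion 𝓘(ℝ, EG) 𝓘(ℝ, EF) (fun g : G => (g : G ⧸ GW))) :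
    IsTwoForm 𝓘(ℝ, E) (fun (q : Q) u v => S.sigma G q u v) :=
  (isTwoForm_KW hS hQT hF).add (IsTwoForm.sum _ fun i _ =>
    (isTwoForm_dDY hS hM hQT hF i).smul_fun (hS.ζ_smooth i))

theorem extDerivOne_equivariant {V : Type*} [NormedAddCommGroup V] [NormedSpace ℝ V]
    (EG : Type*) [NormedAddCommGroup EG]
    [NormedSpace ℝ EG] {G : Type*} [TopologicalSpace G] [ChartedSpace EG G] [Group G]
    [MulAction G Q] [ContMDiffSMul 𝓘(ℝ, EG) 𝓘(ℝ, E) ∞ G Q]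
    {θ : ∀ q : Q, TangentSpace 𝓘(ℝ, E) q →L[ℝ] V} (hθ : SmoothOneForm 𝓘(ℝ, E) θ) (T : V →L[ℝ] V)
    (g : G) (h : ∀ (q : Q) (v : E), θ (g • q) (tanAct E g q v) = T (θ q v)) (q : Q) (u v : E) :
    extDerivOne 𝓘(ℝ, E) θ (g • q) (tanAct E g q u) (tanAct E g q v) =
      T (extDerivOne 𝓘(ℝ, E) θ q u v) := by
  refine (hθ.extDerivOne_pullback (f := fun q : Q => g • q) (contMDiff_act EG g q) u v).symm.trans ?_
  refine Eq.trans ?_ (hθ.extDerivOne_clm_comp T q u v)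
  refine congrArg (fun θ : ∀ q : Q, TangentSpace 𝓘(ℝ, E) q →L[ℝ] V =>
    extDerivOne 𝓘(ℝ, E) θ q u v) ?_
  exact funext fun x => ContinuousLinearMap.ext fun a => h x a

theorem KW_tanAct (hS : S.IsAdmissible GW EM)
    (hQT : IsSmoothSubmersion 𝓘(ℝ, E) 𝓘(ℝ, EQ) (piQ (Q := Q) GW))
    (hF : IsSmoothSubmersion 𝓘(ℝ, EG) 𝓘(ℝ, EF) (fun g : G => (g : G ⧸ GW))) (g : G) (q : Q)
    {u v u' v' : E} (hu : prD G S (g • q) u' = tanAct E g q (prD G S q u))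
    (hv : prD G S (g • q) v' = tanAct E g q (prD G S q v)) :
    S.KW G (g • q) u' v' = adAct EG g (S.KW G q u v) := by
  refine Eq.trans ?_ (extDerivOne_equivariant EG (smoothOneForm_formW hS hQT hF) (adAct EG g) g
    (fun q v => formW_tanAct hS hQT g q v) q (prD G S q u) (prD G S q v))
  rw [← hu, ← hv]
  rfl

theorem dDY_tanAct (hS : S.IsAdmissible GW EM)
    (hM : IsSmoothImmersion 𝓘(ℝ, EM) (cotModel E) (Subtype.val : S.M → CotBundle E Q))
    (hQT : IsSmoothSubmersion 𝓘(ℝ, E) 𝓘(ℝ, EQ) (piQ (Q := Q) GW))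
    (hF : IsSmoothSubmersion 𝓘(ℝ, EG) 𝓘(ℝ, EF) (fun g : G => (g : G ⧸ GW))) (i : Fin S.k) (g : G)
    (q : Q) {u v u' v' : E} (hu : prD G S (g • q) u' = tanAct E g q (prD G S q u))
    (hv : prD G S (g • q) v' = tanAct E g q (prD G S q v)) :
    S.dDY G i (g • q) u' v' = S.dDY G i q u v := by
  refine Eq.trans ?_ (extDerivOne_equivariant EG (smoothOneForm_Y hS hM hQT hF i)
    (ContinuousLinearMap.id ℝ ℝ) g
    (fun q v => formY_tanAct hS hM hQT i g q v) q (prD G S q u) (prD G S q v))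
  rw [← hu, ← hv]
  rfl

theorem KV_tanAct (hS : S.IsAdmissible GW EM) (g : G) (q : Q)
    {u v u' v' : E} (hu : prHor G S (g • q) u' = tanAct E g q (prHor G S q u))
    (hv : prHor G S (g • q) v' = tanAct E g q (prHor G S q v)) :
    S.KV G (g • q) u' v' = adAct EG g (S.KV G q u v) := by
  refine Eq.trans ?_ (extDerivOne_equivariant EG (smoothOneForm_formV hS) (adAct EG g) g
    (fun q v => formV_tanAct hS g q v) q (prHor G S q u) (prHor G S q v))
  rw [← hu, ← hv]
  rfl

theorem sigma_tanAct (hS : S.IsAdmissible GW EM)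
    (hM : IsSmoothImmersion 𝓘(ℝ, EM) (cotModel E) (Subtype.val : S.M → CotBundle E Q))
    (hQT : IsSmoothSubmersion 𝓘(ℝ, E) 𝓘(ℝ, EQ) (piQ (Q := Q) GW))
    (hF : IsSmoothSubmersion 𝓘(ℝ, EG) 𝓘(ℝ, EF) (fun g : G => (g : G ⧸ GW))) (g : G)
    (q : Q) (u v : E) :
    S.sigma G (g • q) (tanAct E g q u) (tanAct E g q v) = adAct EG g (S.sigma G q u v) := by
  have hu := prD_tanAct hS hQT g q u
  have hv := prD_tanAct hS hQT g q v
  have h1 : adAct EG g (S.sigma G q u v) = adAct EG g (S.KW G q u v) +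
      ∑ i, S.dDY G i q u v • adAct EG g (S.ζ i q) := by
    refine (map_add _ _ _).trans ?_
    rw [map_sum]
    simp only [map_smul]
  rw [h1, ← KW_tanAct hS hQT hF g q hu hv]
  refine congrArg₂ (· + ·) rfl (Finset.sum_congr rfl fun i _ => ?_)
  rw [← zeta_smul hS]
  exact congrArg (· • _) (dDY_tanAct hS hM hQT hF i g q hu hv)

end GaugeForms

section ReducedForms

variable {E : Type*} [NormedAddCommGroup E] [NormedSpace ℝ E] [FiniteDimensional ℝ E]
  {Q : Type*} [TopologicalSpace Q] [ChartedSpace E Q] [IsManifold 𝓘(ℝ, E) ∞ Q] [T2Space Q]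
  {EG : Type*} [NormedAddCommGroup EG] [NormedSpace ℝ EG] [FiniteDimensional ℝ EG]
  {G : Type*} [TopologicalSpace G] [ChartedSpace EG G] [Group G] [LieGroup 𝓘(ℝ, EG) ∞ G]
  [MulAction G Q] [ContMDiffSMul 𝓘(ℝ, EG) 𝓘(ℝ, E) ∞ G Q]
  {S : NHData E Q EG} {GW : Subgroup G} [GW.Normal]
  {EM : Type*} [NormedAddCommGroup EM] [NormedSpace ℝ EM] [FiniteDimensional ℝ EM]
  [ChartedSpace EM S.M] [IsManifold 𝓘(ℝ, EM) ∞ S.M]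
  {EQ : Type*} [NormedAddCommGroup EQ] [NormedSpace ℝ EQ] [FiniteDimensional ℝ EQ]
  [ChartedSpace EQ (QT Q GW)] [IsManifold 𝓘(ℝ, EQ) ∞ (QT Q GW)]
  {EF : Type*} [NormedAddCommGroup EF] [NormedSpace ℝ EF] [FiniteDimensional ℝ EF]
  [ChartedSpace EF (G ⧸ GW)] [LieGroup 𝓘(ℝ, EF) ∞ (G ⧸ GW)]

theorem contMDiffAt_tangentBundle_proj (z : TangentBundle 𝓘(ℝ, EM) S.M) :
    ContMDiffAt (𝓘(ℝ, EM)).tangent 𝓘(ℝ, EM) ∞ (fun z : TangentBundle 𝓘(ℝ, EM) S.M => z.1) z :=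
  (contMDiff_proj _) z

theorem smoothVecAt_dtauE
    (hM : IsSmoothImmersion 𝓘(ℝ, EM) (cotModel E) (Subtype.val : S.M → CotBundle E Q))
    (z : TangentBundle 𝓘(ℝ, EM) S.M) :
    SmoothVecAt (𝓘(ℝ, EM)).tangent 𝓘(ℝ, E) (fun z : TangentBundle 𝓘(ℝ, EM) S.M => z.1.1.1)
      (fun z => dtauE EM z.1 z.2) z := by
  have h : SmoothVecAt (𝓘(ℝ, EM)).tangent 𝓘(ℝ, EM)
    (fun z : TangentBundle 𝓘(ℝ, EM) S.M => z.1) (fun z => z.2) z := contMDiffAt_id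
  exact h.mder (contMDiff_tau hM)

/-! ### The gauge terms -/

theorem isTwoForm_JKW (hS : S.IsAdmissible GW EM)
    (hM : IsSmoothImmersion 𝓘(ℝ, EM) (cotModel E) (Subtype.val : S.M → CotBundle E Q))
    (hQT : IsSmoothSubmersion 𝓘(ℝ, E) 𝓘(ℝ, EQ) (piQ (Q := Q) GW))
    (hF : IsSmoothSubmersion 𝓘(ℝ, EG) 𝓘(ℝ, EF) (fun g : G => (g : G ⧸ GW))) :
    IsTwoForm 𝓘(ℝ, EM) (fun (m : S.M) u v => S.JKW G EM m u v) :=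
  ((isTwoForm_KW hS hQT hF).pullback (contMDiff_tau hM)).pairing (contMDiff_momMap hM)

theorem isTwoForm_B1 (hS : S.IsAdmissible GW EM)
    (hM : IsSmoothImmersion 𝓘(ℝ, EM) (cotModel E) (Subtype.val : S.M → CotBundle E Q))
    (hQT : IsSmoothSubmersion 𝓘(ℝ, E) 𝓘(ℝ, EQ) (piQ (Q := Q) GW))
    (hF : IsSmoothSubmersion 𝓘(ℝ, EG) 𝓘(ℝ, EF) (fun g : G => (g : G ⧸ GW))) :
    IsTwoForm 𝓘(ℝ, EM) (fun (m : S.M) u v => S.B1 G EM m u v) :=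
  (isTwoForm_JKW hS hM hQT hF).add (IsTwoForm.sum _ fun i _ =>
    ((isTwoForm_dDY hS hM hQT hF i).pullback (contMDiff_tau hM)).smul_vec (contMDiff_J hS hM i))

variable (S G) in
/-- The pairing `κ(a, σ(P_V w, c)_Q)`. -/
noncomputable def kappaSigma (q : Q) (w a c : E) : ℝ :=
  met S q a (gen E EG G q (S.sigma G q (gen E EG G q (formV G S q w)) c))

theorem kappaWedge_eq (hX : ∀ m : S.M, dtauE EM m (S.Xnh EM m) = vel m) (m : S.M) (u v : EM) :
    S.kappaWedge G EM m u v =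
      kappaSigma G S m.1.1 (vel m) (prHor G S m.1.1 (dtauE EM m u)) (prHor G S m.1.1 (dtauE EM m v)) -
      kappaSigma G S m.1.1 (vel m) (prHor G S m.1.1 (dtauE EM m v))
        (prHor G S m.1.1 (dtauE EM m u)) := by
  rw [← hX m]
  rfl

theorem isSmoothTensor_kappaSigma (hS : S.IsAdmissible GW EM)
    (hM : IsSmoothImmersion 𝓘(ℝ, EM) (cotModel E) (Subtype.val : S.M → CotBundle E Q))
    (hQT : IsSmoothSubmersion 𝓘(ℝ, E) 𝓘(ℝ, EQ) (piQ (Q := Q) GW))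
    (hF : IsSmoothSubmersion 𝓘(ℝ, EG) 𝓘(ℝ, EF) (fun g : G => (g : G ⧸ GW))) :
    IsSmoothTensor 𝓘(ℝ, EM) (fun (m : S.M) (u v : EM) => kappaSigma G S m.1.1 (vel m)
      (prHor G S m.1.1 (dtauE EM m u)) (prHor G S m.1.1 (dtauE EM m v))) := by
  have hσ := isTwoForm_sigma hS hM hQT hF
  refine (smoothTensor_met S).bundlePullback (f := S.tau)
    (Φ := fun m u => prHor G S m.1.1 (dtauE EM m u))
    (Φ' := fun m v => gen E EG G m.1.1 (S.sigma G m.1.1 (gen E EG G m.1.1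
      (formV G S m.1.1 (vel m))) (prHor G S m.1.1 (dtauE EM m v)))) ?_ ?_ ?_ ?_ ?_ ?_
  · exact fun m u v => map_add ((prHor G S m.1.1).comp (dtauE EM m)) u v
  · exact fun m c u => map_smul ((prHor G S m.1.1).comp (dtauE EM m)) c u
  · exact fun z => SmoothVecAt.prHor hS (smoothVecAt_dtauE hM z)
  · intro m u v
    refine Eq.trans ?_ (map_add (gen E EG G m.1.1) _ _)
    refine congrArg (gen E EG G m.1.1) ?_
    refine Eq.trans ?_ (hσ.add_right m.1.1 _ _ _)
    exact congrArg (S.sigma G m.1.1 _) (map_add ((prHor G S m.1.1).comp (dtauE EM m)) u v)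
  · intro m c u
    refine Eq.trans ?_ (map_smul (gen E EG G m.1.1) _ _)
    refine congrArg (gen E EG G m.1.1) ?_
    refine Eq.trans ?_ (hσ.smul_right m.1.1 _ _ _)
    exact congrArg (S.sigma G m.1.1 _) (map_smul ((prHor G S m.1.1).comp (dtauE EM m)) c u)
  · intro z
    have hb : ContMDiffAt (𝓘(ℝ, EM)).tangent 𝓘(ℝ, E) ∞
        (fun z : TangentBundle 𝓘(ℝ, EM) S.M => z.1.1.1) z := (smoothVecAt_dtauE hM z).base
    have hv := smoothVecAt_vel hS.D_smooth hM (contMDiffAt_tangentBundle_proj z)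
    exact smoothVecAt_gen hb (hσ.contMDiffAt_apply
      (smoothVecAt_gen hb (contMDiffAt_formV hS hv))
      (SmoothVecAt.prHor hS (smoothVecAt_dtauE hM z)))

theorem isTwoForm_calB (hS : S.IsAdmissible GW EM)
    (hM : IsSmoothImmersion 𝓘(ℝ, EM) (cotModel E) (Subtype.val : S.M → CotBundle E Q))
    (hQT : IsSmoothSubmersion 𝓘(ℝ, E) 𝓘(ℝ, EQ) (piQ (Q := Q) GW))
    (hF : IsSmoothSubmersion 𝓘(ℝ, EG) 𝓘(ℝ, EF) (fun g : G => (g : G ⧸ GW)))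
    (hX : ∀ m : S.M, dtauE EM m (S.Xnh EM m) = vel m) (s : ℝ) :
    IsTwoForm 𝓘(ℝ, EM) (fun (m : S.M) u v => S.calB G EM s m u v) := by
  have h1 := ((((isTwoForm_KV hS).pullback (contMDiff_tau hM)).clm_comp
    (s • ContinuousLinearMap.id ℝ EG)).pairing (contMDiff_momMap (EG := EG) (G := G) hM)).sub
    ((IsTwoForm.antisymm (isSmoothTensor_kappaSigma hS hM hQT hF)).clm_comp
      ((1 / 2 : ℝ) • ContinuousLinearMap.id ℝ ℝ))
  have h2 : (fun (m : S.M) (u v : EM) => S.calB G EM s m u v) = fun m u v =>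
      momMap EG G m ((s • ContinuousLinearMap.id ℝ EG)
        (S.KV G m.1.1 (dtauE EM m u) (dtauE EM m v))) -
      ((1 / 2 : ℝ) • ContinuousLinearMap.id ℝ ℝ) (
        kappaSigma G S m.1.1 (vel m) (prHor G S m.1.1 (dtauE EM m u)) (prHor G S m.1.1 (dtauE EM m v)) -
        kappaSigma G S m.1.1 (vel m) (prHor G S m.1.1 (dtauE EM m v))
          (prHor G S m.1.1 (dtauE EM m u))) := by
    funext m u v
    rw [← kappaWedge_eq hX]
    rfl
  exact h2 ▸ h1

theorem isTwoForm_Bform (hS : S.IsAdmissible GW EM)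
    (hM : IsSmoothImmersion 𝓘(ℝ, EM) (cotModel E) (Subtype.val : S.M → CotBundle E Q))
    (hQT : IsSmoothSubmersion 𝓘(ℝ, E) 𝓘(ℝ, EQ) (piQ (Q := Q) GW))
    (hF : IsSmoothSubmersion 𝓘(ℝ, EG) 𝓘(ℝ, EF) (fun g : G => (g : G ⧸ GW)))
    (hX : ∀ m : S.M, dtauE EM m (S.Xnh EM m) = vel m) (s : ℝ) :
    IsTwoForm 𝓘(ℝ, EM) (fun (m : S.M) u v => S.Bform G EM s m u v) :=
  (isTwoForm_B1 hS hM hQT hF).add (isTwoForm_calB hS hM hQT hF hX s)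

/-! ### Invariance of the gauge terms -/

theorem momMap_actM (hS : S.IsAdmissible GW EM) (g : G) (m : S.M) (ξ : EG) :
    momMap EG G (actM hS g m) (adAct EG g ξ) = momMap EG G m ξ := momentum_actM hS g m ξ

theorem JKW_actM (hS : S.IsAdmissible GW EM)
    (hQT : IsSmoothSubmersion 𝓘(ℝ, E) 𝓘(ℝ, EQ) (piQ (Q := Q) GW))
    (hF : IsSmoothSubmersion 𝓘(ℝ, EG) 𝓘(ℝ, EF) (fun g : G => (g : G ⧸ GW))) (g : G) (m : S.M)
    {u v u' v' : EM} (hu : prD G S (g • m.1.1) (dtauE EM (actM hS g m) u') =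
      tanAct E g m.1.1 (prD G S m.1.1 (dtauE EM m u)))
    (hv : prD G S (g • m.1.1) (dtauE EM (actM hS g m) v') =
      tanAct E g m.1.1 (prD G S m.1.1 (dtauE EM m v))) :
    S.JKW G EM (actM hS g m) u' v' = S.JKW G EM m u v := by
  refine Eq.trans ?_ (momMap_actM hS g m _)
  exact congrArg (momMap EG G (actM hS g m)) (KW_tanAct hS hQT hF g m.1.1 hu hv)

theorem B1_actM (hS : S.IsAdmissible GW EM)
    (hM : IsSmoothImmersion 𝓘(ℝ, EM) (cotModel E) (Subtype.val : S.M → CotBundle E Q))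
    (hQT : IsSmoothSubmersion 𝓘(ℝ, E) 𝓘(ℝ, EQ) (piQ (Q := Q) GW))
    (hF : IsSmoothSubmersion 𝓘(ℝ, EG) 𝓘(ℝ, EF) (fun g : G => (g : G ⧸ GW))) (g : G) (m : S.M)
    {u v u' v' : EM} (hu : prD G S (g • m.1.1) (dtauE EM (actM hS g m) u') =
      tanAct E g m.1.1 (prD G S m.1.1 (dtauE EM m u)))
    (hv : prD G S (g • m.1.1) (dtauE EM (actM hS g m) v') =
      tanAct E g m.1.1 (prD G S m.1.1 (dtauE EM m v))) :
    S.B1 G EM (actM hS g m) u' v' = S.B1 G EM m u v := by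
  refine congrArg₂ (· + ·) (JKW_actM hS hQT hF g m hu hv) (Finset.sum_congr rfl fun i _ => ?_)
  exact congrArg₂ (· * ·) (J_actM hS g m i) (dDY_tanAct hS hM hQT hF i g m.1.1 hu hv)

theorem kappaSigma_tanAct (hS : S.IsAdmissible GW EM)
    (hM : IsSmoothImmersion 𝓘(ℝ, EM) (cotModel E) (Subtype.val : S.M → CotBundle E Q))
    (hQT : IsSmoothSubmersion 𝓘(ℝ, E) 𝓘(ℝ, EQ) (piQ (Q := Q) GW))
    (hF : IsSmoothSubmersion 𝓘(ℝ, EG) 𝓘(ℝ, EF) (fun g : G => (g : G ⧸ GW))) (g : G) (q : Q)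
    (w a c : E) : kappaSigma G S (g • q) (tanAct E g q w) (tanAct E g q a) (tanAct E g q c) =
      kappaSigma G S q w a c := by
  have h1 := sigma_tanAct hS hM hQT hF g q (gen E EG G q (formV G S q w)) c
  rw [tanAct_gen, ← formV_tanAct hS] at h1
  have h2 : kappaSigma G S (g • q) (tanAct E g q w) (tanAct E g q a) (tanAct E g q c) =
    met S (g • q) (tanAct E g q a) (gen E EG G (g • q) (adAct EG g
      (S.sigma G q (gen E EG G q (formV G S q w)) c))) := by rw [← h1]; rfl
  rw [h2, ← tanAct_gen, met_tanAct hS]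
  rfl

theorem calB_actM (hS : S.IsAdmissible GW EM)
    (hM : IsSmoothImmersion 𝓘(ℝ, EM) (cotModel E) (Subtype.val : S.M → CotBundle E Q))
    (hQT : IsSmoothSubmersion 𝓘(ℝ, E) 𝓘(ℝ, EQ) (piQ (Q := Q) GW))
    (hF : IsSmoothSubmersion 𝓘(ℝ, EG) 𝓘(ℝ, EF) (fun g : G => (g : G ⧸ GW)))
    (hX : ∀ m : S.M, dtauE EM m (S.Xnh EM m) = vel m) (s : ℝ) (g : G) (m : S.M)
    {u v u' v' : EM} (hu : prHor G S (g • m.1.1) (dtauE EM (actM hS g m) u') =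
      tanAct E g m.1.1 (prHor G S m.1.1 (dtauE EM m u)))
    (hv : prHor G S (g • m.1.1) (dtauE EM (actM hS g m) v') =
      tanAct E g m.1.1 (prHor G S m.1.1 (dtauE EM m v))) :
    S.calB G EM s (actM hS g m) u' v' = S.calB G EM s m u v := by
  refine congrArg₂ (· - ·) ?_ (congrArg ((1 / 2 : ℝ) * ·) ?_)
  · refine Eq.trans ?_ (momMap_actM hS g m _)
    rw [map_smul]
    exact congrArg (fun ξ => momMap EG G (actM hS g m) (s • ξ)) (KV_tanAct hS g m.1.1 hu hv)
  · rw [kappaWedge_eq hX, kappaWedge_eq hX]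
    change kappaSigma G S (g • m.1.1) _ (prHor G S (g • m.1.1) _) (prHor G S (g • m.1.1) _) -
      kappaSigma G S (g • m.1.1) _ (prHor G S (g • m.1.1) _) (prHor G S (g • m.1.1) _) = _
    rw [hu, hv, vel_actM hS, kappaSigma_tanAct hS hM hQT hF, kappaSigma_tanAct hS hM hQT hF]

/-! ### The Liouville form and its components -/

variable (G S EM) in
/-- The form `m(P_D Tτ ·)`. -/
noncomputable def thetaD (m : S.M) : TangentSpace 𝓘(ℝ, EM) m →L[ℝ] ℝ :=
  ((cov m).comp ((prD G S m.1.1).comp (dtauE EM m)) : EM →L[ℝ] ℝ)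

variable (G S EM) in
/-- The form `m(P_Hor Tτ ·)`. -/
noncomputable def thetaH (m : S.M) : TangentSpace 𝓘(ℝ, EM) m →L[ℝ] ℝ :=
  ((cov m).comp ((prHor G S m.1.1).comp (dtauE EM m)) : EM →L[ℝ] ℝ)

theorem smoothOneForm_thetaD (hS : S.IsAdmissible GW EM)
    (hM : IsSmoothImmersion 𝓘(ℝ, EM) (cotModel E) (Subtype.val : S.M → CotBundle E Q))
    (hQT : IsSmoothSubmersion 𝓘(ℝ, E) 𝓘(ℝ, EQ) (piQ (Q := Q) GW))
    (hF : IsSmoothSubmersion 𝓘(ℝ, EG) 𝓘(ℝ, EF) (fun g : G => (g : G ⧸ GW))) :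
    SmoothOneForm 𝓘(ℝ, EM) (thetaD G S EM) := fun z =>
  contMDiffAt_cov hM (contMDiffAt_tangentBundle_proj z)
    (SmoothVecAt.prD hS hQT hF (smoothVecAt_dtauE hM z))

theorem smoothOneForm_thetaH (hS : S.IsAdmissible GW EM)
    (hM : IsSmoothImmersion 𝓘(ℝ, EM) (cotModel E) (Subtype.val : S.M → CotBundle E Q)) :
    SmoothOneForm 𝓘(ℝ, EM) (thetaH G S EM) := fun z =>
  contMDiffAt_cov hM (contMDiffAt_tangentBundle_proj z)
    (SmoothVecAt.prHor hS (smoothVecAt_dtauE hM z))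

theorem thetaH_actM (hS : S.IsAdmissible GW EM) (g : G) (m : S.M)
    {u u' : EM} (hu : prHor G S (g • m.1.1) (dtauE EM (actM hS g m) u') =
      tanAct E g m.1.1 (prHor G S m.1.1 (dtauE EM m u))) :
    thetaH G S EM (actM hS g m) u' = thetaH G S EM m u := by
  refine Eq.trans ?_ (cov_actM hS g m (prHor G S m.1.1 (dtauE EM m u)))
  exact congrArg (cov (actM hS g m)) hu

theorem liouville_pullback (m : S.M)
    (hM : IsSmoothImmersion 𝓘(ℝ, EM) (cotModel E) (Subtype.val : S.M → CotBundle E Q)) (u : EM) :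
    liouville E m.1 (dval EM m u) = cov m (dtauE EM m u) := by
  rw [← dval_fst hM]
  exact congrArg (cov m) (mfderiv_cotProj m.1 (dval EM m u))

theorem thetaD_eq (hS : S.IsAdmissible GW EM)
    (hM : IsSmoothImmersion 𝓘(ℝ, EM) (cotModel E) (Subtype.val : S.M → CotBundle E Q)) :
    thetaD G S EM = fun m => thetaH G S EM m + ∑ i, S.J G i m •
      (S.Y G i (S.tau m)).comp (mfderiv 𝓘(ℝ, EM) 𝓘(ℝ, E) S.tau m) := by
  funext m
  refine ContinuousLinearMap.ext fun u => ?_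
  rw [add_apply, sum_apply]
  change cov m (prD G S m.1.1 (dtauE EM m u)) = cov m (prHor G S m.1.1 (dtauE EM m u)) +
    ∑ i, cov m (gen E EG G m.1.1 (S.ζ i m.1.1)) * formY G S i m.1.1 (dtauE EM m u)
  rw [prD_eq hS hM, map_add, map_sum]
  simp only [map_smul, smul_eq_mul, mul_comm]

theorem extDerivOne_thetaD (hS : S.IsAdmissible GW EM)
    (hM : IsSmoothImmersion 𝓘(ℝ, EM) (cotModel E) (Subtype.val : S.M → CotBundle E Q))
    (hQT : IsSmoothSubmersion 𝓘(ℝ, E) 𝓘(ℝ, EQ) (piQ (Q := Q) GW))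
    (hF : IsSmoothSubmersion 𝓘(ℝ, EG) 𝓘(ℝ, EF) (fun g : G => (g : G ⧸ GW))) (m : S.M)
    (u v : EM) :
    extDerivOne 𝓘(ℝ, EM) (thetaD G S EM) m u v = extDerivOne 𝓘(ℝ, EM) (thetaH G S EM) m u v +
      ∑ i, (S.J G i m * extDerivOne 𝓘(ℝ, E) (fun q : Q => S.Y G i q) m.1.1 (dtauE EM m u) (dtauE EM m v) +
        dReal 𝓘(ℝ, EM) (S.J G i) m u * formY G S i m.1.1 (dtauE EM m v) -
        dReal 𝓘(ℝ, EM) (S.J G i) m v * formY G S i m.1.1 (dtauE EM m u)) := by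
  have hY := fun i => (smoothOneForm_Y hS hM hQT hF i).pullback (contMDiff_tau hM)
  have hJY := fun i => (hY i).smul (contMDiff_J hS hM i)
  rw [thetaD_eq hS hM]
  refine ((smoothOneForm_thetaH hS hM).extDerivOne_add
    (SmoothOneForm.sum _ fun i _ => hJY i) m u v).trans (congrArg₂ (· + ·) rfl ?_)
  refine (SmoothOneForm.extDerivOne_sum _ (fun i _ => hJY i) m u v).trans
    (Finset.sum_congr rfl fun i _ => ?_)
  refine ((hY i).extDerivOne_smul (contMDiff_J hS hM i) m u v).trans ?_
  refine congrArg₂ (· - ·) (congrArg₂ (· + ·) (congrArg (S.J G i m * ·) ?_) rfl) rfl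
  exact (smoothOneForm_Y hS hM hQT hF i).extDerivOne_pullback (contMDiff_tau hM m) u v

theorem OmegaM_eq (hS : S.IsAdmissible GW EM)
    (hM : IsSmoothImmersion 𝓘(ℝ, EM) (cotModel E) (Subtype.val : S.M → CotBundle E Q))
    (hQT : IsSmoothSubmersion 𝓘(ℝ, E) 𝓘(ℝ, EQ) (piQ (Q := Q) GW))
    (hF : IsSmoothSubmersion 𝓘(ℝ, EG) 𝓘(ℝ, EF) (fun g : G => (g : G ⧸ GW))) {m : S.M}
    {u v : EM} (hu : dtauE EM m u ∈ subD S m.1.1) (hv : dtauE EM m v ∈ subD S m.1.1) :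
    S.OmegaM EM m u v = - extDerivOne 𝓘(ℝ, EM) (thetaD G S EM) m u v - S.JKW G EM m u v := by
  have hA := (smoothOneForm_formW hS hQT hF).pullback (contMDiff_tau hM)
  have h1 : S.OmegaM EM m u v = - extDerivOne 𝓘(ℝ, EM) (fun m : S.M => (liouville E m.1).comp
      (mfderiv 𝓘(ℝ, EM) (cotModel E) (Subtype.val : S.M → CotBundle E Q) m)) m u v :=
    congrArg Neg.neg (smoothOneForm_liouville.extDerivOne_pullback (hM.1 m) u v).symm
  have h2 : (fun m : S.M => (liouville E m.1).comp
      (mfderiv 𝓘(ℝ, EM) (cotModel E) (Subtype.val : S.M → CotBundle E Q) m)) = fun m : S.M =>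
      thetaD G S EM m + (momMap EG G m).comp ((S.AW G (S.tau m)).comp
        (mfderiv 𝓘(ℝ, EM) 𝓘(ℝ, E) S.tau m)) := by
    funext m
    refine ContinuousLinearMap.ext fun u => (liouville_pullback m hM u).trans ?_
    rw [add_apply]
    change _ = cov m (prD G S m.1.1 (dtauE EM m u)) +
      cov m (gen E EG G m.1.1 (formW G S m.1.1 (dtauE EM m u)))
    rw [← map_add, prD_apply, sub_add_cancel]
  have h3 : extDerivOne 𝓘(ℝ, EM) (fun m : S.M => (momMap EG G m).comp
      ((S.AW G (S.tau m)).comp (mfderiv 𝓘(ℝ, EM) 𝓘(ℝ, E) S.tau m))) m u v = S.JKW G EM m u v := by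
    refine (hA.extDerivOne_pairing (contMDiff_momMap hM) m u v).trans ?_
    have e1 : ∀ {w : EM}, dtauE EM m w ∈ subD S m.1.1 → ((S.AW G (S.tau m)).comp
        (mfderiv 𝓘(ℝ, EM) 𝓘(ℝ, E) S.tau m)) w = 0 := fun hw => formW_of_mem hS hw
    rw [e1 hu, e1 hv]
    simp only [map_zero, add_zero, sub_zero]
    refine congrArg (momMap EG G m) ?_
    refine ((smoothOneForm_formW hS hQT hF).extDerivOne_pullback (contMDiff_tau hM m) u v).trans ?_
    change extDerivOne 𝓘(ℝ, E) (fun q : Q => S.AW G q) m.1.1 (dtauE EM m u) (dtauE EM m v) =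
      extDerivOne 𝓘(ℝ, E) (fun q : Q => S.AW G q) m.1.1 (prD G S m.1.1 (dtauE EM m u))
        (prD G S m.1.1 (dtauE EM m v))
    rw [prD_of_mem hS hu, prD_of_mem hS hv]
  rw [h1, h2]
  refine (congrArg Neg.neg ((smoothOneForm_thetaD hS hM hQT hF).extDerivOne_add
    (hA.pairing (contMDiff_momMap hM)) m u v)).trans ?_
  rw [h3, neg_add, sub_eq_add_neg]

theorem OmegaB_eq (hS : S.IsAdmissible GW EM)
    (hM : IsSmoothImmersion 𝓘(ℝ, EM) (cotModel E) (Subtype.val : S.M → CotBundle E Q))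
    (hQT : IsSmoothSubmersion 𝓘(ℝ, E) 𝓘(ℝ, EQ) (piQ (Q := Q) GW))
    (hF : IsSmoothSubmersion 𝓘(ℝ, EG) 𝓘(ℝ, EF) (fun g : G => (g : G ⧸ GW))) (s : ℝ) {m : S.M}
    {u v : EM} (hu : dtauE EM m u ∈ subD S m.1.1) (hv : dtauE EM m v ∈ subD S m.1.1) :
    S.OmegaB G EM s m u v = - extDerivOne 𝓘(ℝ, EM) (thetaH G S EM) m u v + S.calB G EM s m u v +
      ∑ i, (formY G S i m.1.1 (dtauE EM m u) * dReal 𝓘(ℝ, EM) (S.J G i) m v -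
        formY G S i m.1.1 (dtauE EM m v) * dReal 𝓘(ℝ, EM) (S.J G i) m u) := by
  have h1 : S.OmegaB G EM s m u v = S.OmegaM EM m u v + ((S.JKW G EM m u v + ∑ i, S.J G i m *
      extDerivOne 𝓘(ℝ, E) (fun q : Q => S.Y G i q) m.1.1 (prD G S m.1.1 (dtauE EM m u))
        (prD G S m.1.1 (dtauE EM m v))) + S.calB G EM s m u v) := rfl
  rw [h1, OmegaM_eq hS hM hQT hF hu hv, extDerivOne_thetaD hS hM hQT hF, prD_of_mem hS hu,
    prD_of_mem hS hv]
  have h2 : ∀ a b c d e : Fin S.k → ℝ, ∑ i, a i = ∑ i, (a i + b i * c i - d i * e i) +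
      ∑ i, (e i * d i - c i * b i) := by
    intro a b c d e
    rw [← Finset.sum_add_distrib]
    exact Finset.sum_congr rfl fun i _ => by ring
  rw [h2 (fun i => S.J G i m * extDerivOne 𝓘(ℝ, E) (fun q : Q => S.Y G i q) m.1.1
    (dtauE EM m u) (dtauE EM m v)) (fun i => dReal 𝓘(ℝ, EM) (S.J G i) m u)
    (fun i => formY G S i m.1.1 (dtauE EM m v)) (fun i => dReal 𝓘(ℝ, EM) (S.J G i) m v)
    (fun i => formY G S i m.1.1 (dtauE EM m u))]
  ring

end ReducedForms

section PartialReduction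

variable {E : Type*} [NormedAddCommGroup E] [NormedSpace ℝ E] [FiniteDimensional ℝ E]
  {Q : Type*} [TopologicalSpace Q] [ChartedSpace E Q] [IsManifold 𝓘(ℝ, E) ∞ Q] [T2Space Q]
  {EG : Type*} [NormedAddCommGroup EG] [NormedSpace ℝ EG] [FiniteDimensional ℝ EG]
  {G : Type*} [TopologicalSpace G] [ChartedSpace EG G] [Group G] [LieGroup 𝓘(ℝ, EG) ∞ G]
  [MulAction G Q] [ContMDiffSMul 𝓘(ℝ, EG) 𝓘(ℝ, E) ∞ G Q]
  {S : NHData E Q EG} {GW : Subgroup G} [GW.Normal]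
  {EM : Type*} [NormedAddCommGroup EM] [NormedSpace ℝ EM] [FiniteDimensional ℝ EM]
  [ChartedSpace EM S.M] [IsManifold 𝓘(ℝ, EM) ∞ S.M]
  {EN : Type*} [NormedAddCommGroup EN] [NormedSpace ℝ EN] [FiniteDimensional ℝ EN]
  [ChartedSpace EN (S.MG G)] [IsManifold 𝓘(ℝ, EN) ∞ (S.MG G)]
  {EQ : Type*} [NormedAddCommGroup EQ] [NormedSpace ℝ EQ] [FiniteDimensional ℝ EQ]
  [ChartedSpace EQ (QT Q GW)] [IsManifold 𝓘(ℝ, EQ) ∞ (QT Q GW)]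
  {EF : Type*} [NormedAddCommGroup EF] [NormedSpace ℝ EF] [FiniteDimensional ℝ EF]
  [ChartedSpace EF (G ⧸ GW)] [LieGroup 𝓘(ℝ, EF) ∞ (G ⧸ GW)]

variable (GW EQ) in
/-- The derivative of the projection `Q → Q/G_W`, as a linear map of model spaces. -/
noncomputable def dpi (q : Q) : E →L[ℝ] EQ := mder 𝓘(ℝ, E) 𝓘(ℝ, EQ) (piQ (Q := Q) GW) q

theorem exists_linear_lift (hS : S.IsAdmissible GW EM)
    (hQT : IsSmoothSubmersion 𝓘(ℝ, E) 𝓘(ℝ, EQ) (piQ (Q := Q) GW)) (q : Q) :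
    ∃ R : EQ →L[ℝ] E, (∀ w, R w ∈ subD S q) ∧ ∀ w, dpi GW EQ q (R w) = w := by
  obtain ⟨R, hR⟩ := (dpi GW EQ q : E →L[ℝ] EQ).toLinearMap.exists_rightInverse_of_surjective
    (LinearMap.range_eq_top.2 (hQT.2 q))
  refine ⟨(prD G S q).comp R.toContinuousLinearMap, fun w => prD_mem hS q (R w), fun w => ?_⟩
  change dpi GW EQ q (prD G S q (R w)) = w
  rw [prD_apply, map_sub]
  have h1 : dpi GW EQ q (gen E EG G q (formW G S q (R w))) = 0 :=
    (mem_subW_iff hS hQT).1 (formW_spec hS q (R w)).1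
  rw [h1, sub_zero]
  exact DFunLike.congr_fun hR w

theorem dpi_prD (hS : S.IsAdmissible GW EM)
    (hQT : IsSmoothSubmersion 𝓘(ℝ, E) 𝓘(ℝ, EQ) (piQ (Q := Q) GW)) (q : Q) (v : E) :
    dpi GW EQ q (prD G S q v) = dpi GW EQ q v := by
  have h1 : dpi GW EQ q (gen E EG G q (formW G S q v)) = 0 :=
    (mem_subW_iff hS hQT).1 (formW_spec hS q v).1
  rw [prD_apply, map_sub, h1, sub_zero]

variable (GW EQ) in
/-- The covector `ρ_{G_W}(m)`, on the model space. -/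
noncomputable def covP (m : S.M) : EQ →L[ℝ] ℝ := (S.rhoGW GW EQ m).2

theorem covP_dpi (hS : S.IsAdmissible GW EM)
    (hQT : IsSmoothSubmersion 𝓘(ℝ, E) 𝓘(ℝ, EQ) (piQ (Q := Q) GW)) (m : S.M) {v : E}
    (hv : v ∈ subD S m.1.1) : covP GW EQ m (dpi GW EQ m.1.1 v) = cov m v := by
  have hex : ∃ α : EQ →L[ℝ] ℝ, ∀ v ∈ subD S m.1.1, α (dpi GW EQ m.1.1 v) = cov m v := by
    obtain ⟨R, hR, hR'⟩ := exists_linear_lift hS hQT m.1.1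
    refine ⟨(cov m).comp R, fun v hv => ?_⟩
    rw [ContinuousLinearMap.comp_apply]
    congr 1
    refine sub_eq_zero.1 (mder_piQ_injOn hS hQT (sub_mem (hR _) hv) ?_)
    change dpi GW EQ m.1.1 _ = 0
    rw [map_sub, hR', sub_self]
  exact (Classical.epsilon_spec hex : ∀ v ∈ subD S m.1.1, covP GW EQ m (dpi GW EQ m.1.1 v) =
    cov m v) v hv

theorem rhoGW_eq_of (hS : S.IsAdmissible GW EM)
    (hQT : IsSmoothSubmersion 𝓘(ℝ, E) 𝓘(ℝ, EQ) (piQ (Q := Q) GW)) {m : S.M}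
    {α : CotBundle EQ (QT Q GW)} (h1 : piQ GW m.1.1 = α.1)
    (h2 : ∀ v ∈ subD S m.1.1, (α.2 : EQ →L[ℝ] ℝ) (dpi GW EQ m.1.1 v) = cov m v) :
    S.rhoGW GW EQ m = α := by
  refine cot_ext h1 fun w => ?_
  obtain ⟨R, hR, hR'⟩ := exists_linear_lift hS hQT m.1.1
  rw [← hR' w, h2 _ (hR w)]
  exact covP_dpi hS hQT m (hR w)

theorem contMDiff_rhoGW (hS : S.IsAdmissible GW EM)
    (hM : IsSmoothImmersion 𝓘(ℝ, EM) (cotModel E) (Subtype.val : S.M → CotBundle E Q))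
    (hQT : IsSmoothSubmersion 𝓘(ℝ, E) 𝓘(ℝ, EQ) (piQ (Q := Q) GW)) :
    ContMDiff 𝓘(ℝ, EM) (cotModel EQ) ∞ (S.rhoGW GW EQ) := by
  intro m
  have hb : ContMDiff 𝓘(ℝ, EM) 𝓘(ℝ, EQ) ∞ (fun m : S.M => piQ GW m.1.1) :=
    hQT.1.comp (contMDiff_tau hM)
  refine contMDiffAt_cotangent_of_frame (hb m) fun Z hZ => ?_
  choose v hv hvw using fun m : S.M => exists_lift_mem_D hS hQT m.1.1 (Z (piQ GW m.1.1))
  have h1 : SmoothVecAt 𝓘(ℝ, EM) 𝓘(ℝ, E) (fun m : S.M => m.1.1) v m := by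
    refine smoothVecAt_of_mder_piQ hS hQT (contMDiff_tau hM m) (Eventually.of_forall hv) ?_
    simp only [hvw]
    exact SmoothVecAt.comp (I' := 𝓘(ℝ, EQ)) (b := fun x : QT Q GW => x) (v := Z)
      (f := fun m : S.M => piQ GW m.1.1) hZ (hb m)
  refine (contMDiffAt_cov hM contMDiffAt_id h1).congr_of_eventuallyEq
    (Eventually.of_forall fun m' => ?_)
  refine Eq.trans ?_ (covP_dpi hS hQT m' (hv m'))
  exact congrArg (covP GW EQ m') (hvw m').symm

theorem dpi_tanAct_of_mem (g : G) (hg : g ∈ GW)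
    (hQT : IsSmoothSubmersion 𝓘(ℝ, E) 𝓘(ℝ, EQ) (piQ (Q := Q) GW)) (q : Q) (v : E)
    (hsm : ∀ g : G, ContMDiff 𝓘(ℝ, E) 𝓘(ℝ, E) ∞ (fun q : Q => g • q)) :
    dpi GW EQ (g • q) (tanAct E g q v) = dpi GW EQ q v := by
  refine (mder_comp (I := 𝓘(ℝ, E)) (I' := 𝓘(ℝ, E)) (I'' := 𝓘(ℝ, EQ)) (x := q) (g := piQ GW)
    (f := fun q : Q => g • q) (hQT.1 _) (hsm g q) v).symm.trans ?_
  have h1 : (fun q : Q => piQ GW (g • q)) = piQ GW :=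
    funext fun q => (piQ_eq_iff.2 ⟨g, hg, rfl⟩).symm
  rw [h1]
  rfl

theorem sameOrbit_GW_iff (hS : S.IsAdmissible GW EM) {m m' : S.M} :
    S.SameOrbit GW m m' ↔ ∃ g ∈ GW, m' = actM hS g m :=
  ⟨fun ⟨g, hg⟩ => ⟨g, g.2, Subtype.ext hg⟩,
    fun ⟨g, hg, h⟩ => ⟨⟨g, hg⟩, congrArg Subtype.val h⟩⟩

theorem rhoGW_actM_of_mem (hS : S.IsAdmissible GW EM)
    (hQT : IsSmoothSubmersion 𝓘(ℝ, E) 𝓘(ℝ, EQ) (piQ (Q := Q) GW)) {g : G} (hg : g ∈ GW)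
    (m : S.M) : S.rhoGW GW EQ (actM hS g m) = S.rhoGW GW EQ m := by
  refine rhoGW_eq_of hS hQT (piQ_eq_iff.2 ⟨g, hg, rfl⟩).symm fun v hv => ?_
  have h1 : tanAct E g⁻¹ (g • m.1.1) v ∈ subD S m.1.1 := by
    have := tanAct_mem_D hS g⁻¹ hv
    rwa [actM_base, inv_smul_smul] at this
  have h2 : v = tanAct E g m.1.1 (tanAct E g⁻¹ (g • m.1.1) v) :=
    (tanAct_tanAct_inv EG g m.1.1 v).symm
  rw [h2, cov_actM]
  refine Eq.trans ?_ (covP_dpi hS hQT m h1)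
  exact congrArg (covP GW EQ m) (dpi_tanAct_of_mem g hg hQT _ _ (fun g => contMDiff_act EG g))

theorem rhoGW_eq_iff (hS : S.IsAdmissible GW EM)
    (hQT : IsSmoothSubmersion 𝓘(ℝ, E) 𝓘(ℝ, EQ) (piQ (Q := Q) GW)) {m m' : S.M} :
    S.rhoGW GW EQ m = S.rhoGW GW EQ m' ↔ ∃ g ∈ GW, m' = actM hS g m := by
  constructor
  · intro h
    obtain ⟨g, hg, hgq⟩ := piQ_eq_iff.1 (congrArg (fun α : CotBundle EQ (QT Q GW) => α.1) h :
      piQ GW m.1.1 = piQ GW m'.1.1)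
    refine ⟨g, hg, M_ext hgq.symm fun v hv => ?_⟩
    have hv' : v ∈ subD S (actM hS g m).1.1 := by
      rw [actM_base, hgq]
      exact hv
    rw [← covP_dpi hS hQT m' hv, ← covP_dpi hS hQT _ hv', actM_base, hgq]
    refine congrArg (fun α : CotBundle EQ (QT Q GW) => (α.2 : EQ →L[ℝ] ℝ) _) ?_
    rw [rhoGW_actM_of_mem hS hQT hg, h]
  · rintro ⟨g, hg, rfl⟩
    exact (rhoGW_actM_of_mem hS hQT hg m).symm

theorem rhoGW_surjective (hS : S.IsAdmissible GW EM)
    (hQT : IsSmoothSubmersion 𝓘(ℝ, E) 𝓘(ℝ, EQ) (piQ (Q := Q) GW)) :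
    Function.Surjective (S.rhoGW GW EQ) := by
  intro α
  obtain ⟨q, hq⟩ := piQ_surjective α.1
  obtain ⟨v, hv, hvd⟩ := exists_sharp S q ((α.2 : EQ →L[ℝ] ℝ).comp (dpi GW EQ q))
  exact ⟨mkM q v hv, rhoGW_eq_of hS hQT hq fun d hd => (hvd d hd).symm⟩

theorem fst_mder_rhoGW (hS : S.IsAdmissible GW EM)
    (hM : IsSmoothImmersion 𝓘(ℝ, EM) (cotModel E) (Subtype.val : S.M → CotBundle E Q))
    (hQT : IsSmoothSubmersion 𝓘(ℝ, E) 𝓘(ℝ, EQ) (piQ (Q := Q) GW)) (m : S.M) (u : EM) :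
    (mder 𝓘(ℝ, EM) (cotModel EQ) (S.rhoGW GW EQ) m u).1 = dpi GW EQ m.1.1 (dtauE EM m u) := by
  refine (mfderiv_cotProj (S.rhoGW GW EQ m) _).symm.trans ?_
  refine (mder_comp (I := 𝓘(ℝ, EM)) (I' := cotModel EQ) (I'' := 𝓘(ℝ, EQ))
    (g := fun β : CotBundle EQ (QT Q GW) => β.1) (f := S.rhoGW GW EQ)
    (contMDiff_cotProj _) (contMDiff_rhoGW hS hM hQT m) u).symm.trans ?_
  exact mder_comp (I := 𝓘(ℝ, EM)) (I' := 𝓘(ℝ, E)) (I'' := 𝓘(ℝ, EQ)) (x := m)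
    (g := piQ (Q := Q) GW) (f := S.tau) (hQT.1 _) (contMDiff_tau hM m) u

/-- Local sections of `ρ_{G_W}` tangent to the constraints. -/
theorem exists_section_rhoGW (hS : S.IsAdmissible GW EM)
    (hM : IsSmoothImmersion 𝓘(ℝ, EM) (cotModel E) (Subtype.val : S.M → CotBundle E Q))
    (hQT : IsSmoothSubmersion 𝓘(ℝ, E) 𝓘(ℝ, EQ) (piQ (Q := Q) GW)) (m : S.M) :
    ∃ s : CotBundle EQ (QT Q GW) → S.M,
      ContMDiffAt (cotModel EQ) 𝓘(ℝ, EM) ∞ s (S.rhoGW GW EQ m) ∧ s (S.rhoGW GW EQ m) = m ∧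
      (∀ᶠ α in 𝓝 (S.rhoGW GW EQ m), S.rhoGW GW EQ (s α) = α) ∧
      ∀ w : EQ × (EQ →L[ℝ] ℝ), dtauE EM m
        (mder (cotModel EQ) 𝓘(ℝ, EM) s (S.rhoGW GW EQ m) w) ∈ subD S m.1.1 := by
  obtain ⟨R, hR, hR'⟩ := exists_linear_lift hS hQT m.1.1
  obtain ⟨σ, hσ, hσq, hσπ, hσR⟩ := exists_local_section (hQT.1 m.1.1) R hR'
  set α₀ := S.rhoGW GW EQ m with hα₀
  have hσ₀ : σ α₀.1 = m.1.1 := hσq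
  choose v hv hvd using fun α : CotBundle EQ (QT Q GW) =>
    exists_sharp S (σ α.1) ((α.2 : EQ →L[ℝ] ℝ).comp (dpi GW EQ (σ α.1)))
  let s : CotBundle EQ (QT Q GW) → S.M := fun α => mkM (σ α.1) (v α) (hv α)
  have hb : ContMDiffAt (cotModel EQ) 𝓘(ℝ, E) ∞ (fun α : CotBundle EQ (QT Q GW) => σ α.1) α₀ :=
    ContMDiffAt.comp (g := σ) (f := fun α : CotBundle EQ (QT Q GW) => α.1) α₀ hσ
      (contMDiff_cotProj α₀)
  have hπσ : ∀ᶠ α in 𝓝 α₀, piQ GW (σ α.1) = α.1 :=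
    (contMDiff_cotProj (E := EQ) (Q := QT Q GW) α₀).continuousAt.eventually hσπ
  have hs : ContMDiffAt (cotModel EQ) 𝓘(ℝ, EM) ∞ s α₀ := by
    refine contMDiffAt_mkM hM (smoothVecAt_of_met hS.D_smooth hb (fun Z hZ => ?_)
      (Eventually.of_forall hv) (Eventually.of_forall hvd)) hv
    have h1 := (SmoothVecAt.comp (IX := cotModel EQ) (b := fun q : Q => q)
      (f := fun α : CotBundle EQ (QT Q GW) => σ α.1) hZ hb).mder hQT.1
    refine contMDiffAt_pairing (f := fun α : CotBundle EQ (QT Q GW) => α)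
      (Z := fun α => dpi GW EQ (σ α.1) (Z (σ α.1))) contMDiffAt_id
      (ContMDiffAt.congr_of_eventuallyEq h1 ?_)
    filter_upwards [hπσ] with α hα
    exact TotalSpace.ext hα.symm HEq.rfl
  have hρs : ∀ᶠ α in 𝓝 α₀, S.rhoGW GW EQ (s α) = α := by
    filter_upwards [hπσ] with α hα
    exact rhoGW_eq_of hS hQT hα fun d hd => (hvd α d hd).symm
  have hsm : s α₀ = m := by
    refine M_ext hσ₀ fun d hd => ?_
    have hd' : d ∈ subD S m.1.1 := hσ₀ ▸ hd
    refine (hvd α₀ d hd).trans ?_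
    rw [← covP_dpi hS hQT m hd', ← hσ₀]
    rfl
  refine ⟨s, hs, hsm, hρs, fun w => ?_⟩
  have h1 : dtauE EM m (mder (cotModel EQ) 𝓘(ℝ, EM) s α₀ w) =
      mder (cotModel EQ) 𝓘(ℝ, E) (fun α : CotBundle EQ (QT Q GW) => S.tau (s α)) α₀ w := by
    have h2 := mder_comp (I := cotModel EQ) (I' := 𝓘(ℝ, EM)) (I'' := 𝓘(ℝ, E)) (g := S.tau) (f := s)
      (contMDiff_tau hM _) hs w
    rw [h2, hsm]
    rfl
  have h3 : mder (cotModel EQ) 𝓘(ℝ, E) (fun α : CotBundle EQ (QT Q GW) => σ α.1) α₀ w = R w.1 := by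
    refine (mder_comp (I := cotModel EQ) (I' := 𝓘(ℝ, EQ)) (I'' := 𝓘(ℝ, E)) (g := σ)
      (f := fun α : CotBundle EQ (QT Q GW) => α.1) hσ (contMDiff_cotProj α₀) w).trans ?_
    refine (hσR _).trans (congrArg R ?_)
    exact mfderiv_cotProj α₀ w
  rw [h1]
  exact h3 ▸ hR w.1

/-- A linear lift of tangent vectors of `T^*(Q/G_W)` to the constraint distribution. -/
theorem exists_linear_lift_rhoGW (hS : S.IsAdmissible GW EM)
    (hM : IsSmoothImmersion 𝓘(ℝ, EM) (cotModel E) (Subtype.val : S.M → CotBundle E Q))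
    (hQT : IsSmoothSubmersion 𝓘(ℝ, E) 𝓘(ℝ, EQ) (piQ (Q := Q) GW)) (m : S.M) :
    ∃ L : EQ × (EQ →L[ℝ] ℝ) →L[ℝ] EM, (∀ w, dtauE EM m (L w) ∈ subD S m.1.1) ∧
      ∀ w, mder 𝓘(ℝ, EM) (cotModel EQ) (S.rhoGW GW EQ) m (L w) = w := by
  obtain ⟨s, hs, hsm, hρs, hsD⟩ := exists_section_rhoGW hS hM hQT m
  refine ⟨mder (cotModel EQ) 𝓘(ℝ, EM) s (S.rhoGW GW EQ m), hsD, fun w => ?_⟩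
  have h1 := mder_comp (I := cotModel EQ) (I' := 𝓘(ℝ, EM)) (I'' := cotModel EQ)
    (g := S.rhoGW GW EQ) (f := s) (contMDiff_rhoGW hS hM hQT _) hs w
  rw [hsm] at h1
  rw [← h1, mder_congr hρs, mder_id]
  rfl

theorem isSmoothSubmersion_rhoGW (hS : S.IsAdmissible GW EM)
    (hM : IsSmoothImmersion 𝓘(ℝ, EM) (cotModel E) (Subtype.val : S.M → CotBundle E Q))
    (hQT : IsSmoothSubmersion 𝓘(ℝ, E) 𝓘(ℝ, EQ) (piQ (Q := Q) GW)) :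
    IsSmoothSubmersion 𝓘(ℝ, EM) (cotModel EQ) (S.rhoGW GW EQ) := by
  refine ⟨contMDiff_rhoGW hS hM hQT, fun m w => ?_⟩
  obtain ⟨L, -, hL⟩ := exists_linear_lift_rhoGW hS hM hQT m
  exact ⟨L w, hL w⟩

theorem exists_genM_of_mder_rhoGW [ProperSMul G Q] (hS : S.IsAdmissible GW EM)
    (hM : IsSmoothImmersion 𝓘(ℝ, EM) (cotModel E) (Subtype.val : S.M → CotBundle E Q))
    (hQT : IsSmoothSubmersion 𝓘(ℝ, E) 𝓘(ℝ, EQ) (piQ (Q := Q) GW)) {m : S.M} {u : EM}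
    (hu : mder 𝓘(ℝ, EM) (cotModel EQ) (S.rhoGW GW EQ) m u = 0) :
    ∃ ξ, u = genM hS m ξ ∧ gen E EG G m.1.1 ξ ∈ subW S m.1.1 := by
  obtain ⟨c, hc, hcf, hc0, hcu⟩ :=
    exists_curve_in_fiber (isSmoothSubmersion_rhoGW hS hM hQT) m (u := u) hu
  obtain ⟨ξ, hξ⟩ := exists_genM_of_curve hS hM hc hc0 fun t =>
    (((rhoGW_eq_iff hS hQT).1 (hcf t).symm).imp fun g hg => hg.2)
  have h1 : u = genM hS m ξ := hcu.symm.trans hξ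
  refine ⟨ξ, h1, (mem_subW_iff hS hQT).2 ?_⟩
  rw [← dtauE_genM hS hM, ← h1]
  refine (fst_mder_rhoGW hS hM hQT m u).symm.trans ?_
  rw [hu]
  rfl

theorem eq_zero_of_mder_rhoGW [ProperSMul G Q] (hS : S.IsAdmissible GW EM)
    (hM : IsSmoothImmersion 𝓘(ℝ, EM) (cotModel E) (Subtype.val : S.M → CotBundle E Q))
    (hQT : IsSmoothSubmersion 𝓘(ℝ, E) 𝓘(ℝ, EQ) (piQ (Q := Q) GW)) {m : S.M} {u : EM}
    (huC : dtauE EM m u ∈ subD S m.1.1)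
    (hu : mder 𝓘(ℝ, EM) (cotModel EQ) (S.rhoGW GW EQ) m u = 0) : u = 0 := by
  obtain ⟨ξ, rfl, hξ⟩ := exists_genM_of_mder_rhoGW hS hM hQT hu
  rw [dtauE_genM hS hM] at huC
  have h1 := (Submodule.mem_bot ℝ).1 ((isCompl_DW hS m.1.1).disjoint.le_bot ⟨huC, hξ⟩)
  rw [gen_injective m.1.1 hS (h1.trans (map_zero _).symm), map_zero]

theorem liouville_rhoGW (hS : S.IsAdmissible GW EM)
    (hM : IsSmoothImmersion 𝓘(ℝ, EM) (cotModel E) (Subtype.val : S.M → CotBundle E Q))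
    (hQT : IsSmoothSubmersion 𝓘(ℝ, E) 𝓘(ℝ, EQ) (piQ (Q := Q) GW)) :
    (fun m : S.M => (liouville EQ (S.rhoGW GW EQ m)).comp
      (mfderiv 𝓘(ℝ, EM) (cotModel EQ) (S.rhoGW GW EQ) m)) = thetaD G S EM := by
  funext m
  refine ContinuousLinearMap.ext fun u => ?_
  change covP GW EQ m (mfderiv (cotModel EQ) 𝓘(ℝ, EQ) (fun β : CotBundle EQ (QT Q GW) => β.1)
    (S.rhoGW GW EQ m) (mder 𝓘(ℝ, EM) (cotModel EQ) (S.rhoGW GW EQ) m u)) =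
      cov m (prD G S m.1.1 (dtauE EM m u))
  rw [← covP_dpi hS hQT m (prD_mem hS m.1.1 _), dpi_prD hS hQT]
  exact congrArg (covP GW EQ m)
    ((mfderiv_cotProj (S.rhoGW GW EQ m) _).trans (fst_mder_rhoGW hS hM hQT m u))

theorem canonicalTwoForm_rhoGW (hS : S.IsAdmissible GW EM)
    (hM : IsSmoothImmersion 𝓘(ℝ, EM) (cotModel E) (Subtype.val : S.M → CotBundle E Q))
    (hQT : IsSmoothSubmersion 𝓘(ℝ, E) 𝓘(ℝ, EQ) (piQ (Q := Q) GW))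
    (hF : IsSmoothSubmersion 𝓘(ℝ, EG) 𝓘(ℝ, EF) (fun g : G => (g : G ⧸ GW))) {m : S.M}
    {u v : EM} (hu : dtauE EM m u ∈ subD S m.1.1) (hv : dtauE EM m v ∈ subD S m.1.1) :
    canonicalTwoForm EQ (S.rhoGW GW EQ m) (mder 𝓘(ℝ, EM) (cotModel EQ) (S.rhoGW GW EQ) m u)
      (mder 𝓘(ℝ, EM) (cotModel EQ) (S.rhoGW GW EQ) m v) =
        S.OmegaM EM m u v + S.JKW G EM m u v := by
  rw [OmegaM_eq hS hM hQT hF hu hv, sub_add_cancel, ← liouville_rhoGW hS hM hQT]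
  exact congrArg Neg.neg
    (smoothOneForm_liouville.extDerivOne_pullback (contMDiff_rhoGW hS hM hQT m) u v).symm

theorem existsUnique_of_nondegenerate {F : Type*} [NormedAddCommGroup F] [NormedSpace ℝ F]
    [FiniteDimensional ℝ F] (B : F →L[ℝ] F →L[ℝ] ℝ) (K : Submodule ℝ F)
    (h : ∀ X ∈ K, (∀ u ∈ K, B X u = 0) → X = 0) (ℓ : F →L[ℝ] ℝ) :
    ∃! X, X ∈ K ∧ ∀ u ∈ K, B X u = ℓ u := by
  let f : K →ₗ[ℝ] Module.Dual ℝ K :=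
    { toFun := fun v => (B v).toLinearMap.comp K.subtype
      map_add' := fun v w => LinearMap.ext fun d =>
        congrArg (fun T : F →L[ℝ] ℝ => T (d : F)) (map_add B (v : F) (w : F))
      map_smul' := fun c v => LinearMap.ext fun d =>
        congrArg (fun T : F →L[ℝ] ℝ => T (d : F)) (map_smul B c (v : F)) }
  have hinj : Function.Injective f := by
    rw [injective_iff_map_eq_zero]
    exact fun v hv => Subtype.ext (h v v.2 fun u hu => DFunLike.congr_fun hv ⟨u, hu⟩)
  obtain ⟨X, hX⟩ := (LinearMap.injective_iff_surjective_of_finrank_eq_finrank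
    (Subspace.dual_finrank_eq (K := ℝ) (V := K)).symm).1 hinj (ℓ.toLinearMap.comp K.subtype)
  refine ⟨X, ⟨X.2, fun u hu => DFunLike.congr_fun hX ⟨u, hu⟩⟩, fun X' hX' => ?_⟩
  refine sub_eq_zero.1 (h _ (sub_mem hX'.1 X.2) fun u hu => ?_)
  have h1 : B X u = ℓ u := DFunLike.congr_fun hX ⟨u, hu⟩
  rw [map_sub, sub_apply, hX'.2 u hu, h1, sub_self]

theorem JKW_eq_zero_left (hS : S.IsAdmissible GW EM)
    (hM : IsSmoothImmersion 𝓘(ℝ, EM) (cotModel E) (Subtype.val : S.M → CotBundle E Q))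
    (hQT : IsSmoothSubmersion 𝓘(ℝ, E) 𝓘(ℝ, EQ) (piQ (Q := Q) GW))
    (hF : IsSmoothSubmersion 𝓘(ℝ, EG) 𝓘(ℝ, EF) (fun g : G => (g : G ⧸ GW))) {m : S.M}
    {u : EM} (hu : dtauE EM m u = 0) (v : EM) : S.JKW G EM m u v = 0 := by
  refine Eq.trans ?_ ((isTwoForm_JKW hS hM hQT hF).zero_left m v)
  have h : S.dtau EM m u = S.dtau EM m 0 := hu.trans (map_zero (dtauE EM m)).symm
  unfold NHData.JKW
  rw [h]

/-- The constraint distribution is nondegenerate for the 2-forms which differ from `Ω_𝓜` by a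
semi-basic form. -/
theorem eq_zero_of_semibasic [ProperSMul G Q] (hS : S.IsAdmissible GW EM)
    (hM : IsSmoothImmersion 𝓘(ℝ, EM) (cotModel E) (Subtype.val : S.M → CotBundle E Q))
    (hQT : IsSmoothSubmersion 𝓘(ℝ, E) 𝓘(ℝ, EQ) (piQ (Q := Q) GW))
    (hF : IsSmoothSubmersion 𝓘(ℝ, EG) 𝓘(ℝ, EF) (fun g : G => (g : G ⧸ GW))) {m : S.M}
    {b : EM → EM → ℝ} (hb : ∀ u v, dtauE EM m u = 0 → b u v = 0)
    (hb' : ∀ u v, b u v = - b v u) {X : EM} (hX : dtauE EM m X ∈ subD S m.1.1)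
    (h : ∀ u : EM, dtauE EM m u ∈ subD S m.1.1 → S.OmegaM EM m X u + b X u = 0) : X = 0 := by
  obtain ⟨L, hLC, hL⟩ := exists_linear_lift_rhoGW hS hM hQT m
  have hLT : ∀ u : EM, dtauE EM m u ∈ subD S m.1.1 →
      L (mder 𝓘(ℝ, EM) (cotModel EQ) (S.rhoGW GW EQ) m u) = u := fun u hu => by
    refine sub_eq_zero.1 (eq_zero_of_mder_rhoGW hS hM hQT (m := m) ?_ ?_)
    · rw [map_sub]
      exact sub_mem (hLC _) hu
    · rw [map_sub, hL, sub_self]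
  have hLv : ∀ w : EQ × (EQ →L[ℝ] ℝ), w.1 = 0 → dtauE EM m (L w) = 0 := fun w hw => by
    refine mder_piQ_injOn hS hQT (hLC w) ((fst_mder_rhoGW hS hM hQT m (L w)).symm.trans ?_)
    rw [hL, hw]
  have hskew : ∀ u v : EM, S.JKW G EM m u v = - S.JKW G EM m v u :=
    fun u v => (isTwoForm_JKW hS hM hQT hF).skew m u v
  have key : mder 𝓘(ℝ, EM) (cotModel EQ) (S.rhoGW GW EQ) m X = 0 := by
    refine eq_zero_of_canonical_add_semibasic (S.rhoGW GW EQ m)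
      (β := fun w w' => b (L w) (L w') - S.JKW G EM m (L w) (L w')) ?_ ?_ ?_
    · intro w w' hw
      have h1 : dtauE EM m (L w) = 0 := hLv w ((mfderiv_cotProj _ w).symm.trans hw)
      rw [hb _ _ h1, JKW_eq_zero_left hS hM hQT hF h1, sub_zero]
    · intro w w' hw
      have h1 : dtauE EM m (L w') = 0 := hLv w' ((mfderiv_cotProj _ w').symm.trans hw)
      rw [hb', hskew, hb _ _ h1, JKW_eq_zero_left hS hM hQT hF h1, neg_zero, sub_zero]
    · intro w
      have h2 := canonicalTwoForm_rhoGW hS hM hQT hF hX (hLC w)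
      have h4 := (congrArg (fun z : EQ × (EQ →L[ℝ] ℝ) => canonicalTwoForm EQ (S.rhoGW GW EQ m)
        (mder 𝓘(ℝ, EM) (cotModel EQ) (S.rhoGW GW EQ) m X) z) (hL w)).symm.trans h2
      refine (congrArg (· + _) h4).trans ?_
      rw [hLT X hX]
      have h3 := h (L w) (hLC w)
      linarith
  exact eq_zero_of_mder_rhoGW hS hM hQT hX key

theorem existsUnique_isHam [ProperSMul G Q] (hS : S.IsAdmissible GW EM)
    (hM : IsSmoothImmersion 𝓘(ℝ, EM) (cotModel E) (Subtype.val : S.M → CotBundle E Q))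
    (hQT : IsSmoothSubmersion 𝓘(ℝ, E) 𝓘(ℝ, EQ) (piQ (Q := Q) GW))
    (hF : IsSmoothSubmersion 𝓘(ℝ, EG) 𝓘(ℝ, EF) (fun g : G => (g : G ⧸ GW)))
    {β b : ∀ m : S.M, TangentSpace 𝓘(ℝ, EM) m → TangentSpace 𝓘(ℝ, EM) m → ℝ}
    (hβ : IsTwoForm 𝓘(ℝ, EM) β)
    (hβb : ∀ (m : S.M) (u v : EM), β m u v = S.OmegaM EM m u v + b m u v)
    (hb : ∀ (m : S.M) (u v : EM), dtauE EM m u = 0 → b m u v = 0)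
    (hb' : ∀ (m : S.M) (u v : EM), b m u v = - b m v u) (f : S.M → ℝ) (m : S.M) :
    ∃! X, S.IsHam EM β f m X :=
  existsUnique_of_nondegenerate (F := EM) (hβ.toIsSmoothTensor.bilin m)
    ((subD S m.1.1).comap (dtauE EM m).toLinearMap)
    (fun X hX h => eq_zero_of_semibasic hS hM hQT hF (hb m) (hb' m) hX fun u hu => by
      rw [← hβb]
      exact h u hu) (dReal 𝓘(ℝ, EM) f m)

theorem isTwoForm_OmegaM
    (hM : IsSmoothImmersion 𝓘(ℝ, EM) (cotModel E) (Subtype.val : S.M → CotBundle E Q)) :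
    IsTwoForm 𝓘(ℝ, EM) (fun (m : S.M) u v => S.OmegaM EM m u v) :=
  isTwoForm_canonical.pullback hM.1

theorem existsUnique_Xnh [ProperSMul G Q] (hS : S.IsAdmissible GW EM)
    (hM : IsSmoothImmersion 𝓘(ℝ, EM) (cotModel E) (Subtype.val : S.M → CotBundle E Q))
    (hQT : IsSmoothSubmersion 𝓘(ℝ, E) 𝓘(ℝ, EQ) (piQ (Q := Q) GW))
    (hF : IsSmoothSubmersion 𝓘(ℝ, EG) 𝓘(ℝ, EF) (fun g : G => (g : G ⧸ GW))) (m : S.M) :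
    ∃! X, S.IsHam EM (S.OmegaM EM) (fun m => S.hamiltonian m.1) m X :=
  existsUnique_isHam hS hM hQT hF (b := fun _ _ _ => 0) (isTwoForm_OmegaM hM)
    (fun _ _ _ => (add_zero _).symm) (fun _ _ _ _ => rfl) (fun _ _ _ => neg_zero.symm) _ m

theorem dtauE_Xnh [ProperSMul G Q] (hS : S.IsAdmissible GW EM)
    (hM : IsSmoothImmersion 𝓘(ℝ, EM) (cotModel E) (Subtype.val : S.M → CotBundle E Q))
    (hQT : IsSmoothSubmersion 𝓘(ℝ, E) 𝓘(ℝ, EQ) (piQ (Q := Q) GW))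
    (hF : IsSmoothSubmersion 𝓘(ℝ, EG) 𝓘(ℝ, EF) (fun g : G => (g : G ⧸ GW))) (m : S.M) :
    dtauE EM m (S.Xnh EM m) = vel m :=
  dtauE_of_isHam hS.D_smooth hS.potential_smooth hM
    (Classical.epsilon_spec (existsUnique_Xnh hS hM hQT hF m).exists)

theorem Bform_eq_zero_left [ProperSMul G Q] (hS : S.IsAdmissible GW EM)
    (hM : IsSmoothImmersion 𝓘(ℝ, EM) (cotModel E) (Subtype.val : S.M → CotBundle E Q))
    (hQT : IsSmoothSubmersion 𝓘(ℝ, E) 𝓘(ℝ, EQ) (piQ (Q := Q) GW))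
    (hF : IsSmoothSubmersion 𝓘(ℝ, EG) 𝓘(ℝ, EF) (fun g : G => (g : G ⧸ GW))) (s : ℝ) {m : S.M}
    {u : EM} (hu : dtauE EM m u = 0) (v : EM) : S.Bform G EM s m u v = 0 := by
  refine Eq.trans ?_
    ((isTwoForm_Bform hS hM hQT hF (dtauE_Xnh hS hM hQT hF) s).zero_left m v)
  have h : S.dtau EM m u = S.dtau EM m 0 := hu.trans (map_zero (dtauE EM m)).symm
  unfold NHData.Bform NHData.B1 NHData.calB NHData.JKW NHData.kappaWedge
  rw [h]

theorem existsUnique_hamB [ProperSMul G Q] (hS : S.IsAdmissible GW EM)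
    (hM : IsSmoothImmersion 𝓘(ℝ, EM) (cotModel E) (Subtype.val : S.M → CotBundle E Q))
    (hQT : IsSmoothSubmersion 𝓘(ℝ, E) 𝓘(ℝ, EQ) (piQ (Q := Q) GW))
    (hF : IsSmoothSubmersion 𝓘(ℝ, EG) 𝓘(ℝ, EF) (fun g : G => (g : G ⧸ GW))) (s : ℝ)
    (f : S.M → ℝ) (m : S.M) : ∃! X, S.IsHam EM (S.OmegaB G EM s) f m X :=
  have hB := isTwoForm_Bform hS hM hQT hF (dtauE_Xnh hS hM hQT hF) s
  existsUnique_isHam hS hM hQT hF (b := S.Bform G EM s) ((isTwoForm_OmegaM hM).add hB)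
    (fun _ _ _ => rfl) (fun _ _ v hu => Bform_eq_zero_left hS hM hQT hF s hu v)
    (fun m u v => hB.skew m u v) f m

end PartialReduction

/-! ### The projection of the partially reduced space onto the reduced space -/

section ReducedSpace

variable {E : Type*} [NormedAddCommGroup E] [NormedSpace ℝ E] [FiniteDimensional ℝ E]
  {Q : Type*} [TopologicalSpace Q] [ChartedSpace E Q] [IsManifold 𝓘(ℝ, E) ∞ Q] [T2Space Q]
  {EG : Type*} [NormedAddCommGroup EG] [NormedSpace ℝ EG] [FiniteDimensional ℝ EG]
  {G : Type*} [TopologicalSpace G] [ChartedSpace EG G] [Group G] [LieGroup 𝓘(ℝ, EG) ∞ G]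
  [MulAction G Q] [ContMDiffSMul 𝓘(ℝ, EG) 𝓘(ℝ, E) ∞ G Q]
  {S : NHData E Q EG} {GW : Subgroup G} [GW.Normal]
  {EM : Type*} [NormedAddCommGroup EM] [NormedSpace ℝ EM] [FiniteDimensional ℝ EM]
  [ChartedSpace EM S.M] [IsManifold 𝓘(ℝ, EM) ∞ S.M]
  {EN : Type*} [NormedAddCommGroup EN] [NormedSpace ℝ EN] [FiniteDimensional ℝ EN]
  [ChartedSpace EN (S.MG G)] [IsManifold 𝓘(ℝ, EN) ∞ (S.MG G)]
  {EQ : Type*} [NormedAddCommGroup EQ] [NormedSpace ℝ EQ] [FiniteDimensional ℝ EQ]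
  [ChartedSpace EQ (QT Q GW)] [IsManifold 𝓘(ℝ, EQ) ∞ (QT Q GW)]
  {EF : Type*} [NormedAddCommGroup EF] [NormedSpace ℝ EF] [FiniteDimensional ℝ EF]
  [ChartedSpace EF (G ⧸ GW)] [LieGroup 𝓘(ℝ, EF) ∞ (G ⧸ GW)]

variable (S GW EM EN EQ EF) in
/-- The smooth structures on `𝓜`, `𝓜/G`, `Q/G_W` and `G/G_W` are the submanifold and quotient
structures, and the system is admissible. -/
structure IsReduction : Prop where
  hS : S.IsAdmissible GW EM
  hM : IsSmoothImmersion 𝓘(ℝ, EM) (cotModel E) (Subtype.val : S.M → CotBundle E Q)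
  hMG : IsSmoothSubmersion 𝓘(ℝ, EM) 𝓘(ℝ, EN) (S.rho G)
  hQT : IsSmoothSubmersion 𝓘(ℝ, E) 𝓘(ℝ, EQ) (piQ (Q := Q) GW)
  hF : IsSmoothSubmersion 𝓘(ℝ, EG) 𝓘(ℝ, EF) (fun g : G => (g : G ⧸ GW))

theorem rhoGW_actM (hS : S.IsAdmissible GW EM)
    (hQT : IsSmoothSubmersion 𝓘(ℝ, E) 𝓘(ℝ, EQ) (piQ (Q := Q) GW)) (g : G) (m : S.M) :
    S.rhoGW GW EQ (actM hS g m) = cotLiftF GW EQ (g : G ⧸ GW) (S.rhoGW GW EQ m) := by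
  refine rhoGW_eq_of hS hQT rfl fun v hv => ?_
  have h1 : tanAct E g⁻¹ (g • m.1.1) v ∈ subD S m.1.1 := by
    have := tanAct_mem_D hS g⁻¹ hv
    rwa [actM_base, inv_smul_smul] at this
  have h2 := cov_actM hS g m (tanAct E g⁻¹ (g • m.1.1) v)
  rw [tanAct_tanAct_inv EG] at h2
  refine Eq.trans ?_ ((covP_dpi hS hQT m h1).trans h2.symm)
  refine congrArg (covP GW EQ m) ?_
  have h3 := mder_piQ_tanAct hQT (fun g => contMDiff_act EG g) g⁻¹ (g • m.1.1) v
  rw [inv_smul_smul] at h3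
  exact h3.symm

theorem exists_rhoF (h : IsReduction S GW EM EN EQ EF) : ∃ rhoF : CotBundle EQ (QT Q GW) → S.MG G,
    IsSmoothSubmersion (cotModel EQ) 𝓘(ℝ, EN) rhoF ∧
    (∀ m : S.M, rhoF (S.rhoGW GW EQ m) = S.rho G m) ∧
    ∀ α β, rhoF α = rhoF β ↔ ∃ h : G ⧸ GW, β = cotLiftF GW EQ h α := by
  choose r hr using rhoGW_surjective h.hS h.hQT
  have h1 : ∀ m : S.M, S.rho G (r (S.rhoGW GW EQ m)) = S.rho G m := fun m => by
    obtain ⟨g, -, hg⟩ := (rhoGW_eq_iff h.hS h.hQT).1 (hr (S.rhoGW GW EQ m))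
    exact (rho_eq_iff h.hS).2 ⟨g, hg⟩
  have hsub := isSmoothSubmersion_rhoGW h.hS h.hM h.hQT
  have hsm : ContMDiff (cotModel EQ) 𝓘(ℝ, EN) ∞ (fun α => S.rho G (r α)) := by
    refine contMDiff_of_comp_submersion hsub (rhoGW_surjective h.hS h.hQT) ?_
    simp only [h1]
    exact h.hMG.1
  refine ⟨fun α => S.rho G (r α), ⟨hsm, fun α => ?_⟩, h1, fun α β => ?_⟩
  · obtain ⟨m, rfl⟩ := rhoGW_surjective h.hS h.hQT α
    intro U
    obtain ⟨u, hu⟩ := h.hMG.2 m U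
    refine ⟨mder 𝓘(ℝ, EM) (cotModel EQ) (S.rhoGW GW EQ) m u, ?_⟩
    have h2 := mder_comp (I'' := 𝓘(ℝ, EN)) (x := m) (hsm (S.rhoGW GW EQ m)) (hsub.1 m) u
    refine h2.symm.trans (Eq.trans ?_ hu)
    simp only [h1]
    rfl
  · obtain ⟨m, rfl⟩ := rhoGW_surjective h.hS h.hQT α
    obtain ⟨m', rfl⟩ := rhoGW_surjective h.hS h.hQT β
    simp only [h1]
    rw [rho_eq_iff h.hS]
    constructor
    · rintro ⟨g, rfl⟩
      exact ⟨g, rhoGW_actM h.hS h.hQT g m⟩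
    · rintro ⟨f, hf⟩
      obtain ⟨g, rfl⟩ := QuotientGroup.mk_surjective f
      obtain ⟨g', -, hg'⟩ := (rhoGW_eq_iff h.hS h.hQT).1 ((rhoGW_actM h.hS h.hQT g m).trans hf.symm)
      exact ⟨g' * g, by rw [hg', actM_mul]⟩

theorem projections_of_mder_rhoGW (h : IsReduction S GW EM EN EQ EF) {g : G} (hg : g ∈ GW) {m : S.M} {u u' : EM}
    (hu : mder 𝓘(ℝ, EM) (cotModel EQ) (S.rhoGW GW EQ) m u =
      mder 𝓘(ℝ, EM) (cotModel EQ) (S.rhoGW GW EQ) (actM h.hS g m) u') :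
    prD G S (g • m.1.1) (dtauE EM (actM h.hS g m) u') =
      tanAct E g m.1.1 (prD G S m.1.1 (dtauE EM m u)) ∧
    prHor G S (g • m.1.1) (dtauE EM (actM h.hS g m) u') =
      tanAct E g m.1.1 (prHor G S m.1.1 (dtauE EM m u)) := by
  have h1 : dtauE EM (actM h.hS g m) u' - tanAct E g m.1.1 (dtauE EM m u) ∈
      subW S (g • m.1.1) := by
    refine (mem_subW_iff h.hS h.hQT).2 ?_
    change dpi GW EQ (g • m.1.1) _ = 0
    rw [map_sub, dpi_tanAct_of_mem g hg h.hQT _ _ (fun g => contMDiff_act EG g),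
      ← fst_mder_rhoGW h.hS h.hM h.hQT m u, hu, fst_mder_rhoGW h.hS h.hM h.hQT]
    exact sub_self _
  obtain ⟨ξ, hξ⟩ := subW_le h.hS _ h1
  constructor
  · rw [← sub_eq_zero, ← prD_tanAct h.hS h.hQT, ← map_sub, prD_of_mem_W h.hS h1]
  · rw [← sub_eq_zero, ← prHor_tanAct h.hS, ← map_sub, ← hξ]
    exact prHor_gen h.hS _ ξ

theorem prHor_of_mder_rho [ProperSMul G Q] (h : IsReduction S GW EM EN EQ EF) {g : G} {m : S.M} {u u' : EM}
    (hu : mder 𝓘(ℝ, EM) 𝓘(ℝ, EN) (S.rho G) m u =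
      mder 𝓘(ℝ, EM) 𝓘(ℝ, EN) (S.rho G) (actM h.hS g m) u') :
    prHor G S (g • m.1.1) (dtauE EM (actM h.hS g m) u') =
      tanAct E g m.1.1 (prHor G S m.1.1 (dtauE EM m u)) := by
  obtain ⟨ξ, hξ⟩ := exists_of_mder_rho_eq h.hS h.hM h.hMG hu
  rw [hξ, map_add, prHor_gen h.hS, add_zero, prHor_tanAct h.hS]

/-- Descent of the gauge forms to `T^*(Q/G_W)`. -/
theorem exists_descent_gauge [ProperSMul G Q] (h : IsReduction S GW EM EN EQ EF) (s : ℝ) :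
    ∃ BJK Bt : DForm (cotModel EQ) (CotBundle EQ (QT Q GW)) 2,
      DForm.IsSmooth (cotModel EQ) BJK ∧ DForm.IsSmooth (cotModel EQ) Bt ∧
      PullsBackTo 𝓘(ℝ, EM) (cotModel EQ) (S.rhoGW GW EQ) BJK (S.JKW G EM) ∧
      PullsBackTo 𝓘(ℝ, EM) (cotModel EQ) (S.rhoGW GW EQ) Bt (S.Bform G EM s) := by
  have hX := dtauE_Xnh h.hS h.hM h.hQT h.hF
  have hsub := isSmoothSubmersion_rhoGW h.hS h.hM h.hQT
  obtain ⟨β, hβ, hβ'⟩ := (isTwoForm_JKW h.hS h.hM h.hQT h.hF).exists_descent hsub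
    (rhoGW_surjective h.hS h.hQT) (fun m m' u v u' v' hm hu hv => by
      obtain ⟨g, hg, rfl⟩ := (rhoGW_eq_iff h.hS h.hQT).1 hm
      exact (JKW_actM h.hS h.hQT h.hF g m (projections_of_mder_rhoGW h hg hu).1
        (projections_of_mder_rhoGW h hg hv).1).symm)
  obtain ⟨γ, hγ, hγ'⟩ := (isTwoForm_Bform h.hS h.hM h.hQT h.hF hX s).exists_descent hsub
    (rhoGW_surjective h.hS h.hQT) (fun m m' u v u' v' hm hu hv => by
      obtain ⟨g, hg, rfl⟩ := (rhoGW_eq_iff h.hS h.hQT).1 hm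
      have hu' := projections_of_mder_rhoGW h hg hu
      have hv' := projections_of_mder_rhoGW h hg hv
      exact (congrArg₂ (· + ·) (B1_actM h.hS h.hM h.hQT h.hF g m hu'.1 hv'.1)
        (calB_actM h.hS h.hM h.hQT h.hF hX s g m hu'.2 hv'.2)).symm)
  exact ⟨hβ.toDForm, hγ.toDForm, hβ.isSmooth_toDForm, hγ.isSmooth_toDForm, hβ', hγ'⟩

theorem Jbar_rho (h : IsReduction S GW EM EN EQ EF) (i : Fin S.k) (m : S.M) : S.Jbar G i (S.rho G m) = S.J G i m := by
  obtain ⟨g, hg⟩ := (rho_eq_iff h.hS).1 (Quot.out_eq (S.rho G m) :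
    S.rho G (S.rho G m).out = S.rho G m)
  exact ((congrArg (S.J G i) hg).trans (J_actM h.hS g _ i)).symm

theorem contMDiff_Jbar (h : IsReduction S GW EM EN EQ EF) (i : Fin S.k) : ContMDiff 𝓘(ℝ, EN) 𝓘(ℝ, ℝ) ∞ (S.Jbar G i) := by
  refine contMDiff_of_comp_submersion h.hMG rho_surjective ?_
  simp only [Jbar_rho h]
  exact contMDiff_J h.hS h.hM i

theorem dReal_comp_rho (h : IsReduction S GW EM EN EQ EF) {f : S.MG G → ℝ} (hf : ContMDiff 𝓘(ℝ, EN) 𝓘(ℝ, ℝ) ∞ f) (m : S.M) (u : EM) :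
    dReal 𝓘(ℝ, EM) (fun m => f (S.rho G m)) m u =
      dReal 𝓘(ℝ, EN) f (S.rho G m) (mder 𝓘(ℝ, EM) 𝓘(ℝ, EN) (S.rho G) m u) :=
  dReal_comp ((hf _).mdifferentiableAt (by simp)) ((h.hMG.1 m).mdifferentiableAt (by simp)) u

theorem dReal_J (h : IsReduction S GW EM EN EQ EF) (i : Fin S.k) (m : S.M) (u : EM) : dReal 𝓘(ℝ, EM) (S.J G i) m u =
    dReal 𝓘(ℝ, EN) (S.Jbar G i) (S.rho G m) (mder 𝓘(ℝ, EM) 𝓘(ℝ, EN) (S.rho G) m u) := by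
  rw [← dReal_comp_rho h (contMDiff_Jbar h i)]
  simp only [Jbar_rho h]

theorem exists_lift_C (h : IsReduction S GW EM EN EQ EF) (m : S.M) (U : EN) : ∃ u : EM, dtauE EM m u ∈ subD S m.1.1 ∧
    mder 𝓘(ℝ, EM) 𝓘(ℝ, EN) (S.rho G) m u = U := by
  obtain ⟨u, hu⟩ : ∃ u : EM, mder 𝓘(ℝ, EM) 𝓘(ℝ, EN) (S.rho G) m u = U := h.hMG.2 m U
  refine ⟨u - genM h.hS m (formW G S m.1.1 (dtauE EM m u)), ?_, ?_⟩
  · rw [map_sub, dtauE_genM h.hS h.hM]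
    exact prD_mem h.hS m.1.1 (dtauE EM m u)
  · rw [map_sub, mder_rho_genM h.hS h.hM h.hMG, sub_zero]
    exact hu

theorem linearIndependent_dJbar (h : IsReduction S GW EM EN EQ EF) (x : S.MG G) :
    LinearIndependent ℝ (fun i => dReal 𝓘(ℝ, EN) (S.Jbar G i) x) := by
  obtain ⟨m, rfl⟩ := rho_surjective x
  have h1 : LinearIndependent ℝ (fun i => (dReal 𝓘(ℝ, EM) (S.J G i) m : EM →L[ℝ] ℝ)) :=
    h.hS.J_indep m
  let ℓ : Fin S.k → EN →L[ℝ] ℝ := fun i => dReal 𝓘(ℝ, EN) (S.Jbar G i) (S.rho G m)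
  have h2 : (fun i => (dReal 𝓘(ℝ, EM) (S.J G i) m : EM →L[ℝ] ℝ)) = fun i =>
      (ℓ i).comp (mder 𝓘(ℝ, EM) 𝓘(ℝ, EN) (S.rho G) m) :=
    funext fun i => ContinuousLinearMap.ext fun u => dReal_J h i m u
  rw [h2] at h1
  exact LinearIndependent.of_comp (v := ℓ) (((ContinuousLinearMap.compL ℝ EM EN ℝ).flip
    (mder 𝓘(ℝ, EM) 𝓘(ℝ, EN) (S.rho G) m)).toLinearMap) h1

end ReducedSpace

/-! ### The reduced bracket -/

theorem exists_coeff_of_ker {F : Type*} [NormedAddCommGroup F] [NormedSpace ℝ F] {k : ℕ}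
    [FiniteDimensional ℝ F] {ℓ : Fin k → F →L[ℝ] ℝ} {K : F →L[ℝ] ℝ}
    (h : ∀ v, (∀ i, ℓ i v = 0) → K v = 0) : ∃ c : Fin k → ℝ, ∀ v, K v = ∑ i, c i * ℓ i v := by
  have h1 : K.toLinearMap ∈ Submodule.span ℝ (range fun i => (ℓ i).toLinearMap) :=
    mem_span_of_iInf_ker_le_ker fun v hv => h v fun i => (Submodule.mem_iInf _).1 hv i
  obtain ⟨c, hc⟩ := (Submodule.mem_span_range_iff_exists_fun ℝ).1 h1
  refine ⟨c, fun v => ?_⟩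
  have := congrArg (fun T : F →ₗ[ℝ] ℝ => T v) hc
  simpa [LinearMap.sum_apply] using this.symm

section ReducedSpace

variable {E : Type*} [NormedAddCommGroup E] [NormedSpace ℝ E] [FiniteDimensional ℝ E]
  {Q : Type*} [TopologicalSpace Q] [ChartedSpace E Q] [IsManifold 𝓘(ℝ, E) ∞ Q] [T2Space Q]
  {EG : Type*} [NormedAddCommGroup EG] [NormedSpace ℝ EG] [FiniteDimensional ℝ EG]
  {G : Type*} [TopologicalSpace G] [ChartedSpace EG G] [Group G] [LieGroup 𝓘(ℝ, EG) ∞ G]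
  [MulAction G Q] [ContMDiffSMul 𝓘(ℝ, EG) 𝓘(ℝ, E) ∞ G Q]
  {S : NHData E Q EG} {GW : Subgroup G} [GW.Normal]
  {EM : Type*} [NormedAddCommGroup EM] [NormedSpace ℝ EM] [FiniteDimensional ℝ EM]
  [ChartedSpace EM S.M] [IsManifold 𝓘(ℝ, EM) ∞ S.M]
  {EN : Type*} [NormedAddCommGroup EN] [NormedSpace ℝ EN] [FiniteDimensional ℝ EN]
  [ChartedSpace EN (S.MG G)] [IsManifold 𝓘(ℝ, EN) ∞ (S.MG G)]
  {EQ : Type*} [NormedAddCommGroup EQ] [NormedSpace ℝ EQ] [FiniteDimensional ℝ EQ]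
  [ChartedSpace EQ (QT Q GW)] [IsManifold 𝓘(ℝ, EQ) ∞ (QT Q GW)]
  {EF : Type*} [NormedAddCommGroup EF] [NormedSpace ℝ EF] [FiniteDimensional ℝ EF]
  [ChartedSpace EF (G ⧸ GW)] [LieGroup 𝓘(ℝ, EF) ∞ (G ⧸ GW)]
  {s : ℝ} {Ω : ∀ x : S.MG G, TangentSpace 𝓘(ℝ, EN) x → TangentSpace 𝓘(ℝ, EN) x → ℝ}

variable (EM) in
/-- The 2-form `Ω` on `𝓜/G` is the horizontal part of `Ω_𝓜 + 𝐁`. -/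
structure IsReducedForm (s : ℝ)
    (Ω : ∀ x : S.MG G, TangentSpace 𝓘(ℝ, EN) x → TangentSpace 𝓘(ℝ, EN) x → ℝ) : Prop where
  twoForm : IsTwoForm 𝓘(ℝ, EN) Ω
  eq : ∀ (m : S.M) (u v : EM), dtauE EM m u ∈ subD S m.1.1 → dtauE EM m v ∈ subD S m.1.1 →
    S.OmegaB G EM s m u v = Ω (S.rho G m) (mder 𝓘(ℝ, EM) 𝓘(ℝ, EN) (S.rho G) m u)
      (mder 𝓘(ℝ, EM) 𝓘(ℝ, EN) (S.rho G) m v) + ∑ i,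
      (formY G S i m.1.1 (dtauE EM m u) * dReal 𝓘(ℝ, EN) (S.Jbar G i) (S.rho G m)
        (mder 𝓘(ℝ, EM) 𝓘(ℝ, EN) (S.rho G) m v) -
      formY G S i m.1.1 (dtauE EM m v) * dReal 𝓘(ℝ, EN) (S.Jbar G i) (S.rho G m)
        (mder 𝓘(ℝ, EM) 𝓘(ℝ, EN) (S.rho G) m u))

variable (EN) in
/-- The differentials of the functions `J̄_i`, on the model space. -/
noncomputable def dJbar (i : Fin S.k) (x : S.MG G) : EN →L[ℝ] ℝ := dReal 𝓘(ℝ, EN) (S.Jbar G i) x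

theorem IsReducedForm.apply (hΩ : IsReducedForm EM s Ω) {m : S.M} {u v : EM} {U V : EN}
    (hu : dtauE EM m u ∈ subD S m.1.1) (hv : dtauE EM m v ∈ subD S m.1.1)
    (hU : mder 𝓘(ℝ, EM) 𝓘(ℝ, EN) (S.rho G) m u = U)
    (hV : mder 𝓘(ℝ, EM) 𝓘(ℝ, EN) (S.rho G) m v = V) :
    S.OmegaB G EM s m u v = hΩ.twoForm.bilin (S.rho G m) U V + ∑ i,
      (formY G S i m.1.1 (dtauE EM m u) * dJbar EN i (S.rho G m) V -
      formY G S i m.1.1 (dtauE EM m v) * dJbar EN i (S.rho G m) U) := by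
  subst hU hV
  exact hΩ.eq m u v hu hv

theorem exists_isReducedForm [ProperSMul G Q] (h : IsReduction S GW EM EN EQ EF) (s : ℝ) :
    ∃ Ω : ∀ x : S.MG G, TangentSpace 𝓘(ℝ, EN) x → TangentSpace 𝓘(ℝ, EN) x → ℝ,
      IsReducedForm EM s Ω := by
  have hX := dtauE_Xnh h.hS h.hM h.hQT h.hF
  obtain ⟨θ, hθ, hθ'⟩ := (smoothOneForm_thetaH h.hS h.hM).exists_descent h.hMG rho_surjective
    (fun m m' u u' hm hu => by
      obtain ⟨g, rfl⟩ := (rho_eq_iff h.hS).1 hm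
      exact (thetaH_actM h.hS g m (prHor_of_mder_rho h hu)).symm)
  obtain ⟨β, hβ, hβ'⟩ := (isTwoForm_calB h.hS h.hM h.hQT h.hF hX s).exists_descent h.hMG
    rho_surjective (fun m m' u v u' v' hm hu hv => by
      obtain ⟨g, rfl⟩ := (rho_eq_iff h.hS).1 hm
      exact (calB_actM h.hS h.hM h.hQT h.hF hX s g m (prHor_of_mder_rho h hu)
        (prHor_of_mder_rho h hv)).symm)
  refine ⟨fun x u v => - extDerivOne 𝓘(ℝ, EN) θ x u v + β x u v,
    hθ.isTwoForm_extDerivOne.neg.add hβ, fun m u v hu hv => ?_⟩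
  have h1 : (thetaH G S EM) =
      fun m => (θ (S.rho G m)).comp (mfderiv 𝓘(ℝ, EM) 𝓘(ℝ, EN) (S.rho G) m) :=
    funext fun m => ContinuousLinearMap.ext fun u => (hθ' m u).symm
  have h2 := (congrArg (fun t => extDerivOne 𝓘(ℝ, EM) t m u v) h1).trans
    (SmoothOneForm.extDerivOne_pullback hθ (h.hMG.1 m) u v)
  rw [OmegaB_eq h.hS h.hM h.hQT h.hF s hu hv, ← hβ' m u v]
  simp only [dReal_J h]
  exact congrArg (fun t => - t + _ + _) h2

theorem exists_lift_formY (h : IsReduction S GW EM EN EQ EF) (m : S.M) (U : EN)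
    (y : Fin S.k → ℝ) : ∃ u : EM, dtauE EM m u ∈ subD S m.1.1 ∧
      mder 𝓘(ℝ, EM) 𝓘(ℝ, EN) (S.rho G) m u = U ∧
      ∀ i, formY G S i m.1.1 (dtauE EM m u) = y i := by
  obtain ⟨u, hu, hU⟩ := exists_lift_C h m U
  let c : Fin S.k → ℝ := fun i => y i - formY G S i m.1.1 (dtauE EM m u)
  have h1 : gen E EG G m.1.1 (colMap (fun i => S.ζ i m.1.1) c) =
      ∑ j, c j • gen E EG G m.1.1 (S.ζ j m.1.1) := by
    rw [colMap_apply, map_sum]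
    simp only [map_smul]
  refine ⟨u + genM h.hS m (colMap (fun i => S.ζ i m.1.1) c), ?_, ?_, fun i => ?_⟩
  · rw [map_add, dtauE_genM h.hS h.hM, h1]
    exact add_mem hu (Submodule.sum_mem _ fun j _ => Submodule.smul_mem _ _ (zeta_mem h.hS j _))
  · rw [map_add, mder_rho_genM h.hS h.hM h.hMG, add_zero, hU]
  · rw [map_add, dtauE_genM h.hS h.hM, h1, map_add, map_sum]
    simp only [map_smul, (formY_spec h.hS h.hM i m.1.1).2.2, smul_eq_mul, mul_ite, mul_one,
      mul_zero, Finset.sum_ite_eq, Finset.mem_univ, if_true, c]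
    ring

namespace IsReducedForm

theorem nondeg [ProperSMul G Q] (h : IsReduction S GW EM EN EQ EF) (hΩ : IsReducedForm EM s Ω)
    (x : S.MG G) (U : TangentSpace 𝓘(ℝ, EN) x) (hU : U ∈ levelDist 𝓘(ℝ, EN) (S.Jbar G) x)
    (hV : ∀ V ∈ levelDist 𝓘(ℝ, EN) (S.Jbar G) x, Ω x U V = 0) : U = 0 := by
  obtain ⟨m, rfl⟩ := rho_surjective x
  obtain ⟨c, hc⟩ := exists_coeff_of_ker (F := EN)
    (ℓ := fun i => dReal 𝓘(ℝ, EN) (S.Jbar G i) (S.rho G m)) (K := hΩ.twoForm.bilin _ U)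
    fun V h => hV V (mem_levelDist.2 h)
  have hc : ∀ V : EN, hΩ.twoForm.bilin (S.rho G m) U V =
    ∑ i, c i * dJbar EN i (S.rho G m) V := hc
  have hU : ∀ i, dJbar EN i (S.rho G m) U = 0 := mem_levelDist.1 hU
  obtain ⟨u, hu, hU', huY⟩ := exists_lift_formY h m (U : EN) fun i => - c i
  have hz : (dtauE EM m 0) ∈ subD S m.1.1 := by rw [map_zero]; exact zero_mem _
  have h0 : ∀ v : EM, dtauE EM m v ∈ subD S m.1.1 → S.OmegaB G EM s m 0 v = 0 := fun v hv => by
    refine (hΩ.apply hz hv (map_zero _) rfl).trans ?_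
    simp only [map_zero, zero_apply, zero_mul, mul_zero, sub_zero, Finset.sum_const_zero, add_zero]
  have h1 : ∀ v : EM, dtauE EM m v ∈ subD S m.1.1 → S.OmegaB G EM s m u v = 0 := fun v hv => by
    rw [hΩ.apply hu hv hU' rfl, hc, ← Finset.sum_add_distrib]
    refine Finset.sum_eq_zero fun i _ => ?_
    rw [huY, hU i]
    ring
  have hd : ∀ v, dReal 𝓘(ℝ, EM) (fun _ : S.M => (0 : ℝ)) m v = 0 := fun v =>
    congrArg (fun T : EM →L[ℝ] ℝ => T v) (mfderiv_const (c := (0 : ℝ)))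
  have h2 : u = 0 := (existsUnique_hamB h.hS h.hM h.hQT h.hF s (fun _ => 0) m).unique
    ⟨hu, fun v hv => (h1 v hv).trans (hd v).symm⟩ ⟨hz, fun v hv => (h0 v hv).trans (hd v).symm⟩
  exact hU'.symm.trans ((congrArg _ h2).trans (map_zero _))

theorem hamVec_spec [ProperSMul G Q] (h : IsReduction S GW EM EN EQ EF)
    (hΩ : IsReducedForm EM s Ω) {f : S.MG G → ℝ} (hf : ContMDiff 𝓘(ℝ, EN) 𝓘(ℝ, ℝ) ∞ f) (m : S.M) :
    ∃ X ∈ levelDist 𝓘(ℝ, EN) (S.Jbar G) (S.rho G m),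
      (∀ V ∈ levelDist 𝓘(ℝ, EN) (S.Jbar G) (S.rho G m),
        Ω (S.rho G m) X V = dReal 𝓘(ℝ, EN) f (S.rho G m) V) ∧
      ∀ g : S.MG G → ℝ, ContMDiff 𝓘(ℝ, EN) 𝓘(ℝ, ℝ) ∞ g →
        S.bracketB G EM s (g ∘ S.rho G) (f ∘ S.rho G) m =
          dReal 𝓘(ℝ, EN) g (S.rho G m) X := by
  obtain ⟨X, hX⟩ : ∃ X : EM, X = S.hamVec EM (S.OmegaB G EM s) (f ∘ S.rho G) m := ⟨_, rfl⟩
  obtain ⟨hXD, hX'⟩ : S.IsHam EM (S.OmegaB G EM s) (f ∘ S.rho G) m X := hX ▸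
    Classical.epsilon_spec (existsUnique_hamB h.hS h.hM h.hQT h.hF s (f ∘ S.rho G) m).exists
  have h1 : ∀ v : EM, dtauE EM m v ∈ subD S m.1.1 → S.OmegaB G EM s m X v =
      dReal 𝓘(ℝ, EN) f (S.rho G m) (mder 𝓘(ℝ, EM) 𝓘(ℝ, EN) (S.rho G) m v) := fun v hv =>
    (hX' v hv).trans (dReal_comp_rho h hf m v)
  have h2 : mder 𝓘(ℝ, EM) 𝓘(ℝ, EN) (S.rho G) m X ∈
      levelDist 𝓘(ℝ, EN) (S.Jbar G) (S.rho G m) := by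
    refine mem_levelDist.2 fun j => ?_
    obtain ⟨v, hv, hv0, hvY⟩ := exists_lift_formY h m 0 (Pi.single j 1)
    have h3 := h1 v hv
    rw [hΩ.apply hXD hv rfl hv0, hv0] at h3
    change dJbar EN j (S.rho G m) (mder 𝓘(ℝ, EM) 𝓘(ℝ, EN) (S.rho G) m X) = 0
    have h4 : dReal 𝓘(ℝ, EN) f (S.rho G m) (0 : EN) = 0 := map_zero _
    simpa [hvY, Pi.single_apply, h4] using h3
  refine ⟨_, h2, fun V hV => ?_, fun g hg => ?_⟩
  · obtain ⟨v, hv, rfl⟩ := exists_lift_C h m V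
    refine Eq.trans ?_ (h1 v hv)
    rw [hΩ.apply hXD hv rfl rfl]
    refine (left_eq_add.2 (Finset.sum_eq_zero fun i _ => ?_))
    have e1 : dJbar EN i (S.rho G m) (mder 𝓘(ℝ, EM) 𝓘(ℝ, EN) (S.rho G) m X) = 0 :=
      mem_levelDist.1 h2 i
    have e2 : dJbar EN i (S.rho G m) (mder 𝓘(ℝ, EM) 𝓘(ℝ, EN) (S.rho G) m v) = 0 :=
      mem_levelDist.1 hV i
    rw [e1, e2]
    ring
  · rw [hX]
    exact dReal_comp_rho h hg m _

theorem isLevelBracket [ProperSMul G Q] (h : IsReduction S GW EM EN EQ EF)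
    (hΩ : IsReducedForm EM s Ω) :
    IsLevelBracket 𝓘(ℝ, EN) (S.Jbar G) Ω (S.redBracket G EM s) where
  J_smooth := contMDiff_Jbar h
  J_indep := linearIndependent_dJbar h
  twoForm := hΩ.twoForm
  nondeg := hΩ.nondeg h
  ham f hf x := by
    obtain ⟨m, hm, hbr⟩ : ∃ m, S.rho G m = x ∧ ∀ g, S.redBracket G EM s g f x =
      S.bracketB G EM s (g ∘ S.rho G) (f ∘ S.rho G) m := ⟨x.out, Quot.out_eq x, fun _ => rfl⟩
    subst hm
    simp only [hbr]
    exact hΩ.hamVec_spec h hf m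

theorem redBracket_rho [ProperSMul G Q] (h : IsReduction S GW EM EN EQ EF)
    (hΩ : IsReducedForm EM s Ω) {f g : S.MG G → ℝ} (hf : ContMDiff 𝓘(ℝ, EN) 𝓘(ℝ, ℝ) ∞ f)
    (hg : ContMDiff 𝓘(ℝ, EN) 𝓘(ℝ, ℝ) ∞ g) (m : S.M) :
    S.redBracket G EM s f g (S.rho G m) =
      S.bracketB G EM s (f ∘ S.rho G) (g ∘ S.rho G) m := by
  obtain ⟨X, hX, hX1, hX2⟩ := (hΩ.isLevelBracket h).ham g hg (S.rho G m)
  obtain ⟨Y, hY, hY1, hY2⟩ := hΩ.hamVec_spec h hg m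
  have h1 : X - Y = 0 := by
    refine hΩ.nondeg h _ _ (sub_mem hX hY) fun V hV => ?_
    rw [sub_eq_add_neg, hΩ.twoForm.add_left, hΩ.twoForm.neg_left, hX1 V hV, hY1 V hV,
      add_neg_cancel]
  rw [hX2 f hf, hY2 f hf, sub_eq_zero.1 h1]

end IsReducedForm

end ReducedSpace

/-! ### The level sets of the momentum map of `T^*(Q/G_W)` -/

section LevelSets

variable {E : Type*} [NormedAddCommGroup E] [NormedSpace ℝ E] [FiniteDimensional ℝ E]
  {Q : Type*} [TopologicalSpace Q] [ChartedSpace E Q] [IsManifold 𝓘(ℝ, E) ∞ Q] [T2Space Q]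
  {EG : Type*} [NormedAddCommGroup EG] [NormedSpace ℝ EG] [FiniteDimensional ℝ EG]
  {G : Type*} [TopologicalSpace G] [ChartedSpace EG G] [Group G] [LieGroup 𝓘(ℝ, EG) ∞ G]
  [MulAction G Q] [ContMDiffSMul 𝓘(ℝ, EG) 𝓘(ℝ, E) ∞ G Q]
  {S : NHData E Q EG} {GW : Subgroup G} [GW.Normal]
  {EM : Type*} [NormedAddCommGroup EM] [NormedSpace ℝ EM] [FiniteDimensional ℝ EM]
  [ChartedSpace EM S.M] [IsManifold 𝓘(ℝ, EM) ∞ S.M]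
  {EN : Type*} [NormedAddCommGroup EN] [NormedSpace ℝ EN] [FiniteDimensional ℝ EN]
  [ChartedSpace EN (S.MG G)] [IsManifold 𝓘(ℝ, EN) ∞ (S.MG G)]
  {EQ : Type*} [NormedAddCommGroup EQ] [NormedSpace ℝ EQ] [FiniteDimensional ℝ EQ]
  [ChartedSpace EQ (QT Q GW)] [IsManifold 𝓘(ℝ, EQ) ∞ (QT Q GW)]
  {EF : Type*} [NormedAddCommGroup EF] [NormedSpace ℝ EF] [FiniteDimensional ℝ EF]
  [ChartedSpace EF (G ⧸ GW)] [LieGroup 𝓘(ℝ, EF) ∞ (G ⧸ GW)]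

variable (GW EF) in
/-- The projection of Lie algebras `𝔤 → 𝔣`, on the model spaces. -/
noncomputable def dmk : EG →L[ℝ] EF := mder 𝓘(ℝ, EG) 𝓘(ℝ, EF) (fun g : G => (g : G ⧸ GW)) 1

theorem dmk_adAct (hF : IsSmoothSubmersion 𝓘(ℝ, EG) 𝓘(ℝ, EF) (fun g : G => (g : G ⧸ GW))) {w : G}
    (hw : w ∈ GW) (ξ : EG) : dmk GW EF (adAct EG w ξ) = dmk GW EF ξ := by
  have h1 := mder_comp (I'' := 𝓘(ℝ, EF)) (g := fun g : G => (g : G ⧸ GW)) (x := 1)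
    (hF.1 (w * 1 * w⁻¹)) (contMDiff_conj (EG := EG) w 1) ξ
  have h2 : (fun x : G => ((w * x * w⁻¹ : G) : G ⧸ GW)) = fun x : G => (x : G ⧸ GW) := by
    funext x
    have h3 : (w : G ⧸ GW) = 1 := (QuotientGroup.eq_one_iff w).2 hw
    rw [QuotientGroup.mk_mul, QuotientGroup.mk_mul, QuotientGroup.mk_inv, h3]
    simp
  rw [h2, mul_one, mul_inv_cancel] at h1
  exact h1.symm

theorem eta_piQ (h : IsReduction S GW EM EN EQ EF) (i : Fin S.k) (q : Q) :
    S.eta GW EF i (piQ GW q) = dmk GW EF (S.ζ i q) := by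
  obtain ⟨w, hw, hq⟩ := piQ_eq_iff.1 (Quotient.out_eq' (piQ GW q) :
    piQ GW (piQ GW q).out = piQ GW q)
  have h1 := zeta_smul h.hS i w (piQ GW q).out
  rw [hq] at h1
  rw [h1, dmk_adAct h.hF hw]
  rfl

theorem dmk_colMap_zeta (h : IsReduction S GW EM EN EQ EF) (q : Q) (c : Fin S.k → ℝ) :
    dmk GW EF (colMap (fun i => S.ζ i q) c) =
      colMap (fun i => S.eta GW EF i (piQ GW q)) c := by
  simp only [colMap_apply, map_sum, map_smul, eta_piQ h]

theorem eta_injective (h : IsReduction S GW EM EN EQ EF) (x : QT Q GW) :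
    Function.Injective (colMap (fun i => S.eta GW EF i x)) := by
  obtain ⟨q, rfl⟩ := piQ_surjective x
  refine (injective_iff_map_eq_zero _).2 fun c hc => ?_
  rw [← dmk_colMap_zeta h] at hc
  have h1 : gen E EG G q (colMap (fun i => S.ζ i q) c) ∈ subD S q := by
    rw [colMap_apply, map_sum]
    refine Submodule.sum_mem _ fun j _ => ?_
    rw [map_smul]
    exact Submodule.smul_mem _ _ (zeta_mem h.hS j q)
  have h2 := (isCompl_DW h.hS q).disjoint.le_bot
    ⟨h1, (gen_mem_subW_iff h.hS h.hQT h.hF).2 hc⟩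
  have h3 := gen_injective q h.hS ((show gen E EG G q _ = 0 from h2).trans (map_zero _).symm)
  exact colMap_injective (linearIndependent_zeta h.hS h.hM q) (h3.trans (map_zero _).symm)

theorem eta_surjective (h : IsReduction S GW EM EN EQ EF) (x : QT Q GW) (ν : EF) :
    ∃ c, colMap (fun i => S.eta GW EF i x) c = ν := by
  obtain ⟨q, rfl⟩ := piQ_surjective x
  obtain ⟨ξ, rfl⟩ : ∃ ξ : EG, dmk GW EF ξ = ν := h.hF.2 1 ν
  have h1 : gen E EG G q (ξ - formW G S q (gen E EG G q ξ)) ∈ subD S q := by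
    rw [map_sub]
    exact prD_mem h.hS q (gen E EG G q ξ)
  have h2 : dmk GW EF (formW G S q (gen E EG G q ξ)) = 0 :=
    (gen_mem_subW_iff h.hS h.hQT h.hF).1 (formW_spec h.hS q _).1
  obtain ⟨c, hc⟩ := exists_zeta_coeff h.hS h.hM h1
  exact ⟨c, by rw [← dmk_colMap_zeta h, hc, map_sub, h2, sub_zero]⟩

theorem muBasis_eta (h : IsReduction S GW EM EN EQ EF) (x : QT Q GW) (i j : Fin S.k) :
    S.muBasis GW EF x i (S.eta GW EF j x) = if i = j then 1 else 0 := by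
  obtain ⟨L, hL⟩ := (colMap (fun i => S.eta GW EF i x)).toLinearMap.exists_leftInverse_of_injective
    (LinearMap.ker_eq_bot.2 (eta_injective h x))
  refine Classical.epsilon_spec (p := fun μ : Fin S.k → EF →L[ℝ] ℝ =>
    ∀ i j, μ i (S.eta GW EF j x) = if i = j then 1 else 0)
    ⟨fun i => (ContinuousLinearMap.proj i).comp L.toContinuousLinearMap, fun i j => ?_⟩ i j
  have h1 := congrFun (DFunLike.congr_fun hL (Pi.single j 1)) i
  have h2 : colMap (fun i => S.eta GW EF i x) (Pi.single j 1) = S.eta GW EF j x := by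
    simp [colMap_apply, Pi.single_apply]
  simpa [h2, Pi.single_apply] using h1

theorem rhoGW_mem_levelSet (h : IsReduction S GW EM EN EQ EF) (m : S.M) (c : Fin S.k → ℝ) :
    S.rhoGW GW EQ m ∈ S.levelSet GW EQ EF c ↔ ∀ i, S.J G i m = c i := by
  have h1 : ∀ i, momentumF GW EF (S.rhoGW GW EQ m) (S.eta GW EF i (piQ GW m.1.1)) = S.J G i m := by
    intro i
    rw [eta_piQ h]
    refine Eq.trans (congrArg (covP GW EQ m) ?_) (covP_dpi h.hS h.hQT m (zeta_mem h.hS i m.1.1))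
    exact (mder_piQ_gen h.hQT h.hF m.1.1 (S.ζ i m.1.1)).symm
  have h2 : ∀ i, S.mu GW EF c (piQ GW m.1.1) (S.eta GW EF i (piQ GW m.1.1)) = c i := by
    intro i
    simp [NHData.mu, sum_apply, muBasis_eta h]
  constructor
  · intro hm i
    rw [← h1, ← h2 i]
    exact congrArg (fun T : EF →L[ℝ] ℝ => T (S.eta GW EF i (piQ GW m.1.1))) hm
  · intro hm
    change momentumF GW EF (S.rhoGW GW EQ m) = S.mu GW EF c (piQ GW m.1.1)
    ext ν
    obtain ⟨d, rfl⟩ := eta_surjective h (piQ GW m.1.1) ν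
    simp only [colMap_apply, map_sum, map_smul, h1, h2, hm]

theorem mem_levelSet_iff (h : IsReduction S GW EM EN EQ EF)
    {rhoF : CotBundle EQ (QT Q GW) → S.MG G} (hr : ∀ m : S.M, rhoF (S.rhoGW GW EQ m) = S.rho G m)
    (c : Fin S.k → ℝ) (α : CotBundle EQ (QT Q GW)) :
    α ∈ S.levelSet GW EQ EF c ↔ ∀ i, S.Jbar G i (rhoF α) = c i := by
  obtain ⟨m, rfl⟩ := rhoGW_surjective h.hS h.hQT α
  simp only [rhoGW_mem_levelSet h, hr, Jbar_rho h]

theorem image_levelSet (h : IsReduction S GW EM EN EQ EF)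
    {rhoF : CotBundle EQ (QT Q GW) → S.MG G} (hr : ∀ m : S.M, rhoF (S.rhoGW GW EQ m) = S.rho G m)
    (c : Fin S.k → ℝ) : rhoF '' S.levelSet GW EQ EF c = ⋂ i, S.Jbar G i ⁻¹' {c i} := by
  ext x
  simp only [mem_iInter, mem_preimage, mem_singleton_iff]
  constructor
  · rintro ⟨α, hα, rfl⟩
    exact (mem_levelSet_iff h hr c α).1 hα
  · intro hx
    obtain ⟨m, rfl⟩ := rho_surjective x
    exact ⟨S.rhoGW GW EQ m, (mem_levelSet_iff h hr c _).2 (by rwa [hr]), hr m⟩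

end LevelSets

/-! ### Level sets and submersions -/

section LevelProjection

variable {E : Type*} [NormedAddCommGroup E] [NormedSpace ℝ E] [FiniteDimensional ℝ E]
  {H : Type*} [TopologicalSpace H] {I : ModelWithCorners ℝ E H} [I.Boundaryless] {P : Type*}
  [TopologicalSpace P] [ChartedSpace H P] [IsManifold I ∞ P]
  {E' : Type*} [NormedAddCommGroup E'] [NormedSpace ℝ E'] [FiniteDimensional ℝ E']
  {H' : Type*} [TopologicalSpace H'] {I' : ModelWithCorners ℝ E' H'} [I'.Boundaryless] {N : Type*}
  [TopologicalSpace N] [ChartedSpace H' N] [IsManifold I' ∞ N]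
  {k : ℕ} {Jb : Fin k → N → ℝ}

theorem linearIndependent_dReal_comp {f : P → N} (hf : IsSmoothSubmersion I I' f)
    (hJ : ∀ i, ContMDiff I' 𝓘(ℝ, ℝ) ∞ (Jb i)) {x : P}
    (h : LinearIndependent ℝ (fun i => dReal I' (Jb i) (f x))) :
    LinearIndependent ℝ (fun i => dReal I (fun x => Jb i (f x)) x) := by
  let A : E →L[ℝ] E' := mfderiv I I' f x
  have hA : Function.Surjective A := hf.2 x
  let ℓ : Fin k → E' →L[ℝ] ℝ := fun i => dReal I' (Jb i) (f x)
  have h1 : LinearIndependent ℝ (fun i => (ℓ i).comp A) := by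
    refine LinearIndependent.map' (v := ℓ) h
      ((ContinuousLinearMap.compL ℝ E E' ℝ).flip A).toLinearMap
      (LinearMap.ker_eq_bot'.2 fun T hT => ContinuousLinearMap.ext fun v => ?_)
    obtain ⟨u, rfl⟩ := hA v
    exact DFunLike.congr_fun hT u
  have h2 : (fun i => (dReal I (fun x => Jb i (f x)) x : E →L[ℝ] ℝ)) = fun i => (ℓ i).comp A :=
    funext fun i => ContinuousLinearMap.ext fun u =>
      dReal_comp ((hJ i _).mdifferentiableAt (by simp)) ((hf.1 x).mdifferentiableAt (by simp)) u
  exact h2 ▸ h1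

/-- Level sets of independent functions, and of their pull backs by a submersion. -/
theorem exists_level_structures {f : P → N} (hf : IsSmoothSubmersion I I' f)
    (hJ : ∀ i, ContMDiff I' 𝓘(ℝ, ℝ) ∞ (Jb i))
    (h : ∀ x, LinearIndependent ℝ (fun i => dReal I' (Jb i) x)) {c : Fin k → ℝ} {A : Set P}
    {B : Set N} (hA : ∀ a, a ∈ A ↔ ∀ i, Jb i (f a) = c i) (hB : ∀ b, b ∈ B ↔ ∀ i, Jb i b = c i)
    {φ : A → B} (hφ : ∀ a, (φ a).1 = f a.1) :
    ∃ (r r' : ℕ) (_ : ChartedSpace (EuclideanSpace ℝ (Fin r)) A)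
      (_ : ChartedSpace (EuclideanSpace ℝ (Fin r')) B),
      IsManifold (𝓡 r) ∞ A ∧ IsManifold (𝓡 r') ∞ B ∧
      IsSmoothImmersion (𝓡 r) I (Subtype.val : A → P) ∧
      IsSmoothImmersion (𝓡 r') I' (Subtype.val : B → N) ∧ IsSmoothSubmersion (𝓡 r) (𝓡 r') φ ∧
      (∀ (b : B) (v : TangentSpace I' b.1), v ∈ levelDist I' Jb b.1 ↔
        ∃ w : TangentSpace (𝓡 r') b, mfderiv (𝓡 r') I' (Subtype.val : B → N) b w = v) ∧
      ∀ (a : A) (u : TangentSpace (𝓡 r) a),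
        (mfderiv (𝓡 r') I' (Subtype.val : B → N) (φ a) (mfderiv (𝓡 r) (𝓡 r') φ a u) : E') =
          mfderiv I I' f a.1 (mfderiv (𝓡 r) I (Subtype.val : A → P) a u) := by
  obtain ⟨csA, hA1, hA2, hA3⟩ := exists_structure_of_independent
    (f := fun i (x : P) => Jb i (f x)) (fun i => (hJ i).comp hf.1)
    (fun x => linearIndependent_dReal_comp hf hJ (h (f x))) (A := A) (c := c) isOpen_univ
    (subset_univ A) (fun a _ => hA a)
  obtain ⟨csB, hB1, hB2, hB3⟩ := exists_structure_of_independent hJ h (A := B) (c := c)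
    isOpen_univ (subset_univ B) (fun b _ => hB b)
  have hval : (fun a => (φ a).1) = fun a : A => f a.1 := funext hφ
  have hsm : ContMDiff (𝓡 (Module.finrank ℝ E - k)) I' ∞ (fun a => (φ a).1) := by
    rw [hval]
    exact hf.1.comp hA2.1
  have hφs : ContMDiff (𝓡 (Module.finrank ℝ E - k)) (𝓡 (Module.finrank ℝ E' - k)) ∞ φ := fun a =>
    contMDiffAt_of_comp_immersion hB2
      (continuous_induced_rng.2 hsm.continuous).continuousAt (hsm a)
  have hchain : ∀ (a : A) (u : TangentSpace (𝓡 (Module.finrank ℝ E - k)) a),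
      (mfderiv (𝓡 (Module.finrank ℝ E' - k)) I' (Subtype.val : B → N) (φ a)
        (mfderiv (𝓡 (Module.finrank ℝ E - k)) (𝓡 (Module.finrank ℝ E' - k)) φ a u) : E') =
      mfderiv I I' f a.1 (mfderiv (𝓡 (Module.finrank ℝ E - k)) I (Subtype.val : A → P) a u) := by
    intro a u
    have e1 := mder_comp (I'' := I') (g := (Subtype.val : B → N)) (x := a) (hB2.1 (φ a)) (hφs a) u
    have e2 := mder_comp (I'' := I') (g := f) (f := (Subtype.val : A → P)) (x := a) (hf.1 a.1)
      (hA2.1 a) u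
    rw [hval] at e1
    exact e1.symm.trans e2
  have hrange : ∀ (b : B) (v : TangentSpace I' b.1), v ∈ levelDist I' Jb b.1 ↔
      ∃ w : TangentSpace (𝓡 (Module.finrank ℝ E' - k)) b,
        mfderiv (𝓡 (Module.finrank ℝ E' - k)) I' (Subtype.val : B → N) b w = v := by
    refine fun b v => ⟨fun hv => hB3 b v (mem_levelDist.1 hv), ?_⟩
    rintro ⟨w, rfl⟩
    refine mem_levelDist.2 fun i => ?_
    refine (dReal_comp ((hJ i _).mdifferentiableAt (by simp))
      ((hB2.1 b).mdifferentiableAt (by simp)) w).symm.trans ?_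
    have e1 : (fun b : B => Jb i b.1) = fun _ => c i := funext fun b => (hB b.1).1 b.2 i
    rw [e1]
    exact congrArg (fun T : EuclideanSpace ℝ (Fin (Module.finrank ℝ E' - k)) →L[ℝ] ℝ => T w)
      (mfderiv_const (c := c i))
  refine ⟨_, _, csA, csB, hA1, hB1, hA2, hB2, ⟨hφs, fun a w => ?_⟩, hrange, hchain⟩
  let V : E' := mfderiv (𝓡 (Module.finrank ℝ E' - k)) I' (Subtype.val : B → N) (φ a) w
  have hV : ∀ i, dReal I' (Jb i) (f a.1) V = 0 := by
    intro i
    have e1 := mem_levelDist.1 ((hrange (φ a) _).2 ⟨w, rfl⟩) i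
    rwa [hφ a] at e1
  obtain ⟨U, hU⟩ : ∃ U, mfderiv I I' f a.1 U = V := hf.2 a.1 V
  obtain ⟨u, hu⟩ := hA3 a U fun i => (dReal_comp ((hJ i _).mdifferentiableAt (by simp))
    ((hf.1 a.1).mdifferentiableAt (by simp)) U).trans ((congrArg _ hU).trans (hV i))
  refine ⟨u, hB2.2 (φ a) ?_⟩
  exact (hchain a u).trans ((congrArg _ hu).trans hU)

end LevelProjection

section ReducedForms

variable {E : Type*} [NormedAddCommGroup E] [NormedSpace ℝ E] [FiniteDimensional ℝ E]
  {Q : Type*} [TopologicalSpace Q] [ChartedSpace E Q] [IsManifold 𝓘(ℝ, E) ∞ Q] [T2Space Q]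
  {EG : Type*} [NormedAddCommGroup EG] [NormedSpace ℝ EG] [FiniteDimensional ℝ EG]
  {G : Type*} [TopologicalSpace G] [ChartedSpace EG G] [Group G] [LieGroup 𝓘(ℝ, EG) ∞ G]
  [MulAction G Q] [ContMDiffSMul 𝓘(ℝ, EG) 𝓘(ℝ, E) ∞ G Q]
  {S : NHData E Q EG} {GW : Subgroup G} [GW.Normal]
  {EM : Type*} [NormedAddCommGroup EM] [NormedSpace ℝ EM] [FiniteDimensional ℝ EM]
  [ChartedSpace EM S.M] [IsManifold 𝓘(ℝ, EM) ∞ S.M]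
  {EN : Type*} [NormedAddCommGroup EN] [NormedSpace ℝ EN] [FiniteDimensional ℝ EN]
  [ChartedSpace EN (S.MG G)] [IsManifold 𝓘(ℝ, EN) ∞ (S.MG G)]
  {EQ : Type*} [NormedAddCommGroup EQ] [NormedSpace ℝ EQ] [FiniteDimensional ℝ EQ]
  [ChartedSpace EQ (QT Q GW)] [IsManifold 𝓘(ℝ, EQ) ∞ (QT Q GW)]
  {EF : Type*} [NormedAddCommGroup EF] [NormedSpace ℝ EF] [FiniteDimensional ℝ EF]
  [ChartedSpace EF (G ⧸ GW)] [LieGroup 𝓘(ℝ, EF) ∞ (G ⧸ GW)]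
  {s : ℝ} {Ω : ∀ x : S.MG G, TangentSpace 𝓘(ℝ, EN) x → TangentSpace 𝓘(ℝ, EN) x → ℝ}

/-- On the level sets of the momenta, the gauge transformed form of `T^*(Q/G_W)` is the pull back
of the reduced form. -/
theorem IsReducedForm.pullback_rhoF (h : IsReduction S GW EM EN EQ EF)
    (hΩ : IsReducedForm EM s Ω) {rhoF : CotBundle EQ (QT Q GW) → S.MG G}
    (hsub : IsSmoothSubmersion (cotModel EQ) 𝓘(ℝ, EN) rhoF)
    (hr : ∀ m : S.M, rhoF (S.rhoGW GW EQ m) = S.rho G m)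
    {BJK Bt : DForm (cotModel EQ) (CotBundle EQ (QT Q GW)) 2}
    (hBJK : PullsBackTo 𝓘(ℝ, EM) (cotModel EQ) (S.rhoGW GW EQ) BJK (S.JKW G EM))
    (hBt : PullsBackTo 𝓘(ℝ, EM) (cotModel EQ) (S.rhoGW GW EQ) Bt (S.Bform G EM s))
    (α : CotBundle EQ (QT Q GW)) (u v : EQ × (EQ →L[ℝ] ℝ))
    (hu : ∀ i, dJbar EN i (rhoF α) (mder (cotModel EQ) 𝓘(ℝ, EN) rhoF α u) = 0)
    (hv : ∀ i, dJbar EN i (rhoF α) (mder (cotModel EQ) 𝓘(ℝ, EN) rhoF α v) = 0) :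
    canonicalTwoForm EQ α u v - BJK α ![u, v] + Bt α ![u, v] =
      Ω (rhoF α) (mder (cotModel EQ) 𝓘(ℝ, EN) rhoF α u)
        (mder (cotModel EQ) 𝓘(ℝ, EN) rhoF α v) := by
  obtain ⟨m, rfl⟩ := rhoGW_surjective h.hS h.hQT α
  obtain ⟨L, hL, hL'⟩ := exists_linear_lift_rhoGW h.hS h.hM h.hQT m
  obtain ⟨u, rfl, huD⟩ : ∃ û : EM, mder 𝓘(ℝ, EM) (cotModel EQ) (S.rhoGW GW EQ) m û = u ∧
    dtauE EM m û ∈ subD S m.1.1 := ⟨L u, hL' u, hL u⟩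
  obtain ⟨v, rfl, hvD⟩ : ∃ û : EM, mder 𝓘(ℝ, EM) (cotModel EQ) (S.rhoGW GW EQ) m û = v ∧
    dtauE EM m û ∈ subD S m.1.1 := ⟨L v, hL' v, hL v⟩
  have hchain : ∀ w : EM, mder 𝓘(ℝ, EM) 𝓘(ℝ, EN) (S.rho G) m w =
      mder (cotModel EQ) 𝓘(ℝ, EN) rhoF (S.rhoGW GW EQ m)
        (mder 𝓘(ℝ, EM) (cotModel EQ) (S.rhoGW GW EQ) m w) := fun w => by
    have e := mder_comp (I'' := 𝓘(ℝ, EN)) (x := m) (hsub.1 (S.rhoGW GW EQ m))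
      (contMDiff_rhoGW h.hS h.hM h.hQT m) w
    rw [← e]
    simp only [hr]
  have e1 := canonicalTwoForm_rhoGW h.hS h.hM h.hQT h.hF huD hvD
  have e2 := hBJK m u v
  have e3 := hBt m u v
  have e4 := hΩ.apply huD hvD rfl rfl
  simp only [← hchain, hr] at hu hv ⊢
  simp only [hu, hv, mul_zero, sub_zero, Finset.sum_const_zero, add_zero] at e4
  have e5 : ∀ {x y : S.MG G} (U V : EN), x = y → (Ω x U V : ℝ) = Ω y U V := by
    rintro x _ U V rfl
    rfl
  refine Eq.trans ?_ (e4.trans (e5 _ _ (hr m).symm))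
  refine (congrArg₂ (· + ·) (congrArg₂ (· - ·) e1 e2) e3).trans ?_
  change _ = S.OmegaM EM m u v + S.Bform G EM s m u v
  ring

end ReducedForms

end NHReduction

theorem theorem5p2
    {E : Type*} [NormedAddCommGroup E] [NormedSpace ℝ E] [FiniteDimensional ℝ E]
    {Q : Type*} [TopologicalSpace Q] [ChartedSpace E Q] [IsManifold 𝓘(ℝ, E) ∞ Q]
    [T2Space Q] [SecondCountableTopology Q]
    {EG : Type*} [NormedAddCommGroup EG] [NormedSpace ℝ EG] [FiniteDimensional ℝ EG]
    {G : Type*} [TopologicalSpace G] [ChartedSpace EG G] [Group G] [LieGroup 𝓘(ℝ, EG) ∞ G]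
    [T2Space G] [SecondCountableTopology G]
    -- a smooth proper action of `G` on `Q`, a nonholonomic system, and a normal subgroup `G_W`
    [MulAction G Q] [ContMDiffSMul 𝓘(ℝ, EG) 𝓘(ℝ, E) ∞ G Q] [ProperSMul G Q]
    (S : NHData E Q EG) (GW : Subgroup G) [GW.Normal]
    -- the smooth structure of the embedded submanifold `𝓜` of `T^*Q`
    {EM : Type*} [NormedAddCommGroup EM] [NormedSpace ℝ EM] [FiniteDimensional ℝ EM]
    [ChartedSpace EM S.M] [IsManifold 𝓘(ℝ, EM) ∞ S.M]
    (hM : IsSmoothImmersion 𝓘(ℝ, EM) (cotModel E) (Subtype.val : S.M → CotBundle E Q))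
    -- the quotient smooth structure of `𝓜/G`
    {EN : Type*} [NormedAddCommGroup EN] [NormedSpace ℝ EN] [FiniteDimensional ℝ EN]
    [ChartedSpace EN (S.MG G)] [IsManifold 𝓘(ℝ, EN) ∞ (S.MG G)] [T2Space (S.MG G)]
    (hMG : IsSmoothSubmersion 𝓘(ℝ, EM) 𝓘(ℝ, EN) (S.rho G))
    -- the quotient smooth structure of `Q̃ = Q/G_W`
    {EQ : Type*} [NormedAddCommGroup EQ] [NormedSpace ℝ EQ] [FiniteDimensional ℝ EQ]
    [ChartedSpace EQ (QT Q GW)] [IsManifold 𝓘(ℝ, EQ) ∞ (QT Q GW)] [T2Space (QT Q GW)]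
    (hQT : IsSmoothSubmersion 𝓘(ℝ, E) 𝓘(ℝ, EQ) (piQ (Q := Q) GW))
    -- the quotient Lie group structure of `F = G/G_W`
    {EF : Type*} [NormedAddCommGroup EF] [NormedSpace ℝ EF] [FiniteDimensional ℝ EF]
    [ChartedSpace EF (G ⧸ GW)] [LieGroup 𝓘(ℝ, EF) ∞ (G ⧸ GW)]
    (hF : IsSmoothSubmersion 𝓘(ℝ, EG) 𝓘(ℝ, EF) (fun g : G => (g : G ⧸ GW)))
    -- the standing assumptions
    (hS : S.IsAdmissible GW EM)
    -- the sign convention for the curvature of the connection `𝓐`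
    (s : ℝ) (hs : s = 1 ∨ s = -1) :
    -- the nonholonomic vector field, the gauge transformed bracket on `𝓜`, its reduction to `𝓜/G`
    -- and the hamiltonian vector fields on `𝓜/G` are well defined
    (∀ m : S.M, ∃! X, S.IsHam EM (S.OmegaM EM) (fun m => S.hamiltonian m.1) m X) ∧
    (∀ f : S.M → ℝ, ContMDiff 𝓘(ℝ, EM) 𝓘(ℝ, ℝ) ∞ f → ∀ m : S.M,
      ∃! X, S.IsHam EM (S.OmegaB G EM s) f m X) ∧
    (∀ f g : S.MG G → ℝ, ContMDiff 𝓘(ℝ, EN) 𝓘(ℝ, ℝ) ∞ f → ContMDiff 𝓘(ℝ, EN) 𝓘(ℝ, ℝ) ∞ g →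
      ∀ m : S.M, S.redBracket G EM s f g (S.rho G m) =
        S.bracketB G EM s (f ∘ S.rho G) (g ∘ S.rho G) m) ∧
    (∀ f : S.MG G → ℝ, ContMDiff 𝓘(ℝ, EN) 𝓘(ℝ, ℝ) ∞ f → ∀ x : S.MG G,
      ∃! X : TangentSpace 𝓘(ℝ, EN) x, ∀ g : S.MG G → ℝ, ContMDiff 𝓘(ℝ, EN) 𝓘(ℝ, ℝ) ∞ g →
        dReal 𝓘(ℝ, EN) g x X = S.redBracket G EM s g f x) ∧
    -- the reduced bracket is twisted Poisson
    IsTwistedPoisson 𝓘(ℝ, EN) (S.redBracket G EM s) ∧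
    -- `ρ_{G_W} : 𝓜 → T^*Q̃` is the orbit projection of the `G_W`-action
    (∀ m : S.M, ∀ v ∈ S.D m.1.1, (S.rhoGW GW EQ m).2
      (mfderiv 𝓘(ℝ, E) 𝓘(ℝ, EQ) (piQ (Q := Q) GW) m.1.1 v) = m.1.2 v) ∧
    IsSmoothSubmersion 𝓘(ℝ, EM) (cotModel EQ) (S.rhoGW GW EQ) ∧
    Function.Surjective (S.rhoGW GW EQ) ∧
    (∀ m m' : S.M, S.rhoGW GW EQ m = S.rhoGW GW EQ m' ↔ S.SameOrbit GW m m') ∧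
    -- the `J̄_i`, the `η_i` and the dual basis `μ^i` are well defined
    (∀ (i) (m : S.M), S.Jbar G i (S.rho G m) = S.J G i m) ∧
    (∀ (i) (q : Q), S.eta GW EF i (piQ GW q) =
      (mfderiv 𝓘(ℝ, EG) 𝓘(ℝ, EF) (fun g : G => (g : G ⧸ GW)) 1 : EG →L[ℝ] EF) (S.ζ i q)) ∧
    (∀ (x : QT Q GW) (i j), S.muBasis GW EF x i (S.eta GW EF j x) = if i = j then 1 else 0) ∧
    -- `ρ_F` identifies `T^*Q̃/F` with `𝓜/G`; `B_⟨J𝓚⟩` and `𝐁̃` are the 2-forms on `T^*Q̃`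
    -- descending from `⟨J, 𝓚_W⟩` and `𝐁`
    ∃ (rhoF : CotBundle EQ (QT Q GW) → S.MG G)
      (BJK Bt : DForm (cotModel EQ) (CotBundle EQ (QT Q GW)) 2),
      IsSmoothSubmersion (cotModel EQ) 𝓘(ℝ, EN) rhoF ∧
      (∀ m : S.M, rhoF (S.rhoGW GW EQ m) = S.rho G m) ∧
      (∀ α β, rhoF α = rhoF β ↔ ∃ h : G ⧸ GW, β = cotLiftF GW EQ h α) ∧
      DForm.IsSmooth (cotModel EQ) BJK ∧ DForm.IsSmooth (cotModel EQ) Bt ∧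
      PullsBackTo 𝓘(ℝ, EM) (cotModel EQ) (S.rhoGW GW EQ) BJK (S.JKW G EM) ∧
      PullsBackTo 𝓘(ℝ, EM) (cotModel EQ) (S.rhoGW GW EQ) Bt (S.Bform G EM s) ∧
      -- the almost symplectic reduced spaces `J̃⁻¹(μ)/F ⊆ 𝓜/G`, for `μ = c_i μ^i`
      (∀ c : Fin S.k → ℝ,
        (∀ (h : G ⧸ GW), ∀ α ∈ S.levelSet GW EQ EF c, cotLiftF GW EQ h α ∈ S.levelSet GW EQ EF c) ∧
        -- they are the common level sets of the `J̄_i`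
        rhoF '' S.levelSet GW EQ EF c = ⋂ i, S.Jbar G i ⁻¹' {c i} ∧
        -- `J̃⁻¹(μ)` and `J̃⁻¹(μ)/F` are embedded submanifolds
        ∃ (r r' : ℕ) (_ : ChartedSpace (EuclideanSpace ℝ (Fin r)) (S.levelSet GW EQ EF c))
          (_ : ChartedSpace (EuclideanSpace ℝ (Fin r')) (rhoF '' S.levelSet GW EQ EF c)),
          IsManifold (𝓡 r) ∞ (S.levelSet GW EQ EF c) ∧
          IsManifold (𝓡 r') ∞ (rhoF '' S.levelSet GW EQ EF c) ∧
          IsSmoothImmersion (𝓡 r) (cotModel EQ)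
            (Subtype.val : S.levelSet GW EQ EF c → CotBundle EQ (QT Q GW)) ∧
          IsSmoothImmersion (𝓡 r') 𝓘(ℝ, EN)
            (Subtype.val : (rhoF '' S.levelSet GW EQ EF c : Set (S.MG G)) → S.MG G) ∧
          IsSmoothSubmersion (𝓡 r) (𝓡 r')
            (Set.imageFactorization rhoF (S.levelSet GW EQ EF c)) ∧
          -- the almost symplectic form `ω_μ^𝐁`, with `ι_μ^* Ω̃_𝐁 = ρ_μ^* ω_μ^𝐁`
          ∃ om : DForm (𝓡 r') (rhoF '' S.levelSet GW EQ EF c : Set (S.MG G)) 2,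
            IsAlmostSymplectic (𝓡 r') om ∧
            PullsBackTo (𝓡 r) (𝓡 r') (Set.imageFactorization rhoF (S.levelSet GW EQ EF c)) om
              (fun α u v =>
                let u' := mfderiv (𝓡 r) (cotModel EQ)
                  (Subtype.val : S.levelSet GW EQ EF c → CotBundle EQ (QT Q GW)) α u
                let v' := mfderiv (𝓡 r) (cotModel EQ)
                  (Subtype.val : S.levelSet GW EQ EF c → CotBundle EQ (QT Q GW)) α v
                canonicalTwoForm EQ α.1 u' v' - BJK α.1 ![u', v'] + Bt α.1 ![u', v']) ∧
            -- it is the 2-form of the bracket: the hamiltonian vector field `X_f` is tangent to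
            -- `J̃⁻¹(μ)/F` and `i_{X_f} ω_μ^𝐁 = d(f|)`
            ∀ f : S.MG G → ℝ, ContMDiff 𝓘(ℝ, EN) 𝓘(ℝ, ℝ) ∞ f →
              ∀ p : (rhoF '' S.levelSet GW EQ EF c : Set (S.MG G)),
              ∃ w : TangentSpace (𝓡 r') p,
                mfderiv (𝓡 r') 𝓘(ℝ, EN)
                  (Subtype.val : (rhoF '' S.levelSet GW EQ EF c : Set (S.MG G)) → S.MG G) p w =
                  bracketHam 𝓘(ℝ, EN) (S.redBracket G EM s) f p.1 ∧
                ∀ z : TangentSpace (𝓡 r') p, om p ![w, z] =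
                  dReal (𝓡 r') (fun y : (rhoF '' S.levelSet GW EQ EF c : Set (S.MG G)) => f y.1)
                    p z) ∧
      -- the leaves are exactly the connected components of the spaces `J̃⁻¹(μ)/F`
      ∀ L : Set (S.MG G), IsLeaf 𝓘(ℝ, EN) (S.redBracket G EM s) L ↔
        ∃ c : Fin S.k → ℝ, ∃ x ∈ rhoF '' S.levelSet GW EQ EF c,
          L = connectedComponentIn (rhoF '' S.levelSet GW EQ EF c) x := by
  have h : NHReduction.IsReduction S GW EM EN EQ EF := ⟨hS, hM, hMG, hQT, hF⟩
  obtain ⟨Ω, hΩ⟩ := NHReduction.exists_isReducedForm h s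
  have hbr := hΩ.isLevelBracket h
  refine ⟨NHReduction.existsUnique_Xnh hS hM hQT hF,
    fun f _ m => NHReduction.existsUnique_hamB hS hM hQT hF s f m,
    fun f g hf hg m => hΩ.redBracket_rho h hf hg m, fun f hf x => hbr.existsUnique_ham hf x,
    hbr.isTwistedPoisson, fun m v hv => NHReduction.covP_dpi hS hQT m hv,
    NHReduction.isSmoothSubmersion_rhoGW hS hM hQT, NHReduction.rhoGW_surjective hS hQT,
    fun m m' => (NHReduction.rhoGW_eq_iff hS hQT).trans (NHReduction.sameOrbit_GW_iff hS).symm,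
    NHReduction.Jbar_rho h, NHReduction.eta_piQ h, NHReduction.muBasis_eta h, ?_⟩
  obtain ⟨rhoF, hsub, hr, hfib⟩ := NHReduction.exists_rhoF h
  obtain ⟨BJK, Bt, hBJK, hBt, hBJK', hBt'⟩ := NHReduction.exists_descent_gauge h s
  have himage := NHReduction.image_levelSet h hr
  refine ⟨rhoF, BJK, Bt, hsub, hr, hfib, hBJK, hBt, hBJK', hBt', fun c => ⟨fun g α hα => ?_,
    himage c, ?_⟩, fun L => ?_⟩
  · rw [NHReduction.mem_levelSet_iff h hr] at hα ⊢
    rwa [← (hfib α _).2 ⟨g, rfl⟩]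
  · have hB : ∀ x, x ∈ rhoF '' S.levelSet GW EQ EF c ↔ ∀ i, S.Jbar G i x = c i := fun x => by
      rw [himage c]
      simp
    obtain ⟨r, r', csA, csB, hA1, hB1, hA2, hB2, hφ, hrange, hchain⟩ :=
      NHReduction.exists_level_structures hsub hbr.J_smooth hbr.J_indep
        (NHReduction.mem_levelSet_iff h hr c) hB
        (φ := Set.imageFactorization rhoF (S.levelSet GW EQ EF c)) fun _ => rfl
    have hom := hΩ.twoForm.pullback hB2.1
    refine ⟨r, r', csA, csB, hA1, hB1, hA2, hB2, hφ, hom.toDForm, ⟨hom.isSmooth_toDForm, ?_⟩, ?_,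
      fun f hf p => ?_⟩
    · intro b u hu
      have h1 : mfderiv (𝓡 r') 𝓘(ℝ, EN) (Subtype.val :
          (rhoF '' S.levelSet GW EQ EF c : Set (S.MG G)) → S.MG G) b u = 0 := by
        refine hbr.nondeg b.1 _ ((hrange b _).2 ⟨u, rfl⟩) fun V hV => ?_
        obtain ⟨w, rfl⟩ := (hrange b V).1 hV
        exact hu w
      exact hB2.2 b (h1.trans (map_zero _).symm)
    · intro a u v
      have hker : ∀ w : TangentSpace (𝓡 r) a, ∀ i, NHReduction.dJbar EN i (rhoF a.1)
          (NHReduction.mder (cotModel EQ) 𝓘(ℝ, EN) rhoF a.1 (mfderiv (𝓡 r) (cotModel EQ)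
            (Subtype.val : S.levelSet GW EQ EF c → CotBundle EQ (QT Q GW)) a w)) = 0 := by
        intro w i
        refine Eq.trans ?_ (NHReduction.mem_levelDist.1 ((hrange _ _).2
          ⟨mfderiv (𝓡 r) (𝓡 r') (Set.imageFactorization rhoF (S.levelSet GW EQ EF c)) a w, rfl⟩) i)
        exact congrArg (NHReduction.dJbar EN i (rhoF a.1)) (hchain a w).symm
      refine Eq.trans ?_ (hΩ.pullback_rhoF h hsub hr hBJK' hBt' a.1 _ _ (hker u) (hker v)).symm
      exact congrArg₂ (fun U V : EN => Ω (rhoF a.1) U V) (hchain a u) (hchain a v)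
    · obtain ⟨w, hw⟩ := (hrange p _).1 (hbr.bracketHam_mem hf p.1)
      refine ⟨w, hw, fun z => ?_⟩
      refine (congrArg (fun X : EN => Ω p.1 X _) hw).trans ?_
      refine (hbr.omega_bracketHam hf ((hrange p _).2 ⟨z, rfl⟩)).trans ?_
      exact (NHReduction.dReal_comp ((hf _).mdifferentiableAt (by simp))
        ((hB2.1 p).mdifferentiableAt (by simp)) z).symm
  · simp only [himage]
    exact hbr.isLeaf_iff L
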